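/- A Pauli string on $n$ qubits is a tensor product of $n$ matrices from $\{I,X,Y,Z\}$. Let $G$ be a maximal commuting set of Pauli strings on $n$ qubits (closed under multiplication up to phase, $|G|=2^n$), given by $n$ independent generators $g_1,\dots,g_n$. Let $H_0=-\sum_{j=1}^m\alpha_j h_j$ be a stabilizer Hamiltonian with real coefficients and distinct terms $h_1,\dots,h_m\in G$, let $\delta H=\sum_{i=1}^k\gamma_iP_i$ with arbitrary distinct Pauli strings $P_i$ and $\gamma_i\in\mathbb R$, and put $H=H_0+\delta H$. Let $|K|$ be the dimension of the group $K=\langle P_1,\dots,P_k\rangle$, that is, its number of independent generators modulo phases. Let $|\psi_0\rangle$ be a stabilizer eigenstate of $H_0$, i.e. a unit vector with $g_i|\psi_0\rangle=(-1)^{x_i}|\psi_0\rangle$ for all $i$, and for $t\in\mathbb R$ let $|\psi(t)\rangle=e^{-iHt}|\psi_0\rangle$. The input consists of $n,m,k$, the strings $g_i,h_j,P_i$, the signs $x_i$, the real numbers $\alpha_j,\gamma_i,t$, and one nonzero amplitude $\langle z|\psi_0\rangle$ together with its label $z\in\{0,1\}^n$ (which fixes the global phase of $|\psi_0\rangle$).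 Computations are carried out on a real random access machine: exact real arithmetic, comparison, sine and cosine, at unit cost; extraction of a prescribed real root of a stored real polynomial, at cost proportional to its degree; coin flips with a prescribed real bias; natural numbers, used as data and as array indices, that can only be compared, incremented and decremented; and counted loops. There are three fixed classical programs and one constant $C$ such that, for all such inputs, 1. for every $y\in\{0,1\}^n$, the first program exactly evaluates the amplitude $\langle y|\psi(t)\rangle$; 2. for every Pauli string $P$, the second program exactly evaluates the expectation value $\langle\psi(t)|P|\psi(t)\rangle$; 3. the third program outputs a random bitstring that equals each $y\in\{0,1\}^n$ with probability exactly $|\langle y|\psi(t)\rangle|^2$; and each program always stops within $C\,\bigl(n^2(n+m)+2^{3|K|}\bigr)$ steps. In particular the running time is independent of $t$, of the coefficients and of $k$, and it is $O(n^3+2^{3|K|})$ when the number $m$ of terms of $H_0$ is $O(n)$. -/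

import Mathlib

noncomputable section

namespace StabQuench

/-! ### Qubits, Pauli strings and stabilizer Hamiltonians -/

/-- Computational-basis labels of `n` qubits. -/
abbrev Bits (n : ℕ) := Fin n → Fin 2

/-- (Unnormalised) state vectors of `n` qubits, as amplitudes in the computational basis. -/
abbrev Ket (n : ℕ) := Bits n → ℂ

/-- Operators on `n` qubits, as matrices in the computational basis. -/
abbrev Op (n : ℕ) := Matrix (Bits n) (Bits n) ℂ

/-- An `n`-qubit Pauli string in its symplectic representation: at each qubit an
`X`-bit and a `Z`-bit.  Componentwise addition is multiplication of Pauli operators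
modulo phases. -/
abbrev PauliString (n : ℕ) := Fin n → ZMod 2 × ZMod 2

/-- The single-qubit Pauli matrices: `(0,0) ↦ I`, `(0,1) ↦ Z`, `(1,0) ↦ X`, `(1,1) ↦ Y`. -/
def pauli1 (p : ZMod 2 × ZMod 2) : Matrix (Fin 2) (Fin 2) ℂ :=
  if p.1 = 0 then
    if p.2 = 0 then !![1, 0; 0, 1] else !![1, 0; 0, -1]
  else
    if p.2 = 0 then !![0, 1; 1, 0] else !![0, -Complex.I; Complex.I, 0]

/-- The operator of a Pauli string: the tensor product of its single-qubit Pauli matrices. -/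
def pauliOp {n : ℕ} (P : PauliString n) : Op n :=
  fun y y' => ∏ q, pauli1 (P q) (y q) (y' q)

/-- The data of a quench: a stabilizer Hamiltonian `H₀ = - ∑ j, α j • h j` with `m` terms
from a maximal commuting set `G` of Pauli strings (generated by `g`), a perturbation
`δH = ∑ i, γ i • P i` made of `k` arbitrary distinct Pauli strings, and a stabilizer eigenstate
`ψ₀` of `H₀`, that is, a unit vector which is a common eigenvector of all elements of `G`. -/
structure Quench (n m k : ℕ) where
  /-- Independent generators of `G`. -/
  g : Fin n → PauliString n
  /-- The Pauli strings occurring in `H₀`. -/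
  h : Fin m → PauliString n
  /-- The coefficients of `H₀`. -/
  α : Fin m → ℝ
  /-- The Pauli strings occurring in the perturbation. -/
  P : Fin k → PauliString n
  /-- The coefficients of the perturbation. -/
  γ : Fin k → ℝ
  /-- The initial state. -/
  ψ₀ : Ket n
  /-- The phases by which the generators act on the initial state. -/
  x : Bits n
  /-- A reference basis state on which the initial state has nonzero amplitude. -/
  z : Bits n
  g_indep : LinearIndependent (ZMod 2) g
  g_comm : ∀ i j, Commute (pauliOp (g i)) (pauliOp (g j))
  h_inj : Function.Injective h
  h_mem : ∀ j, h j ∈ Submodule.span (ZMod 2) (Set.range g)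
  P_inj : Function.Injective P
  ψ₀_norm : ∑ y, ‖ψ₀ y‖ ^ 2 = 1
  ψ₀_eigen : ∀ i, (pauliOp (g i)).mulVec ψ₀ = ((-1 : ℂ) ^ (x i).val) • ψ₀
  ψ₀_ref : ψ₀ z ≠ 0

namespace Quench

variable {n m k : ℕ} (I : Quench n m k)

/-- The stabilizer Hamiltonian. -/
def H₀ : Op n := -∑ j, (I.α j : ℂ) • pauliOp (I.h j)

/-- The perturbation. -/
def δH : Op n := ∑ i, (I.γ i : ℂ) • pauliOp (I.P i)

/-- The quenched Hamiltonian. -/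
def H : Op n := I.H₀ + I.δH

/-- The dimension `|K|` of the group `K` generated by the perturbing Pauli operators: the
number of independent generators modulo phases. -/
def dimK : ℕ := Module.finrank (ZMod 2) (Submodule.span (ZMod 2) (Set.range I.P))

/-- The quenched state `ψ(t) = exp (-i H t) ψ₀`. -/
def ψ (t : ℝ) : Ket n := (NormedSpace.exp ((-(Complex.I * (t : ℂ))) • I.H)).mulVec I.ψ₀

/-- The expectation value of a Pauli string in the quenched state. -/
def expect (t : ℝ) (P : PauliString n) : ℂ :=
  star (I.ψ t) ⬝ᵥ (pauliOp P).mulVec (I.ψ t)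

end Quench

/-! ### The machine model

A real random access machine with structured programs.  The memory consists of two-dimensional
arrays of natural numbers and of exact real numbers.  Natural numbers can only be compared,
incremented and decremented, so along a run no number can exceed the inputs by more than a
constant times the running time.  There is no conversion between the two sorts of data.
Real numbers admit arithmetic, comparison, sine and cosine, and the extraction of a real root
of a polynomial whose coefficients are stored in memory, which is charged proportionally to the
degree.  Programs are built from assignments, coin flips with a given bias, conditionals,
sequencing and counted loops. -/

/-- Memory contents together with a step counter, which programs cannot read. -/
@[ext] structure Store where
  /-- `nat a i j` is entry `(i, j)` of the `a`-th array of natural numbers. -/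
  nat : ℕ → ℕ → ℕ → ℕ
  /-- `real a i j` is entry `(i, j)` of the `a`-th array of real numbers. -/
  real : ℕ → ℕ → ℕ → ℝ
  /-- The number of steps performed so far. -/
  time : ℕ

namespace Store

/-- Overwrite one natural-number cell. -/
def setNat (s : Store) (a i j v : ℕ) : Store :=
  { s with nat := fun a' i' j' => if a' = a ∧ i' = i ∧ j' = j then v else s.nat a' i' j' }

/-- Overwrite one real cell. -/
def setReal (s : Store) (a i j : ℕ) (v : ℝ) : Store :=
  { s with real := fun a' i' j' => if a' = a ∧ i' = i ∧ j' = j then v else s.real a' i' j' }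

/-- Let `c` steps pass. -/
def tick (s : Store) (c : ℕ) : Store := { s with time := s.time + c }

end Store

/-- Expressions for natural numbers. -/
inductive NExpr where
  | lit (c : ℕ)
  | get (a : ℕ) (i j : NExpr)
  | succ (e : NExpr)
  | pred (e : NExpr)

namespace NExpr

/-- Value of an expression. -/
def eval (s : Store) : NExpr → ℕ
  | lit c => c
  | get a i j => s.nat a (i.eval s) (j.eval s)
  | succ e => e.eval s + 1
  | pred e => e.eval s - 1

/-- Cost of evaluating an expression: the number of its nodes. -/
def cost : NExpr → ℕ
  | lit _ => 1
  | get _ i j => i.cost + j.cost + 1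
  | succ e => e.cost + 1
  | pred e => e.cost + 1

end NExpr

/-- Expressions for real numbers. -/
inductive RExpr where
  | lit (c : ℚ)
  | get (a : ℕ) (i j : NExpr)
  | add (e f : RExpr)
  | sub (e f : RExpr)
  | mul (e f : RExpr)
  | div (e f : RExpr)
  | sin (e : RExpr)
  | cos (e : RExpr)

namespace RExpr

/-- Value of an expression; dividing by zero yields zero. -/
def eval (s : Store) : RExpr → ℝ
  | lit c => (c : ℝ)
  | get a i j => s.real a (i.eval s) (j.eval s)
  | add e f => e.eval s + f.eval s
  | sub e f => e.eval s - f.eval s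
  | mul e f => e.eval s * f.eval s
  | div e f => e.eval s / f.eval s
  | sin e => Real.sin (e.eval s)
  | cos e => Real.cos (e.eval s)

/-- Cost of evaluating an expression: the number of its nodes. -/
def cost : RExpr → ℕ
  | lit _ => 1
  | get _ i j => i.cost + j.cost + 1
  | add e f => e.cost + f.cost + 1
  | sub e f => e.cost + f.cost + 1
  | mul e f => e.cost + f.cost + 1
  | div e f => e.cost + f.cost + 1
  | sin e => e.cost + 1
  | cos e => e.cost + 1

end RExpr

/-- Tests. -/
inductive Test where
  | natEq (e f : NExpr)
  | natLt (e f : NExpr)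
  | realLt (e f : RExpr)
  | not (b : Test)
  | and (b c : Test)

namespace Test

/-- Truth of a test. -/
def holds (s : Store) : Test → Prop
  | natEq e f => e.eval s = f.eval s
  | natLt e f => e.eval s < f.eval s
  | realLt e f => e.eval s < f.eval s
  | not b => ¬ b.holds s
  | and b c => b.holds s ∧ c.holds s

/-- Cost of a test: the number of its nodes. -/
def cost : Test → ℕ
  | natEq e f => e.cost + f.cost + 1
  | natLt e f => e.cost + f.cost + 1
  | realLt e f => e.cost + f.cost + 1
  | not b => b.cost + 1
  | and b c => b.cost + c.cost + 1

end Test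

/-- The real polynomial of degree at most `d` whose coefficients are stored in row `i` of the
real array `a`. -/
def Store.poly (s : Store) (a i d : ℕ) : Polynomial ℝ :=
  ∑ l ∈ Finset.range (d + 1), Polynomial.monomial l (s.real a i l)

/-- The `r`-th smallest real root of `p` (counted from zero, with multiplicity), and `0` if
there is none. -/
def realRoot (p : Polynomial ℝ) (r : ℕ) : ℝ :=
  (p.roots.sort (fun u v : ℝ => u ≤ v)).getD r 0

/-- A coin that shows `true` with probability `p`, where `p` is first clamped to `[0, 1]`. -/
def coin (p : ℝ) : PMF Bool :=
  PMF.ofFintype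
    (fun b => if b then ENNReal.ofReal (max 0 (min 1 p))
      else ENNReal.ofReal (1 - max 0 (min 1 p)))
    (by
      have h1 : 0 ≤ max 0 (min 1 p) := le_max_left _ _
      have h2 : 0 ≤ 1 - max 0 (min 1 p) :=
        sub_nonneg.mpr (max_le zero_le_one (min_le_left _ _))
      simp only [Fintype.sum_bool, if_true, Bool.false_eq_true, if_false]
      rw [← ENNReal.ofReal_add h1 h2]
      simp)

/-- Programs. -/
inductive Prog where
  /-- Do nothing. -/
  | skip
  /-- Assign to a natural-number cell. -/
  | setN (a : ℕ) (i j e : NExpr)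
  /-- Assign to a real cell. -/
  | setR (a : ℕ) (i j : NExpr) (e : RExpr)
  /-- `root a i j b l d r` stores in cell `(i, j)` of the real array `a` the `r`-th smallest
  real root of the polynomial of degree at most `d` stored in row `l` of the real array `b`. -/
  | root (a : ℕ) (i j : NExpr) (b : ℕ) (l d r : NExpr)
  /-- Set a natural-number cell to `1` with probability `p` and to `0` otherwise. -/
  | flip (a : ℕ) (i j : NExpr) (p : RExpr)
  /-- Sequential composition. -/
  | seq (c d : Prog)
  /-- Conditional. -/
  | ite (b : Test) (c d : Prog)
  /-- `loop x e c` evaluates `e` once, to `N`, and then runs `c` for the values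
  `0, …, N - 1` of the counter, which is kept in cell `(0, 0)` of the array `x`. -/
  | loop (x : ℕ) (e : NExpr) (c : Prog)

/-- `N` rounds of a counted loop with counter `x` and body `f`, each of which costs one step in
addition to the cost of the body. -/
def loopEval (x : ℕ) (f : Store → PMF Store) : ℕ → Store → PMF Store
  | 0, s => PMF.pure s
  | N + 1, s => (loopEval x f N s).bind fun s' => f ((s'.setNat x 0 0 N).tick 1)

open scoped Classical in
/-- The distribution of the final store of a program, as a function of the initial store. -/
def Prog.eval : Prog → Store → PMF Store
  | .skip, s => PMF.pure (s.tick 1)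
  | .setN a i j e, s =>
      PMF.pure ((s.setNat a (i.eval s) (j.eval s) (e.eval s)).tick
        (i.cost + j.cost + e.cost + 1))
  | .setR a i j e, s =>
      PMF.pure ((s.setReal a (i.eval s) (j.eval s) (e.eval s)).tick
        (i.cost + j.cost + e.cost + 1))
  | .root a i j b l d r, s =>
      PMF.pure ((s.setReal a (i.eval s) (j.eval s)
          (realRoot (s.poly b (l.eval s) (d.eval s)) (r.eval s))).tick
        (i.cost + j.cost + l.cost + d.cost + r.cost + d.eval s + 1))
  | .flip a i j p, s =>
      (coin (p.eval s)).map fun b =>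
        (s.setNat a (i.eval s) (j.eval s) (if b then 1 else 0)).tick
          (i.cost + j.cost + p.cost + 1)
  | .seq c d, s => (c.eval s).bind d.eval
  | .ite b c d, s =>
      if b.holds s then c.eval (s.tick (b.cost + 1)) else d.eval (s.tick (b.cost + 1))
  | .loop x e c, s => loopEval x c.eval (e.eval s) (s.tick (e.cost + 1))

/-! ### Inputs and outputs -/

/-- A vector as an array row, filled up with zeros. -/
def row {R : Type} [Zero R] {n : ℕ} (f : Fin n → R) (i j : ℕ) : R :=
  if h : i = 0 ∧ j < n then f ⟨j, h.2⟩ else 0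

/-- A matrix as an array, filled up with zeros. -/
def table {R : Type} [Zero R] {m n : ℕ} (f : Fin m → Fin n → R) (i j : ℕ) : R :=
  if h : i < m ∧ j < n then f ⟨i, h.1⟩ ⟨j, h.2⟩ else 0

/-- The initial store for a quench observed at time `t`: the numbers `n`, `m`, `k`; the symplectic
bits of `g`, `h` and `P`; the signs `x`; the reference label `z`; the coefficients `α` and `γ`;
the time `t`; and the amplitude of `ψ₀` at `z`, which fixes the global phase of `ψ₀`.
All other cells are zero. -/
def Quench.input {n m k : ℕ} (I : Quench n m k) (t : ℝ) : Store where
  nat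
    | 0 => row ![n, m, k]
    | 1 => table fun i q => (I.g i q).1.val
    | 2 => table fun i q => (I.g i q).2.val
    | 3 => table fun j q => (I.h j q).1.val
    | 4 => table fun j q => (I.h j q).2.val
    | 5 => table fun i q => (I.P i q).1.val
    | 6 => table fun i q => (I.P i q).2.val
    | 7 => row fun i => (I.x i).val
    | 8 => row fun q => (I.z q).val
    | _ => fun _ _ => 0
  real
    | 0 => row I.α
    | 1 => row I.γ
    | 2 => row ![t, (I.ψ₀ I.z).re, (I.ψ₀ I.z).im]
    | _ => fun _ _ => 0
  time := 0

/-- Add a bitstring to the input, in array `9`. -/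
def Store.withBits (s : Store) {n : ℕ} (y : Bits n) : Store :=
  { s with nat := fun a => if a = 9 then row fun q => (y q).val else s.nat a }

/-- Add a Pauli string to the input, in arrays `10` and `11`. -/
def Store.withPauli (s : Store) {n : ℕ} (Q : PauliString n) : Store :=
  { s with nat := fun a =>
      if a = 10 then row fun q => (Q q).1.val
      else if a = 11 then row fun q => (Q q).2.val
      else s.nat a }

/-- The complex number in the output cells (real and imaginary part). -/
def Store.outComplex (s : Store) : ℂ := ⟨s.real 3 0 0, s.real 3 0 1⟩

/-- The output cells hold the bitstring `y`. -/
def Store.OutBits (s : Store) {n : ℕ} (y : Bits n) : Prop :=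
  ∀ q : Fin n, s.nat 12 0 q = (y q).val

/-- The program started in `s` certainly stops within `T` steps. -/
def Prog.RunsIn (A : Prog) (s : Store) (T : ℕ) : Prop :=
  ∀ s' ∈ (A.eval s).support, s'.time ≤ s.time + T

/-- The program started in `s` certainly outputs the complex number `v`. -/
def Prog.Outputs (A : Prog) (s : Store) (v : ℂ) : Prop :=
  ∀ s' ∈ (A.eval s).support, s'.outComplex = v

/-- The probability that the program started in `s` outputs the bitstring `y`. -/
def Prog.probOut (A : Prog) (s : Store) {n : ℕ} (y : Bits n) : ENNReal :=
  (A.eval s).toOuterMeasure {s' | s'.OutBits y}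

end StabQuench

end

open StabQuench

noncomputable section

namespace StabQuench

section

/-! ### Signs and Weyl operators -/

/-! Let `T u` run through the elements of the group `K` generated by the perturbing strings, and let
`D = 2 ^ |K|`. The states `T u ψ₀` span a space invariant under the Hamiltonian. Each perturbing
string permutes them up to phases. Each term of `H₀` lies in the stabilizer group of `ψ₀`, so it has
`ψ₀` as an eigenvector and commutes with `T u` up to a sign; it therefore acts diagonally. Hence `H`
is intertwined with a Hermitian `D × D` matrix, `blockH`, by the linear map `combine`, which sends
the basis vector of the identity to `ψ₀` (`H_combine`). The family may be linearly dependent: the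
map still sends eigenvectors of the matrix to eigenvectors of `H` or to zero, and no more is needed.

The exponential of the small matrix applied to one vector is computed exactly with the Lanczos
recursion started there. It stops after some `L ≤ D` steps with the zero vector. The last polynomial
`P L` then divides a product of distinct linear factors that annihilates the start vector, so it has
`L` simple real roots (`Lanczos.roots_nodup_card`). Every root gives an explicit eigenvector, and
the Christoffel-Darboux identity expresses the start vector through these eigenvectors
(`Lanczos.sum_ritz`). Root extraction, sine and cosine then yield the coefficients of `ψ(t)` in the
family (`exp_mulVec_lanczos`, `Enum.ψ_eq`) in `O(D ^ 3)` steps, whatever `t` and the coefficients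
are.

All matrix elements of stabilizer operators reduce to one quantity, `rel R`, the amplitude of `R ψ₀`
at the reference label relative to that of `ψ₀`. The generators are brought into an echelon form
with respect to their `X`-parts; multiplying `R` by these rows leaves its action on `ψ₀` unchanged
and removes the pivot bits. Either a string without `X`-bits remains, which contributes a sign, or
the shifted label lies outside the support and the amplitude is zero (`run_relC`). The setup takes
`O(n ^ 3)` steps and each query `O(n ^ 2)`. Amplitudes of `ψ(t)` are sums of `D` such terms.
Expectation values need only the `D` overlaps of `ψ₀` with `Q T u ψ₀`, because an overlap depends on
a pair of elements only through their sum (`expect_combine`).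

Computing the `D` energies directly would cost `m D` signs. But a term of `H₀` acts on the family
only through its eigenvalue and the character of `K` given by its commutation signs. The
coefficients are therefore first collected by characters, in `O(n ^ 2)` steps per term, and a Walsh
transform of size `D` does the rest (`run_buckets`, `run_energies`).

For sampling, every label in the support of `ψ(t)` has the form `z + x(T u) + x(g)` with `g` in the
stabilizer group. The pairs `(g, u)` form a group and the shift is a homomorphism, so all labels in
its range are hit equally often, and it is enough to draw a pair with probability proportional to
the probability of its label (`sum_fiber`). This weight depends on `g` only through its character on
`K` (`norm_combine_shift`). So the generator exponents of `g` can be drawn one after the other by a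
random walk on the `D` characters, with transition probabilities from a table of total remaining
weights; then `u` is drawn digit by digit. Only lower bounds for the sampling probabilities are
proved; since the target probabilities add up to one, they are equalities (`lexp_outInd_eq`).

On the machine, numbers can only be counted up and down, so the group law of `K` (exclusive or of
indices) and its characters are kept in tables that double with every new generator. Correctness is
proved for the semantics without step counter, with loop invariants (`run_loop`) and a syntactic
account of the arrays that a program leaves alone (`Agree`). For the time, loops bounded by `n`, `D`
or `|K|` and nested at most three deep cost `O(max n D ^ 3)` (`Prog.time_le`). Two loops need
separate treatment: the one over the perturbation, where distinctness gives `k ≤ D`, and the one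
over the terms of `H₀`, whose body costs `O(n ^ 2)` because `|K| ≤ 2 n`. -/

/-- Bit vectors of length `n`. -/
abbrev Vec (n : ℕ) := Fin n → ZMod 2

/-- The sign character of `ZMod 2`. -/
def chi (a : ZMod 2) : ℝ := if a = 0 then 1 else -1

theorem zmod2_cases (a : ZMod 2) : a = 0 ∨ a = 1 := by
  revert a; decide

@[simp] theorem chi_zero : chi 0 = 1 := by simp [chi]

@[simp] theorem chi_one : chi 1 = -1 := by simp [chi]

theorem chi_add (a b : ZMod 2) : chi (a + b) = chi a * chi b := by
  rcases zmod2_cases a with rfl | rfl <;> rcases zmod2_cases b with rfl | rfl <;>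
    simp [show (1 : ZMod 2) + 1 = 0 from rfl]

@[simp] theorem chi_mul_self (a : ZMod 2) : chi a * chi a = 1 := by
  rcases zmod2_cases a with rfl | rfl <;> simp

theorem chi_ne_zero (a : ZMod 2) : chi a ≠ 0 := by
  rcases zmod2_cases a with rfl | rfl <;> simp

theorem abs_chi (a : ZMod 2) : |chi a| = 1 := by
  rcases zmod2_cases a with rfl | rfl <;> simp

theorem chi_eq_one {a : ZMod 2} : chi a = 1 ↔ a = 0 := by
  rcases zmod2_cases a with rfl | rfl <;> norm_num

theorem chi_sum {ι : Type*} (s : Finset ι) (f : ι → ZMod 2) :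
    chi (∑ i ∈ s, f i) = ∏ i ∈ s, chi (f i) := by
  classical
  induction s using Finset.induction_on with
  | empty => simp
  | insert a s ha ih => rw [Finset.sum_insert ha, Finset.prod_insert ha, chi_add, ih]

theorem vec_add_self {n : ℕ} (v : Vec n) : v + v = 0 := by
  ext q; exact CharTwo.add_self_eq_zero _

theorem pauli_add_self {n : ℕ} (P : PauliString n) : P + P = 0 := by
  ext q <;> exact CharTwo.add_self_eq_zero _

theorem vec_add_cancel {n : ℕ} (v w : Vec n) : v + w + w = v := by
  rw [add_assoc, vec_add_self, add_zero]

variable {n : ℕ}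

/-- The `X`-bits of a Pauli string. -/
def xp (P : PauliString n) : Vec n := fun q => (P q).1

/-- The `Z`-bits of a Pauli string. -/
def zp (P : PauliString n) : Vec n := fun q => (P q).2

/-- The Pauli string with given bits. -/
def mkP (x z : Vec n) : PauliString n := fun q => (x q, z q)

@[simp] theorem xp_mkP (x z : Vec n) : xp (mkP x z) = x := rfl
@[simp] theorem zp_mkP (x z : Vec n) : zp (mkP x z) = z := rfl
@[simp] theorem xp_add (P Q : PauliString n) : xp (P + Q) = xp P + xp Q := rfl
@[simp] theorem zp_add (P Q : PauliString n) : zp (P + Q) = zp P + zp Q := rfl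
@[simp] theorem xp_zero : xp (0 : PauliString n) = 0 := rfl
@[simp] theorem zp_zero : zp (0 : PauliString n) = 0 := rfl

theorem pauli_ext {P Q : PauliString n} (hx : xp P = xp Q) (hz : zp P = zp Q) : P = Q := by
  funext q; exact Prod.ext (congrFun hx q) (congrFun hz q)

/-- Bit vectors as computational-basis labels. -/
def bitsEquiv : Vec n ≃ Bits n where
  toFun v := v
  invFun y := y
  left_inv _ := rfl
  right_inv _ := rfl

/-- States as functions on the vector space of bit vectors. -/
abbrev Wave (n : ℕ) := Vec n → ℂ

/-- A state vector as a function on bit vectors. -/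
def toWave : Ket n ≃ₗ[ℂ] Wave n := LinearEquiv.funCongrLeft ℂ ℂ bitsEquiv

theorem toWave_apply (φ : Ket n) (y : Vec n) : toWave φ y = φ (bitsEquiv y) := rfl

/-- The Weyl operator `X^x Z^z` of a Pauli string, acting on states. -/
def wop (P : PauliString n) (φ : Wave n) : Wave n :=
  fun y => (chi (zp P ⬝ᵥ (y + xp P)) : ℂ) * φ (y + xp P)

theorem wop_apply (P : PauliString n) (φ : Wave n) (y : Vec n) :
    wop P φ y = (chi (zp P ⬝ᵥ (y + xp P)) : ℂ) * φ (y + xp P) := rfl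

/-- The phase relating a Pauli string to its Weyl operator, for one qubit. -/
def ph1 (a b : ZMod 2) : ℂ := if a = 1 ∧ b = 1 then Complex.I else 1

/-- The phase relating a Pauli string to its Weyl operator. -/
def iph (P : PauliString n) : ℂ := ∏ q, ph1 (xp P q) (zp P q)

/-- In `X ^ x Z ^ z` the factor `Z` acts first, so its sign is read at the column index; the factor
`i` for `Y` is the only phase left over. -/
theorem pauli1_apply (p : ZMod 2 × ZMod 2) (a b : ZMod 2) :
    pauli1 p a b = if b = a + p.1 then ph1 p.1 p.2 * (chi (p.2 * b) : ℂ) else 0 := by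
  obtain ⟨x, z⟩ := p
  rcases zmod2_cases x with rfl | rfl <;> rcases zmod2_cases z with rfl | rfl <;>
  rcases zmod2_cases a with rfl | rfl <;> rcases zmod2_cases b with rfl | rfl <;>
    simp [pauli1, ph1, show (1 : ZMod 2) + 1 = 0 from rfl] <;> rfl

theorem pauliOp_apply (P : PauliString n) (y y' : Vec n) :
    pauliOp P (bitsEquiv y) (bitsEquiv y') =
      if y' = y + xp P then iph P * (chi (zp P ⬝ᵥ y') : ℂ) else 0 := by
  have h : pauliOp P (bitsEquiv y) (bitsEquiv y') = ∏ q, (if y' q = y q + (P q).1 then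
      ph1 (P q).1 (P q).2 * (chi ((P q).2 * y' q) : ℂ) else 0) :=
    Finset.prod_congr rfl fun q _ => pauli1_apply _ _ _
  rw [h]
  split_ifs with hy
  · subst hy
    rw [dotProduct, chi_sum, Complex.ofReal_prod, iph, ← Finset.prod_mul_distrib]
    exact Finset.prod_congr rfl fun q _ => if_pos rfl
  · obtain ⟨q, hq⟩ := Function.ne_iff.mp hy
    exact Finset.prod_eq_zero (Finset.mem_univ q) (if_neg hq)

/-- From here on Pauli operators are treated as Weyl operators, whose products produce only signs.
The powers of `i` that make them Hermitian stay in the scalar `iph`. -/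
theorem toWave_pauliOp_mulVec (P : PauliString n) (φ : Ket n) :
    toWave ((pauliOp P).mulVec φ) = iph P • wop P (toWave φ) := by
  funext y
  have h : toWave ((pauliOp P).mulVec φ) y =
      ∑ y' : Bits n, pauliOp P (bitsEquiv y) y' * φ y' := rfl
  rw [h, ← Equiv.sum_comp bitsEquiv, Finset.sum_eq_single (y + xp P)]
  · rw [pauliOp_apply, if_pos rfl, Pi.smul_apply, wop_apply, smul_eq_mul, mul_assoc, toWave_apply]
  · intro y' _ hy'
    rw [pauliOp_apply, if_neg hy', zero_mul]
  · intro h; exact absurd (Finset.mem_univ _) h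

theorem wop_smul (P : PauliString n) (c : ℂ) (φ : Wave n) : wop P (c • φ) = c • wop P φ := by
  funext y
  rw [wop_apply, Pi.smul_apply, Pi.smul_apply, wop_apply, smul_eq_mul, smul_eq_mul]; ring

theorem wop_zero (φ : Wave n) : wop 0 φ = φ := by
  funext y
  rw [wop_apply]
  simp

/-- The sign arises from moving `Z ^ (zp P)` past `X ^ (xp Q)`. -/
theorem wop_wop (P Q : PauliString n) (φ : Wave n) :
    wop P (wop Q φ) = (chi (zp P ⬝ᵥ xp Q) : ℂ) • wop (P + Q) φ := by
  funext y
  rw [wop_apply, wop_apply, Pi.smul_apply, wop_apply, smul_eq_mul, xp_add, zp_add, ← add_assoc,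
    add_dotProduct, dotProduct_add (zp P) (_ + _) (xp Q), chi_add, chi_add]
  push_cast
  have := chi_mul_self (zp P ⬝ᵥ xp Q)
  have h2 : (chi (zp P ⬝ᵥ xp Q) : ℂ) * chi (zp P ⬝ᵥ xp Q) = 1 := by exact_mod_cast this
  linear_combination (-(chi (zp P ⬝ᵥ (y + xp P)) * chi (zp Q ⬝ᵥ (y + xp P + xp Q)) *
    φ (y + xp P + xp Q) : ℂ)) * h2

/-- The symplectic form, which detects whether Pauli strings commute. -/
def symp (P Q : PauliString n) : ZMod 2 := xp P ⬝ᵥ zp Q + zp P ⬝ᵥ xp Q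

theorem symp_add_left (P Q R : PauliString n) : symp (P + Q) R = symp P R + symp Q R := by
  simp only [symp, xp_add, zp_add, add_dotProduct]; ring

theorem symp_add_right (P Q R : PauliString n) : symp P (Q + R) = symp P Q + symp P R := by
  simp only [symp, xp_add, zp_add, dotProduct_add]; ring

theorem symp_comm (P Q : PauliString n) : symp P Q = symp Q P := by
  simp only [symp, dotProduct_comm (xp P), dotProduct_comm (zp P)]; ring

theorem wop_comm (P Q : PauliString n) (φ : Wave n) :
    wop P (wop Q φ) = (chi (symp P Q) : ℂ) • wop Q (wop P φ) := by
  rw [wop_wop, wop_wop, add_comm Q P, smul_smul, symp, chi_add, dotProduct_comm (xp P)]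
  congr 1
  rw [← Complex.ofReal_mul, mul_comm (chi _) (chi (zp P ⬝ᵥ xp Q)), mul_assoc, chi_mul_self, mul_one]

theorem iph_ne_zero (P : PauliString n) : iph P ≠ 0 := by
  refine Finset.prod_ne_zero_iff.mpr fun q _ => ?_
  unfold ph1; split_ifs <;> simp

/-- Each qubit carrying a `Y` contributes a factor `i`, and `zp P ⬝ᵥ xp P` counts these qubits
modulo two. The same count gives `iph_mul_self`. -/
theorem conj_iph (P : PauliString n) :
    (starRingEnd ℂ) (iph P) = iph P * chi (zp P ⬝ᵥ xp P) := by
  rw [dotProduct, chi_sum, iph, map_prod, Complex.ofReal_prod, ← Finset.prod_mul_distrib]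
  refine Finset.prod_congr rfl fun q _ => ?_
  rcases zmod2_cases (xp P q) with h | h <;> rcases zmod2_cases (zp P q) with h' | h' <;>
    simp [h, h', ph1]

theorem iph_mul_self (P : PauliString n) : iph P * iph P = chi (zp P ⬝ᵥ xp P) := by
  rw [dotProduct, chi_sum, iph, Complex.ofReal_prod, ← Finset.prod_mul_distrib]
  refine Finset.prod_congr rfl fun q _ => ?_
  rcases zmod2_cases (xp P q) with h | h <;> rcases zmod2_cases (zp P q) with h' | h' <;>
    simp [h, h', ph1]

theorem norm_wop_apply (P : PauliString n) (φ : Wave n) (y : Vec n) :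
    ‖wop P φ y‖ = ‖φ (y + xp P)‖ := by
  rw [wop_apply, norm_mul, Complex.norm_real, Real.norm_eq_abs, abs_chi, one_mul]

/-- Weyl operators preserve inner products. -/
theorem wop_inner (P : PauliString n) (φ χ : Wave n) :
    star (wop P φ) ⬝ᵥ wop P χ = star φ ⬝ᵥ χ := by
  have h : ∀ φ χ : Wave n, star φ ⬝ᵥ χ = ∑ y : Vec n, (starRingEnd ℂ) (φ y) * χ y := fun _ _ => rfl
  rw [h, h, ← Equiv.sum_comp (Equiv.addRight (xp P))]
  refine Finset.sum_congr rfl fun y _ => ?_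
  simp only [Equiv.coe_addRight]
  rw [wop_apply, wop_apply, map_mul, Complex.conj_ofReal, vec_add_cancel]
  have := chi_mul_self (zp P ⬝ᵥ y)
  have h2 : (chi (zp P ⬝ᵥ y) : ℂ) * chi (zp P ⬝ᵥ y) = 1 := by exact_mod_cast this
  linear_combination ((starRingEnd ℂ) (φ y) * χ y) * h2

/-! ### Stabilizer states -/

/-- The Pauli strings of which a state is an eigenvector. -/
def eigenPauli (w : Wave n) : Submodule (ZMod 2) (PauliString n) where
  carrier := {P | ∃ c : ℂ, wop P w = c • w}
  add_mem' := by
    rintro P Q ⟨c, hc⟩ ⟨d, hd⟩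
    refine ⟨chi (zp P ⬝ᵥ xp Q) * (d * c), ?_⟩
    have h := wop_wop P Q w
    rw [hd, wop_smul, hc, smul_smul] at h
    rw [mul_smul, h, smul_smul, ← Complex.ofReal_mul, chi_mul_self, Complex.ofReal_one, one_smul]
  zero_mem' := ⟨1, by rw [wop_zero, one_smul]⟩
  smul_mem' := by
    rintro a P ⟨c, hc⟩
    rcases zmod2_cases a with rfl | rfl
    · exact ⟨1, by rw [zero_smul, wop_zero, one_smul]⟩
    · exact ⟨c, by rw [one_smul, hc]⟩

/-- The symplectic form with a fixed first argument. -/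
def sympLin (P : PauliString n) : PauliString n →ₗ[ZMod 2] ZMod 2 where
  toFun Q := symp P Q
  map_add' := symp_add_right P
  map_smul' a Q := by
    rcases zmod2_cases a with rfl | rfl <;> simp [symp]

theorem symp_zero_left (Q : PauliString n) : symp 0 Q = 0 := by simp [symp]

theorem symp_smul_left (a : ZMod 2) (P Q : PauliString n) : symp (a • P) Q = a * symp P Q := by
  rcases zmod2_cases a with rfl | rfl <;> simp [symp_zero_left]

theorem symp_sum_left {ι : Type*} (s : Finset ι) (f : ι → PauliString n) (Q : PauliString n) :
    symp (∑ i ∈ s, f i) Q = ∑ i ∈ s, symp (f i) Q := by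
  classical
  induction s using Finset.induction_on with
  | empty => simp [symp_zero_left]
  | insert a s ha ih => rw [Finset.sum_insert ha, Finset.sum_insert ha, symp_add_left, ih]

theorem eq_zero_of_symp {P : PauliString n} (h : ∀ Q, symp P Q = 0) : P = 0 := by
  apply pauli_ext
  · funext q
    have := h (mkP 0 (Pi.single q 1))
    simpa [symp] using this
  · funext q
    have := h (mkP (Pi.single q 1) 0)
    simpa [symp] using this

section

variable {g : Fin n → PauliString n} (hind : LinearIndependent (ZMod 2) g) {w : Wave n}
  (heig : ∀ i, g i ∈ eigenPauli w)

theorem span_le_eigenPauli (heig : ∀ i, g i ∈ eigenPauli w) :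
    Submodule.span (ZMod 2) (Set.range g) ≤ eigenPauli w := by
  rw [Submodule.span_le]
  rintro _ ⟨i, rfl⟩
  exact heig i

/-- A Weyl operator squares to plus or minus the identity, so it annihilates no nonzero state. -/
theorem eigenPauli_ne_zero (hw : w ≠ 0) {P : PauliString n} {c : ℂ} (h : wop P w = c • w) :
    c ≠ 0 := by
  rintro rfl
  apply hw
  have h2 := wop_wop P P w
  rw [h, zero_smul, pauli_add_self, wop_zero] at h2
  have h0 : wop P (0 : Wave n) = 0 := by funext y; simp [wop_apply]
  rw [h0] at h2
  exact (smul_eq_zero.mp h2.symm).resolve_left (by exact_mod_cast chi_ne_zero _)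

/-- On a common nonzero eigenvector both orders of the product give the same nonzero scalar, so the
commutation sign must be `1`. -/
theorem symp_eq_zero_of_eigen (hw : w ≠ 0) {P Q : PauliString n} (hP : P ∈ eigenPauli w)
    (hQ : Q ∈ eigenPauli w) : symp P Q = 0 := by
  obtain ⟨c, hc⟩ := hP
  obtain ⟨d, hd⟩ := hQ
  have h := wop_comm P Q w
  rw [hd, hc, wop_smul, wop_smul, hc, hd, smul_smul, smul_smul, smul_smul] at h
  have h2 := smul_left_injective ℂ hw h
  have hcd : d * c ≠ 0 := mul_ne_zero (eigenPauli_ne_zero hw hd) (eigenPauli_ne_zero hw hc)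
  have h3 : (chi (symp P Q) : ℂ) = 1 := by
    apply mul_right_cancel₀ hcd
    linear_combination -h2
  exact chi_eq_one.mp (by exact_mod_cast h3)

include hind in
/-- A maximal commuting set of Pauli strings contains all Pauli strings commuting with it. -/
theorem mem_span_of_symp (hcomm : ∀ i j, symp (g i) (g j) = 0) {P : PauliString n}
    (hP : ∀ i, symp (g i) P = 0) : P ∈ Submodule.span (ZMod 2) (Set.range g) := by
  let L : PauliString n →ₗ[ZMod 2] (Fin n → ZMod 2) := LinearMap.pi fun i => sympLin (g i)
  have hL : ∀ Q i, L Q i = symp (g i) Q := fun _ _ => rfl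
  -- A functional that vanishes on the range gives a combination of generators that commutes with
  -- every string. By nondegeneracy of the symplectic form it is zero, and independence of the
  -- generators makes the functional zero.
  have hsurj : LinearMap.range L = ⊤ := by
    by_contra hne
    obtain ⟨f, hf, hle⟩ := Submodule.exists_le_ker_of_lt_top _ (lt_top_iff_ne_top.mpr hne)
    apply hf
    have hsum : ∑ i, f (Pi.single i 1) • g i = 0 := by
      apply eq_zero_of_symp
      intro Q
      rw [symp_sum_left]
      have h1 : f (L Q) = 0 := hle ⟨Q, rfl⟩
      rw [LinearMap.pi_apply_eq_sum_univ f (L Q)] at h1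
      rw [← h1]
      refine Finset.sum_congr rfl fun i _ => ?_
      rw [symp_smul_left, hL, smul_eq_mul, mul_comm]
      congr 2
      funext j; simp [Pi.single_apply, eq_comm]
    have h0 := Fintype.linearIndependent_iff.mp hind _ hsum
    apply LinearMap.ext
    intro v
    rw [LinearMap.pi_apply_eq_sum_univ f v]
    refine Finset.sum_eq_zero fun i _ => ?_
    have : (fun j => if i = j then (1 : ZMod 2) else 0) = Pi.single i 1 := by
      funext j; simp [Pi.single_apply, eq_comm]
    rw [this, h0 i, smul_zero]
  have hle : Submodule.span (ZMod 2) (Set.range g) ≤ LinearMap.ker L := by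
    rw [Submodule.span_le]
    rintro _ ⟨j, rfl⟩
    rw [SetLike.mem_coe, LinearMap.mem_ker]
    funext i
    exact hcomm i j
  -- The kernel, which consists of the strings commuting with all generators, has dimension `2 n - n
  -- = n`. It contains the span of the generators, of the same dimension.
  have hdim := LinearMap.finrank_range_add_finrank_ker L
  rw [hsurj, finrank_top] at hdim
  have hV : Module.finrank (ZMod 2) (PauliString n) = n + n := by
    rw [Module.finrank_pi_fintype]
    simp
    ring
  have hspan := finrank_span_eq_card hind
  rw [Fintype.card_fin] at hspan
  have hF : Module.finrank (ZMod 2) (Fin n → ZMod 2) = n := by simp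
  have heq := Submodule.eq_of_le_of_finrank_eq hle (by omega)
  rw [heq, LinearMap.mem_ker]
  funext i
  exact hP i

include hind heig in
/-- The support of a stabilizer state lies in a coset of the space of `X`-parts. -/
theorem mem_span_xp_of_ne_zero {z v : Vec n} (hz : w z ≠ 0) (hv : w (z + v) ≠ 0) :
    v ∈ Submodule.span (ZMod 2) (Set.range fun i => xp (g i)) := by
  have hw : w ≠ 0 := by rintro rfl; exact hz rfl
  by_contra hmem
  obtain ⟨f, hf, hle⟩ := Submodule.exists_le_ker_of_notMem hmem
  let u : Vec n := fun q => f (Pi.single q 1)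
  have hu : ∀ a : Vec n, f a = u ⬝ᵥ a := by
    intro a
    rw [LinearMap.pi_apply_eq_sum_univ f a, dotProduct]
    refine Finset.sum_congr rfl fun q _ => ?_
    rw [smul_eq_mul, mul_comm]
    congr 2
    funext j; simp [Pi.single_apply, eq_comm]
  -- The functional `u` kills all `X`-parts of generators but not `v`. Thus `Z ^ u` commutes with
  -- all generators and has `w` as an eigenvector, so `u ⬝ᵥ y` takes only one value on labels `y` in
  -- the support; this contradicts nonzero amplitudes at both `z` and `z + v`.
  have hP : mkP 0 u ∈ Submodule.span (ZMod 2) (Set.range g) := by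
    apply mem_span_of_symp hind fun i j => symp_eq_zero_of_eigen hw (heig i) (heig j)
    intro i
    have := hle (Submodule.subset_span ⟨i, rfl⟩)
    rw [LinearMap.mem_ker, hu] at this
    simp only [symp, zp_mkP, xp_mkP, dotProduct_zero, add_zero]
    rw [dotProduct_comm]; exact this
  obtain ⟨c, hc⟩ := span_le_eigenPauli heig hP
  have h1 := congrFun hc z
  have h2 := congrFun hc (z + v)
  simp only [wop_apply, xp_mkP, zp_mkP, add_zero, Pi.smul_apply, smul_eq_mul] at h1 h2
  have e1 := mul_right_cancel₀ hz h1
  have e2 := mul_right_cancel₀ hv h2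
  rw [← e1, dotProduct_add, chi_add] at e2
  have e3 : chi (u ⬝ᵥ z) * chi (u ⬝ᵥ v) = chi (u ⬝ᵥ z) * 1 := by
    rw [mul_one]; exact_mod_cast e2
  have e4 := mul_left_cancel₀ (chi_ne_zero _) e3
  exact hf (by rw [hu]; exact chi_eq_one.mp e4)

include hind heig in
/-- A Pauli string that commutes with the stabilizer group acts as a scalar. -/
theorem wop_eq_of_symp {z : Vec n} (hz : w z ≠ 0) {P : PauliString n}
    (hP : ∀ i, symp (g i) P = 0) : wop P w = (wop P w z / w z) • w := by
  have hw : w ≠ 0 := by rintro rfl; exact hz rfl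
  obtain ⟨c, hc⟩ := span_le_eigenPauli heig
    (mem_span_of_symp hind (fun i j => symp_eq_zero_of_eigen hw (heig i) (heig j)) hP)
  rw [hc, Pi.smul_apply, smul_eq_mul, mul_div_assoc, div_self hz, mul_one]

open scoped ComplexOrder in
/-- A Pauli string that anticommutes with a stabilizer has expectation value zero. -/
theorem inner_wop_eq_zero {P Q : PauliString n} {c : ℂ} (hw : w ≠ 0) (hQ : wop Q w = c • w)
    (h : symp Q P ≠ 0) : star w ⬝ᵥ wop P w = 0 := by
  have h1 : chi (symp Q P) = -1 := by
    rw [(zmod2_cases _).resolve_left h, chi_one]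
  have h2 := wop_inner Q w (wop P w)
  rw [wop_comm, hQ, wop_smul, h1, smul_smul, star_smul, smul_dotProduct, dotProduct_smul,
    smul_eq_mul, smul_eq_mul] at h2
  have h3 := wop_inner Q w w
  rw [hQ, star_smul, smul_dotProduct, dotProduct_smul, smul_eq_mul, smul_eq_mul] at h3
  have hne : star w ⬝ᵥ w ≠ 0 := by
    rw [Ne, dotProduct_star_self_eq_zero]
    exact hw
  have h4 : star c * c = 1 := by
    apply mul_right_cancel₀ hne
    rw [mul_assoc, h3, one_mul]
  push_cast at h2
  have h5 : -(star c * c) * (star w ⬝ᵥ wop P w) = star w ⬝ᵥ wop P w := by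
    linear_combination h2
  rw [h4] at h5
  linear_combination (-1/2 : ℂ) * h5

end

end

section

/-! ### The Lanczos recursion -/

open Polynomial Finset

/-- The vectors, recursion coefficients, squared norms and polynomials produced by `L` rounds of the
Lanczos recursion for the matrix `M`. -/
structure Lanczos {ι : Type*} [Fintype ι] (M : Matrix ι ι ℂ) (v : ℕ → ι → ℂ) (a b nn : ℕ → ℝ)
    (P : ℕ → ℝ[X]) (L : ℕ) : Prop where
  P_zero : P 0 = 1
  P_succ : ∀ j < L, P (j + 1) = (X - C (a j)) * P j - C (b j) * P (j - 1)
  v_succ : ∀ j < L, v (j + 1) = M.mulVec (v j) - (a j : ℂ) • v j - (b j : ℂ) • v (j - 1)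
  nn_eq : ∀ j ≤ L, nn j = ∑ i, ‖v j i‖ ^ 2
  nn_pos : ∀ j < L, 0 < nn j
  a_eq : ∀ j < L, a j = (star (v j) ⬝ᵥ M.mulVec (v j)).re / nn j
  b_zero : b 0 = 0
  b_succ : ∀ j < L, b (j + 1) = nn (j + 1) / nn j

/-- The coefficient at `N` cancels. For `N = 0` the difference would be the zero polynomial, whose
`natDegree` is `0`; that case is treated by hand where it occurs. -/
theorem natDegree_sub_coeff_mul_lt {p q : ℝ[X]} {N : ℕ} (hN : 0 < N) (hp : p.Monic)
    (hpN : p.natDegree = N) (hq : q.natDegree ≤ N) :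
    (q - C (q.coeff N) * p).natDegree < N := by
  have hle : (q - C (q.coeff N) * p).natDegree ≤ N :=
    
    (natDegree_sub_le_of_le hq ((natDegree_C_mul_le _ _).trans hpN.le)).trans (max_self N).le
  refine lt_of_le_of_ne hle fun heq => ?_
  have h0 : (q - C (q.coeff N) * p).leadingCoeff = 0 := by
    have hc : p.coeff N = 1 := by rw [← hpN]; exact hp
    rw [leadingCoeff, heq, coeff_sub, coeff_C_mul, hc, mul_one, sub_self]
  rw [leadingCoeff_eq_zero.mp h0, natDegree_zero] at heq
  omega

namespace Lanczos

variable {ι : Type*} [Fintype ι] {M : Matrix ι ι ℂ} {v : ℕ → ι → ℂ} {a b nn : ℕ → ℝ}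
  {P : ℕ → ℝ[X]} {L : ℕ} (h : Lanczos M v a b nn P L) (hM : M.IsHermitian)

theorem star_dotProduct_self (w : ι → ℂ) : star w ⬝ᵥ w = ((∑ i, ‖w i‖ ^ 2 : ℝ) : ℂ) := by
  rw [dotProduct, Complex.ofReal_sum]
  refine Finset.sum_congr rfl fun i _ => ?_
  rw [Pi.star_apply, RCLike.star_def, Complex.conj_mul']
  push_cast; rfl

theorem star_star_dotProduct (u w : ι → ℂ) : star (star u ⬝ᵥ w) = star w ⬝ᵥ u := by
  simp [dotProduct, mul_comm]

include hM in
theorem dot_mulVec (u w : ι → ℂ) : star u ⬝ᵥ M.mulVec w = star (M.mulVec u) ⬝ᵥ w := by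
  rw [Matrix.star_mulVec, hM.eq, Matrix.dotProduct_mulVec]

include hM in
theorem ofReal_re_dot (u : ι → ℂ) :
    (((star u ⬝ᵥ M.mulVec u).re : ℝ) : ℂ) = star u ⬝ᵥ M.mulVec u := by
  apply Complex.conj_eq_iff_re.mp
  change star (star u ⬝ᵥ M.mulVec u) = _
  rw [star_star_dotProduct, ← dot_mulVec hM]

include h in
theorem self_dot {j : ℕ} (hj : j ≤ L) : star (v j) ⬝ᵥ v j = (nn j : ℂ) := by
  rw [star_dotProduct_self, h.nn_eq j hj]

include h in
theorem mulVec_eq {j : ℕ} (hj : j < L) :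
    M.mulVec (v j) = v (j + 1) + (a j : ℂ) • v j + (b j : ℂ) • v (j - 1) := by
  rw [h.v_succ j hj]; abel

include h hM in
-- Since `M` is Hermitian, the product of `v i` with `M (v j)` equals that of `M (v i)` with `v j`,
-- and `M (v i)` is a combination of `v (i - 1)`, `v i` and `v (i + 1)`. So among the earlier
-- vectors only `v j` and `v (j - 1)` can obstruct orthogonality, and `a j` and `b j` are the
-- coefficients that remove them.
theorem orthogonal {j : ℕ} (hj : j ≤ L) : ∀ i < j, star (v i) ⬝ᵥ v j = 0 := by
  induction j using Nat.strong_induction_on with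
  | _ j ih =>
    rcases j with _ | j
    · intro i hi; omega
    have hjL : j < L := hj
    have hnj : (nn j : ℂ) ≠ 0 := by exact_mod_cast (h.nn_pos j hjL).ne'
    have sym : ∀ i k, k < i → i ≤ j → star (v i) ⬝ᵥ v k = 0 := by
      intro i k hki hij
      have := ih i (by omega) (by omega) k hki
      rw [← star_star_dotProduct, this, star_zero]
    intro i hi
    rw [h.v_succ j hjL, dotProduct_sub, dotProduct_sub, dotProduct_smul, dotProduct_smul,
      smul_eq_mul, smul_eq_mul]
    rcases (Nat.lt_succ_iff.mp hi).eq_or_lt with rfl | hij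
    · have h1 : (b i : ℂ) * (star (v i) ⬝ᵥ v (i - 1)) = 0 := by
        rcases i with _ | i
        · rw [h.b_zero]; simp
        · rw [Nat.add_sub_cancel, sym (i + 1) i (by omega) le_rfl, mul_zero]
      rw [h1, h.self_dot hjL.le, h.a_eq i hjL, Complex.ofReal_div, ofReal_re_dot hM,
        div_mul_cancel₀ _ hnj]
      ring
    · rw [ih j (by omega) hjL.le i hij, dot_mulVec hM, h.mulVec_eq (by omega)]
      simp only [star_add, star_smul, add_dotProduct, smul_dotProduct]
      rw [ih j (by omega) hjL.le i hij, ih j (by omega) hjL.le (i - 1) (by omega)]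
      rcases (Nat.succ_le_of_lt hij).eq_or_lt with hij' | hij'
      · obtain rfl : j = i + 1 := hij'.symm
        rw [Nat.add_sub_cancel, h.self_dot hjL.le, h.self_dot (by omega), h.b_succ i (by omega)]
        have : (nn i : ℂ) ≠ 0 := by exact_mod_cast (h.nn_pos i (by omega)).ne'
        push_cast
        rw [div_mul_cancel₀ _ this]
        simp
      · rw [ih j (by omega) hjL.le (i + 1) hij', ih (j - 1) (by omega) (by omega) i (by omega)]
        simp

variable [DecidableEq ι]

include h in
theorem v_eq_aeval {j : ℕ} (hj : j ≤ L) : v j = (aeval M (P j)).mulVec (v 0) := by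
  induction j using Nat.strong_induction_on with
  | _ j ih =>
    rcases j with _ | j
    · rw [h.P_zero, map_one, Matrix.one_mulVec]
    · have hc : ∀ r : ℝ, ∀ w : ι → ℂ, (algebraMap ℝ (Matrix ι ι ℂ) r).mulVec w = (r : ℂ) • w := by
        intro r w
        rw [Algebra.algebraMap_eq_smul_one, Matrix.smul_mulVec, Matrix.one_mulVec]; rfl
      rw [h.v_succ j hj, h.P_succ j hj, map_sub, map_mul, map_mul, map_sub, aeval_X, aeval_C,
        aeval_C, Matrix.sub_mulVec, ← Matrix.mulVec_mulVec, ← Matrix.mulVec_mulVec,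
        ← ih j (by omega) (by omega), ← ih (j - 1) (by omega) (by omega), Matrix.sub_mulVec,
        hc, hc]

omit [DecidableEq ι] in
include h in
theorem monic_natDegree {j : ℕ} (hj : j ≤ L) : (P j).Monic ∧ (P j).natDegree = j := by
  induction j using Nat.strong_induction_on with
  | _ j ih =>
    rcases j with _ | j
    · rw [h.P_zero]; exact ⟨monic_one, natDegree_one⟩
    · obtain ⟨hm, hd⟩ := ih j (by omega) (by omega)
      have h1 : ((X - C (a j)) * P j).Monic := (monic_X_sub_C _).mul hm
      have h2 : ((X - C (a j)) * P j).natDegree = j + 1 := by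
        rw [(monic_X_sub_C _).natDegree_mul hm, natDegree_X_sub_C, hd, add_comm]
      have h3 : (C (b j) * P (j - 1)).natDegree < ((X - C (a j)) * P j).natDegree := by
        have hd' := (ih (j - 1) (by omega) (by omega)).2
        have := natDegree_C_mul_le (b j) (P (j - 1))
        omega
      rw [h.P_succ j hj]
      exact ⟨h1.sub_of_left (degree_lt_degree h3),
        by rw [natDegree_sub_eq_left_of_natDegree_lt h3, h2]⟩

include h hM in
-- The polynomials `P i` are monic of degree `i`, so a polynomial of degree below `j` is a
-- combination of earlier ones, to whose vectors `v j` is orthogonal. The induction strips off one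
-- leading coefficient at a time.
theorem dot_aeval_eq_zero {j : ℕ} (hj : j ≤ L) : ∀ N, ∀ q : ℝ[X], q.natDegree < N → N ≤ j →
    star (v j) ⬝ᵥ (aeval M q).mulVec (v 0) = 0 := by
  intro N
  induction N with
  | zero => intro q hq; omega
  | succ N ih =>
    intro q hq hN
    obtain ⟨hm, hd⟩ := h.monic_natDegree (show N ≤ L by omega)
    have hlow : (aeval M (q - C (q.coeff N) * P N)).mulVec (v 0) =
        (aeval M q).mulVec (v 0) - (q.coeff N : ℂ) • v N := by
      rw [map_sub, Matrix.sub_mulVec, map_mul, aeval_C, h.v_eq_aeval (show N ≤ L by omega),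
        Algebra.algebraMap_eq_smul_one, smul_mul_assoc, one_mul, Matrix.smul_mulVec]
      rfl
    have hz : star (v j) ⬝ᵥ (aeval M (q - C (q.coeff N) * P N)).mulVec (v 0) = 0 := by
      rcases N.eq_zero_or_pos with rfl | hNpos
      · have hq0 : q = C (q.coeff 0) := eq_C_of_natDegree_eq_zero (by omega)
        rw [h.P_zero, mul_one, ← hq0, sub_self, map_zero, Matrix.zero_mulVec, dotProduct_zero]
      · exact ih _ (natDegree_sub_coeff_mul_lt hNpos hm hd (by omega)) (by omega)
    have ho := h.orthogonal hM hj N (by omega)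
    have ho' : star (v j) ⬝ᵥ v N = 0 := by rw [← star_star_dotProduct, ho, star_zero]
    rw [hlow, dotProduct_sub, dotProduct_smul, ho', smul_zero, sub_zero] at hz
    exact hz

include h hM in
/-- The vectors `v 0, …, v L` are linearly independent unless the last one vanishes. -/
theorem eq_zero_of_aeval {j : ℕ} (hj : j ≤ L) (hpos : ∀ i ≤ j, 0 < nn i) {q : ℝ[X]}
    (hq : q.natDegree ≤ j) (hv : (aeval M q).mulVec (v 0) = 0) : q = 0 := by
  by_contra hne
  have hi : q.natDegree ≤ L := hq.trans hj
  obtain ⟨hm, hd⟩ := h.monic_natDegree hi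
  set i := q.natDegree with hidef
  have h1 : (aeval M (q - C q.leadingCoeff * P i)).mulVec (v 0) =
      - ((q.leadingCoeff : ℂ) • v i) := by
    rw [map_sub, Matrix.sub_mulVec, hv, zero_sub, map_mul, aeval_C, h.v_eq_aeval hi,
      Algebra.algebraMap_eq_smul_one, smul_mul_assoc, one_mul, Matrix.smul_mulVec]
    rfl
  -- The difference has degree below `i`, so `v i` is orthogonal to it. As the vector of `q`
  -- vanishes, what remains is the leading coefficient times the squared norm of `v i`.
  have h2 : star (v i) ⬝ᵥ (aeval M (q - C q.leadingCoeff * P i)).mulVec (v 0) = 0 := by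
    rcases i.eq_zero_or_pos with h0 | hpos'
    · have hq0 : q = C (q.coeff 0) := eq_C_of_natDegree_eq_zero (by omega)
      have : q - C q.leadingCoeff * P i = 0 := by
        rw [h0, h.P_zero, mul_one, leadingCoeff, ← hidef, h0, ← hq0, sub_self]
      rw [this, map_zero, Matrix.zero_mulVec, dotProduct_zero]
    · exact h.dot_aeval_eq_zero hM hi i _ (natDegree_sub_coeff_mul_lt hpos' hm hd le_rfl) le_rfl
  rw [h1, dotProduct_neg, dotProduct_smul, h.self_dot hi, neg_eq_zero, smul_eq_mul, mul_eq_zero] at h2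
  rcases h2 with h2 | h2
  · exact hne (leadingCoeff_eq_zero.mp (by exact_mod_cast h2))
  · exact (hpos i hq).ne' (by exact_mod_cast h2)

theorem aeval_mulVec_of_eigen {u : ι → ℂ} {r : ℝ} (hu : M.mulVec u = (r : ℂ) • u) (q : ℝ[X]) :
    (aeval M q).mulVec u = ((q.eval r : ℝ) : ℂ) • u := by
  induction q using Polynomial.induction_on' with
  | add p q hp hq => rw [map_add, Matrix.add_mulVec, hp, hq, eval_add, Complex.ofReal_add, add_smul]
  | monomial k c =>
    have hk : (M ^ k).mulVec u = ((r ^ k : ℝ) : ℂ) • u := by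
      induction k with
      | zero => simp
      | succ k ih =>
        rw [pow_succ, ← Matrix.mulVec_mulVec, hu, Matrix.mulVec_smul, ih, smul_smul, pow_succ]
        push_cast
        rw [mul_comm]
    rw [aeval_monomial, ← Matrix.mulVec_mulVec, hk, Algebra.algebraMap_eq_smul_one,
      Matrix.smul_mulVec, Matrix.one_mulVec, eval_monomial]
    push_cast
    rw [mul_smul]; rfl

include hM in
-- The product runs over the set of eigenvalues, so repeated eigenvalues occur once and all roots
-- are simple. It kills each vector of an eigenbasis, hence every vector.
theorem exists_annihilator (w : ι → ℂ) : ∃ q : ℝ[X], q ≠ 0 ∧ q.natDegree ≤ Fintype.card ι ∧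
    q.roots.Nodup ∧ q.Splits ∧ (aeval M q).mulVec w = 0 := by
  let S : Finset ℝ := Finset.univ.image hM.eigenvalues
  let q : ℝ[X] := ∏ r ∈ S, (X - C r)
  have hroots : q.roots = S.val := roots_prod_X_sub_C S
  refine ⟨q, (monic_prod_of_monic _ _ fun r _ => monic_X_sub_C r).ne_zero, ?_, ?_, ?_, ?_⟩
  · rw [natDegree_prod_of_monic _ _ fun r _ => monic_X_sub_C r]
    simpa using Finset.card_image_le (s := Finset.univ) (f := hM.eigenvalues)
  · rw [hroots]; exact S.nodup
  · exact Splits.prod fun r _ => Splits.X_sub_C r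
  · have hsum := hM.eigenvectorBasis.sum_repr (WithLp.toLp 2 w)
    have hw : w = ∑ k, (hM.eigenvectorBasis.repr (WithLp.toLp 2 w)).ofLp k •
        (hM.eigenvectorBasis k).ofLp := by
      have := congrArg WithLp.ofLp hsum
      rw [WithLp.ofLp_sum] at this
      exact this.symm
    rw [hw, Matrix.mulVec_sum]
    refine Finset.sum_eq_zero fun k _ => ?_
    rw [Matrix.mulVec_smul, aeval_mulVec_of_eigen (r := hM.eigenvalues k)
      (hM.mulVec_eigenvectorBasis k)]
    have : q.eval (hM.eigenvalues k) = 0 := by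
      have hk : hM.eigenvalues k ∈ q.roots := by
        rw [hroots]; exact Finset.mem_image_of_mem _ (Finset.mem_univ k)
      exact isRoot_of_mem_roots hk
    rw [this]; simp

include h hM in
/-- After as many rounds as the dimension, the recursion has terminated. -/
theorem nn_card_eq_zero (hL : L = Fintype.card ι) : nn L = 0 := by
  obtain ⟨q, hq0, hdeg, -, -, hq⟩ := exists_annihilator hM (v 0)
  by_contra hne
  have hpos : 0 < nn L :=
    lt_of_le_of_ne (by rw [h.nn_eq L le_rfl]; positivity) (Ne.symm hne)
  refine hq0 (h.eq_zero_of_aeval hM le_rfl (fun i hi => ?_) (hdeg.trans hL.ge) hq)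
  rcases hi.eq_or_lt with rfl | hi
  · exact hpos
  · exact h.nn_pos i hi

include h in
omit [DecidableEq ι] in
theorem v_eq_zero (h0 : nn L = 0) : v L = 0 := by
  have h1 := h.nn_eq L le_rfl
  rw [h0, eq_comm, Finset.sum_eq_zero_iff_of_nonneg fun i _ => by positivity] at h1
  funext i
  simpa using h1 i (Finset.mem_univ i)

include h hM in
/-- The last polynomial has as many distinct real roots as its degree. -/
theorem roots_nodup_card (h0 : nn L = 0) : (P L).roots.Nodup ∧ (P L).roots.card = L := by
  obtain ⟨q, hq0, -, hnd, hsp, hq⟩ := exists_annihilator hM (v 0)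
  obtain ⟨hm, hd⟩ := h.monic_natDegree le_rfl
  -- Because `P L` annihilates the start vector, so does the remainder of `q` modulo `P L`. Its
  -- degree is below `L`, and the vectors `v 0, …, v (L - 1)` are independent, so the remainder is
  -- zero. Simple real roots and splitting are inherited by divisors.
  have hdvd : P L ∣ q := by
    rw [← modByMonic_eq_zero_iff_dvd hm]
    rcases L.eq_zero_or_pos with hL | hL
    · rw [hL, h.P_zero, modByMonic_one]
    have hlt : (q %ₘ P L).natDegree < L := by
      have := natDegree_modByMonic_lt q hm (by intro h1; rw [h1, natDegree_one] at hd; omega)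
      omega
    refine h.eq_zero_of_aeval hM (j := L - 1) (by omega) (fun i hi => h.nn_pos i (by omega))
      (by omega) ?_
    have h1 := congrArg (fun r => (aeval M r).mulVec (v 0)) (modByMonic_add_div q (P L))
    simp only [map_add] at h1
    rw [hq, Matrix.add_mulVec, mul_comm, map_mul, ← Matrix.mulVec_mulVec,
      ← h.v_eq_aeval le_rfl, h.v_eq_zero h0, Matrix.mulVec_zero, add_zero] at h1
    exact h1
  exact ⟨Multiset.nodup_of_le (roots.le_of_dvd hq0 hdvd) hnd,
    by rw [← (hsp.of_dvd hq0 hdvd).natDegree_eq_card_roots, hd]⟩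

include h in
omit [DecidableEq ι] in
-- The three-term recurrence telescopes after division by `nn j`, because `b (j + 1) = nn (j + 1) /
-- nn j`. For two distinct roots of `P L` and `J = L - 1` the right side vanishes, which makes the
-- values of the polynomials at the roots orthogonal.
theorem christoffel_darboux (x y : ℝ) {J : ℕ} (hJ : J < L) :
    (x - y) * ∑ j ∈ range (J + 1), (P j).eval x * (P j).eval y / nn j =
      ((P (J + 1)).eval x * (P J).eval y - (P J).eval x * (P (J + 1)).eval y) / nn J := by
  induction J with
  | zero =>
    rw [h.P_succ 0 hJ, h.b_zero]
    simp [h.P_zero]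
    ring
  | succ J ih =>
    have h1 : nn J ≠ 0 := (h.nn_pos J (by omega)).ne'
    have h2 : nn (J + 1) ≠ 0 := (h.nn_pos (J + 1) hJ).ne'
    rw [Finset.sum_range_succ, mul_add, ih (by omega), h.P_succ (J + 1) hJ, Nat.add_sub_cancel,
      h.b_succ J (by omega)]
    simp only [eval_sub, eval_mul, eval_X, eval_C]
    field_simp
    ring

/-- The eigenvector of `M` belonging to a root of the last polynomial. -/
def ritz (v : ℕ → ι → ℂ) (nn : ℕ → ℝ) (P : ℕ → ℝ[X]) (L : ℕ) (x : ℝ) : ι → ℂ :=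
  ∑ j ∈ range L, (((P j).eval x / nn j : ℝ) : ℂ) • v j

include h in
omit [DecidableEq ι] in
theorem mulVec_ritz (h0 : nn L = 0) {x : ℝ} (hx : (P L).eval x = 0) :
    M.mulVec (ritz v nn P L x) = (x : ℂ) • ritz v nn P L x := by
  -- Truncated sums satisfy the eigenvector equation up to two boundary terms. At `J = L` these
  -- vanish, one because `v L = 0` and the other because `x` is a root of `P L`.
  have key : ∀ J ≤ L, M.mulVec (ritz v nn P J x) - (x : ℂ) • ritz v nn P J x =
      if J = 0 then 0 else (((P (J - 1)).eval x / nn (J - 1) : ℝ) : ℂ) • v J -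
        (((P J).eval x / nn (J - 1) : ℝ) : ℂ) • v (J - 1) := by
    intro J hJ
    induction J with
    | zero => simp [ritz]
    | succ J ih =>
      have h1 := ih (by omega)
      have hr : ritz v nn P (J + 1) x =
          ritz v nn P J x + (((P J).eval x / nn J : ℝ) : ℂ) • v J := Finset.sum_range_succ _ _
      have hJn : (nn J : ℂ) ≠ 0 := by exact_mod_cast (h.nn_pos J hJ).ne'
      rw [hr, Matrix.mulVec_add, Matrix.mulVec_smul, h.mulVec_eq hJ, if_neg (by omega),
        Nat.add_sub_cancel, smul_add (x : ℂ)]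
      rw [sub_eq_iff_eq_add] at h1
      rw [h1, h.P_succ J hJ]
      rcases J with _ | J
      · rw [h.P_zero, h.b_zero]
        funext i
        simp
        ring
      · have hJn' : (nn J : ℂ) ≠ 0 := by exact_mod_cast (h.nn_pos J (by omega)).ne'
        rw [if_neg (by omega), Nat.add_sub_cancel, h.b_succ J (by omega)]
        funext i
        simp only [Pi.add_apply, Pi.sub_apply, Pi.smul_apply, smul_eq_mul, eval_sub, eval_mul,
          eval_X, eval_C]
        push_cast
        field_simp
        ring
  have hL := key L le_rfl
  rw [← sub_eq_zero, hL, hx, h.v_eq_zero h0]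
  split_ifs <;> simp

include h in
omit [DecidableEq ι] in
/-- The initial vector as a combination of eigenvectors. -/
theorem sum_ritz (hL : 0 < L) {r : ℕ → ℝ}
    (hr : ∀ l < L, (P L).eval (r l) = 0)
    (hinj : ∀ l < L, ∀ l' < L, r l = r l' → l = l') :
    v 0 = ∑ l ∈ range L,
      ((1 / (∑ j ∈ range L, (P j).eval (r l) ^ 2 / nn j) : ℝ) : ℂ) • ritz v nn P L (r l) := by
  let S : ℕ → ℝ := fun l => ∑ j ∈ range L, (P j).eval (r l) ^ 2 / nn j
  have hS : ∀ l, 0 < S l := fun l => by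
    refine Finset.sum_pos' (fun j hj => div_nonneg (sq_nonneg _)
      (h.nn_pos j (Finset.mem_range.mp hj)).le) ⟨0, Finset.mem_range.mpr hL, ?_⟩
    rw [h.P_zero]
    have := h.nn_pos 0 hL
    simp [this]
  -- The Christoffel-Darboux identity gives `A * B = 1`. For square matrices this implies `B * A =
  -- 1`, whose column `0` says that the weighted eigenvectors add up to `v 0`, as `P 0 = 1`.
  let A : Matrix (Fin L) (Fin L) ℝ := fun l j => (P j).eval (r l) / S l
  let B : Matrix (Fin L) (Fin L) ℝ := fun j l => (P j).eval (r l) / nn j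
  have hAB : A * B = 1 := by
    ext l l'
    rw [Matrix.mul_apply, Matrix.one_apply]
    have e : ∑ j : Fin L, A l j * B j l' =
        (∑ j ∈ range L, (P j).eval (r l) * (P j).eval (r l') / nn j) / S l := by
      rw [Finset.sum_range, Finset.sum_div]
      refine Finset.sum_congr rfl fun j _ => ?_
      simp only [A, B]; ring
    rw [e]
    split_ifs with hll
    · subst hll
      have : (∑ j ∈ range L, (P j).eval (r l) * (P j).eval (r l) / nn j) = S l :=
        Finset.sum_congr rfl fun j _ => by rw [sq]
      rw [this, div_self (hS l).ne']
    · have hcd := h.christoffel_darboux (r l) (r l') (J := L - 1) (by omega)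
      rw [Nat.sub_add_cancel hL, hr l l.2, hr l' l'.2] at hcd
      have hne : r l - r l' ≠ 0 := fun h' =>
        hll (Fin.ext (hinj l l.2 l' l'.2 (sub_eq_zero.mp h')))
      have : (∑ j ∈ range L, (P j).eval (r l) * (P j).eval (r l') / nn j) = 0 := by
        apply mul_left_cancel₀ hne
        rw [hcd]; simp
      rw [this, zero_div]
  have hBA : B * A = 1 := mul_eq_one_comm.mp hAB
  have hcoef : ∀ j < L, ∑ l ∈ range L, (P j).eval (r l) / nn j / S l = if j = 0 then 1 else 0 := by
    intro j hj
    have e := congrFun (congrFun hBA ⟨j, hj⟩) ⟨0, hL⟩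
    rw [Matrix.mul_apply, Matrix.one_apply] at e
    rw [Finset.sum_range]
    simp only [A, B, h.P_zero, eval_one, Fin.mk.injEq] at e
    rw [← e]
    exact Finset.sum_congr rfl fun l _ => by ring
  have hexp : ∑ l ∈ range L, ((1 / S l : ℝ) : ℂ) • ritz v nn P L (r l) =
      ∑ j ∈ range L, ((∑ l ∈ range L, (P j).eval (r l) / nn j / S l : ℝ) : ℂ) • v j := by
    simp only [ritz, Finset.smul_sum]
    rw [Finset.sum_comm]
    refine Finset.sum_congr rfl fun j _ => ?_
    rw [Complex.ofReal_sum, Finset.sum_smul]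
    refine Finset.sum_congr rfl fun l _ => ?_
    rw [smul_smul, ← Complex.ofReal_mul]
    congr 2
    ring
  change v 0 = ∑ l ∈ range L, ((1 / S l : ℝ) : ℂ) • ritz v nn P L (r l)
  rw [hexp, Finset.sum_eq_single 0]
  · rw [hcoef 0 hL]; simp
  · intro j hj hj0
    rw [hcoef j (Finset.mem_range.mp hj), if_neg hj0]; simp
  · intro h'; exact absurd (Finset.mem_range.mpr hL) h'

end Lanczos

/-! ### Real roots in increasing order -/

theorem eval_realRoot {p : ℝ[X]} {l : ℕ} (hl : l < p.roots.card) :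
    p.eval (realRoot p l) = 0 := by
  have hlen : l < (p.roots.sort (fun u v : ℝ => u ≤ v)).length := by
    rw [Multiset.length_sort]; exact hl
  have hmem : realRoot p l ∈ p.roots := by
    rw [realRoot, List.getD_eq_getElem _ _ hlen, ← Multiset.mem_sort (r := fun u v : ℝ => u ≤ v)]
    exact List.getElem_mem hlen
  exact isRoot_of_mem_roots hmem

theorem realRoot_inj {p : ℝ[X]} (hnd : p.roots.Nodup) {l l' : ℕ} (hl : l < p.roots.card)
    (hl' : l' < p.roots.card) (h : realRoot p l = realRoot p l') : l = l' := by
  have hlen : (p.roots.sort (fun u v : ℝ => u ≤ v)).length = p.roots.card :=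
    Multiset.length_sort _
  have hnd' : (p.roots.sort (fun u v : ℝ => u ≤ v)).Nodup := by
    rw [← Multiset.coe_nodup, Multiset.sort_eq]; exact hnd
  rw [realRoot, realRoot, List.getD_eq_getElem _ _ (by omega),
    List.getD_eq_getElem _ _ (by omega)] at h
  exact (hnd'.getElem_inj_iff).mp h

/-! ### Evolution of the quenched state -/

variable {n m k : ℕ}

open Finset Polynomial

open scoped Matrix.Norms.Operator in
theorem exp_mulVec_eigen {A : Op n} {φ : Ket n} {c : ℂ} (h : A.mulVec φ = c • φ) :
    (NormedSpace.exp A).mulVec φ = Complex.exp c • φ := by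
  have hpow : ∀ j : ℕ, (A ^ j).mulVec φ = c ^ j • φ := by
    intro j
    induction j with
    | zero => simp
    | succ j ih => rw [pow_succ, ← Matrix.mulVec_mulVec, h, Matrix.mulVec_smul, ih, smul_smul,
        pow_succ, mul_comm]
  have h1 := NormedSpace.exp_series_hasSum_exp' (𝕂 := ℂ) A
  let F : Op n →ₗ[ℂ] Ket n :=
    { toFun := fun B => B.mulVec φ
      map_add' := fun B C => Matrix.add_mulVec B C φ
      map_smul' := fun r B => Matrix.smul_mulVec r B φ }
  have h2 := (F.toContinuousLinearMap).hasSum h1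
  have h3 := (NormedSpace.exp_series_hasSum_exp' (𝕂 := ℂ) c).smul_const φ
  have h4 : ∀ j : ℕ, F.toContinuousLinearMap (((j.factorial : ℂ)⁻¹) • A ^ j) =
      (((j.factorial : ℂ)⁻¹) • c ^ j) • φ := by
    intro j
    change ((((j.factorial : ℂ)⁻¹) • A ^ j)).mulVec φ = _
    rw [Matrix.smul_mulVec, hpow, smul_assoc]
  have h5 := (funext h4 : (fun j : ℕ => F.toContinuousLinearMap (((j.factorial : ℂ)⁻¹) • A ^ j)) = _)
  have h2' : HasSum (fun j : ℕ => F.toContinuousLinearMap (((j.factorial : ℂ)⁻¹) • A ^ j))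
      (F.toContinuousLinearMap (NormedSpace.exp A)) := h2
  rw [h5] at h2'
  have := h2'.unique h3
  rw [Complex.exp_eq_exp_ℂ]
  exact this

/-- The coefficients of the evolved vector produced by the Lanczos recursion. -/
def evolvedVec {ι : Type*} (v : ℕ → ι → ℂ) (nn : ℕ → ℝ) (P : ℕ → ℝ[X]) (L : ℕ) (t : ℝ) : ι → ℂ :=
  ∑ l ∈ range L, (Complex.exp (-(Complex.I * t) * realRoot (P L) l) *
    ((1 / (∑ j ∈ range L, (P j).eval (realRoot (P L) l) ^ 2 / nn j) : ℝ) : ℂ)) •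
      Lanczos.ritz v nn P L (realRoot (P L) l)

/-- Only the intertwining relation `hΦ` enters: it turns eigenvectors of `M` into vectors on which
`A` acts by the same scalar. No injectivity of `Φ` is required, so the spanning family may be
linearly dependent. -/
theorem exp_mulVec_lanczos {ι : Type*} [Fintype ι] [DecidableEq ι] {M : Matrix ι ι ℂ}
    {v : ℕ → ι → ℂ} {a b nn : ℕ → ℝ} {P : ℕ → ℝ[X]} {L : ℕ} (h : Lanczos M v a b nn P L)
    (hM : M.IsHermitian) (h0 : nn L = 0) (hv : v 0 ≠ 0) {A : Op n} (Φ : (ι → ℂ) →ₗ[ℂ] Ket n)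
    (hΦ : ∀ u, A.mulVec (Φ u) = Φ (M.mulVec u)) (t : ℝ) :
    (NormedSpace.exp ((-(Complex.I * (t : ℂ))) • A)).mulVec (Φ (v 0)) =
      Φ (evolvedVec v nn P L t) := by
  obtain ⟨hnd, hcard⟩ := h.roots_nodup_card hM h0
  have hr : ∀ l < L, (P L).eval (realRoot (P L) l) = 0 := fun l hl => eval_realRoot (by omega)
  have hL : 0 < L := by
    rcases L.eq_zero_or_pos with rfl | hL
    · exact absurd (h.v_eq_zero h0) hv
    · exact hL
  have hsum := h.sum_ritz hL hr fun l hl l' hl' e => realRoot_inj hnd (by omega) (by omega) e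
  rw [hsum, map_sum, Matrix.mulVec_sum, evolvedVec, map_sum]
  refine Finset.sum_congr rfl fun l hl => ?_
  rw [map_smul, Matrix.mulVec_smul, map_smul, mul_comm (Complex.exp _), mul_smul]
  congr 1
  refine exp_mulVec_eigen ?_
  rw [Matrix.smul_mulVec, hΦ, h.mulVec_ritz h0 (hr l (Finset.mem_range.mp hl)), map_smul, smul_smul]

/-! ### The Hamiltonian on the span of the images of the initial state -/

namespace Quench

variable (I : Quench n m k)

/-- The initial state as a function on bit vectors. -/
def wave : Wave n := toWave I.ψ₀

/-- The reference label. -/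
def zv : Vec n := bitsEquiv.symm I.z

theorem wave_zv_ne : I.wave I.zv ≠ 0 := I.ψ₀_ref

theorem wave_ne : I.wave ≠ 0 := fun h => I.wave_zv_ne (by rw [h]; rfl)

/-- The signs of the generators. -/
def sx (i : Fin n) : ZMod 2 := I.x i

theorem g_eigen (i : Fin n) :
    iph (I.g i) • wop (I.g i) I.wave = (chi (I.sx i) : ℂ) • I.wave := by
  have h := congrArg toWave (I.ψ₀_eigen i)
  rw [toWave_pauliOp_mulVec, map_smul] at h
  rw [wave, h]
  congr 1
  have hx : ∀ x : ZMod 2, (-1 : ℂ) ^ x.val = (chi x : ℂ) := by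
    intro x
    rcases zmod2_cases x with rfl | rfl
    · simp
    · simp [show (1 : ZMod 2).val = 1 from rfl]
  exact hx (I.x i)

theorem g_mem (i : Fin n) : I.g i ∈ eigenPauli I.wave :=
  ⟨(iph (I.g i))⁻¹ * chi (I.sx i), by
    rw [mul_smul, ← I.g_eigen, smul_smul, inv_mul_cancel₀ (iph_ne_zero _), one_smul]⟩

/-- The amplitude at the reference label after applying a Weyl operator, relative to the
reference amplitude. -/
def rel (R : PauliString n) : ℂ := wop R I.wave I.zv / I.wave I.zv

theorem rel_mul (R : PauliString n) : I.rel R * I.ψ₀ I.z = wop R I.wave I.zv :=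
  div_mul_cancel₀ _ I.wave_zv_ne

theorem wop_eq_rel {R : PauliString n} (hR : R ∈ eigenPauli I.wave) :
    wop R I.wave = I.rel R • I.wave := by
  obtain ⟨c, hc⟩ := hR
  rw [rel, hc, Pi.smul_apply, smul_eq_mul, mul_div_assoc, div_self I.wave_zv_ne, mul_one]

/-- The eigenvalue of a stabilizer Pauli string. -/
def lam (R : PauliString n) : ℝ := (iph R * I.rel R).re

/-- A Pauli operator squares to the identity, so its eigenvalue is `1` or `-1` and taking the real
part loses nothing. -/
theorem lam_eq {R : PauliString n} (hR : R ∈ eigenPauli I.wave) :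
    (I.lam R : ℂ) = iph R * I.rel R := by
  have h1 : iph R * I.rel R * (iph R * I.rel R) = 1 := by
    have h2 := wop_wop R R I.wave
    rw [I.wop_eq_rel hR, wop_smul, I.wop_eq_rel hR, smul_smul, pauli_add_self, wop_zero] at h2
    have h3 : I.rel R * I.rel R = _ := smul_left_injective ℂ I.wave_ne h2
    have h4 := iph_mul_self R
    have h5 : (chi (zp R ⬝ᵥ xp R) : ℂ) * chi (zp R ⬝ᵥ xp R) = 1 := by
      exact_mod_cast chi_mul_self _
    calc _ = (iph R * iph R) * (I.rel R * I.rel R) := by ring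
      _ = 1 := by rw [h3, h4, h5]
  rcases mul_self_eq_one_iff.mp h1 with h | h <;> simp [lam, h]

theorem h_mem_eigen (j : Fin m) : I.h j ∈ eigenPauli I.wave :=
  span_le_eigenPauli I.g_mem (I.h_mem j)

/-- The coefficient of a Pauli string in the perturbation. -/
def gam (Q : PauliString n) : ℝ := ∑ i, if I.P i = Q then I.γ i else 0

/-- The unperturbed energy of the state obtained by applying a Pauli string. -/
def energy (Q : PauliString n) : ℝ := -∑ j, I.α j * I.lam (I.h j) * chi (symp (I.h j) Q)

/-- The Hamiltonian in the spanning family obtained by applying `T` to the initial state. -/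
def blockH {D : ℕ} (T : Fin D → PauliString n) : Matrix (Fin D) (Fin D) ℂ := fun a b =>
  (I.gam (T a + T b) : ℂ) * iph (T a + T b) * chi (zp (T a + T b) ⬝ᵥ xp (T b)) +
    if a = b then (I.energy (T a) : ℂ) else 0

/-- The combination of the states obtained by applying `T` to the initial state. -/
def combine {D : ℕ} (T : Fin D → PauliString n) : (Fin D → ℂ) →ₗ[ℂ] Ket n where
  toFun u := toWave.symm (∑ s, u s • wop (T s) I.wave)
  map_add' u v := by simp only [Pi.add_apply, add_smul, Finset.sum_add_distrib, map_add]
  map_smul' c u := by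
    simp only [Pi.smul_apply, smul_eq_mul, mul_smul, ← Finset.smul_sum, map_smul, RingHom.id_apply]

theorem toWave_combine {D : ℕ} (T : Fin D → PauliString n) (u : Fin D → ℂ) :
    toWave (I.combine T u) = ∑ s, u s • wop (T s) I.wave := by
  simp [combine]

theorem toWave_H (φ : Ket n) : toWave (I.H.mulVec φ) =
    -∑ j, ((I.α j : ℂ) * iph (I.h j)) • wop (I.h j) (toWave φ) +
      ∑ i, ((I.γ i : ℂ) * iph (I.P i)) • wop (I.P i) (toWave φ) := by
  rw [H, H₀, δH, Matrix.add_mulVec, Matrix.neg_mulVec, map_add, map_neg, Matrix.sum_mulVec,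
    Matrix.sum_mulVec, map_sum, map_sum]
  simp only [Matrix.smul_mulVec, map_smul, toWave_pauliOp_mulVec, smul_smul]

/-- This is checked on the entries: conjugating `iph` produces exactly the sign that exchanges `xp
(T b)` for `xp (T a)`. It cannot be inherited from `H`, since the family need not be linearly
independent. -/
theorem blockH_isHermitian {D : ℕ} (T : Fin D → PauliString n) : (I.blockH T).IsHermitian := by
  ext a b
  rw [Matrix.conjTranspose_apply]
  simp only [blockH, star_add, star_mul', RCLike.star_def, Complex.conj_ofReal, conj_iph]
  rw [add_comm (T b) (T a)]
  have h1 : (chi (zp (T a + T b) ⬝ᵥ xp (T a + T b)) : ℂ) * chi (zp (T a + T b) ⬝ᵥ xp (T a)) =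
      chi (zp (T a + T b) ⬝ᵥ xp (T b)) := by
    rw [← Complex.ofReal_mul, ← chi_add, ← dotProduct_add, xp_add, add_comm (xp (T a)),
      vec_add_cancel]
  congr 1
  · rw [← h1]; ring
  · by_cases h : a = b
    · subst h; simp
    · rw [if_neg h, if_neg (Ne.symm h)]; simp

/-- A perturbing string moves `T b` to the member of the family given by `hP`, which is unique by
injectivity. A term of `H₀` passes through `T b` at the cost of a commutation sign and then meets an
eigenvector. -/
theorem H_wop {D : ℕ} {T : Fin D → PauliString n} (hinj : Function.Injective T)
    (hP : ∀ i b, ∃ a, T a = I.P i + T b) (b : Fin D) :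
    toWave (I.H.mulVec (toWave.symm (wop (T b) I.wave))) =
      ∑ a, I.blockH T a b • wop (T a) I.wave := by
  rw [toWave_H, LinearEquiv.apply_symm_apply]
  simp only [blockH, add_smul, Finset.sum_add_distrib, ite_smul, zero_smul, Finset.sum_ite_eq',
    Finset.mem_univ, if_true]
  rw [add_comm]
  congr 1
  · have h1 : ∀ a, ((I.gam (T a + T b) : ℂ) * iph (T a + T b) *
        chi (zp (T a + T b) ⬝ᵥ xp (T b))) • wop (T a) I.wave =
        ∑ i, if I.P i = T a + T b then
          ((I.γ i : ℂ) * iph (I.P i)) • wop (I.P i) (wop (T b) I.wave) else 0 := by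
      intro a
      rw [gam, Complex.ofReal_sum, Finset.sum_mul, Finset.sum_mul, Finset.sum_smul]
      refine Finset.sum_congr rfl fun i _ => ?_
      split_ifs with hi
      · rw [wop_wop, smul_smul, hi, add_assoc, pauli_add_self, add_zero]
      · simp
    rw [Finset.sum_congr rfl fun a _ => h1 a, Finset.sum_comm]
    refine Finset.sum_congr rfl fun i _ => ?_
    obtain ⟨a, ha⟩ := hP i b
    have h2 : ∀ a', (I.P i = T a' + T b) ↔ a' = a := by
      intro a'
      constructor
      · intro h
        apply hinj
        rw [ha, h, add_assoc, pauli_add_self, add_zero]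
      · rintro rfl
        rw [ha, add_assoc, pauli_add_self, add_zero]
    simp only [h2, Finset.sum_ite_eq', Finset.mem_univ, if_true]
  · rw [energy, Complex.ofReal_neg, neg_smul, Complex.ofReal_sum, Finset.sum_smul]
    congr 1
    refine Finset.sum_congr rfl fun j _ => ?_
    have hj := I.h_mem_eigen j
    rw [wop_comm, I.wop_eq_rel hj, wop_smul, smul_smul, smul_smul]
    push_cast
    rw [I.lam_eq hj]
    congr 1
    ring

theorem H_combine {D : ℕ} {T : Fin D → PauliString n} (hinj : Function.Injective T)
    (hP : ∀ i b, ∃ a, T a = I.P i + T b) (u : Fin D → ℂ) :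
    I.H.mulVec (I.combine T u) = I.combine T ((I.blockH T).mulVec u) := by
  apply toWave.injective
  have h1 : I.combine T u = ∑ b, u b • toWave.symm (wop (T b) I.wave) := by
    apply toWave.injective
    rw [toWave_combine, map_sum]
    simp
  rw [h1, Matrix.mulVec_sum, map_sum, toWave_combine]
  simp only [Matrix.mulVec_smul, map_smul, I.H_wop hinj hP, Finset.smul_sum, smul_smul,
    Matrix.mulVec, dotProduct, Finset.sum_smul]
  rw [Finset.sum_comm]
  exact Finset.sum_congr rfl fun a _ => Finset.sum_congr rfl fun b _ => by rw [mul_comm]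

theorem H_isHermitian : I.H.IsHermitian := by
  have hP : ∀ P : PauliString n, (pauliOp P).IsHermitian := by
    intro P
    ext y y'
    change star (pauliOp P (bitsEquiv (bitsEquiv.symm y')) (bitsEquiv (bitsEquiv.symm y))) =
      pauliOp P (bitsEquiv (bitsEquiv.symm y)) (bitsEquiv (bitsEquiv.symm y'))
    rw [pauliOp_apply, pauliOp_apply]
    generalize bitsEquiv.symm y = y
    generalize bitsEquiv.symm y' = y'
    have hiff : y = y' + xp P ↔ y' = y + xp P :=
      ⟨fun h => by rw [h, vec_add_cancel], fun h => by rw [h, vec_add_cancel]⟩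
    by_cases h : y' = y + xp P
    · rw [if_pos h, if_pos (hiff.mpr h), RCLike.star_def, map_mul, conj_iph, Complex.conj_ofReal, h,
        dotProduct_add, chi_add]
      push_cast; ring
    · rw [if_neg h, if_neg (mt hiff.mp h), star_zero]
  have hs : ∀ (r : ℝ) (P : PauliString n), ((r : ℂ) • pauliOp P).IsHermitian := by
    intro r P
    rw [Matrix.IsHermitian, Matrix.conjTranspose_smul, (hP P).eq, RCLike.star_def,
      Complex.conj_ofReal]
  rw [H, H₀, δH, Matrix.IsHermitian, Matrix.conjTranspose_add, Matrix.conjTranspose_neg,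
    Matrix.conjTranspose_sum, Matrix.conjTranspose_sum]
  simp only [(hs _ _).eq]

/-- The evolved state is normalised. -/
theorem norm_ψ (t : ℝ) : ∑ y, ‖I.ψ t y‖ ^ 2 = 1 := by
  have h : ∀ φ : Ket n, ((∑ y, ‖φ y‖ ^ 2 : ℝ) : ℂ) = star φ ⬝ᵥ φ := fun φ =>
    (Lanczos.star_dotProduct_self φ).symm
  have hU : (NormedSpace.exp ((-(Complex.I * (t : ℂ))) • I.H)).conjTranspose *
      NormedSpace.exp ((-(Complex.I * (t : ℂ))) • I.H) = 1 := by
    rw [← Matrix.exp_conjTranspose, Matrix.conjTranspose_smul, I.H_isHermitian.eq]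
    have : star (-(Complex.I * (t : ℂ))) • I.H = -((-(Complex.I * (t : ℂ))) • I.H) := by
      rw [← neg_smul]
      congr 1
      simp
    rw [this, Matrix.exp_neg]
    exact Matrix.nonsing_inv_mul _ ((Matrix.isUnit_iff_isUnit_det _).mp (Matrix.isUnit_exp _))
  have key : ((∑ y, ‖I.ψ t y‖ ^ 2 : ℝ) : ℂ) = ((∑ y, ‖I.ψ₀ y‖ ^ 2 : ℝ) : ℂ) := by
    rw [h, h, ψ, Matrix.star_mulVec, ← Matrix.dotProduct_mulVec, Matrix.mulVec_mulVec, hU,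
      Matrix.one_mulVec]
  rw [← I.ψ₀_norm]
  exact_mod_cast key

end Quench

/-! ### Amplitudes, expectation values and outcome probabilities -/

namespace Quench

variable {n m k : ℕ} (I : Quench n m k)

open Finset

/-- The pure `X`-string `y + I.zv` carries the label `y` to the reference label, so every amplitude
becomes a value of `rel`. -/
theorem wop_apply_eq_rel (R : PauliString n) (y : Vec n) :
    wop R I.wave y = I.rel (mkP (y + I.zv) 0 + R) * I.ψ₀ I.z := by
  have h := congrFun (wop_wop (mkP (y + I.zv) 0) R I.wave) I.zv
  rw [wop_apply] at h
  simp only [zp_mkP, xp_mkP, zero_dotProduct, chi_zero, Complex.ofReal_one, one_mul, one_smul] at h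
  rw [rel_mul, ← h, add_comm y, ← add_assoc, vec_add_self, zero_add]

theorem combine_apply {D : ℕ} (T : Fin D → PauliString n) (c : Fin D → ℂ) (y : Vec n) :
    I.combine T c (bitsEquiv y) =
      (∑ s, c s * I.rel (mkP (y + I.zv) 0 + T s)) * I.ψ₀ I.z := by
  rw [← toWave_apply (I.combine T c), toWave_combine, Finset.sum_apply, Finset.sum_mul]
  refine Finset.sum_congr rfl fun s _ => ?_
  rw [Pi.smul_apply, wop_apply_eq_rel, smul_eq_mul, mul_assoc]

open scoped Classical in
/-- The matrix elements `⟨ψ₀| Q T |ψ₀⟩`. -/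
def overlap (Q T : PauliString n) : ℂ :=
  if ∀ i, symp (I.g i) (Q + T) = 0 then iph Q * chi (zp Q ⬝ᵥ xp T) * I.rel (Q + T) else 0

theorem wave_inner_self : star I.wave ⬝ᵥ I.wave = 1 := by
  rw [Lanczos.star_dotProduct_self]
  have : ∑ y, ‖I.wave y‖ ^ 2 = ∑ y, ‖I.ψ₀ y‖ ^ 2 := Equiv.sum_comp bitsEquiv fun y => ‖I.ψ₀ y‖ ^ 2
  rw [this, I.ψ₀_norm]; simp

/-- By maximality of the stabilizer group there are two cases: `Q + T` commutes with all generators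
and acts as a scalar, or it anticommutes with one of them and its expectation value vanishes. -/
theorem overlap_eq (Q T : PauliString n) :
    I.overlap Q T = iph Q * chi (zp Q ⬝ᵥ xp T) * (star I.wave ⬝ᵥ wop (Q + T) I.wave) := by
  rw [overlap]
  split_ifs with h
  · congr 1
    rw [wop_eq_of_symp I.g_indep I.g_mem I.wave_zv_ne h, dotProduct_smul, wave_inner_self,
      smul_eq_mul, mul_one]
    rfl
  · push Not at h
    obtain ⟨i, hi⟩ := h
    obtain ⟨c, hc⟩ := I.g_mem i
    rw [inner_wop_eq_zero I.wave_ne hc hi, mul_zero]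

/-- Moving the isometry `wop S` to the other side leaves an overlap that depends on `S` and `T` only
through their sum. Hence as many overlaps are needed as there are listed elements, rather than pairs
of them. -/
theorem inner_wop_wop (Q S T : PauliString n) :
    iph Q * (star (wop S I.wave) ⬝ᵥ wop Q (wop T I.wave)) =
      chi (zp S ⬝ᵥ xp S) * chi (zp S ⬝ᵥ xp T) * chi (symp S Q) * I.overlap Q (S + T) := by
  rw [overlap_eq, ← wop_inner S, wop_wop S S, pauli_add_self, wop_zero, wop_comm S Q, wop_wop S T,
    wop_smul, wop_wop Q (S + T), star_smul, smul_dotProduct, dotProduct_smul, dotProduct_smul,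
    dotProduct_smul]
  simp only [smul_eq_mul, RCLike.star_def, Complex.conj_ofReal]
  ring

theorem expect_combine {D : ℕ} (T : Fin D → PauliString n) (c : Fin D → ℂ) (Q : PauliString n) :
    star (I.combine T c) ⬝ᵥ (pauliOp Q).mulVec (I.combine T c) =
      ∑ s, ∑ s', (starRingEnd ℂ) (c s) * c s' *
        (chi (zp (T s) ⬝ᵥ xp (T s)) * chi (zp (T s) ⬝ᵥ xp (T s')) * chi (symp (T s) Q) : ℝ) *
          I.overlap Q (T s + T s') := by
  have hinner : ∀ φ χ : Ket n, star φ ⬝ᵥ χ = star (toWave φ) ⬝ᵥ toWave χ := fun φ χ =>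
    (Equiv.sum_comp bitsEquiv fun y => star (φ y) * χ y).symm
  have hwsum : wop Q (∑ s, c s • wop (T s) I.wave) = ∑ s, c s • wop Q (wop (T s) I.wave) := by
    funext y
    simp only [wop_apply Q, Finset.sum_apply, Pi.smul_apply, Finset.mul_sum, smul_eq_mul]
    exact Finset.sum_congr rfl fun s _ => by ring
  rw [hinner, toWave_pauliOp_mulVec, toWave_combine, hwsum, dotProduct_smul, star_sum,
    sum_dotProduct, Finset.smul_sum]
  refine Finset.sum_congr rfl fun s _ => ?_
  rw [dotProduct_sum, Finset.smul_sum]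
  refine Finset.sum_congr rfl fun s' _ => ?_
  rw [star_smul, smul_dotProduct, dotProduct_smul]
  have := I.inner_wop_wop Q (T s) (T s')
  simp only [smul_eq_mul, RCLike.star_def]
  push_cast
  linear_combination ((starRingEnd ℂ) (c s) * c s') * this

/-! ### Outcome probabilities along the stabilizer group -/

/-- The relative amplitude of the evolved state at the label shifted by `T u` and a stabilizer
whose commutation signs with the family `T` are `ε`. -/
def shiftedAmp {D : ℕ} (T : Fin D → PauliString n) (c : Fin D → ℂ) (ε : Fin D → ℝ) (u : Fin D) : ℂ :=
  ∑ s, c s * (ε s * chi (zp (T s) ⬝ᵥ (I.zv + xp (T u) + xp (T s))) : ℝ) *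
    I.rel (mkP (xp (T s + T u)) 0)

/-- Applying `G` moves the label by `xp G` without changing absolute values, and it multiplies the
initial state by a scalar of modulus one. What is left of `G` are its commutation signs with the
family, so stabilizers with equal signs give equal probabilities. -/
theorem norm_combine_shift {D : ℕ} (T : Fin D → PauliString n) (c : Fin D → ℂ) (u : Fin D)
    {G : PauliString n} (hG : G ∈ eigenPauli I.wave) :
    ‖I.combine T c (bitsEquiv (I.zv + xp (T u) + xp G))‖ =
      ‖I.shiftedAmp T c (fun s => chi (symp G (T s))) u‖ * ‖I.ψ₀ I.z‖ := by
  obtain ⟨r, hr⟩ := id hG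
  have hr1 : ‖r‖ = 1 := by
    have h2 := wop_inner G I.wave I.wave
    rw [hr, star_smul, smul_dotProduct, dotProduct_smul, wave_inner_self] at h2
    simp only [smul_eq_mul, mul_one, RCLike.star_def] at h2
    rw [Complex.conj_mul'] at h2
    have h3 : ‖r‖ ^ 2 = 1 := by exact_mod_cast h2
    exact (pow_eq_one_iff_of_nonneg (norm_nonneg r) two_ne_zero).mp h3
  rw [← toWave_apply (I.combine T c), ← norm_wop_apply, toWave_combine, ← norm_mul]
  have h1 : wop G (∑ s, c s • wop (T s) I.wave) (I.zv + xp (T u)) =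
      r * (I.shiftedAmp T c (fun s => chi (symp G (T s))) u * I.ψ₀ I.z) := by
    have hwsum : wop G (∑ s, c s • wop (T s) I.wave) =
        ∑ s, c s • wop G (wop (T s) I.wave) := by
      funext y
      simp only [wop_apply G, Finset.sum_apply, Pi.smul_apply, Finset.mul_sum, smul_eq_mul]
      exact Finset.sum_congr rfl fun s _ => by ring
    rw [hwsum, Finset.sum_apply, shiftedAmp, Finset.sum_mul, Finset.mul_sum]
    refine Finset.sum_congr rfl fun s _ => ?_
    rw [wop_comm, hr, wop_smul, Pi.smul_apply, Pi.smul_apply, Pi.smul_apply, wop_apply]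
    have h4 : I.wave (I.zv + xp (T u) + xp (T s)) =
        I.rel (mkP (xp (T s + T u)) 0) * I.ψ₀ I.z := by
      have := I.wop_apply_eq_rel 0 (I.zv + xp (T u) + xp (T s))
      rw [wop_zero, add_zero] at this
      rw [this]
      congr 3
      rw [xp_add, add_comm, add_assoc, ← add_assoc, vec_add_self, zero_add, add_comm]
    rw [h4]
    simp only [smul_eq_mul]
    push_cast
    ring
  rw [h1, norm_mul, hr1, one_mul]

/-- The element of the stabilizer group with given exponents. -/
def gcomb (a : Vec n) : PauliString n := ∑ i, a i • I.g i

theorem gcomb_mem (a : Vec n) : I.gcomb a ∈ eigenPauli I.wave :=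
  Submodule.sum_mem _ fun i _ => Submodule.smul_mem _ _ (I.g_mem i)

theorem symp_gcomb (a : Vec n) (Q : PauliString n) :
    symp (I.gcomb a) Q = ∑ i, a i * symp (I.g i) Q := by
  rw [gcomb, symp_sum_left]
  exact Finset.sum_congr rfl fun i _ => symp_smul_left _ _ _

theorem xp_gcomb (a : Vec n) : xp (I.gcomb a) = ∑ i, a i • xp (I.g i) := by
  funext q
  simp [gcomb, xp, Finset.sum_apply, Prod.fst_sum]

/-- The subspace generated by the perturbing Pauli strings. -/
abbrev K : Submodule (ZMod 2) (PauliString n) := Submodule.span (ZMod 2) (Set.range I.P)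

/-- Some summand of the amplitude is nonzero, and it is an amplitude of the initial state, whose
support lies in the coset of the reference label by the `X`-parts of the stabilizers. -/
theorem exists_shift_of_ne_zero {D : ℕ} {T : Fin D → PauliString n} {c : Fin D → ℂ} {y : Vec n}
    (h : I.combine T c (bitsEquiv y) ≠ 0) : ∃ u a, y = I.zv + xp (T u) + xp (I.gcomb a) := by
  rw [← toWave_apply (I.combine T c), toWave_combine, Finset.sum_apply] at h
  obtain ⟨s, -, hs⟩ := Finset.exists_ne_zero_of_sum_ne_zero h
  rw [Pi.smul_apply, smul_eq_mul, wop_apply] at hs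
  have hw := right_ne_zero_of_mul (right_ne_zero_of_mul hs)
  have hmem := mem_span_xp_of_ne_zero I.g_indep I.g_mem I.wave_zv_ne (v := I.zv + (y + xp (T s)))
    (by rwa [← add_assoc, vec_add_self, zero_add])
  obtain ⟨a, ha⟩ := (Submodule.mem_span_range_iff_exists_fun (ZMod 2)).mp hmem
  refine ⟨s, a, ?_⟩
  rw [xp_gcomb, ha, add_assoc, ← add_assoc (xp (T s)), add_comm (xp (T s)), add_assoc,
    add_comm (xp (T s)), vec_add_cancel, ← add_assoc, vec_add_self, zero_add]

/-- Every outcome is hit equally often by the pairs of a stabilizer and an element of `K`. -/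
theorem sum_fiber {D : ℕ} {T : Fin D → PauliString n} (hinj : Function.Injective T)
    (hK : ∀ Q, Q ∈ I.K ↔ ∃ u, T u = Q) {c : Fin D → ℂ} {t : ℝ} (hc : I.ψ t = I.combine T c)
    {q : Vec n → Fin D → ℝ} {κ : ℝ} (hκ : 0 < κ)
    (hq : ∀ a u, ‖I.ψ t (bitsEquiv (I.zv + xp (T u) + xp (I.gcomb a)))‖ ^ 2 = q a u * κ)
    (y : Vec n) :
    0 < ∑ a, ∑ u, q a u ∧
      ∑ a, ∑ u, (if I.zv + xp (T u) + xp (I.gcomb a) = y then q a u else 0) =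
        ‖I.ψ t (bitsEquiv y)‖ ^ 2 * ∑ a, ∑ u, q a u := by
  classical
  let e : Fin D ≃ I.K := Equiv.ofBijective (fun u => ⟨T u, (hK _).mpr ⟨u, rfl⟩⟩)
    ⟨fun u u' h => hinj (congrArg Subtype.val h), fun Q => by
      obtain ⟨u, hu⟩ := (hK Q).mp Q.2
      exact ⟨u, Subtype.ext hu⟩⟩
  have : Fintype I.K := Fintype.ofEquiv _ e
  -- The shift of the label is a homomorphism of finite groups, so its fibres over points of its
  -- range all have the same cardinality.
  let f : Vec n × I.K →+ Vec n :=
    { toFun := fun p => xp (p.2 : PauliString n) + xp (I.gcomb p.1)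
      map_zero' := by simp [gcomb]
      map_add' := by
        rintro ⟨a, Q⟩ ⟨a', Q'⟩
        have : I.gcomb (a + a') = I.gcomb a + I.gcomb a' := by
          simp [gcomb, add_smul, Finset.sum_add_distrib]
        simp only [Prod.mk_add_mk, Submodule.coe_add, xp_add, this]
        abel }
  let p : Vec n → ℝ := fun y => ‖I.ψ t (bitsEquiv y)‖ ^ 2
  let N : Vec n → ℕ := fun y => (Finset.univ.filter fun r : Vec n × I.K => f r = I.zv + y).card
  have hsum : ∀ F : Vec n → I.K → ℝ, ∑ a, ∑ u, F a (e u) = ∑ r : Vec n × I.K, F r.1 r.2 := by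
    intro F
    rw [Fintype.sum_prod_type]
    exact Finset.sum_congr rfl fun a _ => Equiv.sum_comp e fun Q => F a Q
  have hfib : ∀ y, ∑ r : Vec n × I.K, (if I.zv + f r = y then p (I.zv + f r) else 0) = N y * p y := by
    intro y
    rw [← Finset.sum_filter]
    have : ∀ r : Vec n × I.K, (I.zv + f r = y) ↔ f r = I.zv + y := fun r =>
      ⟨fun h => by rw [← h, ← add_assoc, vec_add_self, zero_add],
        fun h => by rw [h, ← add_assoc, vec_add_self, zero_add]⟩
    simp only [this]
    rw [Finset.sum_congr rfl (g := fun _ => p y), Finset.sum_const, nsmul_eq_mul]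
    intro r hr
    rw [(Finset.mem_filter.mp hr).2, ← add_assoc, vec_add_self, zero_add]
  -- Labels outside the range have probability zero, so after multiplication by `p y` the fibre
  -- count may be taken constant everywhere.
  have hN : ∀ y, p y ≠ 0 → N y = N I.zv := by
    intro y hy
    have hne : I.combine T c (bitsEquiv y) ≠ 0 := by
      intro h0; apply hy; simp only [p]; rw [hc, h0]; simp
    obtain ⟨u, a, hua⟩ := I.exists_shift_of_ne_zero hne
    refine AddMonoidHom.card_fiber_eq_of_mem_range f ⟨(a, e u), ?_⟩ ⟨0, ?_⟩
    · change xp (T u) + xp (I.gcomb a) = I.zv + y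
      rw [hua, add_assoc I.zv, ← add_assoc I.zv, vec_add_self, zero_add]
    · rw [map_zero, vec_add_self]
  have hp1 : ∑ y, p y = 1 := by
    rw [← I.norm_ψ t]; exact Equiv.sum_comp bitsEquiv fun y => ‖I.ψ t y‖ ^ 2
  have hNp : ∀ y, (N y : ℝ) * p y = N I.zv * p y := by
    intro y
    by_cases h : p y = 0
    · rw [h, mul_zero, mul_zero]
    · rw [hN y h]
  have htot : ∑ r : Vec n × I.K, p (I.zv + f r) = N I.zv := by
    have h1 : ∑ r : Vec n × I.K, p (I.zv + f r) =
        ∑ y, ∑ r : Vec n × I.K, (if I.zv + f r = y then p (I.zv + f r) else 0) := by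
      rw [Finset.sum_comm]
      exact Finset.sum_congr rfl fun r _ => by simp
    rw [h1, Finset.sum_congr rfl fun y _ => (hfib y).trans (hNp y), ← Finset.mul_sum, hp1, mul_one]
  have hNpos : 0 < (N I.zv : ℝ) := by
    have : 0 < N I.zv := Finset.card_pos.mpr ⟨0, by
      rw [Finset.mem_filter]; exact ⟨Finset.mem_univ _, by rw [map_zero, vec_add_self]⟩⟩
    exact_mod_cast this
  have hqp : ∀ a u, q a u * κ = p (I.zv + f (a, e u)) := by
    intro a u
    rw [← hq]
    simp only [p]
    rw [add_assoc]; rfl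
  have hS : (∑ a, ∑ u, q a u) * κ = N I.zv := by
    rw [← htot, ← hsum fun a Q => p (I.zv + f (a, Q)), Finset.sum_mul]
    refine Finset.sum_congr rfl fun a _ => ?_
    rw [Finset.sum_mul]
    exact Finset.sum_congr rfl fun u _ => hqp a u
  refine ⟨pos_of_mul_pos_left (hS ▸ hNpos) hκ.le, ?_⟩
  apply mul_right_cancel₀ hκ.ne'
  rw [mul_assoc, hS, mul_comm _ (N I.zv : ℝ), ← hNp y, ← hfib y,
    ← hsum fun a Q => if I.zv + f (a, Q) = y then p (I.zv + f (a, Q)) else 0, Finset.sum_mul]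
  refine Finset.sum_congr rfl fun a _ => ?_
  rw [Finset.sum_mul]
  refine Finset.sum_congr rfl fun u _ => ?_
  rw [ite_mul, zero_mul, hqp]
  have : I.zv + xp (T u) + xp (I.gcomb a) = I.zv + f (a, e u) := by rw [add_assoc]; rfl
  rw [this]

end Quench

/-! ### Program semantics without step counting -/

/-- Forget the step counter. -/
def Store.erase (s : Store) : Store := { s with time := 0 }

/-- The distribution of the final memory contents. -/
def distLoop (x : ℕ) (f : Store → PMF Store) : ℕ → Store → PMF Store
  | 0, s => PMF.pure s
  | N + 1, s => (distLoop x f N s).bind fun s' => f (s'.setNat x 0 0 N)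

open scoped Classical in
/-- The distribution of the final memory contents of a program, disregarding the step counter. -/
def Prog.dist : Prog → Store → PMF Store
  | .skip, s => PMF.pure s
  | .setN a i j e, s => PMF.pure (s.setNat a (i.eval s) (j.eval s) (e.eval s))
  | .setR a i j e, s => PMF.pure (s.setReal a (i.eval s) (j.eval s) (e.eval s))
  | .root a i j b l d r, s =>
      PMF.pure (s.setReal a (i.eval s) (j.eval s)
          (realRoot (s.poly b (l.eval s) (d.eval s)) (r.eval s)))
  | .flip a i j p, s =>
      (coin (p.eval s)).map fun b => s.setNat a (i.eval s) (j.eval s) (if b then 1 else 0)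
  | .seq c d, s => (c.dist s).bind d.dist
  | .ite b c d, s => if b.holds s then c.dist s else d.dist s
  | .loop x e c, s => distLoop x c.dist (e.eval s) s

/-- `N` rounds of a counted loop without coin flips. -/
def runLoop (x : ℕ) (f : Store → Store) : ℕ → Store → Store
  | 0, s => s
  | N + 1, s => f ((runLoop x f N s).setNat x 0 0 N)

open scoped Classical in
/-- The final memory contents of a program without coin flips. -/
def Prog.run : Prog → Store → Store
  | .skip, s => s
  | .setN a i j e, s => s.setNat a (i.eval s) (j.eval s) (e.eval s)
  | .setR a i j e, s => s.setReal a (i.eval s) (j.eval s) (e.eval s)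
  | .root a i j b l d r, s =>
      s.setReal a (i.eval s) (j.eval s) (realRoot (s.poly b (l.eval s) (d.eval s)) (r.eval s))
  | .flip _ _ _ _, s => s
  | .seq c d, s => d.run (c.run s)
  | .ite b c d, s => if b.holds s then c.run s else d.run s
  | .loop x e c, s => runLoop x c.run (e.eval s) s

/-- The program flips no coins. -/
def Prog.flipFree : Prog → Bool
  | .flip _ _ _ _ => false
  | .seq c d => c.flipFree && d.flipFree
  | .ite _ c d => c.flipFree && d.flipFree
  | .loop _ _ c => c.flipFree
  | _ => true

/-- The program may write to the natural-number array `a`. -/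
def Prog.modN : Prog → ℕ → Bool
  | .setN b _ _ _, a => a == b
  | .flip b _ _ _, a => a == b
  | .seq c d, a => c.modN a || d.modN a
  | .ite _ c d, a => c.modN a || d.modN a
  | .loop x _ c, a => a == x || c.modN a
  | _, _ => false

/-- The program may write to the real array `a`. -/
def Prog.modR : Prog → ℕ → Bool
  | .setR b _ _ _, a => a == b
  | .root b _ _ _ _ _ _, a => a == b
  | .seq c d, a => c.modR a || d.modR a
  | .ite _ c d, a => c.modR a || d.modR a
  | .loop _ _ c, a => c.modR a
  | _, _ => false

theorem NExpr.eval_erase (s : Store) (e : NExpr) : e.eval s.erase = e.eval s := by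
  induction e with
  | lit c => rfl
  | get a i j hi hj => simp only [NExpr.eval, hi, hj]; rfl
  | succ e h => simp only [NExpr.eval, h]
  | pred e h => simp only [NExpr.eval, h]

theorem RExpr.eval_erase (s : Store) (e : RExpr) : e.eval s.erase = e.eval s := by
  induction e with
  | lit c => rfl
  | get a i j => simp only [RExpr.eval, NExpr.eval_erase]; rfl
  | add e f he hf => simp only [RExpr.eval, he, hf]
  | sub e f he hf => simp only [RExpr.eval, he, hf]
  | mul e f he hf => simp only [RExpr.eval, he, hf]
  | div e f he hf => simp only [RExpr.eval, he, hf]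
  | sin e h => simp only [RExpr.eval, h]
  | cos e h => simp only [RExpr.eval, h]

theorem Test.holds_erase (s : Store) (b : Test) : b.holds s.erase ↔ b.holds s := by
  induction b with
  | natEq e f => simp only [Test.holds, NExpr.eval_erase]
  | natLt e f => simp only [Test.holds, NExpr.eval_erase]
  | realLt e f => simp only [Test.holds, RExpr.eval_erase]
  | not b h => simp only [Test.holds, h]
  | and b c hb hc => simp only [Test.holds, hb, hc]

/-- Programs cannot read the step counter, so it never influences memory. Correctness can therefore
be proved for `dist` and `run`, and running times separately. -/
theorem Prog.map_erase_eval (c : Prog) (s : Store) :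
    (c.eval s).map Store.erase = c.dist s.erase := by
  induction c generalizing s with
  | skip => simp only [Prog.eval, Prog.dist, PMF.pure_map]; rfl
  | setN a i j e =>
    simp only [Prog.eval, Prog.dist, PMF.pure_map, NExpr.eval_erase]; rfl
  | setR a i j e =>
    simp only [Prog.eval, Prog.dist, PMF.pure_map, NExpr.eval_erase, RExpr.eval_erase]; rfl
  | root a i j b l d r =>
    simp only [Prog.eval, Prog.dist, PMF.pure_map, NExpr.eval_erase]; rfl
  | flip a i j p =>
    simp only [Prog.eval, Prog.dist, PMF.map_comp, NExpr.eval_erase, RExpr.eval_erase]; rfl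
  | seq c d hc hd =>
    simp only [Prog.eval, Prog.dist, PMF.map_bind, ← hc, PMF.bind_map, hd]
    rfl
  | ite b c d hc hd =>
    by_cases hb : b.holds s
    · rw [Prog.eval, Prog.dist, if_pos hb, if_pos ((b.holds_erase s).mpr hb), hc]; rfl
    · rw [Prog.eval, Prog.dist, if_neg hb, if_neg (mt (b.holds_erase s).mp hb), hd]; rfl
  | loop x e c hc =>
    simp only [Prog.eval, Prog.dist, NExpr.eval_erase]
    have h : ∀ N (s : Store), (loopEval x c.eval N s).map Store.erase =
        distLoop x c.dist N s.erase := by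
      intro N
      induction N with
      | zero => intro s; simp only [loopEval, distLoop, PMF.pure_map]
      | succ N ih =>
        intro s
        simp only [loopEval, distLoop, PMF.map_bind, ← ih, PMF.bind_map, hc]
        rfl
    rw [h]; rfl

theorem Prog.dist_eq_pure_run (c : Prog) (hc : c.flipFree = true) (s : Store) :
    c.dist s = PMF.pure (c.run s) := by
  induction c generalizing s with
  | flip a i j p => simp [Prog.flipFree] at hc
  | seq c d ihc ihd =>
    simp only [Prog.flipFree, Bool.and_eq_true] at hc
    simp only [Prog.dist, Prog.run, ihc hc.1, PMF.pure_bind, ihd hc.2]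
  | ite b c d ihc ihd =>
    simp only [Prog.flipFree, Bool.and_eq_true] at hc
    simp only [Prog.dist, Prog.run]
    split_ifs
    · exact ihc hc.1 s
    · exact ihd hc.2 s
  | loop x e c ih =>
    simp only [Prog.dist, Prog.run]
    have h : ∀ N, distLoop x c.dist N s = PMF.pure (runLoop x c.run N s) := by
      intro N
      induction N with
      | zero => rfl
      | succ N ihN => rw [distLoop, ihN, PMF.pure_bind, ih hc]; rfl
    exact h _
  | _ => rfl

/-! ### Arrays left alone by a program -/

/-- Two stores agree on the arrays that a program leaves alone. -/
structure Agree (c : Prog) (s s' : Store) : Prop where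
  nat : ∀ a, c.modN a = false → s'.nat a = s.nat a
  real : ∀ a, c.modR a = false → s'.real a = s.real a

theorem Store.setNat_nat_of_ne (s : Store) {a b : ℕ} (h : b ≠ a) (i j v : ℕ) :
    (s.setNat a i j v).nat b = s.nat b := by
  funext i' j'
  simp [Store.setNat, h]

theorem Store.setReal_real_of_ne (s : Store) {a b : ℕ} (h : b ≠ a) (i j : ℕ) (v : ℝ) :
    (s.setReal a i j v).real b = s.real b := by
  funext i' j'
  simp [Store.setReal, h]

theorem Agree.refl (c : Prog) (s : Store) : Agree c s s := ⟨fun _ _ => rfl, fun _ _ => rfl⟩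

/-- The condition is syntactic: an array can change only if it occurs as a target. For concrete
programs it is decided by evaluation, which discharges the frame conditions of all later correctness
proofs. -/
theorem Prog.agree_dist (c : Prog) (s : Store) : ∀ s' ∈ (c.dist s).support, Agree c s s' := by
  induction c generalizing s with
  | skip => intro s' h; rw [Prog.dist, PMF.mem_support_pure_iff] at h; subst h; exact .refl _ _
  | setN a i j e =>
    intro s' h; rw [Prog.dist, PMF.mem_support_pure_iff] at h; subst h
    refine ⟨fun b hb => ?_, fun _ _ => rfl⟩
    exact Store.setNat_nat_of_ne _ (by simpa [Prog.modN] using hb) _ _ _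
  | setR a i j e =>
    intro s' h; rw [Prog.dist, PMF.mem_support_pure_iff] at h; subst h
    refine ⟨fun _ _ => rfl, fun b hb => ?_⟩
    exact Store.setReal_real_of_ne _ (by simpa [Prog.modR] using hb) _ _ _
  | root a i j b l d r =>
    intro s' h; rw [Prog.dist, PMF.mem_support_pure_iff] at h; subst h
    refine ⟨fun _ _ => rfl, fun b hb => ?_⟩
    exact Store.setReal_real_of_ne _ (by simpa [Prog.modR] using hb) _ _ _
  | flip a i j p =>
    intro s' h
    rw [Prog.dist, PMF.mem_support_map_iff] at h
    obtain ⟨b, -, rfl⟩ := h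
    refine ⟨fun b hb => ?_, fun _ _ => rfl⟩
    exact Store.setNat_nat_of_ne _ (by simpa [Prog.modN] using hb) _ _ _
  | seq c d hc hd =>
    intro s' h
    rw [Prog.dist, PMF.mem_support_bind_iff] at h
    obtain ⟨s1, h1, h2⟩ := h
    refine ⟨fun b hb => ?_, fun b hb => ?_⟩
    · simp only [Prog.modN, Bool.or_eq_false_iff] at hb
      rw [(hd s1 s' h2).nat b hb.2, (hc s s1 h1).nat b hb.1]
    · simp only [Prog.modR, Bool.or_eq_false_iff] at hb
      rw [(hd s1 s' h2).real b hb.2, (hc s s1 h1).real b hb.1]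
  | ite b c d hc hd =>
    intro s' h
    rw [Prog.dist] at h
    refine ⟨fun b hb => ?_, fun b hb => ?_⟩
    · simp only [Prog.modN, Bool.or_eq_false_iff] at hb
      split_ifs at h
      · exact (hc s s' h).nat b hb.1
      · exact (hd s s' h).nat b hb.2
    · simp only [Prog.modR, Bool.or_eq_false_iff] at hb
      split_ifs at h
      · exact (hc s s' h).real b hb.1
      · exact (hd s s' h).real b hb.2
  | loop x e c hc =>
    have key : ∀ N, ∀ s' ∈ (distLoop x c.dist N s).support, Agree (.loop x e c) s s' := by
      intro N
      induction N with
      | zero => intro s' h; rw [distLoop, PMF.mem_support_pure_iff] at h; subst h; exact .refl _ _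
      | succ N ih =>
        intro s' h
        rw [distLoop, PMF.mem_support_bind_iff] at h
        obtain ⟨s1, h1, h2⟩ := h
        refine ⟨fun b hb => ?_, fun b hb => ?_⟩
        · have hb' := hb
          simp only [Prog.modN, Bool.or_eq_false_iff] at hb'
          rw [(hc _ s' h2).nat b hb'.2, Store.setNat_nat_of_ne _ (by simpa using hb'.1),
            (ih s1 h1).nat b hb]
        · rw [(hc _ s' h2).real b hb]
          exact (ih s1 h1).real b hb
    intro s' h
    exact key _ s' h

theorem Prog.agree_run (c : Prog) (hc : c.flipFree = true) (s : Store) : Agree c s (c.run s) :=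
  c.agree_dist s _ (by rw [c.dist_eq_pure_run hc]; simp)

theorem run_seq (c d : Prog) (s : Store) : (Prog.seq c d).run s = d.run (c.run s) := rfl

theorem run_ite_pos {b : Test} (c d : Prog) {s : Store} (h : b.holds s) :
    (Prog.ite b c d).run s = c.run s := if_pos h

theorem run_ite_neg {b : Test} (c d : Prog) {s : Store} (h : ¬ b.holds s) :
    (Prog.ite b c d).run s = d.run s := if_neg h

/-- The invariant rule for counted loops. -/
theorem run_loop {x : ℕ} {e : NExpr} {c : Prog} {s : Store} (hc : c.flipFree = true)
    (Inv : ℕ → Store → Prop) (h0 : Inv 0 s)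
    (hs : ∀ j s', j < e.eval s → s'.nat x 0 0 = j → Agree (.loop x e c) s s' → Inv j s' →
      Inv (j + 1) (c.run s'))
    (hx : ∀ j s', Inv j s' → Inv j (s'.setNat x 0 0 j) := by intro j s' h; exact h) :
    Inv (e.eval s) ((Prog.loop x e c).run s) := by
  -- The invariant is carried along with `Agree`, so that it needs to mention only data that the
  -- loop itself changes.
  have key : ∀ N ≤ e.eval s, Inv N (runLoop x c.run N s) ∧
      Agree (.loop x e c) s (runLoop x c.run N s) := by
    intro N
    induction N with
    | zero => intro _; exact ⟨h0, .refl _ _⟩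
    | succ N ih =>
      intro hN
      obtain ⟨h1, h2⟩ := ih (by omega)
      have h3 : Agree (.loop x e c) s ((runLoop x c.run N s).setNat x 0 0 N) := by
        refine ⟨fun b hb => ?_, fun b hb => h2.real b hb⟩
        rw [Store.setNat_nat_of_ne _ _, h2.nat b hb]
        simp only [Prog.modN, Bool.or_eq_false_iff] at hb
        simpa using hb.1
      refine ⟨hs N _ hN ?_ h3 (hx _ _ h1), ?_⟩
      · simp [Store.setNat]
      · have h4 := c.agree_run hc ((runLoop x c.run N s).setNat x 0 0 N)
        refine ⟨fun b hb => ?_, fun b hb => ?_⟩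
        · rw [← h3.nat b hb]
          simp only [Prog.modN, Bool.or_eq_false_iff] at hb
          exact h4.nat b hb.2
        · rw [← h3.real b hb]
          exact h4.real b hb
  exact (key _ le_rfl).1

/-! ### Running times -/

/-- A bound for the number of steps apart from repetitions. -/
def Prog.size : Prog → ℕ
  | .skip => 1
  | .setN _ i j e => i.cost + j.cost + e.cost + 1
  | .setR _ i j e => i.cost + j.cost + e.cost + 1
  | .root _ i j _ l d r => i.cost + j.cost + l.cost + d.cost + r.cost + 2
  | .flip _ i j p => i.cost + j.cost + p.cost + 1
  | .seq c d => c.size + d.size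
  | .ite b c d => b.cost + 1 + (c.size + d.size)
  | .loop _ e c => e.cost + 1 + (c.size + 1)

/-- The nesting depth of loops, where a root extraction counts as a loop. -/
def Prog.depth : Prog → ℕ
  | .root _ _ _ _ _ _ _ => 1
  | .seq c d => max c.depth d.depth
  | .ite _ c d => max c.depth d.depth
  | .loop _ _ c => c.depth + 1
  | _ => 0

/-- The expressions that bound loops and degrees. -/
def Prog.bounds : Prog → List NExpr
  | .root _ _ _ _ _ d _ => [d]
  | .seq c d => c.bounds ++ d.bounds
  | .ite _ c d => c.bounds ++ d.bounds
  | .loop _ e c => e :: c.bounds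
  | _ => []

/-- The expression is a fixed cell of one of the arrays `0` and `20`, which hold the sizes. -/
def NExpr.isSize : NExpr → Bool
  | .get a (.lit _) (.lit _) => a == 0 || a == 20
  | _ => false

/-- The arrays that hold the sizes coincide. -/
def SameSizes (s s' : Store) : Prop := s'.nat 0 = s.nat 0 ∧ s'.nat 20 = s.nat 20

theorem NExpr.eval_of_sameSizes {s s' : Store} (h : SameSizes s s') {e : NExpr}
    (he : e.isSize = true) : e.eval s' = e.eval s := by
  unfold NExpr.isSize at he
  split at he
  · rename_i a i j
    simp only [Bool.or_eq_true, beq_iff_eq] at he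
    rcases he with rfl | rfl
    · simp only [NExpr.eval, h.1]
    · simp only [NExpr.eval, h.2]
  · simp at he

/-- All loops of the program are bounded by size cells, which it leaves alone. -/
def Prog.static (c : Prog) : Bool :=
  c.bounds.all NExpr.isSize && !c.modN 0 && !c.modN 20

/-- Costs of a sequence add up, and each loop multiplies by at most `M`. Since the program never
writes to the arrays of sizes, bounds evaluated in the middle of a run are still those of the
initial store. A root extraction counts as one level of nesting because its cost contains the
degree. -/
theorem Prog.time_le {M : ℕ} (hM : 1 ≤ M) (c : Prog) (hc : c.static = true) (s : Store)
    (hb : ∀ e ∈ c.bounds, e.eval s ≤ M) : ∀ s' ∈ (c.eval s).support,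
      s'.time ≤ s.time + c.size * M ^ c.depth ∧ SameSizes s s' := by
  have hpow : ∀ {a b : ℕ}, a ≤ b → M ^ a ≤ M ^ b := fun h => Nat.pow_le_pow_right hM h
  simp only [Prog.static, Bool.and_eq_true, Bool.not_eq_true', List.all_eq_true] at hc
  obtain ⟨⟨hsz, h0⟩, h20⟩ := hc
  induction c generalizing s with
  | skip =>
    intro s' h; rw [Prog.eval, PMF.mem_support_pure_iff] at h; subst h
    exact ⟨by simp [Prog.size, Store.tick, Prog.depth], rfl, rfl⟩
  | setN a i j e =>
    intro s' h; rw [Prog.eval, PMF.mem_support_pure_iff] at h; subst h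
    simp only [Prog.modN, beq_eq_false_iff_ne] at h0 h20
    exact ⟨by simp [Prog.size, Store.tick, Prog.depth, Store.setNat],
      Store.setNat_nat_of_ne _ h0 _ _ _, Store.setNat_nat_of_ne _ h20 _ _ _⟩
  | setR a i j e =>
    intro s' h; rw [Prog.eval, PMF.mem_support_pure_iff] at h; subst h
    exact ⟨by simp [Prog.size, Store.tick, Prog.depth, Store.setReal], rfl, rfl⟩
  | root a i j b l d r =>
    intro s' h; rw [Prog.eval, PMF.mem_support_pure_iff] at h; subst h
    refine ⟨?_, rfl, rfl⟩
    have := hb d (by simp [Prog.bounds])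
    simp only [Prog.size, Store.tick, Prog.depth, Store.setReal, pow_one]
    nlinarith
  | flip a i j p =>
    intro s' h
    rw [Prog.eval, PMF.mem_support_map_iff] at h
    obtain ⟨b, -, rfl⟩ := h
    simp only [Prog.modN, beq_eq_false_iff_ne] at h0 h20
    exact ⟨by simp [Prog.size, Store.tick, Prog.depth, Store.setNat],
      Store.setNat_nat_of_ne _ h0 _ _ _, Store.setNat_nat_of_ne _ h20 _ _ _⟩
  | seq c d ihc ihd =>
    intro s' h
    rw [Prog.eval, PMF.mem_support_bind_iff] at h
    obtain ⟨s1, h1, h2⟩ := h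
    simp only [Prog.modN, Bool.or_eq_false_iff] at h0 h20
    simp only [Prog.bounds, List.mem_append] at hb hsz
    obtain ⟨t1, e1⟩ := ihc s (fun e he => hb e (.inl he)) h20.1 (fun e he => hsz e (.inl he)) h0.1
      s1 h1
    obtain ⟨t2, e2⟩ := ihd s1 (fun e he => by
      rw [NExpr.eval_of_sameSizes e1 (hsz e (.inr he))]; exact hb e (.inr he))
      h20.2 (fun e he => hsz e (.inr he)) h0.2 s' h2
    refine ⟨?_, e2.1.trans e1.1, e2.2.trans e1.2⟩
    have p1 := Nat.mul_le_mul_left c.size (hpow (le_max_left c.depth d.depth))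
    have p2 := Nat.mul_le_mul_left d.size (hpow (le_max_right c.depth d.depth))
    simp only [Prog.size, Prog.depth, add_mul]
    omega
  | ite b c d ihc ihd =>
    intro s' h
    rw [Prog.eval] at h
    simp only [Prog.modN, Bool.or_eq_false_iff] at h0 h20
    simp only [Prog.bounds, List.mem_append] at hb hsz
    have p1 := Nat.mul_le_mul_left c.size (hpow (le_max_left c.depth d.depth))
    have p2 := Nat.mul_le_mul_left d.size (hpow (le_max_right c.depth d.depth))
    have p3 := Nat.mul_le_mul_left (b.cost + 1) (hpow (Nat.zero_le (max c.depth d.depth)))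
    simp only [pow_zero, mul_one] at p3
    split_ifs at h
    · obtain ⟨t1, e1⟩ := ihc (s.tick (b.cost + 1)) (fun e he => by
        rw [NExpr.eval_of_sameSizes (s := s) (s' := s.tick (b.cost + 1)) ⟨rfl, rfl⟩ (hsz e (.inl he))]
        exact hb e (.inl he)) h20.1 (fun e he => hsz e (.inl he)) h0.1 s' h
      refine ⟨?_, e1⟩
      simp only [Prog.size, Prog.depth, add_mul, Store.tick] at *
      omega
    · obtain ⟨t1, e1⟩ := ihd (s.tick (b.cost + 1)) (fun e he => by
        rw [NExpr.eval_of_sameSizes (s := s) (s' := s.tick (b.cost + 1)) ⟨rfl, rfl⟩ (hsz e (.inr he))]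
        exact hb e (.inr he)) h20.2 (fun e he => hsz e (.inr he)) h0.2 s' h
      refine ⟨?_, e1⟩
      simp only [Prog.size, Prog.depth, add_mul, Store.tick] at *
      omega
  | loop x e c ih =>
    intro s' h
    simp only [Prog.modN, Bool.or_eq_false_iff, beq_eq_false_iff_ne] at h0 h20
    simp only [Prog.bounds, List.mem_cons, forall_eq_or_imp] at hb hsz
    have key : ∀ N, ∀ s' ∈ (loopEval x c.eval N (s.tick (e.cost + 1))).support,
        s'.time ≤ s.time + (e.cost + 1) + N * (c.size * M ^ c.depth + 1) ∧ SameSizes s s' := by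
      intro N
      induction N with
      | zero =>
        intro s' h; rw [loopEval, PMF.mem_support_pure_iff] at h; subst h
        exact ⟨by simp [Store.tick], rfl, rfl⟩
      | succ N ihN =>
        intro s' h
        rw [loopEval, PMF.mem_support_bind_iff] at h
        obtain ⟨s1, h1, h2⟩ := h
        obtain ⟨t1, e1⟩ := ihN s1 h1
        have e1' : SameSizes s ((s1.setNat x 0 0 N).tick 1) :=
          ⟨(Store.setNat_nat_of_ne s1 h0.1 0 0 N).trans e1.1,
            (Store.setNat_nat_of_ne s1 h20.1 0 0 N).trans e1.2⟩
        obtain ⟨t2, e2⟩ := ih _ (fun f hf => by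
          rw [NExpr.eval_of_sameSizes e1' (hsz.2 f hf)]; exact hb.2 f hf) h20.2 hsz.2 h0.2 s' h2
        refine ⟨?_, e2.1.trans e1'.1, e2.2.trans e1'.2⟩
        simp only [Store.tick, Store.setNat] at t2
        rw [add_mul]
        omega
    obtain ⟨t1, e1⟩ := key _ s' h
    refine ⟨?_, e1⟩
    have p1 : 1 ≤ M ^ c.depth := Nat.one_le_pow _ _ hM
    have p2 : e.eval s * (c.size * M ^ c.depth + 1) ≤ M * (c.size * M ^ c.depth + M ^ c.depth) :=
      Nat.mul_le_mul hb.1 (by omega)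
    have p3 : e.cost + 1 ≤ (e.cost + 1) * M ^ (c.depth + 1) :=
      Nat.le_mul_of_pos_right _ (Nat.one_le_pow _ _ hM)
    simp only [Prog.size, Prog.depth]
    have p4 : (e.cost + 1 + (c.size + 1)) * M ^ (c.depth + 1) =
        (e.cost + 1) * M ^ (c.depth + 1) + M * (c.size * M ^ c.depth + M ^ c.depth) := by
      rw [pow_succ]; ring
    omega

theorem Prog.support_erase {c : Prog} (hc : c.flipFree = true) {s s' : Store}
    (h : s' ∈ (c.eval s).support) : s'.erase = c.run s.erase := by
  have h1 : s'.erase ∈ ((c.eval s).map Store.erase).support :=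
    (PMF.mem_support_map_iff _ _ _).mpr ⟨s', h, rfl⟩
  rw [c.map_erase_eval, c.dist_eq_pure_run hc, PMF.mem_support_pure_iff] at h1
  exact h1

/-! ### Partial sums and products -/

/-- The product of the first `j` values. -/
def pprod {n : ℕ} {R : Type*} [CommMonoid R] (f : Fin n → R) (j : ℕ) : R :=
  ∏ q ∈ Finset.univ.filter (fun q : Fin n => (q : ℕ) < j), f q

theorem filter_val_lt_succ {n j : ℕ} (hj : j < n) :
    (Finset.univ.filter fun q : Fin n => (q : ℕ) < j + 1) =
      insert ⟨j, hj⟩ (Finset.univ.filter fun q : Fin n => (q : ℕ) < j) := by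
  ext q
  simp only [Finset.mem_filter, Finset.mem_univ, true_and, Finset.mem_insert, Fin.ext_iff]
  omega

@[simp] theorem pprod_zero {n : ℕ} {R : Type*} [CommMonoid R] (f : Fin n → R) : pprod f 0 = 1 := by
  simp [pprod]

theorem pprod_succ {n : ℕ} {R : Type*} [CommMonoid R] (f : Fin n → R) {j : ℕ} (hj : j < n) :
    pprod f (j + 1) = pprod f j * f ⟨j, hj⟩ := by
  rw [pprod, filter_val_lt_succ hj, Finset.prod_insert (by simp), mul_comm]; rfl

theorem pprod_self {n : ℕ} {R : Type*} [CommMonoid R] (f : Fin n → R) : pprod f n = ∏ q, f q := by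
  rw [pprod, Finset.filter_true_of_mem fun q _ => q.2]

/-! ### Complex-valued expressions and assignments -/

/-- A complex cell, stored in two adjacent real arrays. -/
def Store.cx (s : Store) (a i j : ℕ) : ℂ := ⟨s.real a i j, s.real (a + 1) i j⟩

/-- Complex-valued expressions. -/
structure CExpr where
  /-- The real part. -/
  re : RExpr
  /-- The imaginary part. -/
  im : RExpr

namespace CExpr

/-- The value of a complex expression. -/
def eval (s : Store) (e : CExpr) : ℂ := ⟨e.re.eval s, e.im.eval s⟩

/-- A complex cell. -/
def get (a : ℕ) (i j : NExpr) : CExpr := ⟨.get a i j, .get (a + 1) i j⟩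

/-- A real expression as a complex one. -/
def ofReal (e : RExpr) : CExpr := ⟨e, .lit 0⟩

/-- Addition. -/
def add (e f : CExpr) : CExpr := ⟨.add e.re f.re, .add e.im f.im⟩

/-- Subtraction. -/
def sub (e f : CExpr) : CExpr := ⟨.sub e.re f.re, .sub e.im f.im⟩

/-- Multiplication. -/
def mul (e f : CExpr) : CExpr :=
  ⟨.sub (.mul e.re f.re) (.mul e.im f.im), .add (.mul e.re f.im) (.mul e.im f.re)⟩

/-- Multiplication by a real expression. -/
def smul (r : RExpr) (e : CExpr) : CExpr := ⟨.mul r e.re, .mul r e.im⟩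

/-- Complex conjugation. -/
def conj (e : CExpr) : CExpr := ⟨e.re, .sub (.lit 0) e.im⟩

@[simp] theorem eval_get (s : Store) (a : ℕ) (i j : NExpr) :
    (get a i j).eval s = s.cx a (i.eval s) (j.eval s) := rfl

@[simp] theorem eval_ofReal (s : Store) (e : RExpr) : (ofReal e).eval s = (e.eval s : ℂ) := by
  apply Complex.ext <;> simp [eval, ofReal, RExpr.eval]

@[simp] theorem eval_add (s : Store) (e f : CExpr) : (add e f).eval s = e.eval s + f.eval s := by
  apply Complex.ext <;> simp [eval, add, RExpr.eval]

@[simp] theorem eval_sub (s : Store) (e f : CExpr) : (sub e f).eval s = e.eval s - f.eval s := by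
  apply Complex.ext <;> simp [eval, sub, RExpr.eval]

@[simp] theorem eval_mul (s : Store) (e f : CExpr) : (mul e f).eval s = e.eval s * f.eval s := by
  apply Complex.ext <;> simp [eval, mul, RExpr.eval]

@[simp] theorem eval_smul (s : Store) (r : RExpr) (e : CExpr) :
    (smul r e).eval s = (r.eval s : ℂ) * e.eval s := by
  apply Complex.ext <;> simp [eval, smul, RExpr.eval]

@[simp] theorem eval_conj (s : Store) (e : CExpr) :
    (conj e).eval s = (starRingEnd ℂ) (e.eval s) := by
  apply Complex.ext <;> simp [eval, conj, RExpr.eval]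

end CExpr

/-- Assign to a complex cell. -/
def Prog.setC (a : ℕ) (i j : NExpr) (e : CExpr) : Prog :=
  .seq (.setR 100 (.lit 0) (.lit 0) e.re)
    (.seq (.setR (a + 1) i j e.im) (.setR a i j (.get 100 (.lit 0) (.lit 0))))

theorem NExpr.eval_congr {s s' : Store} (h : s'.nat = s.nat) (e : NExpr) : e.eval s' = e.eval s := by
  induction e with
  | lit c => rfl
  | get a i j hi hj => simp only [NExpr.eval, hi, hj, h]
  | succ e he => simp only [NExpr.eval, he]
  | pred e he => simp only [NExpr.eval, he]

@[simp] theorem NExpr.eval_setReal (s : Store) (a i j : ℕ) (v : ℝ) (e : NExpr) :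
    e.eval (s.setReal a i j v) = e.eval s :=
  NExpr.eval_congr (s := s) (s' := s.setReal a i j v) rfl e

theorem run_setC_nat (a : ℕ) (i j : NExpr) (e : CExpr) (s : Store) :
    ((Prog.setC a i j e).run s).nat = s.nat := rfl

/-- The expression does not read the real array `a`. -/
def RExpr.avoids (a : ℕ) : RExpr → Bool
  | lit _ => true
  | get b _ _ => b != a
  | add e f | sub e f | mul e f | div e f => e.avoids a && f.avoids a
  | sin e | cos e => e.avoids a

theorem RExpr.eval_setReal {a : ℕ} {e : RExpr} (he : e.avoids a = true) (s : Store) (i j : ℕ)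
    (v : ℝ) : e.eval (s.setReal a i j v) = e.eval s := by
  induction e with
  | lit c => rfl
  | get b i' j' =>
    simp only [RExpr.avoids, bne_iff_ne] at he
    simp only [RExpr.eval, NExpr.eval_setReal, s.setReal_real_of_ne he]
  | sin e h => simp only [RExpr.avoids] at he; simp only [RExpr.eval, h he]
  | cos e h => simp only [RExpr.avoids] at he; simp only [RExpr.eval, h he]
  | _ e f he' hf' =>
    simp only [RExpr.avoids, Bool.and_eq_true] at he
    simp only [RExpr.eval, he' he.1, hf' he.2]

/-- The real part waits in array `100` until the imaginary part has been evaluated, so the target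
cell may occur in the expression. The bound on `a` keeps both halves of the target away from array
`100`. -/
theorem run_setC_cx {a : ℕ} (i j : NExpr) (e : CExpr) (s : Store) (ha : a < 99)
    (he : e.im.avoids 100 = true) (i' j' : ℕ) :
    ((Prog.setC a i j e).run s).cx a i' j' =
      if i' = i.eval s ∧ j' = j.eval s then e.eval s else s.cx a i' j' := by
  have h1 : a ≠ 100 := by omega
  have h2 : a + 1 ≠ 100 := by omega
  simp only [Prog.setC, Prog.run, NExpr.eval, RExpr.eval, NExpr.eval_setReal,
    RExpr.eval_setReal he]
  simp only [Store.cx, Store.setReal, CExpr.eval]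
  by_cases h : i' = i.eval s ∧ j' = j.eval s
  · simp [h, h2.symm]
  · simp [h, h1, h2]

theorem Agree.cx {c : Prog} {s s' : Store} (h : Agree c s s') (a : ℕ)
    (h1 : c.modR a = false) (h2 : c.modR (a + 1) = false) (i j : ℕ) : s'.cx a i j = s.cx a i j := by
  rw [Store.cx, Store.cx, h.real a h1, h.real (a + 1) h2]

/-! ### Cells and lookup tables for bits -/

/-- Cell `(0, 0)` of an array. -/
abbrev NExpr.cell (a : ℕ) : NExpr := .get a (.lit 0) (.lit 0)

/-- An entry of the row `0` of an array. -/
abbrev NExpr.at (a : ℕ) (j : NExpr) : NExpr := .get a (.lit 0) j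

/-- Cell `(0, 0)` of a real array. -/
abbrev RExpr.cell (a : ℕ) : RExpr := .get a (.lit 0) (.lit 0)

/-- An entry of the row `0` of a real array. -/
abbrev RExpr.at (a : ℕ) (j : NExpr) : RExpr := .get a (.lit 0) j

/-- Cell `(0, 0)` of a complex array. -/
abbrev CExpr.cell (a : ℕ) : CExpr := .get a (.lit 0) (.lit 0)

/-- An entry of the row `0` of a complex array. -/
abbrev CExpr.at (a : ℕ) (j : NExpr) : CExpr := .get a (.lit 0) j

/-- Addition of bits, by table lookup. -/
abbrev NExpr.xor (e f : NExpr) : NExpr := .get 21 e f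

/-- The sign `(-1) ^ (e f)` of bits, by table lookup. -/
abbrev RExpr.sign (e f : NExpr) : RExpr := .get 20 e f

/-- The phase between a Pauli matrix and its Weyl operator, by table lookup. -/
abbrev CExpr.phase (e f : NExpr) : CExpr := .get 21 e f

/-- The number of qubits. -/
abbrev NExpr.qubits : NExpr := .cell 0

/-- The lookup tables for bits have been filled in. -/
structure Tables (s : Store) : Prop where
  xor : ∀ a b : ZMod 2, s.nat 21 a.val b.val = (a + b).val
  sign : ∀ a b : ZMod 2, s.real 20 a.val b.val = chi (a * b)
  phase : ∀ a b : ZMod 2, s.cx 21 a.val b.val = ph1 a b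

/-- Fill in the lookup tables. -/
def Prog.tables : Prog :=
  .seq (.setN 21 (.lit 0) (.lit 1) (.lit 1)) <|
  .seq (.setN 21 (.lit 1) (.lit 0) (.lit 1)) <|
  .seq (.setR 20 (.lit 0) (.lit 0) (.lit 1)) <|
  .seq (.setR 20 (.lit 0) (.lit 1) (.lit 1)) <|
  .seq (.setR 20 (.lit 1) (.lit 0) (.lit 1)) <|
  .seq (.setR 20 (.lit 1) (.lit 1) (.lit (-1))) <|
  .seq (.setR 21 (.lit 0) (.lit 0) (.lit 1)) <|
  .seq (.setR 21 (.lit 0) (.lit 1) (.lit 1)) <|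
  .seq (.setR 21 (.lit 1) (.lit 0) (.lit 1)) <|
  .setR 22 (.lit 1) (.lit 1) (.lit 1)

/-- Entries equal to zero are never written; they rely on empty memory. -/
theorem run_tables {s : Store} (h1 : s.nat 21 = 0) (h2 : s.real 21 = 0) (h3 : s.real 22 = 0) :
    Tables (Prog.tables.run s) := by
  have v1 : (1 : ZMod 2).val = 1 := rfl
  have h1' := fun i j => congrFun (congrFun h1 i) j
  have h2' := fun i j => congrFun (congrFun h2 i) j
  have h3' := fun i j => congrFun (congrFun h3 i) j
  simp only [Pi.zero_apply] at h1' h2' h3'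
  constructor <;> intro a b <;> rcases zmod2_cases a with rfl | rfl <;>
    rcases zmod2_cases b with rfl | rfl <;>
    simp [Prog.tables, Prog.run, Store.setNat, Store.setReal, NExpr.eval, RExpr.eval, v1, h1', h2',
      h3', Store.cx, ph1, show (1 : ZMod 2) + 1 = 0 from rfl] <;> rfl

/-! ### Reducing Pauli strings by stabilizer rows -/

/-- The register for a phase times a Weyl operator. -/
structure Reg {n : ℕ} (s : Store) (P : PauliString n) (ω : ℂ) : Prop where
  x : ∀ q : Fin n, s.nat 31 0 q = (xp P q).val
  z : ∀ q : Fin n, s.nat 32 0 q = (zp P q).val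
  phase : s.cx 25 0 0 = ω

/-- Load into the register the product of a Hermitian Pauli string and a Weyl operator, whose bits
at position `cell 72` are given by expressions. -/
def Prog.load (ax az bx bz : NExpr) : Prog :=
  .seq (.setC 25 (.lit 0) (.lit 0) (.ofReal (.lit 1))) <|
  .loop 72 .qubits <|
  .seq (.setC 25 (.lit 0) (.lit 0) (.mul (.cell 25) (.smul (.sign az bx) (.phase ax az)))) <|
  .seq (.setN 31 (.lit 0) (.cell 72) (.xor ax bx)) <|
  .setN 32 (.lit 0) (.cell 72) (.xor az bz)

/-- The operands of `load` evaluate to the given bits whatever is in the scratch arrays. -/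
def Operand {n : ℕ} (s : Store) (e : NExpr) (v : Vec n) : Prop :=
  ∀ s' : Store, (∀ a, a ≠ 31 → a ≠ 32 → a ≠ 72 → s'.nat a = s.nat a) →
    ∀ q : Fin n, s'.nat 72 0 0 = q → e.eval s' = (v q).val

/-- The operator factorises over qubits: each contributes the phase of its Hermitian Pauli matrix
from `A` and the sign of moving a `Z` of `A` past an `X` of `B`. The factor `B` is a Weyl operator
and brings no phase. -/
theorem run_load {n : ℕ} {s : Store} (ht : Tables s) (hn : s.nat 0 0 0 = n)
    {ax az bx bz : NExpr} {A B : PauliString n} (hax : Operand s ax (xp A))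
    (haz : Operand s az (zp A)) (hbx : Operand s bx (xp B)) (hbz : Operand s bz (zp B)) :
    Reg ((Prog.load ax az bx bz).run s) (A + B) (iph A * chi (zp A ⬝ᵥ xp B)) := by
  unfold Prog.load
  rw [run_seq]
  have hr0 := (run_setC_cx (.lit 0) (.lit 0) (.ofReal (.lit 1)) s (a := 25) (by simp) rfl 0 0)
  have hag0 := (Prog.setC 25 (.lit 0) (.lit 0) (.ofReal (.lit 1))).agree_run rfl s
  generalize (Prog.setC 25 (.lit 0) (.lit 0) (.ofReal (.lit 1))).run s = s0 at *
  have hn0 : NExpr.qubits.eval s0 = n := by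
    change s0.nat 0 0 0 = n
    rw [hag0.nat 0 rfl, hn]
  have := run_loop (x := 72) (e := .qubits) (s := s0) (c := 
    .seq (.setC 25 (.lit 0) (.lit 0) (.mul (.cell 25) (.smul (.sign az bx) (.phase ax az)))) <|
    .seq (.setN 31 (.lit 0) (.cell 72) (.xor ax bx)) <|
    .setN 32 (.lit 0) (.cell 72) (.xor az bz)) rfl
    (fun j s' => (∀ q : Fin n, (q : ℕ) < j → s'.nat 31 0 q = (xp A q + xp B q).val) ∧
      (∀ q : Fin n, (q : ℕ) < j → s'.nat 32 0 q = (zp A q + zp B q).val) ∧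
      s'.cx 25 0 0 = pprod (fun q => ph1 (xp A q) (zp A q) * (chi (zp A q * xp B q) : ℂ)) j)
    ⟨by simp, by simp, by rw [hr0]; simp [RExpr.eval, NExpr.eval]⟩ ?_
  · rw [hn0] at this
    refine ⟨fun q => this.1 q q.2, fun q => this.2.1 q q.2, this.2.2.trans ?_⟩
    rw [pprod_self, Finset.prod_mul_distrib, dotProduct, chi_sum, Complex.ofReal_prod]; rfl
  · rintro j s1 hj hc hag ⟨h1, h2, h3⟩
    rw [hn0] at hj
    have hnat : ∀ a, a ≠ 31 → a ≠ 32 → a ≠ 72 → s1.nat a = s.nat a := by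
      intro a a1 a2 a3
      rw [hag.nat a (by simp [Prog.modN, Prog.setC, *]), hag0.nat a rfl]
    have hX : ∀ a b : ZMod 2, s1.nat 21 a.val b.val = (a + b).val := fun a b => by
      rw [hnat 21 (by simp) (by simp) (by simp), ht.xor]
    have hS : ∀ a b : ZMod 2, s1.real 20 a.val b.val = chi (a * b) := fun a b => by
      rw [hag.real 20 rfl, hag0.real 20 rfl, ht.sign]
    have hP : ∀ a b : ZMod 2, s1.cx 21 a.val b.val = ph1 a b := fun a b => by
      rw [hag.cx 21 rfl rfl, hag0.cx 21 rfl rfl, ht.phase]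
    have e1 := hax s1 hnat ⟨j, hj⟩ hc
    have e2 := haz s1 hnat ⟨j, hj⟩ hc
    have e3 := hbx s1 hnat ⟨j, hj⟩ hc
    have e4 := hbz s1 hnat ⟨j, hj⟩ hc
    rw [run_seq]
    have c1 := run_setC_cx (.lit 0) (.lit 0)
      (.mul (.cell 25) (.smul (.sign az bx) (.phase ax az))) s1 (a := 25) (by simp) rfl 0 0
    have c2 := run_setC_nat 25 (.lit 0) (.lit 0)
      (.mul (.cell 25) (.smul (.sign az bx) (.phase ax az))) s1
    generalize Prog.run (Prog.setC 25 _ _ _) s1 = s2 at *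
    simp only [CExpr.eval_mul, CExpr.eval_smul, CExpr.eval_get, RExpr.eval, NExpr.eval, e1, e2, e3,
      hS, hP, h3, and_self, if_true] at c1
    have f1 : ∀ e : NExpr, e.eval s2 = e.eval s1 := NExpr.eval_congr c2
    have hnat' : ∀ v, ∀ a, a ≠ 31 → a ≠ 32 → a ≠ 72 → (s2.setNat 31 0 j v).nat a = s.nat a := by
      intro v a a1 a2 a3
      rw [Store.setNat_nat_of_ne _ a1, c2, hnat a a1 a2 a3]
    have hc2 : s2.nat 72 0 0 = j := by rw [c2, hc]
    -- The `Z`-operands are evaluated after array `31` has been changed. This is why `Operand`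
    -- speaks of all stores that agree outside the scratch arrays.
    have g2 := fun v => haz _ (hnat' v) ⟨j, hj⟩ hc2
    have g4 := fun v => hbz _ (hnat' v) ⟨j, hj⟩ hc2
    have X2 : s2.nat 21 = s1.nat 21 := by rw [c2]
    have r1 : (Prog.seq (.setN 31 (.lit 0) (.cell 72) (.xor ax bx))
        (.setN 32 (.lit 0) (.cell 72) (.xor az bz))).run s2 =
        (s2.setNat 31 0 j (xp A ⟨j, hj⟩ + xp B ⟨j, hj⟩).val).setNat 32 0 j
          (zp A ⟨j, hj⟩ + zp B ⟨j, hj⟩).val := by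
      simp only [Prog.run, NExpr.eval, f1, e1, e3, hX, hc2, X2]
      rw [g2, g4]
      congr 1
      change s2.nat 21 _ _ = _
      rw [X2]
      exact hX _ _
    rw [r1]
    refine ⟨fun q hq => ?_, fun q hq => ?_, ?_⟩
    · change (if 31 = 31 ∧ 0 = 0 ∧ (q : ℕ) = j then _ else s2.nat 31 0 q) = _
      rw [c2]
      by_cases h : (q : ℕ) = j
      · subst h; simp
      · rw [if_neg (by simp [h]), h1 q (by omega)]
    · change (if 32 = 32 ∧ 0 = 0 ∧ (q : ℕ) = j then _ else s2.nat 32 0 q) = _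
      rw [c2]
      by_cases h : (q : ℕ) = j
      · subst h; simp
      · rw [if_neg (by simp [h]), h2 q (by omega)]
    · change s2.cx 25 0 0 = _
      rw [c1, pprod_succ _ hj]
      ring

theorem ite_val_succ {n : ℕ} {q : Fin n} {j : ℕ} (hj : j < n) {α : Type*} (A B : Fin n → α) :
    (if (q : ℕ) = j then A ⟨j, hj⟩ else if (q : ℕ) < j then A q else B q) =
      if (q : ℕ) < j + 1 then A q else B q := by
  by_cases h : (q : ℕ) = j
  · subst h; simp
  · rw [if_neg h]
    congr 1
    exact propext (by omega)

/-- The register loop of `mulRow`. -/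
def Prog.mulRowBits : Prog :=
  .loop 71 .qubits <|
  .seq (.setC 25 (.lit 0) (.lit 0)
    (.smul (.sign (.at 32 (.cell 71)) (.get 33 (.cell 70) (.cell 71))) (.cell 25))) <|
  .seq (.setN 31 (.lit 0) (.cell 71) (.xor (.at 31 (.cell 71)) (.get 33 (.cell 70) (.cell 71)))) <|
  .setN 32 (.lit 0) (.cell 71) (.xor (.at 32 (.cell 71)) (.get 34 (.cell 70) (.cell 71)))

/-- Multiply the register by the stabilizer row `cell 70`. -/
def Prog.mulRow : Prog :=
  .seq .mulRowBits (.setC 25 (.lit 0) (.lit 0) (.mul (.cell 25) (.at 27 (.cell 70))))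

/-- At each qubit the sign uses the `Z`-bit of the old register, so it is multiplied in before that
bit is overwritten. The invariant records that positions from `j` on are still unchanged. -/
theorem run_mulRowBits {n : ℕ} {s : Store} (ht : Tables s) (hn : s.nat 0 0 0 = n)
    {P R : PauliString n} {ω : ℂ} (hr : Reg s P ω) {r : ℕ} (h70 : s.nat 70 0 0 = r)
    (hx : ∀ q : Fin n, s.nat 33 r q = (xp R q).val) (hz : ∀ q : Fin n, s.nat 34 r q = (zp R q).val) :
    Reg (Prog.mulRowBits.run s) (P + R) (ω * chi (zp P ⬝ᵥ xp R)) := by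
  have hn0 : NExpr.qubits.eval s = n := hn
  have := run_loop (x := 71) (e := .qubits) (s := s) (c := 
    .seq (.setC 25 (.lit 0) (.lit 0)
      (.smul (.sign (.at 32 (.cell 71)) (.get 33 (.cell 70) (.cell 71))) (.cell 25))) <|
    .seq (.setN 31 (.lit 0) (.cell 71)
      (.xor (.at 31 (.cell 71)) (.get 33 (.cell 70) (.cell 71)))) <|
    .setN 32 (.lit 0) (.cell 71) (.xor (.at 32 (.cell 71)) (.get 34 (.cell 70) (.cell 71)))) rfl
    (fun j s' => (∀ q : Fin n, s'.nat 31 0 q =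
        if (q : ℕ) < j then (xp P q + xp R q).val else (xp P q).val) ∧
      (∀ q : Fin n, s'.nat 32 0 q =
        if (q : ℕ) < j then (zp P q + zp R q).val else (zp P q).val) ∧
      s'.cx 25 0 0 = ω * pprod (fun q => (chi (zp P q * xp R q) : ℂ)) j)
    ⟨fun q => by simp [hr.x], fun q => by simp [hr.z], by simp [hr.phase]⟩ ?_
  · rw [hn0] at this
    refine ⟨fun q => (this.1 q).trans (if_pos q.2), fun q => (this.2.1 q).trans (if_pos q.2),
      this.2.2.trans ?_⟩
    rw [pprod_self, dotProduct, chi_sum, Complex.ofReal_prod]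
  · rintro j s1 hj hc hag ⟨h1, h2, h3⟩
    rw [hn0] at hj
    have hX : ∀ a b : ZMod 2, s1.nat 21 a.val b.val = (a + b).val := fun a b => by
      rw [hag.nat 21 rfl, ht.xor]
    have hS : ∀ a b : ZMod 2, s1.real 20 a.val b.val = chi (a * b) := fun a b => by
      rw [hag.real 20 rfl, ht.sign]
    have e1 : s1.nat 31 0 j = (xp P ⟨j, hj⟩).val := (h1 ⟨j, hj⟩).trans (if_neg (lt_irrefl j))
    have e2 : s1.nat 32 0 j = (zp P ⟨j, hj⟩).val := (h2 ⟨j, hj⟩).trans (if_neg (lt_irrefl j))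
    have e3 : s1.nat 33 r j = (xp R ⟨j, hj⟩).val := by rw [hag.nat 33 rfl]; exact hx ⟨j, hj⟩
    have e4 : s1.nat 34 r j = (zp R ⟨j, hj⟩).val := by rw [hag.nat 34 rfl]; exact hz ⟨j, hj⟩
    have e5 : s1.nat 70 0 0 = r := by rw [hag.nat 70 rfl, h70]
    rw [run_seq]
    have c1 := run_setC_cx (.lit 0) (.lit 0)
      (.smul (.sign (.at 32 (.cell 71)) (.get 33 (.cell 70) (.cell 71))) (.cell 25)) s1 (a := 25)
      (by simp) rfl 0 0
    have c2 := run_setC_nat 25 (.lit 0) (.lit 0)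
      (.smul (.sign (.at 32 (.cell 71)) (.get 33 (.cell 70) (.cell 71))) (.cell 25)) s1
    generalize Prog.run (Prog.setC 25 _ _ _) s1 = s2 at *
    simp only [CExpr.eval_smul, CExpr.eval_get, RExpr.eval, NExpr.eval, hc, e2, e3, e5, hS, h3,
      and_self, if_true] at c1
    refine ⟨fun q => ?_, fun q => ?_, ?_⟩
    · rw [← ite_val_succ hj (fun q => (xp P q + xp R q).val) fun q => (xp P q).val]
      simp [Prog.run, Store.setNat, NExpr.eval, c2, hc, e1, e3, e5, hX, h1]
    · rw [← ite_val_succ hj (fun q => (zp P q + zp R q).val) fun q => (zp P q).val]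
      simp [Prog.run, Store.setNat, NExpr.eval, c2, hc, e2, e4, e5, hX, h2]
    · change s2.cx 25 0 0 = _
      rw [c1, pprod_succ _ hj]
      ring

theorem run_mulRow {n : ℕ} {s : Store} (ht : Tables s) (hn : s.nat 0 0 0 = n)
    {P R : PauliString n} {ω ρ : ℂ} (hr : Reg s P ω) {r : ℕ} (h70 : s.nat 70 0 0 = r)
    (hx : ∀ q : Fin n, s.nat 33 r q = (xp R q).val) (hz : ∀ q : Fin n, s.nat 34 r q = (zp R q).val)
    (hρ : s.cx 27 0 r = ρ) :
    Reg (Prog.mulRow.run s) (P + R) (ω * chi (zp P ⬝ᵥ xp R) * ρ) := by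
  have h := run_mulRowBits ht hn hr h70 hx hz
  have hag := Prog.mulRowBits.agree_run rfl s
  rw [Prog.mulRow, run_seq]
  generalize Prog.mulRowBits.run s = s1 at *
  refine ⟨h.x, h.z, ?_⟩
  rw [run_setC_cx _ _ _ _ (by simp) rfl]
  simp only [NExpr.eval, and_self, if_true, CExpr.eval_mul, CExpr.eval_get, h.phase,
    hag.nat 70 rfl, hag.cx 27 rfl rfl, h70, hρ]

/-- Clear the pivot bits of the register with the stabilizer rows. -/
def Prog.reduce : Prog :=
  .loop 70 .qubits <|
  .ite (.and (.natEq (.at 31 (.cell 70)) (.lit 1)) (.natEq (.at 35 (.cell 70)) (.lit 1)))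
    .mulRow .skip

/-- The stabilizer rows stored in memory: row `q` is present if `has q`, it then stabilizes the
state and its first nonzero `X`-bit is at position `q`. -/
structure Rows {n : ℕ} (s : Store) (w : Wave n) (has : Fin n → Prop) (R : Fin n → PauliString n)
    (ρ : Fin n → ℂ) : Prop where
  mem_x : ∀ r q : Fin n, s.nat 33 r q = (xp (R r) q).val
  mem_z : ∀ r q : Fin n, s.nat 34 r q = (zp (R r) q).val
  mem_phase : ∀ r : Fin n, s.cx 27 0 r = ρ r
  mem_has : ∀ r : Fin n, s.nat 35 0 r = 1 ↔ has r
  absent : ∀ r, ¬ has r → R r = 0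
  stab : ∀ r, has r → ρ r • wop (R r) w = w
  pivot : ∀ r, has r → xp (R r) r = 1
  lead : ∀ r, has r → ∀ q < r, xp (R r) q = 0

/-- Multiplying by a row that stabilizes the state changes the string but not the resulting vector.
Row `r` has no `X`-bits before position `r`, so pivots treated in increasing order stay cleared. -/
theorem run_reduce {n : ℕ} {s : Store} (ht : Tables s) (hn : s.nat 0 0 0 = n) {w : Wave n}
    {has : Fin n → Prop} {R : Fin n → PauliString n} {ρ : Fin n → ℂ} (hR : Rows s w has R ρ)
    {P : PauliString n} {ω : ℂ} (hr : Reg s P ω) :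
    ∃ P' ω', Reg (Prog.reduce.run s) P' ω' ∧ ω' • wop P' w = ω • wop P w ∧
      (∀ q, has q → xp P' q = 0) ∧
      xp P + xp P' ∈ Submodule.span (ZMod 2) (Set.range fun r => xp (R r)) := by
  have hn0 : NExpr.qubits.eval s = n := hn
  have := run_loop (x := 70) (e := .qubits) (s := s) (c := 
    .ite (.and (.natEq (.at 31 (.cell 70)) (.lit 1)) (.natEq (.at 35 (.cell 70)) (.lit 1)))
      .mulRow .skip) rfl
    (fun j s' => ∃ P' ω', Reg s' P' ω' ∧ ω' • wop P' w = ω • wop P w ∧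
      (∀ q : Fin n, (q : ℕ) < j → has q → xp P' q = 0) ∧
      xp P + xp P' ∈ Submodule.span (ZMod 2) (Set.range fun r => xp (R r)))
    ⟨P, ω, hr, rfl, by simp, by rw [vec_add_self]; exact Submodule.zero_mem _⟩ ?_
    (by rintro j s' ⟨P', ω', ⟨h1, h2, h3⟩, h⟩; exact ⟨P', ω', ⟨h1, h2, h3⟩, h⟩)
  · rw [hn0] at this
    obtain ⟨P', ω', h1, h2, h3, h4⟩ := this
    exact ⟨P', ω', h1, h2, fun q => h3 q q.2, h4⟩
  · rintro j s1 hj hc hag ⟨P', ω', h1, h2, h3, h4⟩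
    rw [hn0] at hj
    have ht1 : Tables s1 := ⟨fun a b => by rw [hag.nat 21 rfl, ht.xor],
      fun a b => by rw [hag.real 20 rfl, ht.sign], fun a b => by rw [hag.cx 21 rfl rfl, ht.phase]⟩
    have hx1 := h1.x ⟨j, hj⟩
    have hh := hR.mem_has ⟨j, hj⟩
    simp only at hx1 hh
    by_cases hcond : xp P' ⟨j, hj⟩ = 1 ∧ has ⟨j, hj⟩
    · have hT : (Test.and (.natEq (.at 31 (.cell 70)) (.lit 1))
          (.natEq (.at 35 (.cell 70)) (.lit 1))).holds s1 := by
        simp only [Test.holds, NExpr.eval, hc, hx1, hag.nat 35 rfl]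
        exact ⟨by rw [hcond.1]; rfl, hh.mpr hcond.2⟩
      rw [Prog.run, if_pos hT]
      refine ⟨_, _, run_mulRow ht1 (by rw [hag.nat 0 rfl, hn]) h1 hc
        (fun q => by rw [hag.nat 33 rfl]; exact hR.mem_x ⟨j, hj⟩ q)
        (fun q => by rw [hag.nat 34 rfl]; exact hR.mem_z ⟨j, hj⟩ q)
        ((hag.cx 27 rfl rfl 0 j).trans (hR.mem_phase ⟨j, hj⟩)), ?_, ?_, ?_⟩
      · rw [← h2]
        conv_rhs => rw [← hR.stab _ hcond.2, wop_smul, wop_wop, smul_smul, smul_smul]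
        congr 1
        ring
      · intro q hq hq'
        rw [xp_add, Pi.add_apply]
        rcases (Nat.lt_succ_iff_lt_or_eq.mp hq) with hlt | heq
        · rw [h3 q hlt hq', hR.lead ⟨j, hj⟩ hcond.2 q hlt, add_zero]
        · obtain rfl : q = ⟨j, hj⟩ := Fin.ext heq
          rw [hcond.1, hR.pivot _ hcond.2]; rfl
      · rw [xp_add, ← add_assoc]
        exact Submodule.add_mem _ h4 (Submodule.subset_span ⟨_, rfl⟩)
    · have hT : ¬ (Test.and (.natEq (.at 31 (.cell 70)) (.lit 1))
          (.natEq (.at 35 (.cell 70)) (.lit 1))).holds s1 := by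
        simp only [Test.holds, NExpr.eval, hc, hx1, hag.nat 35 rfl]
        rintro ⟨h5, h6⟩
        refine hcond ⟨?_, hh.mp h6⟩
        rcases zmod2_cases (xp P' ⟨j, hj⟩) with h0 | h0
        · rw [h0] at h5; simp at h5
        · exact h0
      rw [Prog.run, if_neg hT]
      refine ⟨P', ω', h1, h2, fun q hq hq' => ?_, h4⟩
      rcases (Nat.lt_succ_iff_lt_or_eq.mp hq) with hlt | heq
      · exact h3 q hlt hq'
      · obtain rfl : q = ⟨j, hj⟩ := Fin.ext heq
        exact (zmod2_cases _).resolve_right fun h' => hcond ⟨h', hq'⟩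

/-! ### Sums and arrays -/

theorem Agree.seq {c d : Prog} {s s1 s2 : Store} (h1 : Agree c s s1) (h2 : Agree d s1 s2) :
    Agree (.seq c d) s s2 := by
  refine ⟨fun a ha => ?_, fun a ha => ?_⟩
  · simp only [Prog.modN, Bool.or_eq_false_iff] at ha
    rw [h2.nat a ha.2, h1.nat a ha.1]
  · simp only [Prog.modR, Bool.or_eq_false_iff] at ha
    rw [h2.real a ha.2, h1.real a ha.1]

/-- Sum a complex expression, which is evaluated after running `c`. -/
def Prog.sumC (acc x : ℕ) (N : NExpr) (c : Prog) (e : CExpr) : Prog :=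
  .seq (.setC acc (.lit 0) (.lit 0) (.ofReal (.lit 0)))
    (.loop x N (.seq c (.setC acc (.lit 0) (.lit 0) (.add (.cell acc) e))))

theorem run_sumC {acc x : ℕ} {N : NExpr} {c : Prog} {e : CExpr} {s : Store}
    (hc : c.flipFree = true) (hacc : acc < 99) (h1 : c.modR acc = false)
    (h2 : c.modR (acc + 1) = false) (he : e.im.avoids 100 = true) (f : ℕ → ℂ)
    (hf : ∀ j s', j < N.eval s → s'.nat x 0 0 = j → Agree (.sumC acc x N c e) s s' →
      e.eval (c.run s') = f j) :
    ((Prog.sumC acc x N c e).run s).cx acc 0 0 = ∑ j ∈ Finset.range (N.eval s), f j := by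
  rw [Prog.sumC, run_seq]
  have hr0 := run_setC_cx (.lit 0) (.lit 0) (.ofReal (.lit 0)) s hacc rfl 0 0
  have hag0 := (Prog.setC acc (.lit 0) (.lit 0) (.ofReal (.lit 0))).agree_run rfl s
  have hN : N.eval _ = N.eval s := NExpr.eval_congr
    (run_setC_nat acc (.lit 0) (.lit 0) (.ofReal (.lit 0)) s) N
  generalize (Prog.setC acc (.lit 0) (.lit 0) (.ofReal (.lit 0))).run s = s0 at *
  rw [← hN]
  refine run_loop (x := x) (e := N) (s := s0) (by simpa [Prog.flipFree, Prog.setC] using hc)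
    (fun j s' => s'.cx acc 0 0 = ∑ j ∈ Finset.range j, f j)
    (by rw [hr0]; simp [RExpr.eval, NExpr.eval]) ?_
  intro j s1 hj hx hag hi
  rw [run_seq, run_setC_cx _ _ _ _ hacc (by
    simp only [CExpr.add, CExpr.get, RExpr.avoids, he, Bool.and_true, bne_iff_ne]; omega)]
  simp only [NExpr.eval, and_self, if_true, CExpr.eval_add, CExpr.eval_get]
  rw [hf j s1 (hN ▸ hj) hx (hag0.seq hag), (c.agree_run hc s1).cx acc h1 h2, hi,
    Finset.sum_range_succ]

/-- Sum a real expression, which is evaluated after running `c`. -/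
def Prog.sumR (acc x : ℕ) (N : NExpr) (c : Prog) (e : RExpr) : Prog :=
  .seq (.setR acc (.lit 0) (.lit 0) (.lit 0))
    (.loop x N (.seq c (.setR acc (.lit 0) (.lit 0) (.add (.cell acc) e))))

theorem run_sumR {acc x : ℕ} {N : NExpr} {c : Prog} {e : RExpr} {s : Store}
    (hc : c.flipFree = true) (h1 : c.modR acc = false) (f : ℕ → ℝ)
    (hf : ∀ j s', j < N.eval s → s'.nat x 0 0 = j → Agree (.sumR acc x N c e) s s' →
      e.eval (c.run s') = f j) :
    ((Prog.sumR acc x N c e).run s).real acc 0 0 = ∑ j ∈ Finset.range (N.eval s), f j := by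
  rw [Prog.sumR, run_seq]
  have hag0 := (Prog.setR acc (.lit 0) (.lit 0) (.lit 0)).agree_run rfl s
  have hr0 : ((Prog.setR acc (.lit 0) (.lit 0) (.lit 0)).run s).real acc 0 0 = 0 := by
    simp [Prog.run, Store.setReal, NExpr.eval, RExpr.eval]
  have hN : N.eval ((Prog.setR acc (.lit 0) (.lit 0) (.lit 0)).run s) = N.eval s :=
    NExpr.eval_setReal _ _ _ _ _ _
  generalize (Prog.setR acc (.lit 0) (.lit 0) (.lit 0)).run s = s0 at *
  rw [← hN]
  refine run_loop (x := x) (e := N) (s := s0) (by simpa [Prog.flipFree] using hc)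
    (fun j s' => s'.real acc 0 0 = ∑ j ∈ Finset.range j, f j) (by rw [hr0]; simp) ?_
  intro j s1 hj hx hag hi
  rw [run_seq, Finset.sum_range_succ, ← hi, ← hf j s1 (hN ▸ hj) hx (hag0.seq hag)]
  simp only [Prog.run, Store.setReal, NExpr.eval, RExpr.eval, and_self, if_true]
  rw [(c.agree_run hc s1).real acc h1]

/-- Fill a row of a real array with the values of an expression, each of which is evaluated after
running `c`. -/
def Prog.fillR (a : ℕ) (i : NExpr) (x : ℕ) (N : NExpr) (c : Prog) (e : RExpr) : Prog :=
  .loop x N (.seq c (.setR a i (.cell x) e))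

theorem run_fillR {a x : ℕ} {i N : NExpr} {c : Prog} {e : RExpr} {s : Store}
    (hc : c.flipFree = true) (h1 : c.modR a = false) (hx : c.modN x = false) (i₀ : ℕ)
    (hi : ∀ s', Agree (.fillR a i x N c e) s s' → i.eval (c.run s') = i₀) (f : ℕ → ℝ)
    (hf : ∀ j s', j < N.eval s → s'.nat x 0 0 = j → Agree (.fillR a i x N c e) s s' →
      e.eval (c.run s') = f j) (i' j' : ℕ) :
    ((Prog.fillR a i x N c e).run s).real a i' j' =
      if i' = i₀ ∧ j' < N.eval s then f j' else s.real a i' j' := by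
  refine run_loop (x := x) (e := N) (s := s) (by simpa [Prog.flipFree] using hc)
    (fun j s' => s'.real a i' j' = if i' = i₀ ∧ j' < j then f j' else s.real a i' j') (by simp) ?_
  intro j s1 hj hxj hag hinv
  rw [run_seq]
  have hag1 := c.agree_run hc s1
  simp only [Prog.run, Store.setReal, hi s1 hag, hf j s1 hj hxj hag, NExpr.eval, hag1.nat x hx,
    hxj, true_and]
  rw [hag1.real a h1, hinv]
  by_cases h : i' = i₀
  · by_cases h' : j' = j
    · subst h'; simp [h]
    · simp only [h, h', and_false, if_false, true_and]
      congr 1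
      exact propext (by omega)
  · simp [h]

/-- Fill a row of a complex array with the values of an expression, each of which is evaluated
after running `c`. -/
def Prog.fillC (a : ℕ) (i : NExpr) (x : ℕ) (N : NExpr) (c : Prog) (e : CExpr) : Prog :=
  .loop x N (.seq c (.setC a i (.cell x) e))

theorem run_fillC {a x : ℕ} {i N : NExpr} {c : Prog} {e : CExpr} {s : Store}
    (hc : c.flipFree = true) (ha : a < 99) (h1 : c.modR a = false) (h2 : c.modR (a + 1) = false)
    (hx : c.modN x = false) (he : e.im.avoids 100 = true) (i₀ : ℕ)
    (hi : ∀ s', Agree (.fillC a i x N c e) s s' → i.eval (c.run s') = i₀) (f : ℕ → ℂ)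
    (hf : ∀ j s', j < N.eval s → s'.nat x 0 0 = j → Agree (.fillC a i x N c e) s s' →
      e.eval (c.run s') = f j) (i' j' : ℕ) :
    ((Prog.fillC a i x N c e).run s).cx a i' j' =
      if i' = i₀ ∧ j' < N.eval s then f j' else s.cx a i' j' := by
  refine run_loop (x := x) (e := N) (s := s) (by simpa [Prog.flipFree, Prog.setC] using hc)
    (fun j s' => s'.cx a i' j' = if i' = i₀ ∧ j' < j then f j' else s.cx a i' j') (by simp) ?_
  intro j s1 hj hxj hag hinv
  have hag1 := c.agree_run hc s1
  rw [run_seq, run_setC_cx _ _ _ _ ha he]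
  simp only [hi s1 hag, hf j s1 hj hxj hag, NExpr.eval, hag1.nat x hx, hxj]
  rw [hag1.cx a h1 h2, hinv]
  by_cases h : i' = i₀
  · by_cases h' : j' = j
    · subst h'; simp [h]
    · simp only [h, h', and_false, if_false, true_and]
      congr 1
      exact propext (by omega)
  · simp [h]

/-- Fill a complex array with the values of an expression. -/
def Prog.fillC₂ (a x : ℕ) (M : NExpr) (y : ℕ) (N : NExpr) (c : Prog) (e : CExpr) : Prog :=
  .loop x M (.fillC a (.cell x) y N c e)

theorem run_fillC₂ {a x y : ℕ} {M N : NExpr} {c : Prog} {e : CExpr} {s : Store}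
    (hc : c.flipFree = true) (ha : a < 99) (h1 : c.modR a = false) (h2 : c.modR (a + 1) = false)
    (hx : c.modN x = false) (hy : c.modN y = false) (hxy : x ≠ y) (he : e.im.avoids 100 = true)
    (N₀ : ℕ) (hN : ∀ s', Agree (.fillC₂ a x M y N c e) s s' → N.eval s' = N₀) (f : ℕ → ℕ → ℂ)
    (hf : ∀ i j s', i < M.eval s → j < N₀ → s'.nat x 0 0 = i → s'.nat y 0 0 = j →
      Agree (.fillC₂ a x M y N c e) s s' → e.eval (c.run s') = f i j) (i j : ℕ) :
    ((Prog.fillC₂ a x M y N c e).run s).cx a i j =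
      if i < M.eval s ∧ j < N₀ then f i j else s.cx a i j := by
  refine run_loop (x := x) (e := M) (s := s)
    (by simpa [Prog.fillC, Prog.flipFree, Prog.setC] using hc)
    (fun i' s' => s'.cx a i j = if i < i' ∧ j < N₀ then f i j else s.cx a i j) (by simp) ?_
  intro i' s1 hi' hx1 hag hinv
  have hmod : (Prog.fillC a (.cell x) y N c e).modN x = false := by
    simp [Prog.fillC, Prog.modN, Prog.setC, hx, hxy]
  have htr : ∀ {s2 : Store}, Agree (Prog.fillC a (.cell x) y N c e) s1 s2 →
      Agree (.fillC₂ a x M y N c e) s s2 := fun h =>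
    ⟨fun b hb => by
      rw [h.nat b (by simp only [Prog.fillC₂, Prog.modN, Bool.or_eq_false_iff] at hb; exact hb.2),
        hag.nat b hb],
     fun b hb => by rw [h.real b hb, hag.real b hb]⟩
  rw [run_fillC hc ha h1 h2 hy he i' (fun s2 h => by
      rw [NExpr.eval, (c.agree_run hc s2).nat x hx, h.nat x hmod]; exact hx1) (f i')
      (fun j s2 hj hy2 h => hf i' j s2 hi' (by rwa [hN s1 hag] at hj)
        (by rw [h.nat x hmod]; exact hx1) hy2 (htr h)), hN s1 hag, hinv]
  by_cases h : i = i'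
  · subst h; simp
  · simp only [h, false_and, if_false]
    congr 1
    exact propext (and_congr_left fun _ => by omega)

end

section

variable {n m k : ℕ}

/-- In a nontrivial combination consider the smallest row that occurs. No larger row has an `X`-bit
at its pivot, so the coefficient of that row is visible there and must vanish. -/
theorem Rows.eq_zero {s : Store} {w : Wave n} {has : Fin n → Prop} {R : Fin n → PauliString n}
    {ρ : Fin n → ℂ} (hR : Rows s w has R ρ) {v : Vec n}
    (hv : v ∈ Submodule.span (ZMod 2) (Set.range fun r => xp (R r)))
    (h0 : ∀ q, has q → v q = 0) : v = 0 := by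
  classical
  obtain ⟨c, rfl⟩ := (Submodule.mem_span_range_iff_exists_fun (ZMod 2)).mp hv
  have hR0 : ∀ r, ¬ has r → xp (R r) = 0 := fun r hr => by rw [hR.absent r hr]; rfl
  by_contra hne
  have hex : ∃ r, has r ∧ c r ≠ 0 := by
    by_contra! hall
    refine hne (Finset.sum_eq_zero fun r _ => ?_)
    by_cases hr : has r
    · rw [hall r hr, zero_smul]
    · rw [hR0 r hr, smul_zero]
  let S := Finset.univ.filter fun r => has r ∧ c r ≠ 0
  have hS : S.Nonempty := by
    obtain ⟨r, hr⟩ := hex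
    exact ⟨r, by simpa [S] using hr⟩
  obtain ⟨hq, hcq⟩ : has (S.min' hS) ∧ c (S.min' hS) ≠ 0 := by
    simpa [S] using S.min'_mem hS
  refine hcq ?_
  have := h0 _ hq
  rw [Finset.sum_apply, Finset.sum_eq_single (S.min' hS)] at this
  · simpa [hR.pivot _ hq] using this
  · intro r _ hr
    by_cases h : has r ∧ c r ≠ 0
    · have hle := S.min'_le r (by simpa [S] using h)
      have := hR.lead r h.1 _ (lt_of_le_of_ne hle (Ne.symm hr))
      simp [this]
    · by_cases h1 : has r
      · have : c r = 0 := by by_contra h2; exact h ⟨h1, h2⟩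
        simp [this]
      · simp [hR0 r h1]
  · simp

/-- The program leaves the listed arrays alone. -/
def Prog.keeps (c : Prog) (ns rs : List ℕ) : Bool :=
  ns.all (fun a => !c.modN a) && rs.all (fun a => !c.modR a)

theorem Agree.keeps {c : Prog} {s s' : Store} (h : Agree c s s') {ns rs : List ℕ}
    (hk : c.keeps ns rs = true) :
    (∀ a ∈ ns, s'.nat a = s.nat a) ∧ (∀ a ∈ rs, s'.real a = s.real a) := by
  simp only [Prog.keeps, Bool.and_eq_true, List.all_eq_true, Bool.not_eq_true'] at hk
  exact ⟨fun a ha => h.nat a (hk.1 a ha), fun a ha => h.real a (hk.2 a ha)⟩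

/-! ### The input and the stabilizer rows in memory -/

/-- The input is in memory. -/
structure Loaded (I : Quench n m k) (t : ℝ) (s : Store) : Prop where
  nat : ∀ a ≤ 8, s.nat a = (I.input t).nat a
  real : ∀ a ≤ 2, s.real a = (I.input t).real a

namespace Loaded

variable {I : Quench n m k} {t : ℝ} {s : Store} (h : Loaded I t s)
include h

theorem qubits : s.nat 0 0 0 = n := by rw [h.nat 0 (by simp)]; simp [Quench.input, row]

theorem terms : s.nat 0 0 1 = m := by rw [h.nat 0 (by simp)]; simp [Quench.input, row]

theorem perts : s.nat 0 0 2 = k := by rw [h.nat 0 (by simp)]; simp [Quench.input, row]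

theorem gx (i q : Fin n) : s.nat 1 i q = (xp (I.g i) q).val := by
  rw [h.nat 1 (by simp)]; simp [Quench.input, table, xp]

theorem gz (i q : Fin n) : s.nat 2 i q = (zp (I.g i) q).val := by
  rw [h.nat 2 (by simp)]; simp [Quench.input, table, zp]

theorem hx (i : Fin m) (q : Fin n) : s.nat 3 i q = (xp (I.h i) q).val := by
  rw [h.nat 3 (by simp)]; simp [Quench.input, table, xp]

theorem hz (i : Fin m) (q : Fin n) : s.nat 4 i q = (zp (I.h i) q).val := by
  rw [h.nat 4 (by simp)]; simp [Quench.input, table, zp]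

theorem px (i : Fin k) (q : Fin n) : s.nat 5 i q = (xp (I.P i) q).val := by
  rw [h.nat 5 (by simp)]; simp [Quench.input, table, xp]

theorem pz (i : Fin k) (q : Fin n) : s.nat 6 i q = (zp (I.P i) q).val := by
  rw [h.nat 6 (by simp)]; simp [Quench.input, table, zp]

theorem sx (i : Fin n) : s.nat 7 0 i = (I.sx i).val := by
  rw [h.nat 7 (by simp)]; simp [Quench.input, row, Quench.sx, ZMod.val]

theorem zv (q : Fin n) : s.nat 8 0 q = (I.zv q).val := by
  rw [h.nat 8 (by simp)]; simp [Quench.input, row, Quench.zv, bitsEquiv, ZMod.val]; rfl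

theorem α (i : Fin m) : s.real 0 0 i = I.α i := by
  rw [h.real 0 (by simp)]; simp [Quench.input, row]

theorem γ (i : Fin k) : s.real 1 0 i = I.γ i := by
  rw [h.real 1 (by simp)]; simp [Quench.input, row]

theorem time : s.real 2 0 0 = t := by
  rw [h.real 2 (by simp)]; simp [Quench.input, row]

theorem ref_re : s.real 2 0 1 = (I.ψ₀ I.z).re := by
  rw [h.real 2 (by simp)]; simp [Quench.input, row]

theorem ref_im : s.real 2 0 2 = (I.ψ₀ I.z).im := by
  rw [h.real 2 (by simp)]; simp [Quench.input, row]

theorem mono {s' : Store} {c : Prog} (ha : Agree c s s')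
    (hk : c.keeps [0, 1, 2, 3, 4, 5, 6, 7, 8] [0, 1, 2] = true) : Loaded I t s' := by
  obtain ⟨h1, h2⟩ := ha.keeps hk
  refine ⟨fun a ha => ?_, fun a ha => ?_⟩
  · rw [h1 a (by simp only [List.mem_cons, List.not_mem_nil]; omega), h.nat a ha]
  · rw [h2 a (by simp only [List.mem_cons, List.not_mem_nil]; omega), h.real a ha]

end Loaded

theorem Tables.mono {s s' : Store} (h : Tables s) {c : Prog} (ha : Agree c s s')
    (hk : c.keeps [21] [20, 21, 22] = true) : Tables s' := by
  obtain ⟨h1, h2⟩ := ha.keeps hk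
  refine ⟨fun a b => ?_, fun a b => ?_, fun a b => ?_⟩
  · rw [h1 21 (by simp), h.xor]
  · rw [h2 20 (by simp), h.sign]
  · rw [← h.phase, Store.cx, Store.cx, h2 21 (by simp), h2 22 (by simp)]

theorem Rows.mono {s s' : Store} {w : Wave n} {has : Fin n → Prop} {R : Fin n → PauliString n}
    {ρ : Fin n → ℂ} (hR : Rows s w has R ρ) {c : Prog} (ha : Agree c s s')
    (hk : c.keeps [33, 34, 35] [27, 28] = true) : Rows s' w has R ρ := by
  obtain ⟨h1, h2⟩ := ha.keeps hk
  refine ⟨?_, ?_, ?_, ?_, hR.absent, hR.stab, hR.pivot, hR.lead⟩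
  · rw [h1 33 (by simp)]; exact hR.mem_x
  · rw [h1 34 (by simp)]; exact hR.mem_z
  · intro r; rw [← hR.mem_phase, Store.cx, Store.cx, h2 27 (by simp), h2 28 (by simp)]
  · rw [h1 35 (by simp)]; exact hR.mem_has

/-- The input and the lookup tables are in memory, and the stabilizer rows have been set up. -/
structure Setup (I : Quench n m k) (t : ℝ) (s : Store) : Prop where
  loaded : Loaded I t s
  tables : Tables s
  rows : ∃ has R ρ, Rows s I.wave has R ρ ∧
    ∀ i, xp (I.g i) ∈ Submodule.span (ZMod 2) (Set.range fun r => xp (R r))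

theorem Setup.mono {I : Quench n m k} {t : ℝ} {s s' : Store} (h : Setup I t s) {c : Prog}
    (ha : Agree c s s') (hk : c.keeps [0, 1, 2, 3, 4, 5, 6, 7, 8, 21, 33, 34, 35]
      [0, 1, 2, 20, 21, 22, 27, 28] = true) : Setup I t s' := by
  simp only [Prog.keeps, List.all_cons, List.all_nil, Bool.and_true, Bool.and_eq_true] at hk
  refine ⟨h.loaded.mono ha ?_, h.tables.mono ha ?_, ?_⟩
  · simp [Prog.keeps, hk]
  · simp [Prog.keeps, hk]
  · obtain ⟨has, R, ρ, hR, hg⟩ := h.rows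
    exact ⟨has, R, ρ, hR.mono ha (by simp [Prog.keeps, hk]), hg⟩

/-! ### Relative amplitudes by reduction -/

/-- The loop of `relC` over the qubits. -/
def Prog.readRel : Prog :=
  .loop 73 .qubits <|
  .ite (.natEq (.at 31 (.cell 73)) (.lit 1))
    (.setC 29 (.lit 0) (.lit 0) (.ofReal (.lit 0)))
    (.setC 29 (.lit 0) (.lit 0) (.smul (.sign (.at 32 (.cell 73)) (.at 8 (.cell 73))) (.cell 29)))

/-- Compute the relative amplitude at the reference label after applying the product of a Hermitian
Pauli string and a Weyl operator. -/
def Prog.relC (ax az bx bz : NExpr) : Prog :=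
  .seq (.load ax az bx bz) <|
  .seq .reduce <|
  .seq (.setC 29 (.lit 0) (.lit 0) (.cell 25)) .readRel

/-- A remaining `X`-bit enters as a factor zero, so the loop can run over all qubits without an
early exit. -/
theorem run_readRel {s : Store} (ht : Tables s) (hn : s.nat 0 0 0 = n) {z : Vec n}
    (hz : ∀ q : Fin n, s.nat 8 0 q = (z q).val) {P : PauliString n} {ω : ℂ} (hr : Reg s P ω)
    (hω : s.cx 29 0 0 = ω) :
    (Prog.readRel.run s).cx 29 0 0 = if xp P = 0 then ω * chi (zp P ⬝ᵥ z) else 0 := by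
  have hn0 : NExpr.qubits.eval s = n := hn
  have := run_loop (x := 73) (e := .qubits) (s := s) (c :=
    .ite (.natEq (.at 31 (.cell 73)) (.lit 1))
    (.setC 29 (.lit 0) (.lit 0) (.ofReal (.lit 0)))
    (.setC 29 (.lit 0) (.lit 0)
      (.smul (.sign (.at 32 (.cell 73)) (.at 8 (.cell 73))) (.cell 29)))) rfl
    (fun j s' => s'.cx 29 0 0 = ω * pprod (fun q : Fin n => if xp P q = 1 then (0 : ℂ) else
      (chi (zp P q * z q) : ℂ)) j) (by simp [hω]) ?_
  · rw [hn0] at this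
    refine this.trans ?_
    rw [pprod_self]
    split_ifs with h
    · rw [dotProduct, chi_sum, Complex.ofReal_prod]
      congr 1
      exact Finset.prod_congr rfl fun q _ => by rw [h]; simp
    · obtain ⟨q, hq⟩ := Function.ne_iff.mp h
      rw [Finset.prod_eq_zero (Finset.mem_univ q), mul_zero]
      exact if_pos ((zmod2_cases _).resolve_left hq)
  · intro j s1 hj hc hag h1
    rw [hn0] at hj
    have e1 : s1.nat 31 0 j = (xp P ⟨j, hj⟩).val := by rw [hag.nat 31 rfl]; exact hr.x ⟨j, hj⟩
    have e2 : s1.nat 32 0 j = (zp P ⟨j, hj⟩).val := by rw [hag.nat 32 rfl]; exact hr.z ⟨j, hj⟩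
    have e3 : s1.nat 8 0 j = (z ⟨j, hj⟩).val := by rw [hag.nat 8 rfl]; exact hz ⟨j, hj⟩
    have hS : ∀ a b : ZMod 2, s1.real 20 a.val b.val = chi (a * b) := fun a b => by
      rw [hag.real 20 rfl, ht.sign]
    rw [pprod_succ _ hj, Prog.run]
    simp only [Test.holds, NExpr.eval, hc, e1]
    rcases zmod2_cases (xp P ⟨j, hj⟩) with h | h
    · rw [if_neg (by rw [h]; decide), if_neg (by rw [h]; decide),
        run_setC_cx _ _ _ _ (by simp) rfl]
      simp only [NExpr.eval, and_self, if_true, CExpr.eval_smul, CExpr.eval_get, RExpr.eval, hc,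
        e2, e3, hS, h1]
      ring
    · rw [if_pos (by rw [h]; decide), if_pos h, run_setC_cx _ _ _ _ (by simp) rfl]
      simp [NExpr.eval, RExpr.eval]

theorem Quench.rel_eq_zero_of_xp (I : Quench n m k) {A : PauliString n}
    (h : xp A ∉ Submodule.span (ZMod 2) (Set.range fun i => xp (I.g i))) : I.rel A = 0 := by
  by_contra h0
  refine h (mem_span_xp_of_ne_zero I.g_indep I.g_mem I.wave_zv_ne fun h1 => h0 ?_)
  rw [Quench.rel, wop_apply, h1, mul_zero, zero_div]

/-- Reduction does not change the vector obtained from the state. If no `X`-bit survives, the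
reduced string is diagonal and contributes a sign at the reference label. Otherwise the original
`X`-part is outside the span of the `X`-parts of the stabilizers, by the echelon form, and the
amplitude vanishes. -/
theorem run_relC {I : Quench n m k} {t : ℝ} {s : Store} (hs : Setup I t s)
    {ax az bx bz : NExpr} {A B : PauliString n} (hax : Operand s ax (xp A))
    (haz : Operand s az (zp A)) (hbx : Operand s bx (xp B)) (hbz : Operand s bz (zp B)) :
    ((Prog.relC ax az bx bz).run s).cx 29 0 0 = iph A * chi (zp A ⬝ᵥ xp B) * I.rel (A + B) := by
  have hr := run_load hs.tables hs.loaded.qubits hax haz hbx hbz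
  have hag := (Prog.load ax az bx bz).agree_run rfl s
  rw [Prog.relC, run_seq, run_seq, run_seq]
  have hs1 := hs.mono hag rfl
  generalize (Prog.load ax az bx bz).run s = s1 at *
  obtain ⟨has, R, ρ, hR, hg⟩ := hs1.rows
  obtain ⟨P', ω', h1, h2, h3, h4⟩ := run_reduce hs1.tables hs1.loaded.qubits hR hr
  have hag2 := Prog.reduce.agree_run rfl s1
  have hs2 := hs1.mono hag2 rfl
  generalize Prog.reduce.run s1 = s2 at *
  have hag3 := (Prog.setC 29 (.lit 0) (.lit 0) (.cell 25)).agree_run rfl s2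
  have hs3 := hs2.mono hag3 rfl
  have h5 : ((Prog.setC 29 (.lit 0) (.lit 0) (.cell 25)).run s2).cx 29 0 0 = ω' := by
    rw [run_setC_cx _ _ _ _ (by simp) rfl]
    simp [NExpr.eval, h1.phase]
  generalize (Prog.setC 29 (.lit 0) (.lit 0) (.cell 25)).run s2 = s3 at *
  rw [run_readRel hs3.tables hs3.loaded.qubits hs3.loaded.zv (P := P') (ω := ω')
    ⟨by rw [hag3.nat 31 rfl]; exact h1.x, by rw [hag3.nat 32 rfl]; exact h1.z,
      by rw [hag3.cx 25 rfl rfl]; exact h1.phase⟩ h5]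
  have hval : iph A * chi (zp A ⬝ᵥ xp B) * I.rel (A + B) * I.wave I.zv =
      ω' * wop P' I.wave I.zv := by
    rw [mul_assoc, Quench.rel, div_mul_cancel₀ _ I.wave_zv_ne]
    exact (congrFun h2 I.zv).symm
  split_ifs with h
  · rw [wop_apply, h, add_zero, ← mul_assoc] at hval
    exact (mul_right_cancel₀ I.wave_zv_ne hval).symm
  · rw [I.rel_eq_zero_of_xp, mul_zero]
    intro hmem
    refine h (hR.eq_zero ?_ h3)
    have h6 : xp (A + B) ∈ Submodule.span (ZMod 2) (Set.range fun r => xp (R r)) :=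
      Submodule.span_le.mpr (by rintro _ ⟨i, rfl⟩; exact hg i) hmem
    have := Submodule.add_mem _ h6 h4
    rwa [← add_assoc, vec_add_self, zero_add] at this

/-! ### Setting up the stabilizer rows -/

/-- Copy the register to the stabilizer row `cell 61`. -/
def Prog.storeRow : Prog :=
  .seq (.setN 36 (.lit 0) (.lit 0) (.lit 1)) <|
  .seq (.setN 35 (.lit 0) (.cell 61) (.lit 1)) <|
  .seq (.setC 27 (.lit 0) (.cell 61) (.cell 25)) <|
  .loop 62 .qubits <|
  .seq (.setN 33 (.cell 61) (.cell 62) (.at 31 (.cell 62)))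
    (.setN 34 (.cell 61) (.cell 62) (.at 32 (.cell 62)))

/-- Store the register as a new stabilizer row at its first nonzero `X`-bit. -/
def Prog.placeRow : Prog :=
  .seq (.setN 36 (.lit 0) (.lit 0) (.lit 0)) <|
  .loop 61 .qubits <|
  .ite (.and (.natEq (.at 31 (.cell 61)) (.lit 1)) (.natEq (.cell 36) (.lit 0))) .storeRow .skip

/-- Insert the generators one after the other. -/
def Prog.insertRows : Prog :=
  .loop 60 .qubits <|
  .seq (.load (.get 1 (.cell 60) (.cell 72)) (.get 2 (.cell 60) (.cell 72)) (.lit 0) (.lit 0)) <|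
  .seq (.setC 25 (.lit 0) (.lit 0) (.smul (.sign (.at 7 (.cell 60)) (.lit 1)) (.cell 25))) <|
  .seq .reduce .placeRow

theorem run_storeRow {s : Store} (hn : s.nat 0 0 0 = n) {P : PauliString n} {ω : ℂ}
    (hr : Reg s P ω) {r : Fin n} (h61 : s.nat 61 0 0 = r) {w : Wave n} {has : Fin n → Prop}
    {R : Fin n → PauliString n} {ρ : Fin n → ℂ} (hR : Rows s w has R ρ) (hω : ω • wop P w = w)
    (hp : xp P r = 1) (hl : ∀ q < r, xp P q = 0) :
    (Prog.storeRow.run s).nat 36 0 0 = 1 ∧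
    Rows (Prog.storeRow.run s) w (fun q => q = r ∨ has q) (Function.update R r P)
      (Function.update ρ r ω) := by
  let c1 : Prog := .setN 36 (.lit 0) (.lit 0) (.lit 1)
  let c2 : Prog := .setN 35 (.lit 0) (.cell 61) (.lit 1)
  let c3 : Prog := .setC 27 (.lit 0) (.cell 61) (.cell 25)
  let c4 : Prog := .seq (.setN 33 (.cell 61) (.cell 62) (.at 31 (.cell 62)))
    (.setN 34 (.cell 61) (.cell 62) (.at 32 (.cell 62)))
  change ((Prog.loop 62 .qubits c4).run (c3.run (c2.run (c1.run s)))).nat 36 0 0 = 1 ∧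
    Rows ((Prog.loop 62 .qubits c4).run (c3.run (c2.run (c1.run s)))) w _ _ _
  have a1 := c1.agree_run rfl s
  have v1 : (c1.run s).nat 36 0 0 = 1 := by simp [c1, Prog.run, Store.setNat, NExpr.eval]
  generalize c1.run s = s1 at *
  have a2 := c2.agree_run rfl s1
  have v2 : ∀ q : ℕ, (c2.run s1).nat 35 0 q = if q = r then 1 else s.nat 35 0 q := by
    intro q
    simp [c2, Prog.run, Store.setNat, NExpr.eval, a1.nat 61 rfl, h61, a1.nat 35 rfl]
  generalize c2.run s1 = s2 at *
  have a3 := c3.agree_run rfl s2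
  have v3 : ∀ q : ℕ, (c3.run s2).cx 27 0 q = if q = r then ω else s.cx 27 0 q := by
    intro q
    rw [run_setC_cx _ _ _ _ (by simp) rfl]
    simp [NExpr.eval, a1.nat 61 rfl, a2.nat 61 rfl, h61, a2.cx 25 rfl rfl, a1.cx 25 rfl rfl,
      a2.cx 27 rfl rfl, a1.cx 27 rfl rfl, hr.phase]
  generalize c3.run s2 = s3 at *
  have a4 := (Prog.loop 62 .qubits c4).agree_run rfl s3
  have hn3 : NExpr.qubits.eval s3 = n := by
    change s3.nat 0 0 0 = n
    rw [a3.nat 0 rfl, a2.nat 0 rfl, a1.nat 0 rfl, hn]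
  have h31 : s3.nat 31 = s.nat 31 := by rw [a3.nat 31 rfl, a2.nat 31 rfl, a1.nat 31 rfl]
  have h32 : s3.nat 32 = s.nat 32 := by rw [a3.nat 32 rfl, a2.nat 32 rfl, a1.nat 32 rfl]
  have h33 : s3.nat 33 = s.nat 33 := by rw [a3.nat 33 rfl, a2.nat 33 rfl, a1.nat 33 rfl]
  have h34 : s3.nat 34 = s.nat 34 := by rw [a3.nat 34 rfl, a2.nat 34 rfl, a1.nat 34 rfl]
  have h61' : s3.nat 61 0 0 = r := by rw [a3.nat 61 rfl, a2.nat 61 rfl, a1.nat 61 rfl, h61]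
  have v4 := run_loop (x := 62) (e := .qubits) (s := s3) (c := c4) rfl
    (fun j s' => ∀ p q : Fin n,
      s'.nat 33 p q = (if p = r ∧ (q : ℕ) < j then (xp P q).val else (xp (R p) q).val) ∧
      s'.nat 34 p q = (if p = r ∧ (q : ℕ) < j then (zp P q).val else (zp (R p) q).val))
    (by intro p q; simp [h33, h34, hR.mem_x, hR.mem_z]) (by
      intro j s' hj hc hag hi p q
      rw [hn3] at hj
      have e1 : s'.nat 31 0 j = (xp P ⟨j, hj⟩).val := by
        rw [hag.nat 31 rfl, h31]; exact hr.x ⟨j, hj⟩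
      have e2 : s'.nat 32 0 j = (zp P ⟨j, hj⟩).val := by
        rw [hag.nat 32 rfl, h32]; exact hr.z ⟨j, hj⟩
      have e3 : s'.nat 61 0 0 = r := by rw [hag.nat 61 rfl, h61']
      obtain ⟨i1, i2⟩ := hi p q
      simp only [c4, Prog.run, Store.setNat, NExpr.eval, hc]
      by_cases h : p = r
      · by_cases h' : (q : ℕ) = j
        · subst h'; simp [h, e1, e2, e3]
        · have : (q : ℕ) < j + 1 ↔ (q : ℕ) < j := by omega
          simp [h, h', this, e3] at i1 i2 ⊢
          exact ⟨i1, i2⟩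
      · have h'' : (p : ℕ) ≠ r := fun h' => h (Fin.ext h')
        simp [h, h'', e3] at i1 i2 ⊢
        exact ⟨i1, i2⟩)
  rw [hn3] at v4
  generalize (Prog.loop 62 .qubits c4).run s3 = s4 at *
  refine ⟨by rw [a4.nat 36 rfl, a3.nat 36 rfl, a2.nat 36 rfl, v1], ?_, ?_, ?_, ?_, ?_, ?_, ?_, ?_⟩
  · intro p q
    rw [(v4 p q).1]
    by_cases h : p = r <;> simp [h]
  · intro p q
    rw [(v4 p q).2]
    by_cases h : p = r <;> simp [h]
  · intro p
    rw [a4.cx 27 rfl rfl, v3]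
    by_cases h : p = r
    · simp [h]
    · have h'' : (p : ℕ) ≠ r := fun h' => h (Fin.ext h')
      simp [h, h'', hR.mem_phase]
  · intro p
    rw [a4.nat 35 rfl, a3.nat 35 rfl, v2]
    by_cases h : p = r
    · simp [h]
    · have h'' : (p : ℕ) ≠ r := fun h' => h (Fin.ext h')
      simp [h, h'', hR.mem_has]
  · intro p hp
    push Not at hp
    simp [hp.1, hR.absent p hp.2]
  · intro p hp'
    by_cases h : p = r
    · simp [h, hω]
    · simp [h, hR.stab p (hp'.resolve_left h)]
  · intro p hp'
    by_cases h : p = r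
    · simp [h, hp]
    · simp [h, hR.pivot p (hp'.resolve_left h)]
  · intro p hp' q hq
    by_cases h : p = r
    · subst h; simp [hl q hq]
    · simp [h, hR.lead p (hp'.resolve_left h) q hq]

/-- The flag in `cell 36` admits only the first nonzero `X`-bit as a position, so that bit becomes
the leading one. The slot is free because the register vanishes at all occupied pivots, hence
nothing of the span is lost. A register without `X`-bits need not be stored. -/
theorem run_placeRow {s : Store} (hn : s.nat 0 0 0 = n) {P : PauliString n} {ω : ℂ}
    (hr : Reg s P ω) {w : Wave n} {has : Fin n → Prop}
    {R : Fin n → PauliString n} {ρ : Fin n → ℂ} (hR : Rows s w has R ρ) (hω : ω • wop P w = w)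
    (hp : ∀ q, has q → xp P q = 0) :
    ∃ has' R' ρ', Rows (Prog.placeRow.run s) w has' R' ρ' ∧
      Submodule.span (ZMod 2) (Set.range fun r => xp (R r)) ≤
        Submodule.span (ZMod 2) (Set.range fun r => xp (R' r)) ∧
      xp P ∈ Submodule.span (ZMod 2) (Set.range fun r => xp (R' r)) := by
  rw [Prog.placeRow, run_seq]
  have a1 := (Prog.setN 36 (.lit 0) (.lit 0) (.lit 0)).agree_run rfl s
  have v1 : ((Prog.setN 36 (.lit 0) (.lit 0) (.lit 0)).run s).nat 36 0 0 = 0 := by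
    simp [Prog.run, Store.setNat, NExpr.eval]
  have hR1 := hR.mono a1 rfl
  generalize (Prog.setN 36 (.lit 0) (.lit 0) (.lit 0)).run s = s1 at *
  have hn1 : NExpr.qubits.eval s1 = n := by
    change s1.nat 0 0 0 = n
    rw [a1.nat 0 rfl, hn]
  have v := run_loop (x := 61) (e := .qubits) (s := s1) (c :=
    .ite (.and (.natEq (.at 31 (.cell 61)) (.lit 1)) (.natEq (.cell 36) (.lit 0))) .storeRow .skip)
    rfl
    (fun j s' => (s'.nat 36 0 0 = 0 ∧ Rows s' w has R ρ ∧ ∀ q : Fin n, (q : ℕ) < j → xp P q = 0) ∨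
      (s'.nat 36 0 0 = 1 ∧ ∃ r : Fin n, xp P r = 1 ∧ Rows s' w (fun q => q = r ∨ has q)
        (Function.update R r P) (Function.update ρ r ω)))
    (Or.inl ⟨v1, hR1, by simp⟩) ?_ ?_
  · rw [hn1] at v
    rcases v with ⟨-, h1, h2⟩ | ⟨-, r, h1, h2⟩
    · refine ⟨_, _, _, h1, le_rfl, ?_⟩
      rw [show xp P = 0 from funext fun q => h2 q q.2]
      exact Submodule.zero_mem _
    · refine ⟨_, _, _, h2, ?_, Submodule.subset_span ⟨r, by simp⟩⟩
      rw [Submodule.span_le]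
      rintro _ ⟨q, rfl⟩
      by_cases hq : q = r
      · subst hq
        beta_reduce
        rw [hR.absent q fun h => by rw [hp q h] at h1; exact absurd h1 (by decide)]
        exact Submodule.zero_mem _
      · exact Submodule.subset_span ⟨q, by simp [hq]⟩
  · intro j s' hj hc hag hi
    rw [hn1] at hj
    have e1 : s'.nat 31 0 j = (xp P ⟨j, hj⟩).val := by
      rw [hag.nat 31 rfl, a1.nat 31 rfl]; exact hr.x ⟨j, hj⟩
    have hreg : Reg s' P ω := ⟨by rw [hag.nat 31 rfl, a1.nat 31 rfl]; exact hr.x,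
      by rw [hag.nat 32 rfl, a1.nat 32 rfl]; exact hr.z,
      by rw [hag.cx 25 rfl rfl, a1.cx 25 rfl rfl]; exact hr.phase⟩
    rw [Prog.run]
    simp only [Test.holds, NExpr.eval, hc, e1]
    rcases hi with ⟨h1, h2, h3⟩ | ⟨h1, h2⟩
    · rcases zmod2_cases (xp P ⟨j, hj⟩) with h | h
      · rw [if_neg (by rw [h]; simp)]
        refine Or.inl ⟨h1, h2, fun q hq => ?_⟩
        rcases Nat.lt_succ_iff_lt_or_eq.mp hq with hlt | heq
        · exact h3 q hlt
        · rwa [show q = ⟨j, hj⟩ from Fin.ext heq]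
      · rw [if_pos ⟨by rw [h]; rfl, h1⟩]
        obtain ⟨h4, h5⟩ := run_storeRow (r := ⟨j, hj⟩)
          (by rw [hag.nat 0 rfl]; exact hn1) hreg hc h2 hω h (fun q hq => h3 q hq)
        exact Or.inr ⟨h4, _, h, h5⟩
    · rw [if_neg (by rw [h1]; simp)]
      exact Or.inr ⟨h1, h2⟩
  · intro j s' h
    have hset : ∀ {has R ρ}, Rows s' w has R ρ → Rows (s'.setNat 61 0 0 j) w has R ρ :=
      fun h => ⟨h.mem_x, h.mem_z, h.mem_phase, h.mem_has, h.absent, h.stab, h.pivot, h.lead⟩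
    rcases h with ⟨h1, h2, h3⟩ | ⟨h1, r, h2, h3⟩
    · exact Or.inl ⟨h1, hset h2, h3⟩
    · exact Or.inr ⟨h1, r, h2, hset h3⟩

/-- Loaded with its sign, a generator fixes the state, and it still does so after reduction. Only
the span of the `X`-parts is recorded as a result, since `run_relC` needs nothing else; stabilizers
that become diagonal are discarded. -/
theorem run_insertRows {I : Quench n m k} {t : ℝ} {s : Store} (hl : Loaded I t s) (ht : Tables s)
    (h33 : s.nat 33 = 0) (h34 : s.nat 34 = 0) (h35 : s.nat 35 = 0) (h27 : s.real 27 = 0)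
    (h28 : s.real 28 = 0) : Setup I t (Prog.insertRows.run s) := by
  have ha := Prog.insertRows.agree_run rfl s
  refine ⟨hl.mono ha rfl, ht.mono ha rfl, ?_⟩
  have hn0 : NExpr.qubits.eval s = n := hl.qubits
  have v := run_loop (x := 60) (e := .qubits) (s := s) (c :=
    .seq (.load (.get 1 (.cell 60) (.cell 72)) (.get 2 (.cell 60) (.cell 72)) (.lit 0) (.lit 0)) <|
    .seq (.setC 25 (.lit 0) (.lit 0) (.smul (.sign (.at 7 (.cell 60)) (.lit 1)) (.cell 25))) <|
    .seq .reduce .placeRow) rfl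
    (fun j s' => ∃ has R ρ, Rows s' I.wave has R ρ ∧
      ∀ i : Fin n, (i : ℕ) < j → xp (I.g i) ∈ Submodule.span (ZMod 2) (Set.range fun r => xp (R r)))
    ⟨fun _ => False, 0, 0, ⟨by simp [h33], by simp [h34], by simp [Store.cx, h27, h28]; exact fun _ => rfl,
      by simp [h35], by simp, by simp, by simp, by simp⟩, by simp⟩ ?_ ?_
  · rw [hn0] at v
    obtain ⟨has, R, ρ, h1, h2⟩ := v
    exact ⟨has, R, ρ, h1, fun i => h2 i i.2⟩
  · rintro j s1 hj hc hag ⟨has, R, ρ, hR, hg⟩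
    rw [hn0] at hj
    have hl1 := hl.mono hag rfl
    have ht1 := ht.mono hag rfl
    rw [run_seq, run_seq, run_seq]
    have hr := run_load (n := n) (A := I.g ⟨j, hj⟩) (B := 0)
      (ax := .get 1 (.cell 60) (.cell 72)) (az := .get 2 (.cell 60) (.cell 72)) (bx := .lit 0)
      (bz := .lit 0) ht1 hl1.qubits
      (fun s' h q h72 => by
        simp only [NExpr.eval, h72, h 60 (by simp) (by simp) (by simp),
          h 1 (by simp) (by simp) (by simp), hc]
        exact hl1.gx ⟨j, hj⟩ q)
      (fun s' h q h72 => by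
        simp only [NExpr.eval, h72, h 60 (by simp) (by simp) (by simp),
          h 2 (by simp) (by simp) (by simp), hc]
        exact hl1.gz ⟨j, hj⟩ q)
      (fun s' h q h72 => by simp [NExpr.eval]) (fun s' h q h72 => by simp [NExpr.eval])
    have ha2 := (Prog.load (.get 1 (.cell 60) (.cell 72)) (.get 2 (.cell 60) (.cell 72)) (.lit 0)
      (.lit 0)).agree_run rfl s1
    have hl2 := hl1.mono ha2 rfl
    have ht2 := ht1.mono ha2 rfl
    have hR2 := hR.mono ha2 rfl
    have hc2 := (congrFun (congrFun (ha2.nat 60 rfl) 0) 0).trans hc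
    generalize Prog.run (Prog.load _ _ _ _) s1 = s2 at *
    let c3 : Prog :=
      .setC 25 (.lit 0) (.lit 0) (.smul (.sign (.at 7 (.cell 60)) (.lit 1)) (.cell 25))
    change ∃ has R ρ, Rows (Prog.placeRow.run (Prog.reduce.run (c3.run s2))) I.wave has R ρ ∧ _
    have ha3 := c3.agree_run rfl s2
    have hl3 := hl2.mono ha3 rfl
    have ht3 := ht2.mono ha3 rfl
    have hR3 := hR2.mono ha3 rfl
    have hr3 : Reg (c3.run s2) (I.g ⟨j, hj⟩) (chi (I.sx ⟨j, hj⟩) * iph (I.g ⟨j, hj⟩)) := by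
      have e1 : s2.nat 7 0 j = (I.sx ⟨j, hj⟩).val := hl2.sx ⟨j, hj⟩
      refine ⟨by rw [ha3.nat 31 rfl]; simpa using hr.x, by rw [ha3.nat 32 rfl]; simpa using hr.z, ?_⟩
      rw [run_setC_cx _ _ _ _ (by simp) rfl]
      have := ht2.sign (I.sx ⟨j, hj⟩) 1
      rw [show (1 : ZMod 2).val = 1 from rfl, mul_one] at this
      simp [NExpr.eval, RExpr.eval, hc2, e1, hr.phase, this]
    generalize c3.run s2 = s3 at *
    obtain ⟨P', ω', h1, h2, h3, h4⟩ := run_reduce ht3 hl3.qubits hR3 hr3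
    have ha4 := Prog.reduce.agree_run rfl s3
    have hl4 := hl3.mono ha4 rfl
    have hR4 := hR3.mono ha4 rfl
    generalize Prog.reduce.run s3 = s4 at *
    have hst : ω' • wop P' I.wave = I.wave := by
      rw [h2, mul_smul, I.g_eigen, smul_smul, ← Complex.ofReal_mul, chi_mul_self,
        Complex.ofReal_one, one_smul]
    obtain ⟨has', R', ρ', k1, k2, k3⟩ := run_placeRow hl4.qubits h1 hR4 hst h3
    refine ⟨has', R', ρ', k1, fun i hi => ?_⟩
    rcases Nat.lt_succ_iff_lt_or_eq.mp hi with hlt | heq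
    · exact k2 (hg i hlt)
    · rw [show i = ⟨j, hj⟩ from Fin.ext heq]
      have := Submodule.add_mem _ (k2 h4) k3
      rwa [vec_add_cancel] at this
  · rintro j s' ⟨has, R, ρ, h, h'⟩
    exact ⟨has, R, ρ, ⟨h.mem_x, h.mem_z, h.mem_phase, h.mem_has, h.absent, h.stab, h.pivot,
      h.lead⟩, h'⟩

/-! ### Enumerating a group of Pauli strings -/

/-- The sum of the generators selected by the binary digits of `a`. -/
def bitSum (gen : ℕ → PauliString n) (d a : ℕ) : PauliString n :=
  ∑ l ∈ Finset.range d, if a.testBit l then gen l else 0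

/-- The Walsh function: the parity of the common binary digits as a sign. -/
def walsh (d a b : ℕ) : ℝ :=
  ∏ l ∈ Finset.range d, if a.testBit l && b.testBit l then (-1 : ℝ) else 1

@[simp] theorem bitSum_zero_right (gen : ℕ → PauliString n) (d : ℕ) : bitSum gen d 0 = 0 := by
  simp [bitSum]

theorem bitSum_xor (gen : ℕ → PauliString n) (d a b : ℕ) :
    bitSum gen d (a ^^^ b) = bitSum gen d a + bitSum gen d b := by
  rw [bitSum, bitSum, bitSum, ← Finset.sum_add_distrib]
  refine Finset.sum_congr rfl fun l _ => ?_
  rw [Nat.testBit_xor]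
  cases a.testBit l <;> cases b.testBit l <;> simp [pauli_add_self]

theorem testBit_two_pow_add_of_lt {d a l : ℕ} (h : l < d) : (2 ^ d + a).testBit l = a.testBit l :=
  Nat.testBit_two_pow_add_gt h a

theorem testBit_two_pow_add_self {d a : ℕ} (h : a < 2 ^ d) : (2 ^ d + a).testBit d = true := by
  rw [Nat.testBit_two_pow_add_eq, Nat.testBit_lt_two_pow h]; rfl

/-- There are no carries. So multiplying by a new generator is a shift of the index by `2 ^ d`,
which can be tabulated by counting. -/
theorem two_pow_add_eq_xor {d a : ℕ} (h : a < 2 ^ d) : 2 ^ d + a = 2 ^ d ^^^ a := by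
  refine Nat.eq_of_testBit_eq fun l => ?_
  rw [Nat.testBit_xor, Nat.testBit_two_pow]
  rcases lt_trichotomy l d with hl | rfl | hl
  · rw [testBit_two_pow_add_of_lt hl]; simp [hl.ne']
  · rw [testBit_two_pow_add_self h, Nat.testBit_lt_two_pow h]; simp
  · have h2 : 2 ^ (d + 1) ≤ 2 ^ l := Nat.pow_le_pow_right two_pos hl
    have h3 : 2 ^ (d + 1) = 2 ^ d + 2 ^ d := by ring
    rw [Nat.testBit_lt_two_pow (by omega), Nat.testBit_lt_two_pow (by omega)]
    simp [hl.ne]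

theorem bitSum_update (gen : ℕ → PauliString n) (d a : ℕ) (P : PauliString n) :
    bitSum (Function.update gen d P) d a = bitSum gen d a := by
  refine Finset.sum_congr rfl fun l hl => ?_
  rw [Function.update_of_ne (Finset.mem_range.mp hl).ne]

theorem bitSum_succ_of_lt (gen : ℕ → PauliString n) {d a : ℕ} (P : PauliString n) (h : a < 2 ^ d) :
    bitSum (Function.update gen d P) (d + 1) a = bitSum gen d a := by
  rw [bitSum, Finset.sum_range_succ, Nat.testBit_lt_two_pow h, ← bitSum_update gen d a P]
  simp [bitSum]

theorem bitSum_succ_add (gen : ℕ → PauliString n) {d a : ℕ} (P : PauliString n) (h : a < 2 ^ d) :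
    bitSum (Function.update gen d P) (d + 1) (2 ^ d + a) = bitSum gen d a + P := by
  rw [bitSum, Finset.sum_range_succ, testBit_two_pow_add_self h, ← bitSum_update gen d a P,
    if_pos rfl, Function.update_self]
  congr 1
  exact Finset.sum_congr rfl fun l hl => by
    rw [testBit_two_pow_add_of_lt (Finset.mem_range.mp hl)]

theorem walsh_comm (d a b : ℕ) : walsh d a b = walsh d b a := by
  simp only [walsh, Bool.and_comm]

theorem walsh_succ_of_lt {d a : ℕ} (b : ℕ) (h : a < 2 ^ d) : walsh (d + 1) a b = walsh d a b := by
  rw [walsh, Finset.prod_range_succ, Nat.testBit_lt_two_pow h]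
  simp [walsh]

theorem walsh_add_left {d a : ℕ} (b : ℕ) : walsh d (2 ^ d + a) b = walsh d a b :=
  Finset.prod_congr rfl fun l hl => by rw [testBit_two_pow_add_of_lt (Finset.mem_range.mp hl)]

/-- These are the blocks of the Hadamard matrix of twice the size: three copies of the old one and
one with the opposite sign. -/
theorem walsh_succ_add {d a b : ℕ} (ha : a < 2 ^ d) (hb : b < 2 ^ d) :
    walsh (d + 1) (2 ^ d + a) b = walsh d a b ∧ walsh (d + 1) a (2 ^ d + b) = walsh d a b ∧
    walsh (d + 1) (2 ^ d + a) (2 ^ d + b) = -walsh d a b := by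
  refine ⟨?_, ?_, ?_⟩
  · rw [walsh_comm, walsh_succ_of_lt _ hb, walsh_comm, walsh_add_left]
  · rw [walsh_succ_of_lt _ ha, walsh_comm, walsh_add_left, walsh_comm]
  · rw [walsh, Finset.prod_range_succ, testBit_two_pow_add_self ha, testBit_two_pow_add_self hb]
    change walsh d (2 ^ d + a) (2 ^ d + b) * _ = _
    rw [walsh_add_left, walsh_comm, walsh_add_left, walsh_comm]
    simp

/-! ### Searching and enlarging the list -/

/-- Clear `cell 27` if the strings differ at the qubit `cell 64`. -/
def Prog.compareQubit : Prog :=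
  .ite (.and (.natEq (.get 22 (.cell 63) (.cell 64)) (.get 5 (.cell 60) (.cell 64)))
      (.natEq (.get 23 (.cell 63) (.cell 64)) (.get 6 (.cell 60) (.cell 64))))
    .skip (.setN 27 (.lit 0) (.lit 0) (.lit 0))

/-- Compare the string `cell 60` of the perturbation with the listed element `cell 63`. -/
def Prog.compare : Prog :=
  .seq (.setN 27 (.lit 0) (.lit 0) (.lit 1)) <| .seq (.loop 64 .qubits .compareQubit) <|
  .ite (.natEq (.cell 27) (.lit 1))
    (.seq (.setN 28 (.lit 0) (.lit 0) (.lit 1)) (.setN 29 (.lit 0) (.lit 0) (.cell 63))) .skip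

/-- Look for the string `cell 60` of the perturbation among the listed ones. -/
def Prog.search : Prog := .seq (.setN 28 (.lit 0) (.lit 0) (.lit 0)) (.loop 63 (.cell 20) .compare)

/-- The group generated by `gen 0, …, gen (d - 1)` is listed in memory. -/
structure Listed (s : Store) (d : ℕ) (gen : ℕ → PauliString n) : Prop where
  x : ∀ a < 2 ^ d, ∀ q : Fin n, s.nat 22 a q = (xp (bitSum gen d a) q).val
  z : ∀ a < 2 ^ d, ∀ q : Fin n, s.nat 23 a q = (zp (bitSum gen d a) q).val

theorem val_eq_iff {v w : Vec n} : v = w ↔ ∀ q, (v q).val = (w q).val :=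
  ⟨fun h q => by rw [h], fun h => funext fun q => ZMod.val_injective 2 (h q)⟩

theorem run_search {I : Quench n m k} {t : ℝ} {s : Store} (hl : Loaded I t s) {i : Fin k}
    (hi : s.nat 60 0 0 = i) {d : ℕ} {gen : ℕ → PauliString n} (hd : s.nat 20 0 0 = 2 ^ d)
    (hg : Listed s d gen) :
    let s' := Prog.search.run s
    (s'.nat 28 0 0 = 1 ∧ s'.nat 29 0 0 < 2 ^ d ∧ bitSum gen d (s'.nat 29 0 0) = I.P i) ∨
    (s'.nat 28 0 0 = 0 ∧ ∀ a < 2 ^ d, bitSum gen d a ≠ I.P i) := by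
  rw [Prog.search, run_seq]
  have a1 := (Prog.setN 28 (.lit 0) (.lit 0) (.lit 0)).agree_run rfl s
  have v1 : ((Prog.setN 28 (.lit 0) (.lit 0) (.lit 0)).run s).nat 28 0 0 = 0 := by
    simp [Prog.run, Store.setNat, NExpr.eval]
  have hl1 := hl.mono a1 rfl
  generalize (Prog.setN 28 (.lit 0) (.lit 0) (.lit 0)).run s = s1 at *
  have hD : (NExpr.cell 20).eval s1 = 2 ^ d := by
    change s1.nat 20 0 0 = _
    rw [a1.nat 20 rfl, hd]
  rw [← hD]
  have v := run_loop (x := 63) (e := .cell 20) (s := s1) (c := .compare) rfl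
    (fun j s' => (s'.nat 28 0 0 = 1 ∧ s'.nat 29 0 0 < 2 ^ d ∧
        bitSum gen d (s'.nat 29 0 0) = I.P i) ∨
      (s'.nat 28 0 0 = 0 ∧ ∀ a < j, bitSum gen d a ≠ I.P i)) (Or.inr ⟨v1, by simp⟩) ?_
  · rwa [hD] at v ⊢
  · intro j s' hj hc hag hinv
    rw [hD] at hj
    rw [Prog.compare, run_seq, run_seq]
    have hl' := hl1.mono hag rfl
    have a2 := (Prog.setN 27 (.lit 0) (.lit 0) (.lit 1)).agree_run rfl s'
    have v2 : ((Prog.setN 27 (.lit 0) (.lit 0) (.lit 1)).run s').nat 27 0 0 = 1 := by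
      simp [Prog.run, Store.setNat, NExpr.eval]
    have hl2 := hl'.mono a2 rfl
    generalize (Prog.setN 27 (.lit 0) (.lit 0) (.lit 1)).run s' = s2 at *
    have hn2 : NExpr.qubits.eval s2 = n := hl2.qubits
    have v3 := run_loop (x := 64) (e := .qubits) (s := s2) (c := .compareQubit) rfl
      (fun q' s' => (s'.nat 27 0 0 = 1 ∧ ∀ q : Fin n, (q : ℕ) < q' →
        (xp (bitSum gen d j) q).val = (xp (I.P i) q).val ∧
        (zp (bitSum gen d j) q).val = (zp (I.P i) q).val) ∨
        (s'.nat 27 0 0 = 0 ∧ bitSum gen d j ≠ I.P i)) (Or.inl ⟨v2, by simp⟩) (by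
        intro q s3 hq hc3 hag3 hi3
        rw [hn2] at hq
        have hl3 := hl2.mono hag3 rfl
        have e1 : s3.nat 22 j q = (xp (bitSum gen d j) ⟨q, hq⟩).val := by
          rw [hag3.nat 22 rfl, a2.nat 22 rfl, hag.nat 22 rfl, a1.nat 22 rfl]
          exact hg.x j hj ⟨q, hq⟩
        have e2 : s3.nat 23 j q = (zp (bitSum gen d j) ⟨q, hq⟩).val := by
          rw [hag3.nat 23 rfl, a2.nat 23 rfl, hag.nat 23 rfl, a1.nat 23 rfl]
          exact hg.z j hj ⟨q, hq⟩
        have e3 : s3.nat 63 0 0 = j := by rw [hag3.nat 63 rfl, a2.nat 63 rfl, hc]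
        have e4 : s3.nat 60 0 0 = i := by
          rw [hag3.nat 60 rfl, a2.nat 60 rfl, hag.nat 60 rfl, a1.nat 60 rfl, hi]
        have e5 := hl3.px i ⟨q, hq⟩
        have e6 := hl3.pz i ⟨q, hq⟩
        simp only at e5 e6
        simp only [Prog.compareQubit, Prog.run, Test.holds, NExpr.eval, hc3, e1, e2, e3, e4, e5, e6]
        split_ifs with h
        · rcases hi3 with ⟨h1, h2⟩ | h1
          · refine Or.inl ⟨h1, fun r hr => ?_⟩
            rcases Nat.lt_succ_iff_lt_or_eq.mp hr with hlt | heq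
            · exact h2 r hlt
            · rw [show r = ⟨q, hq⟩ from Fin.ext heq]; exact h
          · exact Or.inr h1
        · refine Or.inr ⟨by simp [Store.setNat], fun h' => h ?_⟩
          rw [h']; exact ⟨rfl, rfl⟩)
    rw [hn2] at v3
    have a3 := (Prog.loop 64 .qubits .compareQubit).agree_run rfl s2
    change (fun s'' : Store => (s''.nat 28 0 0 = 1 ∧ s''.nat 29 0 0 < 2 ^ d ∧ _) ∨ _) (Prog.run _
      ((Prog.loop 64 .qubits .compareQubit).run s2))
    generalize (Prog.loop 64 .qubits .compareQubit).run s2 = s3 at *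
    have e3 : s3.nat 63 0 0 = j := by rw [a3.nat 63 rfl, a2.nat 63 rfl, hc]
    have e28 : s3.nat 28 0 0 = s'.nat 28 0 0 := by rw [a3.nat 28 rfl, a2.nat 28 rfl]
    have e29 : s3.nat 29 0 0 = s'.nat 29 0 0 := by rw [a3.nat 29 rfl, a2.nat 29 rfl]
    rcases v3 with ⟨h1, h2⟩ | ⟨h1, h2⟩
    · rw [run_ite_pos _ _ (show Test.holds s3 (.natEq (.cell 27) (.lit 1)) from h1)]
      simp only [Prog.run, NExpr.eval]
      refine Or.inl ⟨by simp [Store.setNat], by simpa [Store.setNat, e3] using hj, ?_⟩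
      simp only [Store.setNat, and_self, if_true, e3]
      simp only [show ¬ ((63 : ℕ) = 28) by simp, false_and, if_false]
      exact pauli_ext (val_eq_iff.mpr fun q => (h2 q q.2).1) (val_eq_iff.mpr fun q => (h2 q q.2).2)
    · rw [run_ite_neg _ _ (show ¬ Test.holds s3 (.natEq (.cell 27) (.lit 1)) from fun h => by
        simp only [Test.holds, NExpr.eval, h1] at h; exact absurd h (by simp))]
      simp only [Prog.run, e28, e29]
      rcases hinv with h | ⟨h3, h4⟩
      · exact Or.inl h
      · refine Or.inr ⟨h3, fun a ha => ?_⟩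
        rcases Nat.lt_succ_iff_lt_or_eq.mp ha with hlt | rfl
        · exact h4 a hlt
        · exact h2

/-- Tabulate the addition of the current group order. -/
def Prog.shiftTable : Prog :=
  .seq (.setN 30 (.lit 0) (.lit 0) (.cell 20)) <|
  .loop 63 (.cell 20) <|
  .seq (.setN 26 (.lit 0) (.cell 63) (.cell 30)) (.setN 30 (.lit 0) (.lit 0) (.succ (.cell 30)))

/-- Sums of two stored numbers are not available, so `D + a` is obtained by counting upwards from
`D`. When the loop ends, the counter has reached the next group order. -/
theorem run_shiftTable {s : Store} {D : ℕ} (hD : s.nat 20 0 0 = D) :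
    (∀ a < D, (Prog.shiftTable.run s).nat 26 0 a = D + a) ∧
      (Prog.shiftTable.run s).nat 30 0 0 = D + D := by
  rw [Prog.shiftTable, run_seq]
  have v1 : ((Prog.setN 30 (.lit 0) (.lit 0) (.cell 20)).run s).nat 30 0 0 = D := by
    simp [Prog.run, Store.setNat, NExpr.eval, hD]
  have hD1 : (NExpr.cell 20).eval ((Prog.setN 30 (.lit 0) (.lit 0) (.cell 20)).run s) = D := by
    simp [Prog.run, Store.setNat, NExpr.eval, hD]
  generalize (Prog.setN 30 (.lit 0) (.lit 0) (.cell 20)).run s = s1 at *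
  have v := run_loop (x := 63) (e := .cell 20) (s := s1) (c :=
    .seq (.setN 26 (.lit 0) (.cell 63) (.cell 30)) (.setN 30 (.lit 0) (.lit 0) (.succ (.cell 30))))
    rfl (fun j s' => (∀ a < j, s'.nat 26 0 a = D + a) ∧ s'.nat 30 0 0 = D + j)
    ⟨by simp, by simp [v1]⟩ (by
      rintro j s' hj hc - ⟨h1, h2⟩
      refine ⟨fun a ha => ?_, ?_⟩
      · by_cases h : a = j
        · simp [Prog.run, Store.setNat, NExpr.eval, hc, h2, h]
        · simp [Prog.run, Store.setNat, NExpr.eval, hc, h, h1 a (by omega)]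
      · simp [Prog.run, Store.setNat, NExpr.eval, h2, add_assoc])
  rwa [hD1] at v

/-- Append the product of the element `cell 63` and the new generator. -/
def Prog.rowStrings : Prog :=
  .loop 64 .qubits <|
  .seq (.setN 22 (.at 26 (.cell 63)) (.cell 64)
    (.xor (.get 22 (.cell 63) (.cell 64)) (.get 5 (.cell 60) (.cell 64))))
  (.setN 23 (.at 26 (.cell 63)) (.cell 64)
    (.xor (.get 23 (.cell 63) (.cell 64)) (.get 6 (.cell 60) (.cell 64))))

theorem run_rowStrings {I : Quench n m k} {t : ℝ} {s : Store} (hl : Loaded I t s) (ht : Tables s)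
    {i : Fin k} (hi : s.nat 60 0 0 = i) {a b : ℕ} (ha : s.nat 63 0 0 = a) (hb : s.nat 26 0 a = b)
    (hab : a ≠ b) {A : PauliString n} (hx : ∀ q : Fin n, s.nat 22 a q = (xp A q).val)
    (hz : ∀ q : Fin n, s.nat 23 a q = (zp A q).val) :
    let s' := Prog.rowStrings.run s
    (∀ q : Fin n, s'.nat 22 b q = (xp (A + I.P i) q).val) ∧
    (∀ q : Fin n, s'.nat 23 b q = (zp (A + I.P i) q).val) ∧
    (∀ p ≠ b, s'.nat 22 p = s.nat 22 p ∧ s'.nat 23 p = s.nat 23 p) := by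
  have hn : NExpr.qubits.eval s = n := hl.qubits
  have v := run_loop (x := 64) (e := .qubits) (s := s) (c :=
    .seq (.setN 22 (.at 26 (.cell 63)) (.cell 64)
      (.xor (.get 22 (.cell 63) (.cell 64)) (.get 5 (.cell 60) (.cell 64))))
    (.setN 23 (.at 26 (.cell 63)) (.cell 64)
      (.xor (.get 23 (.cell 63) (.cell 64)) (.get 6 (.cell 60) (.cell 64))))) rfl
    (fun j s' => (∀ q : Fin n, (q : ℕ) < j → s'.nat 22 b q = (xp (A + I.P i) q).val) ∧
      (∀ q : Fin n, (q : ℕ) < j → s'.nat 23 b q = (zp (A + I.P i) q).val) ∧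
      (∀ p ≠ b, ∀ q, s'.nat 22 p q = s.nat 22 p q ∧ s'.nat 23 p q = s.nat 23 p q))
    ⟨by simp, by simp, by simp⟩ (by
      rintro j s' hj hc hag ⟨h1, h2, h3⟩
      rw [hn] at hj
      have hl' := hl.mono hag rfl
      have ht' := ht.mono hag rfl
      have e1 : s'.nat 22 a j = (xp A ⟨j, hj⟩).val := by rw [(h3 a hab j).1]; exact hx ⟨j, hj⟩
      have e2 : s'.nat 23 a j = (zp A ⟨j, hj⟩).val := by rw [(h3 a hab j).2]; exact hz ⟨j, hj⟩
      have e3 : s'.nat 5 i j = _ := hl'.px i ⟨j, hj⟩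
      have e4 : s'.nat 6 i j = _ := hl'.pz i ⟨j, hj⟩
      have e5 : s'.nat 60 0 0 = i := by rw [hag.nat 60 rfl, hi]
      have e6 : s'.nat 63 0 0 = a := by rw [hag.nat 63 rfl, ha]
      have e7 : s'.nat 26 0 a = b := by rw [hag.nat 26 rfl, hb]
      have key : (Prog.run (.seq (.setN 22 (.at 26 (.cell 63)) (.cell 64)
          (.xor (.get 22 (.cell 63) (.cell 64)) (.get 5 (.cell 60) (.cell 64))))
          (.setN 23 (.at 26 (.cell 63)) (.cell 64)
          (.xor (.get 23 (.cell 63) (.cell 64)) (.get 6 (.cell 60) (.cell 64))))) s') =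
          (s'.setNat 22 b j (xp (A + I.P i) ⟨j, hj⟩).val).setNat 23 b j
            (zp (A + I.P i) ⟨j, hj⟩).val := by
        simp [Prog.run, NExpr.eval, Store.setNat, hc, e1, e2, e3, e4, e5, e6, e7, ht'.xor]
      rw [key]
      refine ⟨fun q hq => ?_, fun q hq => ?_, fun p hp q => ?_⟩
      · by_cases h : (q : ℕ) = j
        · subst h; simp [Store.setNat]
        · simp only [Store.setNat, h]; simpa using h1 q (by omega)
      · by_cases h : (q : ℕ) = j
        · subst h; simp [Store.setNat]
        · simp only [Store.setNat, h]; simpa using h2 q (by omega)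
      · simpa [Store.setNat, hp] using h3 p hp q)
  rw [hn] at v
  obtain ⟨h1, h2, h3⟩ := v
  exact ⟨fun q => h1 q q.2, fun q => h2 q q.2,
    fun p hp => ⟨funext fun q => (h3 p hp q).1, funext fun q => (h3 p hp q).2⟩⟩

/-- Extend the tables for the group law and the Walsh functions at one pair of indices. -/
def Prog.cellTables : Prog :=
  .seq (.setN 24 (.cell 63) (.at 26 (.cell 65)) (.at 26 (.get 24 (.cell 63) (.cell 65)))) <|
  .seq (.setN 24 (.at 26 (.cell 63)) (.cell 65) (.at 26 (.get 24 (.cell 63) (.cell 65)))) <|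
  .seq (.setN 24 (.at 26 (.cell 63)) (.at 26 (.cell 65)) (.get 24 (.cell 63) (.cell 65))) <|
  .seq (.setR 23 (.cell 63) (.at 26 (.cell 65)) (.get 23 (.cell 63) (.cell 65))) <|
  .seq (.setR 23 (.at 26 (.cell 63)) (.cell 65) (.get 23 (.cell 63) (.cell 65))) <|
  .setR 23 (.at 26 (.cell 63)) (.at 26 (.cell 65))
    (.sub (.lit 0) (.get 23 (.cell 63) (.cell 65)))

/-- One old entry at `(a, b)` determines the three new entries whose indices involve the new
generator. The bounds by `D` separate the cells written from the entry that is read. -/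
theorem run_cellTables {s : Store} {D a b v : ℕ} {w : ℝ} (ha : s.nat 63 0 0 = a)
    (hb : s.nat 65 0 0 = b) (ha' : a < D) (hb' : b < D) (hv' : v < D)
    (hsh : ∀ a < D, s.nat 26 0 a = D + a) (hv : s.nat 24 a b = v) (hw : s.real 23 a b = w)
    (p q : ℕ) :
    (Prog.cellTables.run s).nat 24 p q =
      (if p = D + a ∧ q = D + b then v else if p = D + a ∧ q = b then D + v else
        if p = a ∧ q = D + b then D + v else s.nat 24 p q) ∧
    (Prog.cellTables.run s).real 23 p q =
      (if p = D + a ∧ q = D + b then -w else if p = D + a ∧ q = b then w else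
        if p = a ∧ q = D + b then w else s.real 23 p q) := by
  have h1 : a ≠ D + a := by omega
  have h2 : b ≠ D + b := by omega
  have h3 : D ≠ 0 := by omega
  have e1 := hsh a ha'
  have e2 := hsh b hb'
  have e3 := hsh v hv'
  constructor
  · simp [Prog.cellTables, Prog.run, Store.setNat, Store.setReal, NExpr.eval, ha, hb, hv, e1, e2, e3,
      h3]
  · simp [Prog.cellTables, Prog.run, Store.setNat, Store.setReal, NExpr.eval, RExpr.eval, ha, hb, e1,
      e2, h3, hw]

/-- The tables for the group law and the Walsh functions are in memory. -/
structure Tabled (s : Store) (d : ℕ) : Prop where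
  xor : ∀ a < 2 ^ d, ∀ b < 2 ^ d, s.nat 24 a b = a ^^^ b
  walsh : ∀ a < 2 ^ d, ∀ b < 2 ^ d, s.real 23 a b = walsh d a b

/-- The extended tables are right at the four pairs of indices that belong to `(a, b)`. -/
def TabledAt (s : Store) (d a b : ℕ) : Prop :=
  (s.nat 24 a (2 ^ d + b) = 2 ^ d + (a ^^^ b) ∧ s.nat 24 (2 ^ d + a) b = 2 ^ d + (a ^^^ b) ∧
    s.nat 24 (2 ^ d + a) (2 ^ d + b) = a ^^^ b) ∧
  s.real 23 a (2 ^ d + b) = walsh d a b ∧ s.real 23 (2 ^ d + a) b = walsh d a b ∧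
    s.real 23 (2 ^ d + a) (2 ^ d + b) = -walsh d a b

theorem Tabled.succ {s : Store} {d : ℕ} (h : Tabled s d)
    (h' : ∀ a < 2 ^ d, ∀ b < 2 ^ d, TabledAt s d a b) : Tabled s (d + 1) := by
  have hx : ∀ a < 2 ^ d, ∀ b < 2 ^ d, a ^^^ b < 2 ^ d := fun a ha b hb => Nat.xor_lt_two_pow ha hb
  have hcases : ∀ a < 2 ^ (d + 1), a < 2 ^ d ∨ ∃ a' < 2 ^ d, a = 2 ^ d + a' := by
    intro a ha
    rw [pow_succ] at ha
    by_cases h : a < 2 ^ d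
    · exact Or.inl h
    · exact Or.inr ⟨a - 2 ^ d, by omega, by omega⟩
  refine ⟨fun a hA b hB => ?_, fun a hA b hB => ?_⟩
  · rcases hcases a hA with ha | ⟨a, ha, rfl⟩ <;> rcases hcases b hB with hb | ⟨b, hb, rfl⟩
    · exact h.xor a ha b hb
    · rw [(h' a ha b hb).1.1, two_pow_add_eq_xor hb, two_pow_add_eq_xor (hx a ha b hb),
        Nat.xor_left_comm]
    · rw [(h' a ha b hb).1.2.1, two_pow_add_eq_xor ha, two_pow_add_eq_xor (hx a ha b hb),
        Nat.xor_assoc]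
    · rw [(h' a ha b hb).1.2.2, two_pow_add_eq_xor ha, two_pow_add_eq_xor hb, Nat.xor_assoc,
        Nat.xor_left_comm a, ← Nat.xor_assoc, Nat.xor_self, Nat.zero_xor]
  · rcases hcases a hA with ha | ⟨a, ha, rfl⟩ <;> rcases hcases b hB with hb | ⟨b, hb, rfl⟩
    · rw [h.walsh a ha b hb, walsh_succ_of_lt _ ha]
    · rw [(h' a ha b hb).2.1, (walsh_succ_add ha hb).2.1]
    · rw [(h' a ha b hb).2.2.1, (walsh_succ_add ha hb).1]
    · rw [(h' a ha b hb).2.2.2, (walsh_succ_add ha hb).2.2]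

/-- Extend the tables for one row. -/
def Prog.rowTables : Prog := .loop 65 (.cell 20) .cellTables

theorem run_rowTables {s : Store} {d a : ℕ} (hD : s.nat 20 0 0 = 2 ^ d) (ha : s.nat 63 0 0 = a)
    (ha' : a < 2 ^ d) (hsh : ∀ a < 2 ^ d, s.nat 26 0 a = 2 ^ d + a) (ht : Tabled s d) :
    let s' := Prog.rowTables.run s
    Tabled s' d ∧ (∀ b < 2 ^ d, TabledAt s' d a b) ∧
      ∀ a' < 2 ^ d, a' ≠ a → ∀ b < 2 ^ d, TabledAt s d a' b → TabledAt s' d a' b := by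
  have hD' : (NExpr.cell 20).eval s = 2 ^ d := hD
  have v := run_loop (x := 65) (e := .cell 20) (s := s) (c := .cellTables) rfl
    (fun j s' => Tabled s' d ∧ (∀ b < j, b < 2 ^ d → TabledAt s' d a b) ∧
      ∀ a' < 2 ^ d, a' ≠ a → ∀ b < 2 ^ d, TabledAt s d a' b → TabledAt s' d a' b)
    ⟨ht, by simp, fun _ _ _ _ _ h => h⟩ (by
      rintro j s' hj hc hag ⟨h1, h2, h3⟩
      rw [hD'] at hj
      have key := run_cellTables (s := s') (by rw [hag.nat 63 rfl, ha]) hc ha' hj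
        (Nat.xor_lt_two_pow ha' hj) (by rw [hag.nat 26 rfl]; exact hsh) (h1.xor a ha' j hj)
        (h1.walsh a ha' j hj)
      refine ⟨⟨fun p hp q hq => ?_, fun p hp q hq => ?_⟩, fun b hb hb' => ?_,
        fun p hp hpa b hb h => ?_⟩
      · rw [(key p q).1, if_neg (by omega), if_neg (by omega), if_neg (by omega), h1.xor p hp q hq]
      · rw [(key p q).2, if_neg (by omega), if_neg (by omega), if_neg (by omega),
          h1.walsh p hp q hq]
      · have n1 : a ≠ 2 ^ d + a := by omega
        have n2 : j ≠ 2 ^ d + j := by omega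
        by_cases h : b = j
        · subst h
          simp only [TabledAt, key]
          simp
        · have := h2 b (by omega) hb'
          have n3 : b ≠ 2 ^ d + j := by omega
          have n4 : 2 ^ d + b ≠ j := by omega
          simp only [TabledAt, key] at this ⊢
          simpa [n1, n2, n3, n4, h] using this
      · have := h3 p hp hpa b hb h
        have n1 : p ≠ 2 ^ d + a := by omega
        have n2 : 2 ^ d + p ≠ a := by omega
        simp only [TabledAt, key] at this ⊢
        simpa [n1, n2, hpa] using this) (by
      rintro j s' ⟨⟨h1, h2⟩, h3⟩
      exact ⟨⟨h1, h2⟩, h3⟩)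
  rw [hD'] at v
  exact ⟨v.1, fun b hb => v.2.1 b hb hb, v.2.2⟩

/-- Append a new generator. -/
def Prog.extend : Prog :=
  .seq .shiftTable <|
  .seq (.loop 63 (.cell 20) (.seq .rowStrings .rowTables)) <|
  .seq (.setN 25 (.lit 0) (.get 20 (.lit 0) (.lit 1)) (.cell 20))
    (.setN 29 (.lit 0) (.lit 0) (.cell 20))

theorem Tabled.mono {s s' : Store} {d : ℕ} (h : Tabled s d) (h1 : s'.nat 24 = s.nat 24)
    (h2 : s'.real 23 = s.real 23) : Tabled s' d :=
  ⟨by rw [h1]; exact h.xor, by rw [h2]; exact h.walsh⟩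

theorem TabledAt.mono {s s' : Store} {d a b : ℕ} (h : TabledAt s d a b) (h1 : s'.nat 24 = s.nat 24)
    (h2 : s'.real 23 = s.real 23) : TabledAt s' d a b := by
  rw [TabledAt, h1, h2]; exact h

/-- The order and the dimension in array `20` are deliberately left unchanged here, because they
bound loops that are still running; `addTerm` updates them at its end. -/
theorem run_extend {I : Quench n m k} {t : ℝ} {s : Store} (hl : Loaded I t s) (ht : Tables s)
    {i : Fin k} (hi : s.nat 60 0 0 = i) {d : ℕ} {gen : ℕ → PauliString n}
    (hD : s.nat 20 0 0 = 2 ^ d) (hd : s.nat 20 0 1 = d) (hg : Listed s d gen) (hT : Tabled s d) :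
    let s' := Prog.extend.run s
    Listed s' (d + 1) (Function.update gen d (I.P i)) ∧ Tabled s' (d + 1) ∧
    (∀ l, s'.nat 25 0 l = if l = d then 2 ^ d else s.nat 25 0 l) ∧ s'.nat 29 0 0 = 2 ^ d ∧
    s'.nat 30 0 0 = 2 ^ (d + 1) := by
  rw [Prog.extend, run_seq, run_seq]
  obtain ⟨hsh, h30⟩ := run_shiftTable hD
  have a1 := Prog.shiftTable.agree_run rfl s
  generalize Prog.shiftTable.run s = s1 at *
  have hl1 := hl.mono a1 rfl
  have ht1 := ht.mono a1 rfl
  have hD1 : (NExpr.cell 20).eval s1 = 2 ^ d := by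
    change s1.nat 20 0 0 = _
    rw [a1.nat 20 rfl, hD]
  have hpos : 0 < 2 ^ d := by positivity
  have v := run_loop (x := 63) (e := .cell 20) (s := s1) (c := .seq .rowStrings .rowTables) rfl
    (fun j s' => Listed s' d gen ∧ Tabled s' d ∧
      (∀ a < j, (∀ q : Fin n, s'.nat 22 (2 ^ d + a) q = (xp (bitSum gen d a + I.P i) q).val) ∧
        (∀ q : Fin n, s'.nat 23 (2 ^ d + a) q = (zp (bitSum gen d a + I.P i) q).val)) ∧
      ∀ a < j, ∀ b < 2 ^ d, TabledAt s' d a b)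
    ⟨⟨by rw [a1.nat 22 rfl]; exact hg.x, by rw [a1.nat 23 rfl]; exact hg.z⟩,
      hT.mono (a1.nat 24 rfl) (a1.real 23 rfl), by simp, by simp⟩ (by
      rintro j s2 hj hc hag ⟨h1, h2, h3, h4⟩
      rw [hD1] at hj
      rw [run_seq]
      obtain ⟨k1, k2, k3⟩ := run_rowStrings (hl1.mono hag rfl) (ht1.mono hag rfl) (i := i)
        (b := 2 ^ d + j)
        (by rw [hag.nat 60 rfl, a1.nat 60 rfl, hi]) hc (by rw [hag.nat 26 rfl]; exact hsh j hj)
        (by omega) (h1.x j hj) (h1.z j hj)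
      have a2 := Prog.rowStrings.agree_run rfl s2
      generalize Prog.rowStrings.run s2 = s3 at *
      obtain ⟨l1, l2, l3⟩ := run_rowTables (s := s3) (d := d) (a := j)
        (by rw [a2.nat 20 rfl, hag.nat 20 rfl]; exact hD1) (by rw [a2.nat 63 rfl, hc]) hj
        (by rw [a2.nat 26 rfl, hag.nat 26 rfl]; exact hsh) (h2.mono (a2.nat 24 rfl) (a2.real 23 rfl))
      have a3 := Prog.rowTables.agree_run rfl s3
      generalize Prog.rowTables.run s3 = s4 at *
      refine ⟨⟨fun a ha => ?_, fun a ha => ?_⟩, l1, fun a ha => ?_, fun a ha b hb => ?_⟩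
      · rw [a3.nat 22 rfl, (k3 a (by omega)).1]; exact h1.x a ha
      · rw [a3.nat 23 rfl, (k3 a (by omega)).2]; exact h1.z a ha
      · rw [a3.nat 22 rfl, a3.nat 23 rfl]
        rcases Nat.lt_succ_iff_lt_or_eq.mp ha with hlt | rfl
        · rw [(k3 _ (by omega)).1, (k3 _ (by omega)).2]; exact h3 a hlt
        · exact ⟨k1, k2⟩
      · rcases Nat.lt_succ_iff_lt_or_eq.mp ha with hlt | rfl
        · exact l3 a (by omega) (by omega) b hb ((h4 a hlt b hb).mono (a2.nat 24 rfl) (a2.real 23 rfl))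
        · exact l2 b hb)
    (by rintro j s' ⟨⟨h1, h2⟩, ⟨h3, h4⟩, h5⟩; exact ⟨⟨h1, h2⟩, ⟨h3, h4⟩, h5⟩)
  rw [hD1] at v
  have a2 := (Prog.loop 63 (.cell 20) (.seq .rowStrings .rowTables)).agree_run rfl s1
  generalize (Prog.loop 63 (.cell 20) (.seq .rowStrings .rowTables)).run s1 = s2 at *
  obtain ⟨h1, h2, h3, h4⟩ := v
  have e1 : s2.nat 20 0 0 = 2 ^ d := by rw [a2.nat 20 rfl]; exact hD1
  have e2 : s2.nat 20 0 1 = d := by rw [a2.nat 20 rfl, a1.nat 20 rfl, hd]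
  let c : Prog := .seq (.setN 25 (.lit 0) (.get 20 (.lit 0) (.lit 1)) (.cell 20))
    (.setN 29 (.lit 0) (.lit 0) (.cell 20))
  have a3 := c.agree_run rfl s2
  have hsplit : ∀ a < 2 ^ (d + 1), a < 2 ^ d ∨ ∃ a' < 2 ^ d, a = 2 ^ d + a' := by
    intro a ha
    rw [pow_succ] at ha
    by_cases h : a < 2 ^ d
    · exact Or.inl h
    · exact Or.inr ⟨a - 2 ^ d, by omega, by omega⟩
  refine ⟨⟨fun a hA => ?_, fun a hA => ?_⟩, (h2.succ h4).mono (a3.nat 24 rfl) (a3.real 23 rfl),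
    fun l => ?_, ?_, ?_⟩
  · rw [a3.nat 22 rfl]
    rcases hsplit a hA with ha | ⟨a, ha, rfl⟩
    · rw [bitSum_succ_of_lt _ _ ha]; exact h1.x a ha
    · rw [bitSum_succ_add _ _ ha]; exact (h3 a ha).1
  · rw [a3.nat 23 rfl]
    rcases hsplit a hA with ha | ⟨a, ha, rfl⟩
    · rw [bitSum_succ_of_lt _ _ ha]; exact h1.z a ha
    · rw [bitSum_succ_add _ _ ha]; exact (h3 a ha).2
  · simp [Prog.run, Store.setNat, NExpr.eval, e1, e2, a2.nat 25 rfl, a1.nat 25 rfl]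
  · simp [Prog.run, Store.setNat, NExpr.eval, e1]
  · rw [a3.nat 30 rfl, a2.nat 30 rfl, h30, pow_succ]; ring

/-- Add the string `cell 60` of the perturbation to the list. -/
def Prog.addTerm : Prog :=
  .seq (.seq .search (.seq (.ite (.natEq (.cell 28) (.lit 0)) .extend .skip)
    (.setR 24 (.lit 0) (.cell 29) (.add (.at 24 (.cell 29)) (.at 1 (.cell 60)))))) <|
  .ite (.natEq (.cell 28) (.lit 0))
    (.seq (.setN 20 (.lit 0) (.lit 1) (.succ (.get 20 (.lit 0) (.lit 1))))
      (.setN 20 (.lit 0) (.lit 0) (.cell 30))) .skip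

/-- The group generated by the first `i` strings of the perturbation has been listed. -/
structure Enum (I : Quench n m k) (s : Store) (i d : ℕ) (gen : ℕ → PauliString n) : Prop where
  order : s.nat 20 0 0 = 2 ^ d
  dim : s.nat 20 0 1 = d
  listed : Listed s d gen
  tabled : Tabled s d
  pow : ∀ l < d, s.nat 25 0 l = 2 ^ l
  gam : ∀ a < 2 ^ d, s.real 24 0 a =
    ∑ j : Fin k, if (j : ℕ) < i ∧ I.P j = bitSum gen d a then I.γ j else 0
  gam_zero : ∀ a, 2 ^ d ≤ a → s.real 24 0 a = 0
  inj : ∀ a < 2 ^ d, ∀ b < 2 ^ d, bitSum gen d a = bitSum gen d b → a = b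
  mem : ∀ a < 2 ^ d, bitSum gen d a ∈ I.K
  cov : ∀ j : Fin k, (j : ℕ) < i → ∃ a < 2 ^ d, bitSum gen d a = I.P j

theorem Quench.gam_succ (I : Quench n m k) (i : Fin k) (Q : PauliString n) :
    (∑ j : Fin k, if (j : ℕ) < (i : ℕ) + 1 ∧ I.P j = Q then I.γ j else 0) =
      (∑ j : Fin k, if (j : ℕ) < i ∧ I.P j = Q then I.γ j else 0) +
        if I.P i = Q then I.γ i else 0 := by
  have : (if I.P i = Q then I.γ i else 0) = ∑ j, if j = i ∧ I.P j = Q then I.γ j else 0 := by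
    rw [Finset.sum_eq_single i]
    · simp
    · intro b _ hb; simp [hb]
    · simp
  rw [this, ← Finset.sum_add_distrib]
  refine Finset.sum_congr rfl fun j _ => ?_
  by_cases hQ : I.P j = Q
  · by_cases h : j = i
    · subst h; simp [hQ]
    · have h' : (j : ℕ) ≠ i := fun h' => h (Fin.ext h')
      have : (j : ℕ) < i + 1 ↔ (j : ℕ) < i := by omega
      simp [hQ, h, this]
  · simp [hQ]

/-- If the string is already listed, only its coefficient is recorded. Otherwise it is independent
of the generators found so far, and the list doubles. -/
theorem run_addTerm {I : Quench n m k} {t : ℝ} {s : Store} (hl : Loaded I t s) (ht : Tables s)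
    {i : Fin k} (hi : s.nat 60 0 0 = i) {d : ℕ} {gen : ℕ → PauliString n} (hE : Enum I s i d gen) :
    ∃ d' gen', Enum I (Prog.addTerm.run s) (i + 1) d' gen' := by
  rw [Prog.addTerm, run_seq, run_seq, run_seq]
  have v1 := run_search hl hi hE.order hE.listed
  have a1 := Prog.search.agree_run rfl s
  have hl1 := hl.mono a1 rfl
  have ht1 := ht.mono a1 rfl
  have hi1 : (Prog.search.run s).nat 60 0 0 = i := by rw [a1.nat 60 rfl, hi]
  have ho1 : (Prog.search.run s).nat 20 0 0 = 2 ^ d := by rw [a1.nat 20 rfl, hE.order]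
  have hd1 : (Prog.search.run s).nat 20 0 1 = d := by rw [a1.nat 20 rfl, hE.dim]
  generalize Prog.search.run s = s1 at *
  have hg1 : Listed s1 d gen :=
    ⟨by rw [a1.nat 22 rfl]; exact hE.listed.x, by rw [a1.nat 23 rfl]; exact hE.listed.z⟩
  have hT1 : Tabled s1 d := hE.tabled.mono (a1.nat 24 rfl) (a1.real 23 rfl)
  rcases v1 with ⟨h1, h2, h3⟩ | ⟨h1, h2⟩
  · have hno : ¬ Test.holds s1 (.natEq (.cell 28) (.lit 0)) := by
      simp [Test.holds, NExpr.eval, h1]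
    rw [run_ite_neg _ _ hno]
    rw [run_ite_neg _ _ (by simp [Test.holds, NExpr.eval, h1, Prog.run, Store.setReal])]
    simp only [Prog.run]
    refine ⟨d, gen, ⟨ho1, hd1, ⟨hg1.x, hg1.z⟩, ⟨hT1.xor, fun a ha b hb => ?_⟩, ?_, ?_, ?_, hE.inj,
      hE.mem, ?_⟩⟩
    · rw [Store.setReal_real_of_ne _ (by simp)]; exact hT1.walsh a ha b hb
    · change ∀ l < d, s1.nat 25 0 l = _
      rw [a1.nat 25 rfl]; exact hE.pow
    · intro a ha
      rw [I.gam_succ, ← hE.gam a ha, ← a1.real 24 rfl]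
      simp only [Store.setReal, NExpr.eval, RExpr.eval, hi1, hl1.γ]
      by_cases h : a = s1.nat 29 0 0
      · subst h; simp [h3]
      · have : I.P i ≠ bitSum gen d a := fun h' => h (hE.inj a ha _ h2 (by rw [h3, h']))
        simp [h, this]
    · intro a ha
      rw [← hE.gam_zero a ha, ← a1.real 24 rfl]
      have : a ≠ s1.nat 29 0 0 := by omega
      simp [Store.setReal, NExpr.eval, this]
    · intro j hj
      rcases Nat.lt_succ_iff_lt_or_eq.mp hj with hlt | heq
      · exact hE.cov j hlt
      · exact ⟨_, h2, by rw [h3, Fin.ext heq]⟩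
  · have hyes : Test.holds s1 (.natEq (.cell 28) (.lit 0)) := by
      simp [Test.holds, NExpr.eval, h1]
    rw [run_ite_pos _ _ hyes]
    obtain ⟨k1, k2, k3, k4, k5⟩ := run_extend hl1 ht1 hi1 ho1 hd1 hg1 hT1
    have a2 := Prog.extend.agree_run rfl s1
    have hl2 := hl1.mono a2 rfl
    have e1 : (Prog.extend.run s1).nat 28 0 0 = 0 := by rw [a2.nat 28 rfl, h1]
    have e2 : (Prog.extend.run s1).nat 60 0 0 = i := by rw [a2.nat 60 rfl, hi1]
    have e3 : (Prog.extend.run s1).nat 20 0 1 = d := by rw [a2.nat 20 rfl, hd1]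
    have e4 : (Prog.extend.run s1).real 24 = s.real 24 := by rw [a2.real 24 rfl, a1.real 24 rfl]
    have e5 : s1.nat 25 = s.nat 25 := a1.nat 25 rfl
    generalize Prog.extend.run s1 = s2 at *
    rw [run_ite_pos _ _ (by simp [Test.holds, NExpr.eval, e1, Prog.run, Store.setReal])]
    simp only [Prog.run]
    have hpow : 2 ^ (d + 1) = 2 ^ d + 2 ^ d := by ring
    have hpos : 0 < 2 ^ d := by positivity
    have hsplit : ∀ a < 2 ^ (d + 1), a < 2 ^ d ∨ ∃ a' < 2 ^ d, a = 2 ^ d + a' := by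
      intro a ha
      by_cases h : a < 2 ^ d
      · exact Or.inl h
      · exact Or.inr ⟨a - 2 ^ d, by omega, by omega⟩
    -- Otherwise the string would be the sum of two listed elements, hence listed at the index `a
    -- ^^^ b`, which the search has excluded.
    have hmix : ∀ a < 2 ^ d, ∀ b < 2 ^ d, bitSum gen d a ≠ bitSum gen d b + I.P i := by
      intro a ha b hb h
      refine h2 (a ^^^ b) (Nat.xor_lt_two_pow ha hb) ?_
      rw [bitSum_xor, h, add_comm, ← add_assoc, pauli_add_self, zero_add]
    refine ⟨d + 1, Function.update gen d (I.P i), ⟨?_, ?_, ⟨?_, ?_⟩, ⟨?_, ?_⟩, ?_, ?_, ?_, ?_, ?_, ?_⟩⟩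
    · simp [Store.setNat, Store.setReal, NExpr.eval, k5]
    · simp [Store.setNat, Store.setReal, NExpr.eval, e3]
    · simpa [Store.setNat, Store.setReal] using k1.x
    · simpa [Store.setNat, Store.setReal] using k1.z
    · simpa [Store.setNat, Store.setReal] using k2.xor
    · simpa [Store.setNat, Store.setReal] using k2.walsh
    · intro l hl
      have := k3 l
      rw [e5] at this
      simp only [Store.setNat, Store.setReal]
      simp only [show ¬ ((25 : ℕ) = 20) by simp, false_and, if_false, this]
      split_ifs with h
      · rw [h]
      · exact hE.pow l (by omega)
    · intro a hA
      have hval : ∀ c : ℕ, (if c = 2 ^ d then s.real 24 0 (2 ^ d) + I.γ i else s.real 24 0 c) =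
          s.real 24 0 c + if c = 2 ^ d then I.γ i else 0 := by
        intro c; split_ifs with h <;> simp [h]
      rw [I.gam_succ]
      simp only [Store.setNat, Store.setReal, NExpr.eval, RExpr.eval, e2, k4, hl2.γ, e4, true_and,
        hval]
      congr 1
      · rcases hsplit a hA with ha | ⟨a, ha, rfl⟩
        · rw [hE.gam a ha, bitSum_succ_of_lt _ _ ha]
        -- All earlier strings lie in the old half of the list, so an element of the new half has
        -- collected no coefficient yet.
        · rw [hE.gam_zero _ (by omega), bitSum_succ_add _ _ ha, Finset.sum_eq_zero]
          intro j _
          rw [if_neg]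
          rintro ⟨hj, h⟩
          obtain ⟨b, hb, hb'⟩ := hE.cov j hj
          exact hmix b hb a ha (hb'.trans h)
      · congr 1
        rcases hsplit a hA with ha | ⟨a, ha, rfl⟩
        · rw [bitSum_succ_of_lt _ _ ha]
          exact propext ⟨fun h => by omega, fun h => absurd h.symm (h2 a ha)⟩
        · rw [bitSum_succ_add _ _ ha]
          refine propext ⟨fun h => ?_, fun h => ?_⟩
          · obtain rfl : a = 0 := by omega
            simp
          · have h0 : bitSum gen d a = 0 := by
              have := congrArg (· + I.P i) h
              simp only [add_assoc, pauli_add_self, add_zero] at this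
              exact this.symm
            rw [hE.inj a ha 0 hpos (by rw [h0, bitSum_zero_right]), add_zero]
    · intro a ha
      have : a ≠ 2 ^ d := by omega
      simp only [Store.setNat, Store.setReal, NExpr.eval, k4, true_and, this, and_false, if_false]
      rw [e4]
      exact hE.gam_zero a (by omega)
    · intro a hA b hB h
      rcases hsplit a hA with ha | ⟨a, ha, rfl⟩ <;> rcases hsplit b hB with hb | ⟨b, hb, rfl⟩
      · rw [bitSum_succ_of_lt _ _ ha, bitSum_succ_of_lt _ _ hb] at h
        exact hE.inj a ha b hb h
      · rw [bitSum_succ_of_lt _ _ ha, bitSum_succ_add _ _ hb] at h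
        exact absurd h (hmix a ha b hb)
      · rw [bitSum_succ_add _ _ ha, bitSum_succ_of_lt _ _ hb] at h
        exact absurd h.symm (hmix b hb a ha)
      · rw [bitSum_succ_add _ _ ha, bitSum_succ_add _ _ hb] at h
        rw [hE.inj a ha b hb (add_right_cancel h)]
    · intro a hA
      rcases hsplit a hA with ha | ⟨a, ha, rfl⟩
      · rw [bitSum_succ_of_lt _ _ ha]; exact hE.mem a ha
      · rw [bitSum_succ_add _ _ ha]
        exact Submodule.add_mem _ (hE.mem a ha) (Submodule.subset_span ⟨i, rfl⟩)
    · intro j hj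
      rcases Nat.lt_succ_iff_lt_or_eq.mp hj with hlt | heq
      · obtain ⟨a, ha, h⟩ := hE.cov j hlt
        exact ⟨a, by omega, by rw [bitSum_succ_of_lt _ _ ha, h]⟩
      · refine ⟨2 ^ d + 0, by omega, ?_⟩
        rw [bitSum_succ_add _ _ hpos, Fin.ext heq]
        simp

theorem Enum.mem_K_iff {I : Quench n m k} {s : Store} {d : ℕ} {gen : ℕ → PauliString n}
    (hE : Enum I s k d gen) (Q : PauliString n) :
    Q ∈ I.K ↔ ∃ u : Fin (2 ^ d), bitSum gen d u = Q := by
  constructor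
  · intro hQ
    let S : Submodule (ZMod 2) (PauliString n) :=
      { carrier := {Q | ∃ u : Fin (2 ^ d), bitSum gen d u = Q}
        zero_mem' := ⟨⟨0, by positivity⟩, bitSum_zero_right _ _⟩
        add_mem' := by
          rintro _ _ ⟨u, rfl⟩ ⟨v, rfl⟩
          exact ⟨⟨u ^^^ v, Nat.xor_lt_two_pow u.2 v.2⟩, bitSum_xor _ _ _ _⟩
        smul_mem' := by
          rintro c _ ⟨u, rfl⟩
          rcases zmod2_cases c with rfl | rfl
          · exact ⟨⟨0, by positivity⟩, by simp⟩
          · exact ⟨u, by simp⟩ }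
    have hle : I.K ≤ S := by
      rw [Quench.K, Submodule.span_le]
      rintro _ ⟨j, rfl⟩
      obtain ⟨a, ha, h⟩ := hE.cov j j.2
      exact ⟨⟨a, ha⟩, h⟩
    exact hle hQ
  · rintro ⟨u, rfl⟩
    exact hE.mem u u.2

theorem card_K (I : Quench n m k) : Nat.card I.K = 2 ^ I.dimK := by
  rw [Module.natCard_eq_pow_finrank (K := ZMod 2)]
  simp [Quench.dimK]

theorem Enum.pow_le {I : Quench n m k} {s : Store} {i d : ℕ} {gen : ℕ → PauliString n}
    (hE : Enum I s i d gen) : d ≤ I.dimK := by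
  have h := Nat.card_le_card_of_injective
    (fun u : Fin (2 ^ d) => (⟨bitSum gen d u, hE.mem u u.2⟩ : I.K)) (fun u v h =>
      Fin.ext (hE.inj u u.2 v v.2 (congrArg Subtype.val h)))
  rw [card_K, Nat.card_eq_fintype_card, Fintype.card_fin] at h
  exact (Nat.pow_le_pow_iff_right (by simp)).mp h

theorem Enum.dim_eq {I : Quench n m k} {s : Store} {d : ℕ} {gen : ℕ → PauliString n}
    (hE : Enum I s k d gen) : d = I.dimK := by
  refine le_antisymm hE.pow_le ?_
  have h := Nat.card_le_card_of_surjective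
    (fun u : Fin (2 ^ d) => (⟨bitSum gen d u, hE.mem u u.2⟩ : I.K)) (fun Q => by
      obtain ⟨u, hu⟩ := (hE.mem_K_iff Q).mp Q.2
      exact ⟨u, Subtype.ext hu⟩)
  rw [card_K, Nat.card_eq_fintype_card, Fintype.card_fin] at h
  exact (Nat.pow_le_pow_iff_right (by simp)).mp h

/-- Start with the trivial group. -/
def Prog.initGroup : Prog :=
  .seq (.setN 20 (.lit 0) (.lit 0) (.lit 1)) (.setR 23 (.lit 0) (.lit 0) (.lit 1))

/-- List the group generated by the perturbation. -/
def Prog.enumerate : Prog := .seq .initGroup (.loop 60 (.get 0 (.lit 0) (.lit 2)) .addTerm)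

theorem run_initGroup {s : Store} (h20 : s.nat 20 = 0) (h22 : s.nat 22 = 0) (h23 : s.nat 23 = 0)
    (h24 : s.nat 24 = 0) (hr : s.real 24 = 0) (I : Quench n m k) :
    Enum I (Prog.initGroup.run s) 0 0 (fun _ => 0) := by
  have hlt : ∀ a, a < 2 ^ 0 → a = 0 := fun a ha => by simpa using ha
  refine ⟨?_, ?_, ⟨?_, ?_⟩, ⟨?_, ?_⟩, by simp, ?_, ?_, ?_, ?_, by simp⟩
  · simp [Prog.initGroup, Prog.run, Store.setNat, Store.setReal, NExpr.eval]
  · simp [Prog.initGroup, Prog.run, Store.setNat, Store.setReal, NExpr.eval, h20]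
  · simp [Prog.initGroup, Prog.run, Store.setNat, Store.setReal, h22, bitSum]
  · simp [Prog.initGroup, Prog.run, Store.setNat, Store.setReal, h23, bitSum]
  · intro a ha b hb
    obtain rfl := hlt a ha
    obtain rfl := hlt b hb
    simp [Prog.initGroup, Prog.run, Store.setNat, Store.setReal, h24]
  · intro a ha b hb
    obtain rfl := hlt a ha
    obtain rfl := hlt b hb
    simp [Prog.initGroup, Prog.run, Store.setNat, Store.setReal, NExpr.eval, RExpr.eval, walsh]
  · simp [Prog.initGroup, Prog.run, Store.setNat, Store.setReal, hr]
  · simp [Prog.initGroup, Prog.run, Store.setNat, Store.setReal, hr]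
  · intro a ha b hb _
    rw [hlt a ha, hlt b hb]
  · intro a ha
    rw [hlt a ha, bitSum_zero_right]
    exact Submodule.zero_mem _

theorem Enum.setCounter {I : Quench n m k} {s : Store} {i d : ℕ} {gen : ℕ → PauliString n}
    (h : Enum I s i d gen) (v : ℕ) : Enum I (s.setNat 60 0 0 v) i d gen :=
  ⟨h.order, h.dim, ⟨h.listed.x, h.listed.z⟩, ⟨h.tabled.xor, h.tabled.walsh⟩, h.pow, h.gam,
    h.gam_zero, h.inj, h.mem, h.cov⟩

/-- Stated for every prefix of the perturbation, not only for all of it: the running time of a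
single round depends on the list size reached just before it. -/
theorem run_addTerms {I : Quench n m k} {t : ℝ} {s : Store} (hl : Loaded I t s) (ht : Tables s)
    (h20 : s.nat 20 = 0) (h22 : s.nat 22 = 0) (h23 : s.nat 23 = 0) (h24 : s.nat 24 = 0)
    (hr : s.real 24 = 0) {N : ℕ} (hN : N ≤ k) :
    ∃ d gen, Enum I ((Prog.loop 60 (.lit N) .addTerm).run (Prog.initGroup.run s)) N d gen := by
  have h0 := run_initGroup h20 h22 h23 h24 hr I
  have a1 := Prog.initGroup.agree_run rfl s
  have hl1 := hl.mono a1 rfl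
  have ht1 := ht.mono a1 rfl
  generalize Prog.initGroup.run s = s1 at *
  exact run_loop (x := 60) (e := .lit N) (s := s1) (c := .addTerm) rfl
    (fun i s' => ∃ d gen, Enum I s' i d gen) ⟨0, _, h0⟩ (by
      rintro j s' hj hc hag ⟨d, gen, hE⟩
      exact run_addTerm (hl1.mono hag rfl) (ht1.mono hag rfl) (i := ⟨j, lt_of_lt_of_le hj hN⟩) hc hE)
    (by rintro j s' ⟨d, gen, hE⟩; exact ⟨d, gen, hE.setCounter j⟩)

theorem run_enumerate {I : Quench n m k} {t : ℝ} {s : Store} (hl : Loaded I t s) (ht : Tables s)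
    (h20 : s.nat 20 = 0) (h22 : s.nat 22 = 0) (h23 : s.nat 23 = 0) (h24 : s.nat 24 = 0)
    (hr : s.real 24 = 0) : ∃ gen, Enum I (Prog.enumerate.run s) k I.dimK gen := by
  obtain ⟨d, gen, hE⟩ := run_addTerms hl ht h20 h22 h23 h24 hr le_rfl
  have hk : (NExpr.get 0 (.lit 0) (.lit 2)).eval (Prog.initGroup.run s) = k :=
    (hl.mono (Prog.initGroup.agree_run rfl s) rfl).perts
  have hrun : Prog.enumerate.run s =
      (Prog.loop 60 (.lit k) .addTerm).run (Prog.initGroup.run s) := by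
    rw [Prog.enumerate, run_seq, Prog.run, Prog.run, hk]
    rfl
  have := hE.dim_eq
  subst this
  exact ⟨gen, hrun ▸ hE⟩

/-- The preparations are complete: the stabilizer rows are set up, and the group generated by the
perturbation is listed. -/
structure Ready (I : Quench n m k) (t : ℝ) (s : Store) (gen : ℕ → PauliString n) : Prop
    extends Setup I t s where
  enum : Enum I s k I.dimK gen

theorem Ready.mono {I : Quench n m k} {t : ℝ} {s s' : Store} {gen : ℕ → PauliString n}
    (h : Ready I t s gen) {c : Prog} (ha : Agree c s s')
    (hk : c.keeps [0, 1, 2, 3, 4, 5, 6, 7, 8, 20, 21, 22, 23, 24, 25, 33, 34, 35]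
      [0, 1, 2, 20, 21, 22, 23, 24, 27, 28] = true) : Ready I t s' gen := by
  simp only [Prog.keeps, List.all_cons, List.all_nil, Bool.and_true, Bool.and_eq_true,
    Bool.not_eq_true'] at hk
  have hE := h.enum
  have hn := fun a h => congrFun (congrFun (ha.nat a h) 0)
  have e1 : ∀ i, s'.nat 20 0 i = s.nat 20 0 i := fun i => by rw [ha.nat 20 (by simp [hk])]
  refine ⟨h.toSetup.mono ha (by simp [Prog.keeps, hk]), ⟨?_, ?_, ⟨?_, ?_⟩, ⟨?_, ?_⟩, ?_, ?_, ?_,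
    hE.inj, hE.mem, hE.cov⟩⟩
  · rw [ha.nat 20 (by simp [hk])]; exact hE.order
  · rw [ha.nat 20 (by simp [hk])]; exact hE.dim
  · rw [ha.nat 22 (by simp [hk])]; exact hE.listed.x
  · rw [ha.nat 23 (by simp [hk])]; exact hE.listed.z
  · rw [ha.nat 24 (by simp [hk])]; exact hE.tabled.xor
  · rw [ha.real 23 (by simp [hk])]; exact hE.tabled.walsh
  · rw [ha.nat 25 (by simp [hk])]; exact hE.pow
  · rw [ha.real 24 (by simp [hk])]; exact hE.gam
  · rw [ha.real 24 (by simp [hk])]; exact hE.gam_zero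

/-! ### Unperturbed energies -/

/-- Multiply the commutation sign with the generator `cell 75` into the accumulator. -/
def Prog.commSign (hx hz : NExpr) : Prog :=
  .seq (.setR 31 (.lit 0) (.lit 0) (.lit 1)) <|
  .loop 74 .qubits <|
  .setR 31 (.lit 0) (.lit 0) (.mul (.cell 31)
    (.mul (.sign hx (.get 23 (.at 25 (.cell 75)) (.cell 74)))
      (.sign hz (.get 22 (.at 25 (.cell 75)) (.cell 74)))))

/-- Compute the index of the Walsh function that describes the commutation of a Pauli string with
the listed group. -/
def Prog.charIdx (hx hz : NExpr) : Prog :=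
  .seq (.setN 37 (.lit 0) (.lit 0) (.lit 0)) <|
  .loop 75 (.get 20 (.lit 0) (.lit 1)) <|
  .seq (.commSign hx hz) <|
  .ite (.realLt (.cell 31) (.lit 0))
    (.setN 37 (.lit 0) (.lit 0) (.get 24 (.cell 37) (.at 25 (.cell 75)))) .skip

/-- The operands of `charIdx` evaluate to the given bits. -/
def Operand' {n : ℕ} (s : Store) (e : NExpr) (v : Vec n) : Prop :=
  ∀ s' : Store, (∀ a, a ≠ 37 → a ≠ 74 → a ≠ 75 → s'.nat a = s.nat a) →
    ∀ q : Fin n, s'.nat 74 0 0 = q → e.eval s' = (v q).val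

theorem bitSum_two_pow (gen : ℕ → PauliString n) {d l : ℕ} (hl : l < d) :
    bitSum gen d (2 ^ l) = gen l := by
  rw [bitSum, Finset.sum_eq_single l]
  · simp
  · intro b _ hb; simp [hb.symm]
  · intro h; exact absurd (Finset.mem_range.mpr hl) h

theorem symp_sum_right {ι : Type*} (Q : PauliString n) (s : Finset ι) (f : ι → PauliString n) :
    symp Q (∑ i ∈ s, f i) = ∑ i ∈ s, symp Q (f i) := by
  rw [symp_comm, symp_sum_left]
  exact Finset.sum_congr rfl fun i _ => symp_comm _ _

/-- Commutation with `Q` is a character of the group, so it is determined by its values on the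
generators; these are the binary digits of `c`. -/
theorem walsh_eq_chi {gen : ℕ → PauliString n} {d c : ℕ} {Q : PauliString n}
    (hc : ∀ l < d, c.testBit l = true ↔ symp Q (gen l) = 1) (a : ℕ) :
    walsh d c a = chi (symp Q (bitSum gen d a)) := by
  rw [bitSum, symp_sum_right, chi_sum, walsh]
  refine Finset.prod_congr rfl fun l hl => ?_
  have := hc l (Finset.mem_range.mp hl)
  cases ha : a.testBit l
  · simp [symp]
  · rcases zmod2_cases (symp Q (gen l)) with h | h
    · have : c.testBit l = false := by
        rw [Bool.eq_false_iff]; intro h'; rw [this.mp h'] at h; exact absurd h (by decide)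
      simp [h, this]
    · simp [h, this.mpr h]

theorem run_commSign {I : Quench n m k} {t : ℝ} {s : Store} {gen : ℕ → PauliString n}
    (hs : Ready I t s gen) {hx hz : NExpr} {Q : PauliString n} (hQx : Operand' s hx (xp Q))
    (hQz : Operand' s hz (zp Q)) {l : ℕ} (hl : l < I.dimK) (h75 : s.nat 75 0 0 = l) :
    ((Prog.commSign hx hz).run s).real 31 0 0 = chi (symp Q (gen l)) := by
  rw [Prog.commSign, run_seq]
  have a1 := (Prog.setR 31 (.lit 0) (.lit 0) (.lit 1)).agree_run rfl s
  have v1 : ((Prog.setR 31 (.lit 0) (.lit 0) (.lit 1)).run s).real 31 0 0 = 1 := by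
    simp [Prog.run, Store.setReal, NExpr.eval, RExpr.eval]
  have hs1 := hs.mono a1 rfl
  generalize (Prog.setR 31 (.lit 0) (.lit 0) (.lit 1)).run s = s1 at *
  have hn : NExpr.qubits.eval s1 = n := hs1.loaded.qubits
  have v := run_loop (x := 74) (e := .qubits) (s := s1) (c :=
    .setR 31 (.lit 0) (.lit 0) (.mul (.cell 31)
    (.mul (.sign hx (.get 23 (.at 25 (.cell 75)) (.cell 74)))
      (.sign hz (.get 22 (.at 25 (.cell 75)) (.cell 74)))))) rfl
    (fun j s' => s'.real 31 0 0 = pprod (fun q : Fin n =>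
      chi (xp Q q * zp (gen l) q) * chi (zp Q q * xp (gen l) q)) j) (by simp [v1]) (by
      intro j s' hj hc hag hi
      rw [hn] at hj
      have hs' := hs1.mono hag rfl
      have hop : ∀ a, a ≠ 37 → a ≠ 74 → a ≠ 75 → s'.nat a = s.nat a := fun a _ h2 _ => by
        rw [hag.nat a (by simp [Prog.modN, h2]), a1.nat a rfl]
      have e1 := hQx s' hop ⟨j, hj⟩ hc
      have e2 := hQz s' hop ⟨j, hj⟩ hc
      have e3 : s'.nat 75 0 0 = l := by rw [hag.nat 75 rfl, a1.nat 75 rfl, h75]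
      have e4 := hs'.enum.pow l hl
      have hlt : 2 ^ l < 2 ^ I.dimK := Nat.pow_lt_pow_right (by simp) hl
      have e5 := hs'.enum.listed.x _ hlt ⟨j, hj⟩
      have e6 := hs'.enum.listed.z _ hlt ⟨j, hj⟩
      rw [bitSum_two_pow _ hl] at e5 e6
      simp only at e5 e6
      rw [pprod_succ _ hj, ← hi]
      simp only [Prog.run, Store.setReal, NExpr.eval, RExpr.eval, and_self, if_true, e1, e2, e3, e4,
        hc, e5, e6, hs'.tables.sign])
  rw [hn] at v
  rw [v, pprod_self, Finset.prod_mul_distrib, symp, chi_add, dotProduct, dotProduct, chi_sum,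
    chi_sum]

/-- A generator that anticommutes with the string makes the product of signs negative; its digit is
then switched on by looking up the exclusive or with a power of two in the table of the group law.
-/
theorem run_charIdx {I : Quench n m k} {t : ℝ} {s : Store} {gen : ℕ → PauliString n}
    (hs : Ready I t s gen) {hx hz : NExpr} {Q : PauliString n} (hQx : Operand' s hx (xp Q))
    (hQz : Operand' s hz (zp Q)) :
    let c := ((Prog.charIdx hx hz).run s).nat 37 0 0
    c < 2 ^ I.dimK ∧ ∀ a, walsh I.dimK c a = chi (symp Q (bitSum gen I.dimK a)) := by
  rw [Prog.charIdx, run_seq]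
  have a1 := (Prog.setN 37 (.lit 0) (.lit 0) (.lit 0)).agree_run rfl s
  have v1 : ((Prog.setN 37 (.lit 0) (.lit 0) (.lit 0)).run s).nat 37 0 0 = 0 := by
    simp [Prog.run, Store.setNat, NExpr.eval]
  have hs1 := hs.mono a1 rfl
  generalize (Prog.setN 37 (.lit 0) (.lit 0) (.lit 0)).run s = s1 at *
  have hd : (NExpr.get 20 (.lit 0) (.lit 1)).eval s1 = I.dimK := hs1.enum.dim
  have v := run_loop (x := 75) (e := .get 20 (.lit 0) (.lit 1)) (s := s1) (c :=
    .seq (.commSign hx hz) <| .ite (.realLt (.cell 31) (.lit 0))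
    (.setN 37 (.lit 0) (.lit 0) (.get 24 (.cell 37) (.at 25 (.cell 75)))) .skip) rfl
    (fun j s' => s'.nat 37 0 0 < 2 ^ I.dimK ∧ ∀ l, (s'.nat 37 0 0).testBit l = true ↔
      l < j ∧ symp Q (gen l) = 1) ⟨by rw [v1]; positivity, by simp [v1]⟩ (by
      rintro j s' hj hc hag ⟨h1, h2⟩
      rw [hd] at hj
      have hop : ∀ a, a ≠ 37 → a ≠ 74 → a ≠ 75 → s'.nat a = s.nat a := fun a p1 p2 p3 => by
        rw [hag.nat a (by simp [Prog.modN, Prog.commSign, p1, p2, p3]),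
          a1.nat a (by simp [Prog.modN, p1])]
      have hs' := hs1.mono hag rfl
      have v2 := run_commSign hs' (fun s'' h q hq => hQx s''
        (fun a p1 p2 p3 => by rw [h a p1 p2 p3, hop a p1 p2 p3]) q hq)
        (fun s'' h q hq => hQz s''
        (fun a p1 p2 p3 => by rw [h a p1 p2 p3, hop a p1 p2 p3]) q hq) hj hc
      have a2 := (Prog.commSign hx hz).agree_run rfl s'
      have hs2 := hs'.mono a2 rfl
      rw [run_seq]
      have e1 : ((Prog.commSign hx hz).run s').nat 37 0 0 = s'.nat 37 0 0 := by rw [a2.nat 37 rfl]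
      have e2 : ((Prog.commSign hx hz).run s').nat 75 0 0 = j := by rw [a2.nat 75 rfl, hc]
      generalize (Prog.commSign hx hz).run s' = s2 at *
      have e3 := hs2.enum.pow j hj
      have hlt : 2 ^ j < 2 ^ I.dimK := Nat.pow_lt_pow_right (by simp) hj
      rcases zmod2_cases (symp Q (gen j)) with h | h
      · rw [run_ite_neg _ _ (by simp [Test.holds, RExpr.eval, NExpr.eval, v2, h])]
        simp only [Prog.run, e1]
        refine ⟨h1, fun l => (h2 l).trans ⟨fun h' => ⟨by omega, h'.2⟩, fun h' => ⟨?_, h'.2⟩⟩⟩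
        rcases Nat.lt_succ_iff_lt_or_eq.mp h'.1 with hlt | rfl
        · exact hlt
        · rw [h] at h'; exact absurd h'.2 (by decide)
      · rw [run_ite_pos _ _ (by simp [Test.holds, RExpr.eval, NExpr.eval, v2, h])]
        have e4 : ((Prog.setN 37 (.lit 0) (.lit 0)
            (.get 24 (.cell 37) (.at 25 (.cell 75)))).run s2).nat 37 0 0 =
            s'.nat 37 0 0 ^^^ 2 ^ j := by
          simp only [Prog.run, Store.setNat, NExpr.eval, and_self, if_true, e1, e2, e3]
          exact hs2.enum.tabled.xor _ h1 _ hlt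
        rw [e4]
        refine ⟨Nat.xor_lt_two_pow h1 hlt, fun l => ?_⟩
        rw [Nat.testBit_xor, Nat.testBit_two_pow]
        by_cases hl : l = j
        · subst hl
          have : (s'.nat 37 0 0).testBit l = false := by
            rw [Bool.eq_false_iff]; intro h'; exact absurd ((h2 l).mp h').1 (lt_irrefl _)
          simp [this, h]
        · have : ¬ j = l := fun h => hl h.symm
          simp only [this, decide_false, Bool.xor_false, h2]
          exact ⟨fun h' => ⟨by omega, h'.2⟩, fun h' => ⟨by omega, h'.2⟩⟩)
  rw [hd] at v
  exact ⟨v.1, walsh_eq_chi fun l hl => (v.2 l).trans ⟨fun h => h.2, fun h => ⟨hl, h⟩⟩⟩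

/-- Add the coefficient of the term `cell 60` to the cell of its Walsh function. -/
def Prog.bucketStep : Prog :=
  .seq (.relC (.get 3 (.cell 60) (.cell 72)) (.get 4 (.cell 60) (.cell 72)) (.lit 0) (.lit 0)) <|
  .seq (.charIdx (.get 3 (.cell 60) (.cell 74)) (.get 4 (.cell 60) (.cell 74))) <|
  .setR 32 (.lit 0) (.cell 37) (.add (.at 32 (.cell 37)) (.mul (.at 0 (.cell 60)) (.cell 29)))

/-- Sort the coefficients of the stabilizer Hamiltonian according to their Walsh functions. -/
def Prog.buckets : Prog := .loop 60 (.get 0 (.lit 0) (.lit 1)) .bucketStep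

/-- A term of `H₀` influences the energies only through its eigenvalue and its character on the
listed group. Adding up coefficients with equal characters makes the work per term independent of
the order of the group. -/
theorem run_buckets {I : Quench n m k} {t : ℝ} {s : Store} {gen : ℕ → PauliString n}
    (hs : Ready I t s gen) (h32 : s.real 32 = 0) (a : ℕ) :
    ∑ c ∈ Finset.range (2 ^ I.dimK), (Prog.buckets.run s).real 32 0 c * walsh I.dimK c a =
      ∑ j, I.α j * I.lam (I.h j) * chi (symp (I.h j) (bitSum gen I.dimK a)) := by
  have hm : (NExpr.get 0 (.lit 0) (.lit 1)).eval s = m := hs.loaded.terms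
  have v := run_loop (x := 60) (e := .get 0 (.lit 0) (.lit 1)) (s := s) (c := .bucketStep) rfl
    (fun j s' => ∑ c ∈ Finset.range (2 ^ I.dimK), s'.real 32 0 c * walsh I.dimK c a =
      ∑ i : Fin m, if (i : ℕ) < j then
        I.α i * I.lam (I.h i) * chi (symp (I.h i) (bitSum gen I.dimK a)) else 0)
    (by simp [h32]) (by
      intro j s' hj hc hag hi
      rw [hm] at hj
      have hs' := hs.mono hag rfl
      rw [Prog.bucketStep, run_seq, run_seq]
      let c1 : Prog :=
        .relC (.get 3 (.cell 60) (.cell 72)) (.get 4 (.cell 60) (.cell 72)) (.lit 0) (.lit 0)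
      have v1 := run_relC (I := I) (A := I.h ⟨j, hj⟩) (B := 0)
        (ax := .get 3 (.cell 60) (.cell 72)) (az := .get 4 (.cell 60) (.cell 72)) (bx := .lit 0)
        (bz := .lit 0) hs'.toSetup
        (fun s'' h q h72 => by
          simp only [NExpr.eval, h72, h 60 (by simp) (by simp) (by simp),
            h 3 (by simp) (by simp) (by simp), hc]
          exact hs'.loaded.hx ⟨j, hj⟩ q)
        (fun s'' h q h72 => by
          simp only [NExpr.eval, h72, h 60 (by simp) (by simp) (by simp),
            h 4 (by simp) (by simp) (by simp), hc]
          exact hs'.loaded.hz ⟨j, hj⟩ q)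
        (fun s'' h q h72 => by simp [NExpr.eval]) (fun s'' h q h72 => by simp [NExpr.eval])
      have a1 := c1.agree_run rfl s'
      have hs1 := hs'.mono a1 rfl
      have h60 : (c1.run s').nat 60 0 0 = j := by rw [a1.nat 60 rfl, hc]
      have e32 : (c1.run s').real 32 = s'.real 32 := a1.real 32 rfl
      change (c1.run s').cx 29 0 0 = _ at v1
      change ∑ c ∈ _, (Prog.run _ (Prog.run _ (c1.run s'))).real 32 0 c * _ = _
      generalize c1.run s' = s1 at *
      let c2 : Prog := .charIdx (.get 3 (.cell 60) (.cell 74)) (.get 4 (.cell 60) (.cell 74))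
      have v2 := run_charIdx hs1 (Q := I.h ⟨j, hj⟩) (hx := .get 3 (.cell 60) (.cell 74))
        (hz := .get 4 (.cell 60) (.cell 74))
        (fun s'' h q h74 => by
          simp only [NExpr.eval, h74, h 60 (by simp) (by simp) (by simp),
            h 3 (by simp) (by simp) (by simp), h60]
          exact hs1.loaded.hx ⟨j, hj⟩ q)
        (fun s'' h q h74 => by
          simp only [NExpr.eval, h74, h 60 (by simp) (by simp) (by simp),
            h 4 (by simp) (by simp) (by simp), h60]
          exact hs1.loaded.hz ⟨j, hj⟩ q)
      have a2 := c2.agree_run rfl s1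
      have hs2 := hs1.mono a2 rfl
      have h60' : (c2.run s1).nat 60 0 0 = j := by rw [a2.nat 60 rfl, h60]
      have e32' : (c2.run s1).real 32 = s'.real 32 := by rw [a2.real 32 rfl, e32]
      have e29 : (c2.run s1).real 29 0 0 = I.lam (I.h ⟨j, hj⟩) := by
        rw [a2.real 29 rfl]
        change (s1.cx 29 0 0).re = _
        rw [v1]; simp [Quench.lam]
      change let c := (c2.run s1).nat 37 0 0; _ at v2
      change ∑ c ∈ _, (Prog.run _ (c2.run s1)).real 32 0 c * _ = _
      generalize c2.run s1 = s2 at *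
      obtain ⟨k1, k2⟩ := v2
      have hα : s2.real 0 0 j = I.α ⟨j, hj⟩ := hs2.loaded.α ⟨j, hj⟩
      have hnew : ∀ c, ((Prog.setR 32 (.lit 0) (.cell 37) (.add (.at 32 (.cell 37))
          (.mul (.at 0 (.cell 60)) (.cell 29)))).run s2).real 32 0 c = s'.real 32 0 c +
          if c = s2.nat 37 0 0 then I.α ⟨j, hj⟩ * I.lam (I.h ⟨j, hj⟩) else 0 := by
        intro c
        simp only [Prog.run, Store.setReal, NExpr.eval, RExpr.eval, h60', hα, e29, e32', true_and]
        split_ifs with h <;> simp [h]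
      simp only [hnew, add_mul, Finset.sum_add_distrib, hi, ite_mul, zero_mul]
      rw [Finset.sum_ite_eq' (Finset.range (2 ^ I.dimK)), if_pos (Finset.mem_range.mpr k1), k2]
      have : ∀ F : Fin m → ℝ, F ⟨j, hj⟩ = ∑ i : Fin m, if (i : ℕ) = j then F i else 0 := by
        intro F
        rw [Finset.sum_eq_single ⟨j, hj⟩]
        · simp
        · intro b _ hb; rw [if_neg fun h => hb (Fin.ext h)]
        · simp
      rw [this fun i => I.α i * I.lam (I.h i) * chi (symp (I.h i) (bitSum gen I.dimK a)),
        ← Finset.sum_add_distrib]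
      refine Finset.sum_congr rfl fun i _ => ?_
      by_cases h : (i : ℕ) = j
      · simp [h]
      · have : (i : ℕ) < j + 1 ↔ (i : ℕ) < j := by omega
        simp [h, this])
  rw [hm] at v
  exact v.trans (Finset.sum_congr rfl fun i _ => if_pos i.2)

/-- Compute the unperturbed energies. -/
def Prog.energies : Prog :=
  .fillR 33 (.lit 0) 63 (.cell 20) (.sumR 31 65 (.cell 20) .skip
    (.mul (.at 32 (.cell 65)) (.get 23 (.cell 65) (.cell 63)))) (.sub (.lit 0) (.cell 31))

theorem run_energies {I : Quench n m k} {t : ℝ} {s : Store} {gen : ℕ → PauliString n}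
    (hs : Ready I t s gen)
    (hb : ∀ a, ∑ c ∈ Finset.range (2 ^ I.dimK), s.real 32 0 c * walsh I.dimK c a =
      ∑ j, I.α j * I.lam (I.h j) * chi (symp (I.h j) (bitSum gen I.dimK a))) :
    ∀ a < 2 ^ I.dimK, (Prog.energies.run s).real 33 0 a = I.energy (bitSum gen I.dimK a) := by
  intro a ha
  have hD : (NExpr.cell 20).eval s = 2 ^ I.dimK := hs.enum.order
  rw [Prog.energies, run_fillR rfl rfl rfl 0 (fun _ _ => rfl)
    (fun a => I.energy (bitSum gen I.dimK a)), hD, if_pos ⟨rfl, ha⟩]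
  intro j s' hj hc hag
  have hs' := hs.mono hag rfl
  have hD' : (NExpr.cell 20).eval s' = 2 ^ I.dimK := hs'.enum.order
  rw [hD] at hj
  have := run_sumR (acc := 31) (x := 65) (N := .cell 20) (c := .skip)
    (e := .mul (.at 32 (.cell 65)) (.get 23 (.cell 65) (.cell 63))) (s := s') rfl rfl
    (fun c => s.real 32 0 c * walsh I.dimK c j) (by
      intro c s2 hc2 hx2 hag2
      have hs2 := hs'.mono hag2 rfl
      rw [hD'] at hc2
      have e1 : s2.nat 63 0 0 = j := by rw [hag2.nat 63 rfl, hc]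
      simp only [Prog.run, RExpr.eval, NExpr.eval, hx2, e1, hag2.real 32 rfl, hag.real 32 rfl,
        hs2.enum.tabled.walsh c hc2 j hj])
  rw [hD', hb] at this
  simp only [RExpr.eval, NExpr.eval, this, Quench.energy]
  simp

end

section

open Polynomial

variable {n m k : ℕ}

/-- Extend a finite family by zero. -/
def extz {D : ℕ} {R : Type*} [Zero R] (f : Fin D → R) (x : ℕ) : R := if h : x < D then f ⟨x, h⟩ else 0

theorem extz_of_lt {D : ℕ} {R : Type*} [Zero R] (f : Fin D → R) {x : ℕ} (h : x < D) :
    extz f x = f ⟨x, h⟩ := dif_pos h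

theorem extz_val {D : ℕ} {R : Type*} [Zero R] (f : Fin D → R) (x : Fin D) : extz f x = f x :=
  dif_pos x.2

theorem sum_range_extz {D : ℕ} {R : Type*} [AddCommMonoid R] (f : Fin D → R) :
    ∑ x ∈ Finset.range D, extz f x = ∑ x, f x := by
  rw [Finset.sum_range]
  exact Finset.sum_congr rfl fun x _ => extz_val f x

/-! ### The Hamiltonian in the listed basis -/

/-- The listed group elements. -/
def elts (I : Quench n m k) (gen : ℕ → PauliString n) (a : Fin (2 ^ I.dimK)) : PauliString n :=
  bitSum gen I.dimK a

/-- The loop of `matEntry`. -/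
def Prog.matPhase : Prog :=
  .loop 64 .qubits <|
  .setC 36 (.lit 0) (.lit 0) (.mul (.cell 36) (.smul
    (.sign (.get 23 (.get 24 (.cell 63) (.cell 65)) (.cell 64)) (.get 22 (.cell 65) (.cell 64)))
    (.phase (.get 22 (.get 24 (.cell 63) (.cell 65)) (.cell 64))
      (.get 23 (.get 24 (.cell 63) (.cell 65)) (.cell 64)))))

/-- Compute one matrix entry. -/
def Prog.matEntry : Prog :=
  .seq (.setC 36 (.lit 0) (.lit 0) (.ofReal (.at 24 (.get 24 (.cell 63) (.cell 65))))) <|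
  .seq .matPhase <|
  .ite (.natEq (.cell 63) (.cell 65))
    (.setC 36 (.lit 0) (.lit 0) (.add (.cell 36) (.ofReal (.at 33 (.cell 63))))) .skip

/-- Compute the matrix of the Hamiltonian. -/
def Prog.fillMat : Prog := .fillC₂ 34 63 (.cell 20) 65 (.cell 20) .matEntry (.cell 36)

/-- The index of the sum of two elements comes from the table of the group law, so the phase and the
sign of an entry cost one pass over the qubits. -/
theorem run_matEntry {I : Quench n m k} {t : ℝ} {s : Store} {gen : ℕ → PauliString n}
    (hs : Ready I t s gen) {a b : Fin (2 ^ I.dimK)} (ha : s.nat 63 0 0 = a) (hb : s.nat 65 0 0 = b)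
    (hE : s.real 33 0 a = I.energy (elts I gen a)) :
    (Prog.matEntry.run s).cx 36 0 0 = I.blockH (elts I gen) a b := by
  have hE' := hs.enum
  have hc := hE'.tabled.xor a a.2 b b.2
  have hclt : (a : ℕ) ^^^ b < 2 ^ I.dimK := Nat.xor_lt_two_pow a.2 b.2
  have hT : bitSum gen I.dimK ((a : ℕ) ^^^ b) = elts I gen a + elts I gen b := bitSum_xor _ _ _ _
  have hγ : s.real 24 0 ((a : ℕ) ^^^ b) = I.gam (elts I gen a + elts I gen b) := by
    rw [hE'.gam _ hclt, Quench.gam, hT]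
    exact Finset.sum_congr rfl fun j _ => by simp
  rw [Prog.matEntry, run_seq, run_seq]
  let c1 : Prog := .setC 36 (.lit 0) (.lit 0) (.ofReal (.at 24 (.get 24 (.cell 63) (.cell 65))))
  have a1 := c1.agree_run rfl s
  have v1 : (c1.run s).cx 36 0 0 = I.gam (elts I gen a + elts I gen b) := by
    rw [run_setC_cx _ _ _ _ (by simp) rfl]
    simp [NExpr.eval, RExpr.eval, ha, hb, hc, hγ]
  have hs1 := hs.mono a1 rfl
  have ha1 : (c1.run s).nat 63 0 0 = a := by rw [a1.nat 63 rfl, ha]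
  have hb1 : (c1.run s).nat 65 0 0 = b := by rw [a1.nat 65 rfl, hb]
  have hE1 : (c1.run s).real 33 0 a = I.energy (elts I gen a) := by rw [a1.real 33 rfl, hE]
  change (Prog.run _ (Prog.run _ (c1.run s))).cx 36 0 0 = _
  generalize c1.run s = s1 at *
  have hn : NExpr.qubits.eval s1 = n := hs1.loaded.qubits
  have v := run_loop (x := 64) (e := .qubits) (s := s1) (c :=
    .setC 36 (.lit 0) (.lit 0) (.mul (.cell 36) (.smul
    (.sign (.get 23 (.get 24 (.cell 63) (.cell 65)) (.cell 64)) (.get 22 (.cell 65) (.cell 64)))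
    (.phase (.get 22 (.get 24 (.cell 63) (.cell 65)) (.cell 64))
      (.get 23 (.get 24 (.cell 63) (.cell 65)) (.cell 64)))))) rfl
    (fun j s' => s'.cx 36 0 0 = I.gam (elts I gen a + elts I gen b) * pprod (fun q : Fin n =>
      (chi (zp (elts I gen a + elts I gen b) q * xp (elts I gen b) q) : ℂ) *
      ph1 (xp (elts I gen a + elts I gen b) q) (zp (elts I gen a + elts I gen b) q)) j)
    (by simp [v1]) (by
      intro j s' hj hc' hag hi
      rw [hn] at hj
      have hs' := hs1.mono hag rfl
      have ha' : s'.nat 63 0 0 = a := by rw [hag.nat 63 rfl, ha1]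
      have hb' : s'.nat 65 0 0 = b := by rw [hag.nat 65 rfl, hb1]
      have e1 := hs'.enum.tabled.xor a a.2 b b.2
      have e2 := hs'.enum.listed.x _ hclt ⟨j, hj⟩
      have e3 := hs'.enum.listed.z _ hclt ⟨j, hj⟩
      have e4 : s'.nat 22 b j = (xp (elts I gen b) ⟨j, hj⟩).val := hs'.enum.listed.x _ b.2 ⟨j, hj⟩
      rw [hT] at e2 e3
      simp only at e2 e3
      rw [run_setC_cx _ _ _ _ (by simp) rfl, pprod_succ _ hj]
      simp only [NExpr.eval, and_self, if_true, CExpr.eval_mul, CExpr.eval_smul, CExpr.eval_get,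
        RExpr.eval, ha', hb', hc', e1, e2, e3, e4, hs'.tables.sign, hs'.tables.phase, hi]
      ring)
  rw [hn] at v
  have a2 := Prog.matPhase.agree_run rfl s1
  change (Prog.matPhase.run s1).cx 36 0 0 = _ at v
  have ha2 : (Prog.matPhase.run s1).nat 63 0 0 = a := by rw [a2.nat 63 rfl, ha1]
  have hb2 : (Prog.matPhase.run s1).nat 65 0 0 = b := by rw [a2.nat 65 rfl, hb1]
  have hE2 : (Prog.matPhase.run s1).real 33 0 a = I.energy (elts I gen a) := by
    rw [a2.real 33 rfl, hE1]
  generalize Prog.matPhase.run s1 = s2 at *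
  rw [pprod_self, Finset.prod_mul_distrib, ← Complex.ofReal_prod, ← chi_sum] at v
  rw [Quench.blockH]
  by_cases hab : a = b
  · rw [run_ite_pos _ _ (by simp [Test.holds, NExpr.eval, ha2, hb2, hab]),
      run_setC_cx _ _ _ _ (by simp) rfl, if_pos hab]
    simp only [NExpr.eval, and_self, if_true, CExpr.eval_add, CExpr.eval_get, CExpr.eval_ofReal,
      RExpr.eval, v, ha2, hE2, iph, dotProduct]
    ring
  · rw [run_ite_neg _ _ (by simpa [Test.holds, NExpr.eval, ha2, hb2, Fin.ext_iff] using hab),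
      if_neg hab]
    change s2.cx 36 0 0 = _
    rw [v, iph, dotProduct]
    ring

theorem run_fillMat {I : Quench n m k} {t : ℝ} {s : Store} {gen : ℕ → PauliString n}
    (hs : Ready I t s gen)
    (hE : ∀ a : Fin (2 ^ I.dimK), s.real 33 0 a = I.energy (elts I gen a)) :
    ∀ a b : Fin (2 ^ I.dimK), (Prog.fillMat.run s).cx 34 a b = I.blockH (elts I gen) a b := by
  intro a b
  have hD : (NExpr.cell 20).eval s = 2 ^ I.dimK := hs.enum.order
  rw [Prog.fillMat, run_fillC₂ (a := 34) (x := 63) (y := 65) (M := .cell 20) (N := .cell 20)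
    (c := .matEntry) (e := .cell 36) rfl (by simp) rfl rfl rfl rfl (by simp) rfl (2 ^ I.dimK)
    (fun s' hag => (hs.mono hag rfl).enum.order)
    (fun a b => extz (fun a => extz (fun b => I.blockH (elts I gen) a b) b) a), hD,
    if_pos ⟨a.2, b.2⟩, extz_val, extz_val]
  intro i j s' hi hj hx hy hag
  rw [hD] at hi
  have := run_matEntry (hs.mono hag rfl) (a := ⟨i, hi⟩) (b := ⟨j, hj⟩) hx hy
    (by rw [hag.real 33 rfl]; exact hE ⟨i, hi⟩)
  rw [extz_of_lt _ hi, extz_of_lt _ hj]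
  exact this

/-! ### The Lanczos recursion as a sequence -/

/-- The state of the Lanczos recursion. -/
structure LzState (ι : Type*) where
  /-- The previous vector. -/
  prev : ι → ℂ
  /-- The current vector. -/
  cur : ι → ℂ
  /-- The current off-diagonal coefficient. -/
  b : ℝ
  /-- The previous polynomial. -/
  pprev : ℝ[X]
  /-- The current polynomial. -/
  p : ℝ[X]

section

variable {ι : Type*} [Fintype ι] (M : Matrix ι ι ℂ)

/-- The squared norm of a vector. -/
def sqNorm (v : ι → ℂ) : ℝ := ∑ i, ‖v i‖ ^ 2

/-- The diagonal coefficient. -/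
def LzState.a (S : LzState ι) : ℝ := (star S.cur ⬝ᵥ M.mulVec S.cur).re / sqNorm S.cur

/-- The next vector. -/
def LzState.next (S : LzState ι) : ι → ℂ :=
  M.mulVec S.cur - (S.a M : ℂ) • S.cur - (S.b : ℂ) • S.prev

/-- One step of the Lanczos recursion. -/
def LzState.step (S : LzState ι) : LzState ι where
  prev := S.cur
  cur := S.next M
  b := sqNorm (S.next M) / sqNorm S.cur
  pprev := S.p
  p := (X - C (S.a M)) * S.p - C S.b * S.pprev

/-- The Lanczos recursion. -/
def lz (v₀ : ι → ℂ) : ℕ → LzState ι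
  | 0 => ⟨v₀, v₀, 0, 1, 1⟩
  | j + 1 => (lz v₀ j).step M

theorem lz_prev (v₀ : ι → ℂ) (j : ℕ) : (lz M v₀ j).prev = (lz M v₀ (j - 1)).cur ∧
    (lz M v₀ j).pprev = (lz M v₀ (j - 1)).p := by
  cases j <;> exact ⟨rfl, rfl⟩

theorem lanczos_lz (v₀ : ι → ℂ) (L : ℕ) (hpos : ∀ j < L, 0 < sqNorm (lz M v₀ j).cur) :
    Lanczos M (fun j => (lz M v₀ j).cur) (fun j => (lz M v₀ j).a M) (fun j => (lz M v₀ j).b)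
      (fun j => sqNorm (lz M v₀ j).cur) (fun j => (lz M v₀ j).p) L where
  P_zero := rfl
  P_succ j _ := by
    rw [← (lz_prev M v₀ j).2]; rfl
  v_succ j _ := by
    rw [← (lz_prev M v₀ j).1]; rfl
  nn_eq _ _ := rfl
  nn_pos := hpos
  a_eq _ _ := rfl
  b_zero := rfl
  b_succ _ _ := rfl

end

/-! ### The Lanczos recursion as a program -/

/-- Multiply the current vector by the matrix. -/
def Prog.lzMul : Prog :=
  .fillC 44 (.lit 0) 63 (.cell 20)
    (.sumC 36 65 (.cell 20) .skip
      (.mul (.get 34 (.cell 63) (.cell 65)) (.get 38 (.cell 38) (.cell 65)))) (.cell 36)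

/-- Compute the diagonal coefficient. -/
def Prog.lzDiag : Prog :=
  .seq (.sumC 36 63 (.cell 20) .skip
      (.mul (.conj (.get 38 (.cell 38) (.cell 63))) (.at 44 (.cell 63))))
    (.setR 41 (.lit 0) (.cell 38) (.div (.cell 36) (.at 40 (.cell 38))))

/-- Compute the next vector. -/
def Prog.lzNext : Prog :=
  .seq (.fillC 46 (.lit 0) 63 (.cell 20) .skip (.sub (.sub (.at 44 (.cell 63))
      (.smul (.at 41 (.cell 38)) (.get 38 (.cell 38) (.cell 63))))
      (.smul (.at 42 (.cell 38)) (.get 38 (.pred (.cell 38)) (.cell 63)))))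
    (.fillC 38 (.succ (.cell 38)) 63 (.cell 20) .skip (.at 46 (.cell 63)))

/-- Compute the next squared norm and the next off-diagonal coefficient. -/
def Prog.lzNorm : Prog :=
  .seq (.sumR 31 63 (.cell 20) .skip (.add (.mul (.at 46 (.cell 63)) (.at 46 (.cell 63)))
    (.mul (.at 47 (.cell 63)) (.at 47 (.cell 63))))) <|
  .seq (.setR 40 (.lit 0) (.succ (.cell 38)) (.cell 31))
    (.setR 42 (.lit 0) (.succ (.cell 38)) (.div (.cell 31) (.at 40 (.cell 38))))

/-- Compute the next polynomial. -/
def Prog.lzPoly : Prog :=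
  .seq (.fillR 48 (.lit 0) 63 (.cell 20)
    (.ite (.natLt (.lit 0) (.cell 63))
      (.setR 31 (.lit 0) (.lit 0) (.get 43 (.cell 38) (.pred (.cell 63))))
      (.setR 31 (.lit 0) (.lit 0) (.lit 0)))
    (.sub (.sub (.cell 31) (.mul (.at 41 (.cell 38)) (.get 43 (.cell 38) (.cell 63))))
      (.mul (.at 42 (.cell 38)) (.get 43 (.pred (.cell 38)) (.cell 63))))) <|
  .seq (.fillR 43 (.succ (.cell 38)) 63 (.cell 20) .skip (.at 48 (.cell 63)))
    (.setR 43 (.succ (.cell 38)) (.succ (.cell 38)) (.lit 1))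

/-- One step of the Lanczos recursion. -/
def Prog.lzStep : Prog :=
  .seq .lzMul <| .seq .lzDiag <| .seq .lzNext <| .seq .lzNorm <| .seq .lzPoly <|
  .setN 38 (.lit 0) (.lit 0) (.succ (.cell 38))

/-- The Lanczos recursion. -/
def Prog.lanczos : Prog :=
  .seq (.seq (.setR 38 (.lit 0) (.lit 0) (.lit 1)) <| .seq (.setR 40 (.lit 0) (.lit 0) (.lit 1))
    (.setR 43 (.lit 0) (.lit 0) (.lit 1))) <|
  .loop 66 (.cell 20) (.ite (.realLt (.lit 0) (.at 40 (.cell 38))) .lzStep .skip)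

/-- The data of the Lanczos recursion up to step `L` are in memory. -/
structure LzMem {D : ℕ} (M : Matrix (Fin D) (Fin D) ℂ) (v₀ : Fin D → ℂ) (s : Store) (L : ℕ) :
    Prop where
  order : s.nat 20 0 0 = D
  mat : ∀ a b : Fin D, s.cx 34 a b = M a b
  step : s.nat 38 0 0 = L
  vec : ∀ j ≤ L, ∀ x : Fin D, s.cx 38 j x = (lz M v₀ j).cur x
  norm : ∀ j ≤ L, s.real 40 0 j = sqNorm (lz M v₀ j).cur
  offdiag : ∀ j ≤ L, s.real 42 0 j = (lz M v₀ j).b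
  poly : ∀ j ≤ L, ∀ i ≤ D, s.real 43 j i = (lz M v₀ j).p.coeff i
  poly_zero : ∀ j > L, ∀ i, s.real 43 j i = 0

theorem run_lzMul {D : ℕ} {M : Matrix (Fin D) (Fin D) ℂ} {v₀ : Fin D → ℂ} {s : Store} {L : ℕ}
    (h : LzMem M v₀ s L) (a : Fin D) :
    (Prog.lzMul.run s).cx 44 0 a = M.mulVec (lz M v₀ L).cur a := by
  have hD : (NExpr.cell 20).eval s = D := h.order
  rw [Prog.lzMul, run_fillC (a := 44) (x := 63) (N := .cell 20) (e := .cell 36) rfl (by simp)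
    rfl rfl rfl rfl 0 (fun _ _ => rfl) (extz (M.mulVec (lz M v₀ L).cur)), hD, if_pos ⟨rfl, a.2⟩,
    extz_val]
  intro j s' hj hx hag
  rw [hD] at hj
  have hD' : (NExpr.cell 20).eval s' = D := by
    change s'.nat 20 0 0 = D
    rw [hag.nat 20 rfl]; exact h.order
  rw [CExpr.eval_get, NExpr.eval, run_sumC (acc := 36) (x := 65) (N := .cell 20) rfl (by simp)
    rfl rfl rfl (extz fun b => M ⟨j, hj⟩ b * (lz M v₀ L).cur b), hD', sum_range_extz,
    extz_of_lt _ hj]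
  · rfl
  · intro b s2 hb hx2 hag2
    rw [hD'] at hb
    have e1 : s2.nat 63 0 0 = j := by rw [hag2.nat 63 rfl, hx]
    have e2 : s2.nat 38 0 0 = L := by rw [hag2.nat 38 rfl, hag.nat 38 rfl, h.step]
    have e3 : s2.cx 34 j b = M ⟨j, hj⟩ ⟨b, hb⟩ := by
      rw [hag2.cx 34 rfl rfl, hag.cx 34 rfl rfl]; exact h.mat ⟨j, hj⟩ ⟨b, hb⟩
    have e4 : s2.cx 38 L b = (lz M v₀ L).cur ⟨b, hb⟩ := by
      rw [hag2.cx 38 rfl rfl, hag.cx 38 rfl rfl]; exact h.vec L le_rfl ⟨b, hb⟩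
    simp only [Prog.run, CExpr.eval_mul, CExpr.eval_get, NExpr.eval, e1, hx2, e2, e3, e4,
      extz_of_lt _ hb]

theorem run_lzDiag {D : ℕ} {M : Matrix (Fin D) (Fin D) ℂ} {v₀ : Fin D → ℂ} {s : Store} {L : ℕ}
    (h : LzMem M v₀ s L) (hW : ∀ a : Fin D, s.cx 44 0 a = M.mulVec (lz M v₀ L).cur a) :
    (Prog.lzDiag.run s).real 41 0 L = (lz M v₀ L).a M := by
  have hD : (NExpr.cell 20).eval s = D := h.order
  rw [Prog.lzDiag, run_seq]
  let c : Prog := .sumC 36 63 (.cell 20) .skip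
      (.mul (.conj (.get 38 (.cell 38) (.cell 63))) (.at 44 (.cell 63)))
  have v := run_sumC (acc := 36) (x := 63) (N := .cell 20) (c := .skip) (s := s)
    (e := .mul (.conj (.get 38 (.cell 38) (.cell 63))) (.at 44 (.cell 63))) rfl (by simp)
    rfl rfl rfl (extz fun b => star (lz M v₀ L).cur b * M.mulVec (lz M v₀ L).cur b) (by
      intro b s2 hb hx2 hag2
      rw [hD] at hb
      have e2 : s2.nat 38 0 0 = L := by rw [hag2.nat 38 rfl, h.step]
      have e4 : s2.cx 38 L b = (lz M v₀ L).cur ⟨b, hb⟩ := by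
        rw [hag2.cx 38 rfl rfl]; exact h.vec L le_rfl ⟨b, hb⟩
      have e5 : s2.cx 44 0 b = M.mulVec (lz M v₀ L).cur ⟨b, hb⟩ := by
        rw [hag2.cx 44 rfl rfl]; exact hW ⟨b, hb⟩
      simp only [Prog.run, CExpr.eval_mul, CExpr.eval_get, CExpr.eval_conj, NExpr.eval, hx2, e2, e4,
        e5, extz_of_lt _ hb]
      rfl)
  rw [hD, sum_range_extz] at v
  have a1 := c.agree_run rfl s
  have e1 : (c.run s).nat 38 0 0 = L := by rw [a1.nat 38 rfl, h.step]
  have e2 : (c.run s).real 40 0 L = sqNorm (lz M v₀ L).cur := by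
    rw [a1.real 40 rfl, h.norm L le_rfl]
  change (c.run s).cx 36 0 0 = star (lz M v₀ L).cur ⬝ᵥ M.mulVec (lz M v₀ L).cur at v
  change (Prog.run _ (c.run s)).real 41 0 L = _
  generalize c.run s = s1 at *
  simp only [Prog.run, Store.setReal, NExpr.eval, RExpr.eval, and_self, if_true, e1, e2, LzState.a,
    ← v]
  rfl

/-- For `L = 0` the truncated predecessor is row `0` again. This agrees with the initial state of
`lz`, where the previous vector is the start vector and its coefficient is `0`. -/
theorem run_lzNext {D : ℕ} {M : Matrix (Fin D) (Fin D) ℂ} {v₀ : Fin D → ℂ} {s : Store} {L : ℕ}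
    (h : LzMem M v₀ s L) (hW : ∀ a : Fin D, s.cx 44 0 a = M.mulVec (lz M v₀ L).cur a)
    (ha : s.real 41 0 L = (lz M v₀ L).a M) :
    (∀ a : Fin D, (Prog.lzNext.run s).cx 46 0 a = (lz M v₀ (L + 1)).cur a) ∧
    ∀ j ≤ L + 1, ∀ x : Fin D, (Prog.lzNext.run s).cx 38 j x = (lz M v₀ j).cur x := by
  have hD : (NExpr.cell 20).eval s = D := h.order
  rw [Prog.lzNext, run_seq]
  let e₁ : CExpr := .sub (.sub (.at 44 (.cell 63))
      (.smul (.at 41 (.cell 38)) (.get 38 (.cell 38) (.cell 63))))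
      (.smul (.at 42 (.cell 38)) (.get 38 (.pred (.cell 38)) (.cell 63)))
  let c : Prog := .fillC 46 (.lit 0) 63 (.cell 20) .skip e₁
  have v := run_fillC (a := 46) (x := 63) (i := .lit 0) (N := .cell 20) (c := .skip) (e := e₁)
    (s := s) rfl (by simp) rfl rfl rfl rfl 0 (fun _ _ => rfl) (extz (lz M v₀ (L + 1)).cur) (by
      intro b s2 hb hx2 hag2
      rw [hD] at hb
      have e2 : s2.nat 38 0 0 = L := by rw [hag2.nat 38 rfl, h.step]
      have e4 : s2.cx 38 L b = (lz M v₀ L).cur ⟨b, hb⟩ := by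
        rw [hag2.cx 38 rfl rfl]; exact h.vec L le_rfl ⟨b, hb⟩
      have e5 : s2.cx 38 (L - 1) b = (lz M v₀ L).prev ⟨b, hb⟩ := by
        rw [hag2.cx 38 rfl rfl, (lz_prev M v₀ L).1]; exact h.vec (L - 1) (by omega) ⟨b, hb⟩
      have e6 : s2.cx 44 0 b = M.mulVec (lz M v₀ L).cur ⟨b, hb⟩ := by
        rw [hag2.cx 44 rfl rfl]; exact hW ⟨b, hb⟩
      have e7 : s2.real 41 0 L = (lz M v₀ L).a M := by rw [hag2.real 41 rfl, ha]
      have e8 : s2.real 42 0 L = (lz M v₀ L).b := by rw [hag2.real 42 rfl, h.offdiag L le_rfl]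
      simp only [e₁, Prog.run, CExpr.eval_sub, CExpr.eval_smul, CExpr.eval_get, NExpr.eval,
        RExpr.eval, hx2, e2, e4, e5, e6, e7, e8, extz_of_lt _ hb]
      rfl)
  rw [hD] at v
  have a1 := c.agree_run rfl s
  change ∀ i' j', (c.run s).cx 46 i' j' = _ at v
  have hD1 : (NExpr.cell 20).eval (c.run s) = D := by
    change (c.run s).nat 20 0 0 = D
    rw [a1.nat 20 rfl]; exact h.order
  have e1 : (c.run s).nat 38 0 0 = L := by rw [a1.nat 38 rfl, h.step]
  have e38 : ∀ i j, (c.run s).cx 38 i j = s.cx 38 i j := a1.cx 38 rfl rfl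
  change (∀ a : Fin D, (Prog.run _ (c.run s)).cx 46 0 a = _) ∧
    ∀ j ≤ L + 1, ∀ x : Fin D, (Prog.run _ (c.run s)).cx 38 j x = _
  generalize c.run s = s1 at *
  have w := run_fillC (a := 38) (x := 63) (i := .succ (.cell 38)) (N := .cell 20) (c := .skip)
    (e := .at 46 (.cell 63)) (s := s1) rfl (by simp) rfl rfl rfl rfl (L + 1)
    (fun s2 hag => by
      simp only [Prog.run, NExpr.eval, hag.nat 38 rfl, e1]) (extz (lz M v₀ (L + 1)).cur) (by
      intro b s2 hb hx2 hag2
      rw [hD1] at hb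
      simp only [Prog.run, CExpr.eval_get, NExpr.eval, hx2]
      rw [hag2.cx 46 rfl rfl, v, if_pos ⟨rfl, hb⟩])
  rw [hD1] at w
  have a2 := (Prog.fillC 38 (.succ (.cell 38)) 63 (.cell 20) .skip (.at 46 (.cell 63))).agree_run rfl
    s1
  refine ⟨fun a => ?_, fun j hj x => ?_⟩
  · rw [a2.cx 46 rfl rfl, v, if_pos ⟨rfl, a.2⟩, extz_val]
  · rw [w]
    by_cases hjL : j = L + 1
    · rw [if_pos ⟨hjL, x.2⟩, extz_val, hjL]
    · rw [if_neg (by simp [hjL]), e38, h.vec j (by omega)]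

theorem run_lzNorm {D : ℕ} {M : Matrix (Fin D) (Fin D) ℂ} {v₀ : Fin D → ℂ} {s : Store} {L : ℕ}
    (hD : s.nat 20 0 0 = D) (hL : s.nat 38 0 0 = L)
    (hn : ∀ j ≤ L, s.real 40 0 j = sqNorm (lz M v₀ j).cur)
    (hb : ∀ j ≤ L, s.real 42 0 j = (lz M v₀ j).b)
    (hv : ∀ a : Fin D, s.cx 46 0 a = (lz M v₀ (L + 1)).cur a) :
    (∀ j ≤ L + 1, (Prog.lzNorm.run s).real 40 0 j = sqNorm (lz M v₀ j).cur) ∧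
    ∀ j ≤ L + 1, (Prog.lzNorm.run s).real 42 0 j = (lz M v₀ j).b := by
  have hD0 : (NExpr.cell 20).eval s = D := hD
  rw [Prog.lzNorm, run_seq]
  let e : RExpr := .add (.mul (.at 46 (.cell 63)) (.at 46 (.cell 63)))
    (.mul (.at 47 (.cell 63)) (.at 47 (.cell 63)))
  let c : Prog := .sumR 31 63 (.cell 20) .skip e
  have v := run_sumR (acc := 31) (x := 63) (N := .cell 20) (c := .skip) (s := s) (e := e) rfl rfl
    (extz fun x => ‖(lz M v₀ (L + 1)).cur x‖ ^ 2) (by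
      intro b s2 hb hx2 hag2
      rw [hD0] at hb
      rw [extz_of_lt _ hb, ← hv ⟨b, hb⟩, Complex.sq_norm, Complex.normSq_apply]
      simp only [e, Prog.run, RExpr.eval, NExpr.eval, hx2, hag2.real 46 rfl, hag2.real 47 rfl,
        Store.cx])
  rw [hD0, sum_range_extz] at v
  have a1 := c.agree_run rfl s
  have e1 : (c.run s).nat 38 0 0 = L := by rw [a1.nat 38 rfl, hL]
  have e2 : (c.run s).real 40 = s.real 40 := a1.real 40 rfl
  have e3 : (c.run s).real 42 = s.real 42 := a1.real 42 rfl
  change (c.run s).real 31 0 0 = sqNorm (lz M v₀ (L + 1)).cur at v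
  change (∀ j ≤ L + 1, (Prog.run _ (c.run s)).real 40 0 j = _) ∧
    ∀ j ≤ L + 1, (Prog.run _ (c.run s)).real 42 0 j = _
  generalize c.run s = s1 at *
  refine ⟨fun j hj => ?_, fun j hj => ?_⟩
  · simp only [Prog.run, Store.setReal, NExpr.eval, RExpr.eval, e1, v, e2]
    by_cases h : j = L + 1
    · simp [h]
    · simp [h, hn j (by omega)]
  · simp only [Prog.run, Store.setReal, NExpr.eval, RExpr.eval, e1, v, e2, e3]
    by_cases h : j = L + 1
    · simp only [h, and_self, if_true, true_and, show ¬ ((31 : ℕ) = 40) by simp, false_and,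
        if_false]
      rw [if_neg (by simp), hn L le_rfl]
      rfl
    · simp [h, hb j (by omega)]

theorem coeff_lz_succ {ι : Type*} [Fintype ι] (M : Matrix ι ι ℂ) (v₀ : ι → ℂ) (L i : ℕ) :
    (lz M v₀ (L + 1)).p.coeff i = (if 0 < i then (lz M v₀ L).p.coeff (i - 1) else 0) -
      (lz M v₀ L).a M * (lz M v₀ L).p.coeff i - (lz M v₀ L).b * (lz M v₀ (L - 1)).p.coeff i := by
  rw [← (lz_prev M v₀ L).2, lz, LzState.step]
  simp only
  rw [coeff_sub, sub_mul, coeff_sub, coeff_C_mul, coeff_C_mul]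
  rcases i with _ | i
  · simp
  · simp [coeff_X_mul]

/-- The fill loop has `D` rounds and reaches only the coefficients below `D`. The leading
coefficient can sit at index `D`, but it is known to be `1` and is written separately. -/
theorem run_lzPoly {D : ℕ} {M : Matrix (Fin D) (Fin D) ℂ} {v₀ : Fin D → ℂ} {s : Store} {L : ℕ}
    (hLD : L < D) (hpos : ∀ j < L + 1, 0 < sqNorm (lz M v₀ j).cur)
    (hD : s.nat 20 0 0 = D) (hL : s.nat 38 0 0 = L)
    (ha : s.real 41 0 L = (lz M v₀ L).a M) (hb : s.real 42 0 L = (lz M v₀ L).b)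
    (hp : ∀ j ≤ L, ∀ i ≤ D, s.real 43 j i = (lz M v₀ j).p.coeff i)
    (h0 : ∀ j > L, ∀ i, s.real 43 j i = 0) :
    (∀ j ≤ L + 1, ∀ i ≤ D, (Prog.lzPoly.run s).real 43 j i = (lz M v₀ j).p.coeff i) ∧
    ∀ j > L + 1, ∀ i, (Prog.lzPoly.run s).real 43 j i = 0 := by
  have hD0 : (NExpr.cell 20).eval s = D := hD
  rw [Prog.lzPoly, run_seq, run_seq]
  let c₀ : Prog := .ite (.natLt (.lit 0) (.cell 63))
      (.setR 31 (.lit 0) (.lit 0) (.get 43 (.cell 38) (.pred (.cell 63))))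
      (.setR 31 (.lit 0) (.lit 0) (.lit 0))
  let e : RExpr := .sub (.sub (.cell 31) (.mul (.at 41 (.cell 38)) (.get 43 (.cell 38) (.cell 63))))
      (.mul (.at 42 (.cell 38)) (.get 43 (.pred (.cell 38)) (.cell 63)))
  let c : Prog := .fillR 48 (.lit 0) 63 (.cell 20) c₀ e
  have v := run_fillR (a := 48) (i := .lit 0) (x := 63) (N := .cell 20) (c := c₀) (e := e) (s := s)
    rfl rfl rfl 0 (fun _ _ => rfl) (fun i => (lz M v₀ (L + 1)).p.coeff i) (by
      intro i s2 hi hx2 hag2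
      rw [hD0] at hi
      have e1 : s2.nat 38 0 0 = L := by rw [hag2.nat 38 rfl, hL]
      have e43 : s2.real 43 = s.real 43 := hag2.real 43 rfl
      have a2 := c₀.agree_run rfl s2
      have hc0 : (c₀.run s2).real 31 0 0 = if 0 < i then (lz M v₀ L).p.coeff (i - 1) else 0 := by
        by_cases h : 0 < i
        · rw [run_ite_pos _ _ (by simpa [Test.holds, NExpr.eval, hx2] using h), if_pos h,
            ← hp L le_rfl (i - 1) (by omega)]
          simp [Prog.run, Store.setReal, NExpr.eval, RExpr.eval, e1, hx2, e43]
        · rw [run_ite_neg _ _ (by simpa [Test.holds, NExpr.eval, hx2] using h), if_neg h]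
          simp [Prog.run, Store.setReal, NExpr.eval, RExpr.eval]
      have e2 : (c₀.run s2).nat = s2.nat := by
        funext a; exact a2.nat a rfl
      have e3 : (c₀.run s2).real 41 0 L = (lz M v₀ L).a M := by
        rw [a2.real 41 rfl, hag2.real 41 rfl, ha]
      have e4 : (c₀.run s2).real 42 0 L = (lz M v₀ L).b := by
        rw [a2.real 42 rfl, hag2.real 42 rfl, hb]
      have e5 : (c₀.run s2).real 43 = s.real 43 := by rw [a2.real 43 rfl, e43]
      rw [coeff_lz_succ, ← hc0, ← hp L le_rfl i (by omega), ← hp (L - 1) (by omega) i (by omega)]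
      simp only [e, RExpr.eval, NExpr.eval, e2, e1, hx2, e3, e4, e5])
  rw [hD0] at v
  have a1 := c.agree_run rfl s
  have hD1 : (NExpr.cell 20).eval (c.run s) = D := by
    change (c.run s).nat 20 0 0 = D
    rw [a1.nat 20 rfl, hD]
  have e1 : (c.run s).nat 38 0 0 = L := by rw [a1.nat 38 rfl, hL]
  have e43 : (c.run s).real 43 = s.real 43 := a1.real 43 rfl
  change ∀ i' j', (c.run s).real 48 i' j' = _ at v
  change (∀ j ≤ L + 1, ∀ i ≤ D, (Prog.run _ (Prog.run _ (c.run s))).real 43 j i = _) ∧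
    ∀ j > L + 1, ∀ i, (Prog.run _ (Prog.run _ (c.run s))).real 43 j i = 0
  generalize c.run s = s1 at *
  let c2 : Prog := .fillR 43 (.succ (.cell 38)) 63 (.cell 20) .skip (.at 48 (.cell 63))
  have w := run_fillR (a := 43) (i := .succ (.cell 38)) (x := 63) (N := .cell 20) (c := .skip)
    (e := .at 48 (.cell 63)) (s := s1) rfl rfl rfl (L + 1) (fun s2 hag => by
      simp only [Prog.run, NExpr.eval, hag.nat 38 rfl, e1])
    (fun i => (lz M v₀ (L + 1)).p.coeff i) (by
      intro b s2 hb hx2 hag2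
      rw [hD1] at hb
      simp only [Prog.run, RExpr.eval, NExpr.eval, hx2]
      rw [hag2.real 48 rfl, v, if_pos ⟨rfl, hb⟩])
  rw [hD1] at w
  have a2 := c2.agree_run rfl s1
  have e2 : (c2.run s1).nat 38 0 0 = L := by rw [a2.nat 38 rfl, e1]
  change ∀ i' j', (c2.run s1).real 43 i' j' = _ at w
  change (∀ j ≤ L + 1, ∀ i ≤ D, (Prog.run _ (c2.run s1)).real 43 j i = _) ∧
    ∀ j > L + 1, ∀ i, (Prog.run _ (c2.run s1)).real 43 j i = 0
  generalize c2.run s1 = s2 at *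
  obtain ⟨hm, hd⟩ := (lanczos_lz M v₀ (L + 1) hpos).monic_natDegree le_rfl
  simp only [Prog.run, Store.setReal, NExpr.eval, RExpr.eval, e2, w, e43, true_and]
  refine ⟨fun j hj i hi => ?_, fun j hj i => ?_⟩
  · by_cases h : j = L + 1
    · subst h
      by_cases h1 : i = L + 1
      · subst h1
        rw [if_pos ⟨rfl, rfl⟩]
        have h2 : (lz M v₀ (L + 1)).p.coeff (lz M v₀ (L + 1)).p.natDegree = 1 := hm
        rw [hd] at h2
        rw [h2]; simp
      · rw [if_neg (by simp [h1])]
        by_cases h2 : i < D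
        · rw [if_pos ⟨rfl, h2⟩]
        -- Here `i = D` and `L + 1 < D`: the cell has never been written, and the coefficient lies
        -- above the degree.
        · rw [if_neg (by simp [h2]), h0 _ (by omega), coeff_eq_zero_of_natDegree_lt]
          rw [hd]; omega
    · rw [if_neg (by simp [h]), if_neg (by simp [h]), hp j (by omega) i hi]
  · have h : j ≠ L + 1 := by omega
    rw [if_neg (by simp [h]), if_neg (by simp [h]), h0 j (by omega)]

theorem run_lzStep {D : ℕ} {M : Matrix (Fin D) (Fin D) ℂ} {v₀ : Fin D → ℂ} {s : Store} {L : ℕ}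
    (h : LzMem M v₀ s L) (hLD : L < D) (hpos : ∀ j < L + 1, 0 < sqNorm (lz M v₀ j).cur) :
    LzMem M v₀ (Prog.lzStep.run s) (L + 1) := by
  rw [Prog.lzStep, run_seq, run_seq, run_seq, run_seq, run_seq]
  have k1 := run_lzMul h
  have a1 := Prog.lzMul.agree_run rfl s
  generalize Prog.lzMul.run s = s1 at *
  have h1 : LzMem M v₀ s1 L := ⟨by rw [a1.nat 20 rfl]; exact h.order,
    by simp only [a1.cx 34 rfl rfl]; exact h.mat, by rw [a1.nat 38 rfl]; exact h.step,
    by simp only [a1.cx 38 rfl rfl]; exact h.vec, by rw [a1.real 40 rfl]; exact h.norm,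
    by rw [a1.real 42 rfl]; exact h.offdiag, by rw [a1.real 43 rfl]; exact h.poly,
    by rw [a1.real 43 rfl]; exact h.poly_zero⟩
  have k2 := run_lzDiag h1 k1
  have a2 := Prog.lzDiag.agree_run rfl s1
  generalize Prog.lzDiag.run s1 = s2 at *
  have h2 : LzMem M v₀ s2 L := ⟨by rw [a2.nat 20 rfl]; exact h1.order,
    by simp only [a2.cx 34 rfl rfl]; exact h1.mat, by rw [a2.nat 38 rfl]; exact h1.step,
    by simp only [a2.cx 38 rfl rfl]; exact h1.vec, by rw [a2.real 40 rfl]; exact h1.norm,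
    by rw [a2.real 42 rfl]; exact h1.offdiag, by rw [a2.real 43 rfl]; exact h1.poly,
    by rw [a2.real 43 rfl]; exact h1.poly_zero⟩
  obtain ⟨k3, k4⟩ := run_lzNext h2 (by simp only [a2.cx 44 rfl rfl]; exact k1) k2
  have a3 := Prog.lzNext.agree_run rfl s2
  generalize Prog.lzNext.run s2 = s3 at *
  obtain ⟨k5, k6⟩ := run_lzNorm (s := s3) (D := D) (L := L) (by rw [a3.nat 20 rfl]; exact h2.order)
    (by rw [a3.nat 38 rfl]; exact h2.step) (by rw [a3.real 40 rfl]; exact h2.norm)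
    (by rw [a3.real 42 rfl]; exact h2.offdiag) k3
  have a4 := Prog.lzNorm.agree_run rfl s3
  generalize Prog.lzNorm.run s3 = s4 at *
  obtain ⟨k7, k8⟩ := run_lzPoly (s := s4) (M := M) (v₀ := v₀) hLD hpos
    (by rw [a4.nat 20 rfl, a3.nat 20 rfl]; exact h2.order)
    (by rw [a4.nat 38 rfl, a3.nat 38 rfl]; exact h2.step)
    (by rw [a4.real 41 rfl, a3.real 41 rfl]; exact k2) (k6 L (by omega))
    (by rw [a4.real 43 rfl, a3.real 43 rfl]; exact h2.poly)
    (by rw [a4.real 43 rfl, a3.real 43 rfl]; exact h2.poly_zero)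
  have a5 := Prog.lzPoly.agree_run rfl s4
  generalize Prog.lzPoly.run s4 = s5 at *
  have a6 := (Prog.setN 38 (.lit 0) (.lit 0) (.succ (.cell 38))).agree_run rfl s5
  refine ⟨?_, ?_, ?_, ?_, ?_, ?_, ?_, ?_⟩
  · rw [a6.nat 20 rfl, a5.nat 20 rfl, a4.nat 20 rfl, a3.nat 20 rfl]; exact h2.order
  · intro a b
    rw [a6.cx 34 rfl rfl, a5.cx 34 rfl rfl, a4.cx 34 rfl rfl, a3.cx 34 rfl rfl]; exact h2.mat a b
  · simp only [Prog.run, Store.setNat, NExpr.eval, and_self, if_true, a5.nat 38 rfl, a4.nat 38 rfl,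
      a3.nat 38 rfl, h2.step]
  · intro j hj x
    rw [a6.cx 38 rfl rfl, a5.cx 38 rfl rfl, a4.cx 38 rfl rfl]; exact k4 j hj x
  · rw [a6.real 40 rfl, a5.real 40 rfl]; exact k5
  · rw [a6.real 42 rfl, a5.real 42 rfl]; exact k6
  · rw [a6.real 43 rfl]; exact k7
  · rw [a6.real 43 rfl]; exact k8

theorem sqNorm_nonneg {ι : Type*} [Fintype ι] (v : ι → ℂ) : 0 ≤ sqNorm v :=
  Finset.sum_nonneg fun _ _ => by positivity

/-- The loop always makes `D` rounds, but does nothing once a squared norm vanishes, which the exact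
comparison detects. If this has not happened before the last round, then `L = D`, and the norm
vanishes because the dimension is exhausted. -/
theorem run_lanczos {D : ℕ} (hD0 : 0 < D) {M : Matrix (Fin D) (Fin D) ℂ} (hM : M.IsHermitian)
    {s : Store} (hD : s.nat 20 0 0 = D) (hmat : ∀ a b : Fin D, s.cx 34 a b = M a b)
    (h38 : s.nat 38 = 0) (hr : ∀ a ∈ [38, 39, 40, 42, 43], s.real a = 0) :
    ∃ L ≤ D, LzMem M (Pi.single ⟨0, hD0⟩ 1) (Prog.lanczos.run s) L ∧
      (∀ j < L, 0 < sqNorm (lz M (Pi.single ⟨0, hD0⟩ 1) j).cur) ∧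
      sqNorm (lz M (Pi.single ⟨0, hD0⟩ 1) L).cur = 0 := by
  have r38 := hr 38 (by simp)
  have r39 := hr 39 (by simp)
  have r40 := hr 40 (by simp)
  have r42 := hr 42 (by simp)
  have r43 := hr 43 (by simp)
  rw [Prog.lanczos, run_seq]
  let c : Prog := .seq (.setR 38 (.lit 0) (.lit 0) (.lit 1)) <|
    .seq (.setR 40 (.lit 0) (.lit 0) (.lit 1)) (.setR 43 (.lit 0) (.lit 0) (.lit 1))
  have a1 := c.agree_run rfl s
  have hinit : LzMem M (Pi.single ⟨0, hD0⟩ 1) (c.run s) 0 := by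
    refine ⟨by rw [a1.nat 20 rfl]; exact hD, by simp only [a1.cx 34 rfl rfl]; exact hmat,
      by rw [a1.nat 38 rfl, h38]; rfl, ?_, ?_, ?_, ?_, ?_⟩
    · intro j hj x
      obtain rfl : j = 0 := by omega
      simp only [lz, Pi.single_apply, Fin.ext_iff]
      apply Complex.ext
      · simp only [Store.cx, c, Prog.run, Store.setReal, NExpr.eval, RExpr.eval, r38]
        by_cases h : (x : ℕ) = 0 <;> simp [h]
      · simp only [Store.cx, c, Prog.run, Store.setReal, NExpr.eval, RExpr.eval, r39]
        by_cases h : (x : ℕ) = 0 <;> simp [h]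
    · intro j hj
      obtain rfl : j = 0 := by omega
      have : sqNorm (Pi.single (⟨0, hD0⟩ : Fin D) (1 : ℂ)) = 1 := by
        rw [sqNorm, Finset.sum_eq_single ⟨0, hD0⟩] <;> simp +contextual
      rw [lz, this]
      simp [c, Prog.run, Store.setReal, NExpr.eval, RExpr.eval]
    · intro j hj
      obtain rfl : j = 0 := by omega
      simp [c, Prog.run, Store.setReal, r42, lz]
    · intro j hj i _
      obtain rfl : j = 0 := by omega
      simp only [c, Prog.run, Store.setReal, NExpr.eval, RExpr.eval, r43, lz, coeff_one, true_and]
      by_cases h : i = 0 <;> simp [h]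
    · intro j hj i
      have : j ≠ 0 := by omega
      simp [c, Prog.run, Store.setReal, NExpr.eval, RExpr.eval, r43, this]
  change ∃ L ≤ D, LzMem M _ (Prog.run _ (c.run s)) L ∧ _
  generalize c.run s = s1 at *
  have hD1 : (NExpr.cell 20).eval s1 = D := hinit.order
  have v := run_loop (x := 66) (e := .cell 20) (s := s1)
    (c := .ite (.realLt (.lit 0) (.at 40 (.cell 38))) .lzStep .skip) rfl
    (fun r s' => ∃ L ≤ r, LzMem M (Pi.single ⟨0, hD0⟩ 1) s' L ∧
      (∀ j < L, 0 < sqNorm (lz M (Pi.single ⟨0, hD0⟩ 1) j).cur) ∧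
      (L < r → sqNorm (lz M (Pi.single ⟨0, hD0⟩ 1) L).cur = 0))
    ⟨0, le_rfl, hinit, by simp, by simp⟩ (by
      rintro r s' hrD - - ⟨L, hL, hmem, hpos, hzero⟩
      rw [hD1] at hrD
      have hval : (RExpr.at 40 (.cell 38)).eval s' = sqNorm (lz M (Pi.single ⟨0, hD0⟩ 1) L).cur := by
        simp only [RExpr.eval, NExpr.eval, hmem.step, hmem.norm L le_rfl]
      have hT : Test.holds s' (.realLt (.lit 0) (.at 40 (.cell 38))) ↔
          0 < sqNorm (lz M (Pi.single ⟨0, hD0⟩ 1) L).cur := by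
        rw [Test.holds, hval]; simp [RExpr.eval]
      have hnn := sqNorm_nonneg (lz M (Pi.single ⟨0, hD0⟩ 1) L).cur
      by_cases h : 0 < sqNorm (lz M (Pi.single ⟨0, hD0⟩ 1) L).cur
      · rw [run_ite_pos _ _ (hT.mpr h)]
        obtain rfl : L = r := by
          by_contra hne
          exact absurd (hzero (by omega)) h.ne'
        have hpos' : ∀ j < L + 1, 0 < sqNorm (lz M (Pi.single ⟨0, hD0⟩ 1) j).cur := by
          intro j hj
          rcases Nat.lt_succ_iff_lt_or_eq.mp hj with hlt | rfl
          · exact hpos j hlt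
          · exact h
        exact ⟨L + 1, le_rfl, run_lzStep hmem hrD hpos', hpos', fun h => absurd h (lt_irrefl _)⟩
      · rw [run_ite_neg _ _ (mt hT.mp h)]
        exact ⟨L, by omega, hmem, hpos, fun _ => by linarith⟩)
    (by
      rintro j s' ⟨L, h1, ⟨p1, p2, p3, p4, p5, p6, p7, p8⟩, h3⟩
      exact ⟨L, h1, ⟨p1, p2, p3, p4, p5, p6, p7, p8⟩, h3⟩)
  rw [hD1] at v
  obtain ⟨L, hL, hmem, hpos, hzero⟩ := v
  refine ⟨L, hL, hmem, hpos, ?_⟩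
  rcases hL.lt_or_eq with h | rfl
  · exact hzero h
  · exact (lanczos_lz M _ L hpos).nn_card_eq_zero hM (by simp)

/-! ### The evolved vector -/

/-- Compute a root of the last polynomial and its powers. -/
def Prog.rootPowers : Prog :=
  .seq (.root 53 (.lit 0) (.lit 0) 43 (.cell 38) (.cell 20) (.cell 66)) <|
  .seq (.setR 54 (.lit 0) (.lit 0) (.lit 1)) <|
  .loop 63 (.cell 20) <|
  .setR 54 (.lit 0) (.succ (.cell 63)) (.mul (.at 54 (.cell 63)) (.cell 53))

/-- Evaluate the polynomials at the root. -/
def Prog.evalPolys : Prog :=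
  .seq (.fillR 55 (.lit 0) 63 (.cell 20) (.sumR 31 65 (.cell 20) .skip
    (.mul (.get 43 (.cell 63) (.cell 65)) (.at 54 (.cell 65)))) (.cell 31)) <|
  .fillR 56 (.lit 0) 63 (.cell 20) (.ite (.natLt (.cell 63) (.cell 38))
    (.setR 31 (.lit 0) (.lit 0) (.div (.at 55 (.cell 63)) (.at 40 (.cell 63))))
    (.setR 31 (.lit 0) (.lit 0) (.lit 0))) (.cell 31)

/-- Compute the weight of the root. -/
def Prog.rootWeight : Prog :=
  .seq (.sumR 31 63 (.cell 20) .skip (.mul (.at 55 (.cell 63)) (.at 56 (.cell 63)))) <|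
  .setC 57 (.lit 0) (.lit 0) ⟨.div (.cos (.mul (.cell 2) (.cell 53))) (.cell 31),
    .div (.sub (.lit 0) (.sin (.mul (.cell 2) (.cell 53)))) (.cell 31)⟩

/-- Add the contribution of the root to the evolved vector. -/
def Prog.addRitz : Prog :=
  .loop 63 (.cell 20) <|
  .seq (.sumC 36 65 (.cell 20) .skip (.smul (.at 56 (.cell 65)) (.get 38 (.cell 65) (.cell 63)))) <|
  .setC 49 (.lit 0) (.cell 63) (.add (.at 49 (.cell 63)) (.mul (.cell 57) (.cell 36)))

/-- Compute the evolved vector. -/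
def Prog.evolve : Prog :=
  .loop 66 (.cell 20) <|
  .ite (.natLt (.cell 66) (.cell 38))
    (.seq .rootPowers <| .seq .evalPolys <| .seq .rootWeight .addRitz) .skip

section

variable {D : ℕ} {M : Matrix (Fin D) (Fin D) ℂ} {v₀ : Fin D → ℂ} {s : Store} {L : ℕ}

/-- A root of the last polynomial. -/
def lzRoot (M : Matrix (Fin D) (Fin D) ℂ) (v₀ : Fin D → ℂ) (L l : ℕ) : ℝ :=
  realRoot (lz M v₀ L).p l

theorem LzMem.mono (h : LzMem M v₀ s L) {c : Prog} {s' : Store} (ha : Agree c s s')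
    (hk : c.keeps [20, 38] [34, 35, 38, 39, 40, 42, 43] = true) : LzMem M v₀ s' L := by
  simp only [Prog.keeps, List.all_cons, List.all_nil, Bool.and_true, Bool.and_eq_true,
    Bool.not_eq_true'] at hk
  refine ⟨by rw [ha.nat 20 (by simp [hk])]; exact h.order, fun a b => ?_,
    by rw [ha.nat 38 (by simp [hk])]; exact h.step, fun j hj x => ?_,
    by rw [ha.real 40 (by simp [hk])]; exact h.norm,
    by rw [ha.real 42 (by simp [hk])]; exact h.offdiag,
    by rw [ha.real 43 (by simp [hk])]; exact h.poly,
    by rw [ha.real 43 (by simp [hk])]; exact h.poly_zero⟩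
  · rw [ha.cx 34 (by simp [hk]) (by simp [hk])]; exact h.mat a b
  · rw [ha.cx 38 (by simp [hk]) (by simp [hk])]; exact h.vec j hj x

/-- The degree handed to the root extraction is `D` and not `L`, so that its cost is bounded by a
size cell; the surplus coefficients are zero and leave the polynomial unchanged. -/
theorem run_rootPowers (h : LzMem M v₀ s L) (hLD : L ≤ D)
    (hpos : ∀ j < L, 0 < sqNorm (lz M v₀ j).cur) {l : ℕ} (hl : s.nat 66 0 0 = l) :
    (Prog.rootPowers.run s).real 53 0 0 = lzRoot M v₀ L l ∧
    ∀ i ≤ D, (Prog.rootPowers.run s).real 54 0 i = lzRoot M v₀ L l ^ i := by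
  rw [Prog.rootPowers, run_seq, run_seq]
  have hpoly : s.poly 43 L D = (lz M v₀ L).p := by
    obtain ⟨-, hd⟩ := (lanczos_lz M v₀ L hpos).monic_natDegree le_rfl
    rw [as_sum_range' (lz M v₀ L).p (D + 1) (by omega), Store.poly]
    exact Finset.sum_congr rfl fun i hi => by
      rw [h.poly L le_rfl i (by simpa [Nat.lt_succ_iff] using hi)]
  let c1 : Prog := .root 53 (.lit 0) (.lit 0) 43 (.cell 38) (.cell 20) (.cell 66)
  have a1 := c1.agree_run rfl s
  have v1 : (c1.run s).real 53 0 0 = lzRoot M v₀ L l := by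
    simp only [c1, Prog.run, Store.setReal, NExpr.eval, h.step, h.order, hl, hpoly, and_self, if_true,
      lzRoot]
  have hD1 : (c1.run s).nat 20 0 0 = D := by rw [a1.nat 20 rfl, h.order]
  change (Prog.run _ (Prog.run _ (c1.run s))).real 53 0 0 = _ ∧
    ∀ i ≤ D, (Prog.run _ (Prog.run _ (c1.run s))).real 54 0 i = _
  generalize c1.run s = s1 at *
  let c2 : Prog := .setR 54 (.lit 0) (.lit 0) (.lit 1)
  have a2 := c2.agree_run rfl s1
  have v2 : (c2.run s1).real 54 0 0 = 1 := by
    simp [c2, Prog.run, Store.setReal, NExpr.eval, RExpr.eval]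
  have v3 : (c2.run s1).real 53 0 0 = lzRoot M v₀ L l := by rw [a2.real 53 rfl, v1]
  have hD2 : (NExpr.cell 20).eval (c2.run s1) = D := by
    change (c2.run s1).nat 20 0 0 = D
    rw [a2.nat 20 rfl, hD1]
  change (Prog.run _ (c2.run s1)).real 53 0 0 = _ ∧ ∀ i ≤ D, (Prog.run _ (c2.run s1)).real 54 0 i = _
  generalize c2.run s1 = s2 at *
  have v := run_loop (x := 63) (e := .cell 20) (s := s2)
    (c := .setR 54 (.lit 0) (.succ (.cell 63)) (.mul (.at 54 (.cell 63)) (.cell 53))) rfl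
    (fun j s' => ∀ i ≤ j, s'.real 54 0 i = lzRoot M v₀ L l ^ i)
    (by intro i hi; obtain rfl : i = 0 := by omega
        rw [v2, pow_zero]) (by
      intro j s' hj hc hag hi i hij
      simp only [Prog.run, Store.setReal, NExpr.eval, RExpr.eval, hc, hag.real 53 rfl, v3,
        hi j le_rfl, true_and]
      by_cases h : i = j + 1
      · rw [if_pos h, h, pow_succ]
      · rw [if_neg h, hi i (by omega)])
  rw [hD2] at v
  refine ⟨?_, v⟩
  rw [((Prog.loop 63 (.cell 20) (.setR 54 (.lit 0) (.succ (.cell 63))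
    (.mul (.at 54 (.cell 63)) (.cell 53)))).agree_run rfl s2).real 53 rfl, v3]

/-- For `j < L ≤ D` the polynomial has degree `j < D`, so `D` coefficients suffice. The quotients
are set to zero from `L` on, which lets later sums run over all `D` indices. -/
theorem run_evalPolys (h : LzMem M v₀ s L) (hLD : L ≤ D)
    (hpos : ∀ j < L, 0 < sqNorm (lz M v₀ j).cur) {r : ℝ} (hr : ∀ i ≤ D, s.real 54 0 i = r ^ i) :
    (∀ j < L, (Prog.evalPolys.run s).real 55 0 j = (lz M v₀ j).p.eval r) ∧
    ∀ j < D, (Prog.evalPolys.run s).real 56 0 j =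
      if j < L then (lz M v₀ j).p.eval r / sqNorm (lz M v₀ j).cur else 0 := by
  have hD : (NExpr.cell 20).eval s = D := h.order
  rw [Prog.evalPolys, run_seq]
  let c1 : Prog := .fillR 55 (.lit 0) 63 (.cell 20) (.sumR 31 65 (.cell 20) .skip
    (.mul (.get 43 (.cell 63) (.cell 65)) (.at 54 (.cell 65)))) (.cell 31)
  have v := run_fillR (a := 55) (i := .lit 0) (x := 63) (N := .cell 20) (s := s) (e := .cell 31)
    (c := .sumR 31 65 (.cell 20) .skip (.mul (.get 43 (.cell 63) (.cell 65)) (.at 54 (.cell 65))))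
    rfl rfl rfl 0 (fun _ _ => rfl) (fun j => ∑ i ∈ Finset.range D, s.real 43 j i * r ^ i) (by
      intro j s2 hj hx2 hag2
      have hD2 : (NExpr.cell 20).eval s2 = D := (h.mono hag2 rfl).order
      rw [RExpr.eval, NExpr.eval, run_sumR (acc := 31) (x := 65) (N := .cell 20) rfl rfl
        (fun i => s.real 43 j i * r ^ i), hD2]
      intro i s3 hi hx3 hag3
      rw [hD2] at hi
      have e1 : s3.nat 63 0 0 = j := by rw [hag3.nat 63 rfl, hx2]
      simp only [Prog.run, RExpr.eval, NExpr.eval, e1, hx3, hag3.real 43 rfl, hag2.real 43 rfl,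
        hag3.real 54 rfl, hag2.real 54 rfl, hr i hi.le])
  rw [hD] at v
  have a1 := c1.agree_run rfl s
  have h1 := h.mono a1 rfl
  have v1 : ∀ j < L, (c1.run s).real 55 0 j = (lz M v₀ j).p.eval r := by
    intro j hj
    obtain ⟨-, hd⟩ := (lanczos_lz M v₀ L hpos).monic_natDegree hj.le
    rw [eval_eq_sum_range' (show (lz M v₀ j).p.natDegree < D by change (lz M v₀ j).p.natDegree = j at hd; omega)]
    refine (v 0 j).trans ?_
    rw [if_pos ⟨rfl, by omega⟩]
    exact Finset.sum_congr rfl fun i hi => by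
      rw [h.poly j hj.le i (Finset.mem_range.mp hi).le]
  change (∀ j < L, (Prog.run _ (c1.run s)).real 55 0 j = _) ∧
    ∀ j < D, (Prog.run _ (c1.run s)).real 56 0 j = _
  generalize c1.run s = s1 at *
  let c₀ : Prog := .ite (.natLt (.cell 63) (.cell 38))
    (.setR 31 (.lit 0) (.lit 0) (.div (.at 55 (.cell 63)) (.at 40 (.cell 63))))
    (.setR 31 (.lit 0) (.lit 0) (.lit 0))
  have hD1 : (NExpr.cell 20).eval s1 = D := h1.order
  have w := run_fillR (a := 56) (i := .lit 0) (x := 63) (N := .cell 20) (s := s1) (e := .cell 31)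
    (c := c₀) rfl rfl rfl 0 (fun _ _ => rfl) (fun j => if j < L then
      (lz M v₀ j).p.eval r / sqNorm (lz M v₀ j).cur else 0) (by
      intro j s2 hj hx2 hag2
      have h2 := h1.mono hag2 rfl
      by_cases hjL : j < L
      · rw [run_ite_pos _ _ (by simpa [Test.holds, NExpr.eval, hx2, h2.step] using hjL), if_pos hjL]
        simp only [Prog.run, Store.setReal, NExpr.eval, RExpr.eval, and_self, if_true, hx2,
          hag2.real 55 rfl, v1 j hjL, h2.norm j hjL.le]
      · rw [run_ite_neg _ _ (by simpa [Test.holds, NExpr.eval, hx2, h2.step] using hjL), if_neg hjL]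
        simp [Prog.run, Store.setReal, NExpr.eval, RExpr.eval])
  rw [hD1] at w
  refine ⟨fun j hj => ?_, fun j hj => ?_⟩
  · rw [← v1 j hj, ((Prog.fillR 56 (.lit 0) 63 (.cell 20) c₀ (.cell 31)).agree_run rfl s1).real 55 rfl]
  · exact (w 0 j).trans (if_pos ⟨rfl, hj⟩)

theorem sum_range_ite_lt {R : Type*} [AddCommMonoid R] (hLD : L ≤ D) (f : ℕ → R) :
    (∑ j ∈ Finset.range D, if j < L then f j else 0) = ∑ j ∈ Finset.range L, f j := by
  rw [← Finset.sum_filter]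
  congr 1
  ext j
  simp only [Finset.mem_filter, Finset.mem_range]
  omega

/-- The reciprocal of the sum is the coefficient of this eigenvector in the expansion of the start
vector; sine and cosine supply the phase that it acquires during the evolution. -/
theorem run_rootWeight (hLD : L ≤ D) (hD : s.nat 20 0 0 = D) {p nn : ℕ → ℝ} {r t : ℝ}
    (h2 : s.real 2 0 0 = t) (h53 : s.real 53 0 0 = r) (h55 : ∀ j < L, s.real 55 0 j = p j)
    (h56 : ∀ j < D, s.real 56 0 j = if j < L then p j / nn j else 0) :
    (Prog.rootWeight.run s).cx 57 0 0 = Complex.exp (-(Complex.I * t) * r) *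
      ((1 / ∑ j ∈ Finset.range L, p j ^ 2 / nn j : ℝ) : ℂ) := by
  have hD0 : (NExpr.cell 20).eval s = D := hD
  rw [Prog.rootWeight, run_seq]
  let c1 : Prog := .sumR 31 63 (.cell 20) .skip (.mul (.at 55 (.cell 63)) (.at 56 (.cell 63)))
  have v := run_sumR (acc := 31) (x := 63) (N := .cell 20) (c := .skip) (s := s)
    (e := .mul (.at 55 (.cell 63)) (.at 56 (.cell 63))) rfl rfl
    (fun j => if j < L then p j ^ 2 / nn j else 0) (by
      intro j s2 hj hx2 hag2
      rw [hD0] at hj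
      simp only [Prog.run, RExpr.eval, NExpr.eval, hx2, hag2.real 55 rfl, hag2.real 56 rfl, h56 j hj]
      split_ifs with h
      · rw [h55 j h]; ring
      · rw [mul_zero])
  rw [hD0, sum_range_ite_lt hLD] at v
  have a1 := c1.agree_run rfl s
  have e1 : (c1.run s).real 2 0 0 = t := by rw [a1.real 2 rfl, h2]
  have e2 : (c1.run s).real 53 0 0 = r := by rw [a1.real 53 rfl, h53]
  change (c1.run s).real 31 0 0 = _ at v
  change (Prog.run _ (c1.run s)).cx 57 0 0 = _
  generalize c1.run s = s1 at *
  rw [run_setC_cx _ _ _ _ (by simp) rfl]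
  simp only [NExpr.eval, and_self, if_true, CExpr.eval, RExpr.eval, e1, e2, v]
  have hexp : Complex.exp (-(Complex.I * t) * r) = ⟨Real.cos (t * r), -Real.sin (t * r)⟩ := by
    rw [show -(Complex.I * t) * r = ((-(t * r) : ℝ) : ℂ) * Complex.I by push_cast; ring,
      Complex.exp_mul_I, ← Complex.ofReal_cos, ← Complex.ofReal_sin, Real.cos_neg, Real.sin_neg]
    apply Complex.ext
    · rw [Complex.add_re, Complex.mul_I_re, Complex.ofReal_re, Complex.ofReal_im, neg_zero, add_zero]
    · rw [Complex.add_im, Complex.mul_I_im, Complex.ofReal_re, Complex.ofReal_im, zero_add]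
  rw [hexp]
  apply Complex.ext
  · rw [Complex.mul_re, Complex.ofReal_re, Complex.ofReal_im]; ring
  · rw [Complex.mul_im, Complex.ofReal_re, Complex.ofReal_im]; push_cast; ring

theorem run_addRitz (h : LzMem M v₀ s L) (hLD : L ≤ D) {g : ℕ → ℝ} {f : ℂ}
    (h57 : s.cx 57 0 0 = f) (h56 : ∀ j < D, s.real 56 0 j = if j < L then g j else 0) (x : Fin D) :
    (Prog.addRitz.run s).cx 49 0 x =
      s.cx 49 0 x + f * ∑ j ∈ Finset.range L, (g j : ℂ) * (lz M v₀ j).cur x := by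
  have hD : (NExpr.cell 20).eval s = D := h.order
  have v := run_loop (x := 63) (e := .cell 20) (s := s)
    (c := .seq (.sumC 36 65 (.cell 20) .skip
      (.smul (.at 56 (.cell 65)) (.get 38 (.cell 65) (.cell 63)))) <|
    .setC 49 (.lit 0) (.cell 63) (.add (.at 49 (.cell 63)) (.mul (.cell 57) (.cell 36)))) rfl
    (fun a s' => s'.cx 49 0 x = if (x : ℕ) < a then
      s.cx 49 0 x + f * ∑ j ∈ Finset.range L, (g j : ℂ) * (lz M v₀ j).cur x else s.cx 49 0 x)
    (by simp) (by
      intro a s' ha hc hag hi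
      rw [hD] at ha
      have h' := h.mono hag rfl
      have hD' : (NExpr.cell 20).eval s' = D := h'.order
      rw [run_seq]
      let c1 : Prog := .sumC 36 65 (.cell 20) .skip
        (.smul (.at 56 (.cell 65)) (.get 38 (.cell 65) (.cell 63)))
      have v1 := run_sumC (acc := 36) (x := 65) (N := .cell 20) (c := .skip) (s := s')
        (e := .smul (.at 56 (.cell 65)) (.get 38 (.cell 65) (.cell 63))) rfl (by simp) rfl rfl
        rfl (fun j => if j < L then (g j : ℂ) * (lz M v₀ j).cur ⟨a, ha⟩ else 0) (by
          intro j s2 hj hx2 hag2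
          rw [hD'] at hj
          have e1 : s2.nat 63 0 0 = a := by rw [hag2.nat 63 rfl, hc]
          have h2 := h'.mono hag2 rfl
          simp only [Prog.run, CExpr.eval_smul, CExpr.eval_get, RExpr.eval, NExpr.eval, e1, hx2,
            hag2.real 56 rfl, hag.real 56 rfl, h56 j hj]
          split_ifs with hjL
          · rw [h2.vec j hjL.le ⟨a, ha⟩]
          · simp)
      rw [hD', sum_range_ite_lt hLD] at v1
      have a1 := c1.agree_run rfl s'
      have e1 : (c1.run s').nat 63 0 0 = a := by rw [a1.nat 63 rfl, hc]
      have e2 : (c1.run s').cx 57 0 0 = f := by rw [a1.cx 57 rfl rfl, hag.cx 57 rfl rfl, h57]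
      have e3 : ∀ i j, (c1.run s').cx 49 i j = s'.cx 49 i j := a1.cx 49 rfl rfl
      change (c1.run s').cx 36 0 0 = _ at v1
      change (Prog.run _ (c1.run s')).cx 49 0 x = _
      generalize c1.run s' = s1 at *
      rw [run_setC_cx _ _ _ _ (by simp) rfl]
      simp only [NExpr.eval, true_and, CExpr.eval_add, CExpr.eval_mul, CExpr.eval_get, e1, e2, e3, v1]
      by_cases hxa : (x : ℕ) = a
      · subst hxa
        rw [if_pos rfl, if_pos (Nat.lt_succ_self _), hi, if_neg (lt_irrefl _)]
      · rw [if_neg hxa, hi]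
        congr 1
        exact propext (by omega))
  rw [hD, if_pos x.2] at v
  exact v

/-- Eigenvectors are never stored: each root is processed completely, in a number of steps quadratic
in `D`, and its contribution is added at once. -/
theorem run_evolve {t : ℝ} (h : LzMem M v₀ s L) (hLD : L ≤ D)
    (hpos : ∀ j < L, 0 < sqNorm (lz M v₀ j).cur) (h2 : s.real 2 0 0 = t) (h49 : s.real 49 = 0)
    (h50 : s.real 50 = 0) (x : Fin D) :
    (Prog.evolve.run s).cx 49 0 x = evolvedVec (fun j => (lz M v₀ j).cur)
      (fun j => sqNorm (lz M v₀ j).cur) (fun j => (lz M v₀ j).p) L t x := by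
  have hD : (NExpr.cell 20).eval s = D := h.order
  let term : ℕ → ℂ := fun l => ((Complex.exp (-(Complex.I * t) * lzRoot M v₀ L l) *
    ((1 / (∑ j ∈ Finset.range L, (lz M v₀ j).p.eval (lzRoot M v₀ L l) ^ 2 /
      sqNorm (lz M v₀ j).cur) : ℝ) : ℂ)) • Lanczos.ritz (fun j => (lz M v₀ j).cur)
      (fun j => sqNorm (lz M v₀ j).cur) (fun j => (lz M v₀ j).p) L (lzRoot M v₀ L l)) x
  have v := run_loop (x := 66) (e := .cell 20) (s := s) (c :=
    .ite (.natLt (.cell 66) (.cell 38))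
    (.seq .rootPowers <| .seq .evalPolys <| .seq .rootWeight .addRitz) .skip) rfl
    (fun r s' => s'.cx 49 0 x = ∑ l ∈ Finset.range r, if l < L then term l else 0)
    (by simp [Store.cx, h49, h50]; rfl) (by
      intro l s' hl hc hag hi
      have h' := h.mono hag rfl
      rw [Finset.sum_range_succ, ← hi]
      by_cases hlL : l < L
      · rw [run_ite_pos _ _ (by simpa [Test.holds, NExpr.eval, hc, h'.step] using hlL), if_pos hlL,
          run_seq, run_seq, run_seq]
        obtain ⟨k1, k2⟩ := run_rootPowers h' hLD hpos hc
        have a1 := Prog.rootPowers.agree_run rfl s'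
        have h1 := h'.mono a1 rfl
        generalize Prog.rootPowers.run s' = s1 at *
        obtain ⟨k3, k4⟩ := run_evalPolys h1 hLD hpos k2
        have a2 := Prog.evalPolys.agree_run rfl s1
        have h2' := h1.mono a2 rfl
        generalize Prog.evalPolys.run s1 = s2 at *
        have k5 := run_rootWeight (s := s2) (t := t) hLD h2'.order
          (by rw [a2.real 2 rfl, a1.real 2 rfl, hag.real 2 rfl, h2])
          (by rw [a2.real 53 rfl, k1]) k3 k4
        have a3 := Prog.rootWeight.agree_run rfl s2
        have h3 := h2'.mono a3 rfl
        generalize Prog.rootWeight.run s2 = s3 at *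
        have k6 := run_addRitz h3 hLD k5 (by rw [a3.real 56 rfl]; exact k4) x
        rw [k6, a3.cx 49 rfl rfl, a2.cx 49 rfl rfl, a1.cx 49 rfl rfl]
        simp only [term, Pi.smul_apply, smul_eq_mul, Lanczos.ritz, Finset.sum_apply]
      · rw [run_ite_neg _ _ (by simpa [Test.holds, NExpr.eval, hc, h'.step] using hlL), if_neg hlL,
          add_zero]
        rfl)
  rw [hD, sum_range_ite_lt hLD] at v
  refine v.trans ?_
  rw [evolvedVec, Finset.sum_apply]
  rfl

end

/-! ### Evolving the state -/

theorem Enum.exists_elts {I : Quench n m k} {s : Store} {gen : ℕ → PauliString n}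
    (h : Enum I s k I.dimK gen) (Q : PauliString n) : Q ∈ I.K ↔ ∃ u, elts I gen u = Q := by
  rw [h.mem_K_iff]
  rfl

theorem Enum.elts_injective {I : Quench n m k} {s : Store} {gen : ℕ → PauliString n}
    (h : Enum I s k I.dimK gen) : Function.Injective (elts I gen) :=
  fun a b e => Fin.ext (h.inj a a.2 b b.2 e)

/-- Index `0` lists the identity, so the first basis vector is mapped to the initial state. The list
is closed under adding perturbing strings, which gives the intertwining relation. -/
theorem Enum.ψ_eq {I : Quench n m k} {s : Store} {gen : ℕ → PauliString n}
    (h : Enum I s k I.dimK gen) {L : ℕ} (t : ℝ) (v₀ : Fin (2 ^ I.dimK) → ℂ)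
    (hv₀ : v₀ = Pi.single ⟨0, by positivity⟩ 1)
    (hpos : ∀ j < L, 0 < sqNorm (lz (I.blockH (elts I gen)) v₀ j).cur)
    (hL : sqNorm (lz (I.blockH (elts I gen)) v₀ L).cur = 0) :
    I.ψ t = I.combine (elts I gen) (evolvedVec (fun j => (lz (I.blockH (elts I gen)) v₀ j).cur)
      (fun j => sqNorm (lz (I.blockH (elts I gen)) v₀ j).cur)
      (fun j => (lz (I.blockH (elts I gen)) v₀ j).p) L t) := by
  have hP : ∀ i b, ∃ a, elts I gen a = I.P i + elts I gen b := fun i b =>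
    (h.exists_elts _).mp (I.K.add_mem (Submodule.subset_span ⟨i, rfl⟩)
      ((h.exists_elts _).mpr ⟨b, rfl⟩))
  have h0 : I.combine (elts I gen) v₀ = I.ψ₀ := by
    apply toWave.injective
    rw [I.toWave_combine, hv₀, Finset.sum_eq_single ⟨0, by positivity⟩]
    · rw [Pi.single_eq_same, one_smul, elts, bitSum_zero_right, wop_zero]
      rfl
    · intro b _ hb
      rw [Pi.single_eq_of_ne hb, zero_smul]
    · intro hn
      exact absurd (Finset.mem_univ _) hn
  rw [← exp_mulVec_lanczos (lanczos_lz _ v₀ L hpos) (I.blockH_isHermitian _) hL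
    (by rw [lz, hv₀]; exact fun e => one_ne_zero ((Pi.single_eq_same _ _).symm.trans (congrFun e _)))
    (I.combine (elts I gen)) (I.H_combine h.elts_injective hP) t]
  change _ = Matrix.mulVec _ (I.combine (elts I gen) v₀)
  rw [h0]
  rfl

/-! ### The common preparation -/

/-- Set up the lookup tables and the stabilizer rows. -/
def Prog.prelude : Prog := .seq .tables .insertRows

/-- Set up the block Hamiltonian. -/
def Prog.assemble : Prog :=
  .seq .prelude <| .seq .enumerate <| .seq .buckets <| .seq .energies .fillMat

/-- Compute the evolved vector from the input. -/
def Prog.prepare : Prog := .seq .assemble (.seq .lanczos .evolve)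

/-- The evolved vector is in memory. -/
structure Evolved (I : Quench n m k) (t : ℝ) (s : Store) (gen : ℕ → PauliString n)
    (c : Fin (2 ^ I.dimK) → ℂ) : Prop extends Ready I t s gen where
  coeff : ∀ u : Fin (2 ^ I.dimK), s.cx 49 0 u = c u
  state : I.ψ t = I.combine (elts I gen) c

theorem Evolved.mono {I : Quench n m k} {t : ℝ} {s s' : Store} {gen : ℕ → PauliString n}
    {c : Fin (2 ^ I.dimK) → ℂ} (h : Evolved I t s gen c) {A : Prog} (ha : Agree A s s')
    (hk : A.keeps [0, 1, 2, 3, 4, 5, 6, 7, 8, 20, 21, 22, 23, 24, 25, 33, 34, 35]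
      [0, 1, 2, 20, 21, 22, 23, 24, 27, 28, 49, 50] = true) : Evolved I t s' gen c := by
  simp only [Prog.keeps, List.all_cons, List.all_nil, Bool.and_true, Bool.and_eq_true,
    Bool.not_eq_true'] at hk
  refine ⟨h.toReady.mono ha (by simp [Prog.keeps, hk]), fun u => ?_, h.state⟩
  rw [ha.cx 49 (by simp [hk]) (by simp [hk]), h.coeff]

/-- Besides the input, memory is empty. -/
structure Fresh (s : Store) : Prop where
  nat : ∀ a, 20 ≤ a → s.nat a = 0
  real : ∀ a, 3 ≤ a → s.real a = 0

/-- The stabilizer rows are set up, and the group generated by the perturbation is not yet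
listed. -/
structure Start (I : Quench n m k) (t : ℝ) (s : Store) : Prop extends Setup I t s where
  nat : ∀ a ∈ [20, 22, 23, 24], s.nat a = 0
  real : ∀ a ∈ [24, 32], s.real a = 0

theorem run_prelude {I : Quench n m k} {t : ℝ} {s : Store} (hl : Loaded I t s) (hf : Fresh s) :
    Start I t (Prog.prelude.run s) := by
  rw [Prog.prelude, run_seq]
  have ht := run_tables (s := s) (hf.nat 21 (by simp)) (hf.real 21 (by simp))
    (hf.real 22 (by simp))
  have a1 := Prog.tables.agree_run rfl s
  have hl1 := hl.mono a1 rfl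
  have n1 : ∀ a, 20 ≤ a → a ≠ 21 → (Prog.tables.run s).nat a = 0 := fun a h h' => by
    rw [a1.nat a (by simp [Prog.tables, Prog.modN, h']), hf.nat a h]
  have r1 : ∀ a, 23 ≤ a → (Prog.tables.run s).real a = 0 := fun a h => by
    rw [a1.real a (by simp [Prog.tables, Prog.modR]; omega), hf.real a (by omega)]
  generalize Prog.tables.run s = s1 at *
  have a2 := Prog.insertRows.agree_run rfl s1
  refine ⟨run_insertRows hl1 ht (n1 33 (by simp) (by simp))
    (n1 34 (by simp) (by simp)) (n1 35 (by simp) (by simp)) (r1 27 (by simp))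
    (r1 28 (by simp)), fun a h => ?_, fun a h => ?_⟩
  · simp only [List.mem_cons, List.not_mem_nil, or_false] at h
    rcases h with rfl | rfl | rfl | rfl <;> rw [a2.nat _ rfl, n1 _ (by simp) (by simp)]
  · simp only [List.mem_cons, List.not_mem_nil, or_false] at h
    rcases h with rfl | rfl <;> rw [a2.real _ rfl, r1 _ (by simp)]

theorem run_assemble {I : Quench n m k} {t : ℝ} {s : Store} (hl : Loaded I t s) (hf : Fresh s) :
    ∃ gen, Ready I t (Prog.assemble.run s) gen ∧
      ∀ a b : Fin (2 ^ I.dimK), (Prog.assemble.run s).cx 34 a b = I.blockH (elts I gen) a b := by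
  rw [Prog.assemble, run_seq, run_seq, run_seq, run_seq]
  have hs := run_prelude hl hf
  generalize Prog.prelude.run s = s2 at *
  obtain ⟨gen, hE⟩ := run_enumerate hs.loaded hs.tables (hs.nat 20 (by simp)) (hs.nat 22 (by simp))
    (hs.nat 23 (by simp)) (hs.nat 24 (by simp)) (hs.real 24 (by simp))
  have a3 := Prog.enumerate.agree_run rfl s2
  have h3 : Ready I t (Prog.enumerate.run s2) gen := ⟨hs.toSetup.mono a3 rfl, hE⟩
  have r3 : (Prog.enumerate.run s2).real 32 = 0 := by rw [a3.real 32 rfl, hs.real 32 (by simp)]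
  generalize Prog.enumerate.run s2 = s3 at *
  have hb := run_buckets h3 r3
  have h4 := h3.mono (Prog.buckets.agree_run rfl s3) rfl
  generalize Prog.buckets.run s3 = s4 at *
  have he := run_energies h4 hb
  have h5 := h4.mono (Prog.energies.agree_run rfl s4) rfl
  generalize Prog.energies.run s4 = s5 at *
  exact ⟨gen, h5.mono (Prog.fillMat.agree_run rfl s5) rfl,
    run_fillMat h5 fun a => he a a.2⟩

theorem run_prepare {I : Quench n m k} {t : ℝ} {s : Store} (hl : Loaded I t s) (hf : Fresh s) :
    ∃ gen c, Evolved I t (Prog.prepare.run s) gen c := by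
  obtain ⟨gen, hs, hmat⟩ := run_assemble hl hf
  have a1 := Prog.assemble.agree_run rfl s
  have n1 : (Prog.assemble.run s).nat 38 = 0 := by
    rw [a1.nat 38 rfl, hf.nat 38 (by simp)]
  have r1 : ∀ a ∈ [38, 39, 40, 42, 43, 49, 50], (Prog.assemble.run s).real a = 0 := by
    intro a h
    simp only [List.mem_cons, List.not_mem_nil, or_false] at h
    rcases h with rfl | rfl | rfl | rfl | rfl | rfl | rfl <;>
      rw [a1.real _ rfl, hf.real _ (by simp)]
  rw [Prog.prepare, run_seq, run_seq]
  generalize Prog.assemble.run s = s1 at *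
  obtain ⟨L, hL, hm, hpos, h0⟩ := run_lanczos (D := 2 ^ I.dimK) (by positivity)
    (I.blockH_isHermitian (elts I gen)) hs.enum.order hmat n1
    (fun a h => r1 a (by simp only [List.mem_cons, List.not_mem_nil, or_false] at h ⊢; omega))
  have a2 := Prog.lanczos.agree_run rfl s1
  have hs2 := hs.mono a2 rfl
  have r2 : ∀ a ∈ [49, 50], (Prog.lanczos.run s1).real a = 0 := by
    intro a h
    simp only [List.mem_cons, List.not_mem_nil, or_false] at h
    rcases h with rfl | rfl <;> rw [a2.real _ rfl, r1 _ (by simp)]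
  generalize Prog.lanczos.run s1 = s2 at *
  exact ⟨gen, _, hs2.mono (Prog.evolve.agree_run rfl s2) rfl,
    run_evolve hm hL hpos hs2.loaded.time (r2 49 (by simp)) (r2 50 (by simp)),
    hs2.enum.ψ_eq t _ rfl hpos h0⟩

/-! ### Amplitudes -/

/-- Multiply the value in cell `36` by the reference amplitude. -/
def Prog.outScaled : Prog :=
  .seq (.setR 3 (.lit 0) (.lit 0) (.sub (.mul (.cell 36) (.at 2 (.lit 1)))
    (.mul (.cell 37) (.at 2 (.lit 2))))) <|
  .setR 3 (.lit 0) (.lit 1) (.add (.mul (.cell 36) (.at 2 (.lit 2)))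
    (.mul (.cell 37) (.at 2 (.lit 1))))

theorem run_outScaled {I : Quench n m k} {t : ℝ} {s : Store} (hl : Loaded I t s) :
    (Prog.outScaled.run s).outComplex = s.cx 36 0 0 * I.ψ₀ I.z := by
  apply Complex.ext <;>
    simp [Prog.outScaled, Prog.run, Store.setReal, NExpr.eval, RExpr.eval, Store.outComplex,
      Store.cx, hl.ref_re, hl.ref_im]

/-- Relative amplitudes with respect to one listed group element. -/
def Prog.relAmp : Prog :=
  .relC (.xor (.at 9 (.cell 72)) (.at 8 (.cell 72))) (.lit 0)
    (.get 22 (.cell 63) (.cell 72)) (.get 23 (.cell 63) (.cell 72))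

/-- Compute an amplitude of the evolved state. -/
def Prog.readAmp : Prog :=
  .seq (.sumC 36 63 (.cell 20) .relAmp (.mul (.at 49 (.cell 63)) (.cell 29))) .outScaled

theorem operand_listed {I : Quench n m k} {t : ℝ} {s : Store} {gen : ℕ → PauliString n}
    (hs : Ready I t s gen) {x : ℕ} (hx : x ≠ 31 ∧ x ≠ 32 ∧ x ≠ 72) {u : ℕ}
    (hu : u < 2 ^ I.dimK) (h : s.nat x 0 0 = u) :
    Operand s (.get 22 (.cell x) (.cell 72)) (xp (elts I gen ⟨u, hu⟩)) ∧
      Operand s (.get 23 (.cell x) (.cell 72)) (zp (elts I gen ⟨u, hu⟩)) := by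
  constructor
  · intro s' hs' q hq
    simp only [NExpr.eval, hq, hs' x hx.1 hx.2.1 hx.2.2, h,
      hs' 22 (by simp) (by simp) (by simp)]
    exact hs.enum.listed.x u hu q
  · intro s' hs' q hq
    simp only [NExpr.eval, hq, hs' x hx.1 hx.2.1 hx.2.2, h,
      hs' 23 (by simp) (by simp) (by simp)]
    exact hs.enum.listed.z u hu q

theorem operand_zero (s : Store) : Operand s (.lit 0) (0 : Vec n) := fun _ _ _ _ => rfl

theorem iph_mkP_zero (v : Vec n) : iph (mkP v 0) = 1 := by
  simp [iph, ph1]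

/-- Each summand is obtained by reducing a pure `X`-string, from the label `y` to the reference
label, times a listed element. Only the final factor involves the stored amplitude and with it the
global phase. -/
theorem run_readAmp {I : Quench n m k} {t : ℝ} {s : Store} {gen : ℕ → PauliString n}
    {c : Fin (2 ^ I.dimK) → ℂ} (h : Evolved I t s gen c) {y : Vec n}
    (hy : ∀ q : Fin n, s.nat 9 0 q = (y q).val) :
    (Prog.readAmp.run s).outComplex = I.ψ t (bitsEquiv y) := by
  rw [Prog.readAmp, run_seq]
  have v := run_sumC (acc := 36) (x := 63) (N := .cell 20) (c := .relAmp)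
    (e := .mul (.at 49 (.cell 63)) (.cell 29)) (s := s) rfl (by simp) rfl rfl rfl
    (extz fun u => c u * I.rel (mkP (y + I.zv) 0 + elts I gen u)) (by
      intro j s' hj hx hag
      have h' := h.mono hag rfl
      have hjD : j < 2 ^ I.dimK := by rw [← h.enum.order]; exact hj
      obtain ⟨o1, o2⟩ := operand_listed h'.toReady (x := 63) (by simp) hjD hx
      have o3 : Operand s' (.xor (.at 9 (.cell 72)) (.at 8 (.cell 72)))
          (xp (mkP (y + I.zv) 0)) := by
        intro s2 hs2 q hq
        have e9 : s2.nat 9 0 q = (y q).val := by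
          rw [hs2 9 (by simp) (by simp) (by simp), hag.nat 9 rfl, hy]
        have e8 : s2.nat 8 0 q = (I.zv q).val := by
          rw [hs2 8 (by simp) (by simp) (by simp), h'.loaded.zv]
        simp only [NExpr.eval, hq, e9, e8, hs2 21 (by simp) (by simp) (by simp),
          h'.tables.xor]
        rfl
      have hr := run_relC h'.toSetup o3 (operand_zero s' (n := n)) o1 o2
      have ha := Prog.relAmp.agree_run rfl s'
      change (Prog.relAmp.run s').cx 29 0 0 = _ at hr
      simp only [CExpr.eval_mul, CExpr.eval_get, NExpr.eval, ha.nat 63 rfl, hx, ha.cx 49 rfl rfl,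
        h'.coeff ⟨j, hjD⟩, hr, extz_of_lt _ hjD, iph_mkP_zero]
      simp)
  rw [show (NExpr.cell 20).eval s = 2 ^ I.dimK from h.enum.order, sum_range_extz] at v
  have h1 := h.mono ((Prog.sumC 36 63 (.cell 20) .relAmp
    (.mul (.at 49 (.cell 63)) (.cell 29))).agree_run rfl s) rfl
  rw [run_outScaled h1.loaded, v, h.state, I.combine_apply]

/-! ### Expectation values -/

/-- Multiply real numbers over the qubits. -/
def Prog.signProd (e : RExpr) : Prog :=
  .seq (.setR 31 (.lit 0) (.lit 0) (.lit 1)) <|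
  .loop 64 .qubits <| .setR 31 (.lit 0) (.lit 0) (.mul (.cell 31) e)

theorem run_signProd {s : Store} (hn : s.nat 0 0 0 = n) {e : RExpr} (f : Fin n → ℝ)
    (hf : ∀ s' : Store, Agree (.signProd e) s s' → ∀ q : Fin n, s'.nat 64 0 0 = q →
      e.eval s' = f q) :
    ((Prog.signProd e).run s).real 31 0 0 = ∏ q, f q := by
  rw [Prog.signProd, run_seq]
  have a1 := (Prog.setR 31 (.lit 0) (.lit 0) (.lit 1)).agree_run rfl s
  have v1 : ((Prog.setR 31 (.lit 0) (.lit 0) (.lit 1)).run s).real 31 0 0 = 1 := by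
    simp [Prog.run, Store.setReal, NExpr.eval, RExpr.eval]
  generalize (Prog.setR 31 (.lit 0) (.lit 0) (.lit 1)).run s = s1 at *
  have hn1 : NExpr.qubits.eval s1 = n := by
    change s1.nat 0 0 0 = n
    rw [a1.nat 0 rfl, hn]
  have v := run_loop (x := 64) (e := .qubits) (s := s1)
    (c := .setR 31 (.lit 0) (.lit 0) (.mul (.cell 31) e)) rfl
    (fun j s' => s'.real 31 0 0 = pprod f j) (by simp [v1]) (by
      intro j s' hj hc hag hi
      rw [hn1] at hj
      rw [pprod_succ _ hj, ← hi, ← hf s' (a1.seq hag) ⟨j, hj⟩ hc]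
      simp [Prog.run, Store.setReal, NExpr.eval, RExpr.eval])
  rw [hn1, pprod_self] at v
  exact v

/-- Test whether the product of the given string and a listed element commutes with all
generators. -/
def Prog.testStab : Prog :=
  .seq (.setN 27 (.lit 0) (.lit 0) (.lit 1)) <|
  .loop 60 .qubits <|
  .seq (.signProd (.mul
    (.sign (.get 1 (.cell 60) (.cell 64)) (.xor (.at 11 (.cell 64)) (.get 23 (.cell 63) (.cell 64))))
    (.sign (.get 2 (.cell 60) (.cell 64))
      (.xor (.at 10 (.cell 64)) (.get 22 (.cell 63) (.cell 64)))))) <|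
  .ite (.realLt (.cell 31) (.lit 0)) (.setN 27 (.lit 0) (.lit 0) (.lit 0)) .skip

/-- Compute one overlap. -/
def Prog.overlapEntry : Prog :=
  .seq .testStab <|
  .seq (.relC (.at 10 (.cell 72)) (.at 11 (.cell 72)) (.get 22 (.cell 63) (.cell 72))
    (.get 23 (.cell 63) (.cell 72))) <|
  .ite (.natEq (.cell 27) (.lit 1)) .skip (.setC 29 (.lit 0) (.lit 0) (.ofReal (.lit 0)))

open scoped Classical in
theorem run_testStab {I : Quench n m k} {t : ℝ} {s : Store} {gen : ℕ → PauliString n}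
    (hs : Ready I t s gen) {Q : PauliString n} (hx : ∀ q : Fin n, s.nat 10 0 q = (xp Q q).val)
    (hz : ∀ q : Fin n, s.nat 11 0 q = (zp Q q).val) {u : ℕ} (hu : u < 2 ^ I.dimK)
    (h63 : s.nat 63 0 0 = u) :
    (Prog.testStab.run s).nat 27 0 0 =
      if ∀ i, symp (I.g i) (Q + elts I gen ⟨u, hu⟩) = 0 then 1 else 0 := by
  rw [Prog.testStab, run_seq]
  let c1 : Prog := .setN 27 (.lit 0) (.lit 0) (.lit 1)
  have a1 := c1.agree_run rfl s
  have v1 : (c1.run s).nat 27 0 0 = 1 := by simp [c1, Prog.run, Store.setNat, NExpr.eval]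
  have hs1 := hs.mono a1 rfl
  change (Prog.run _ (c1.run s)).nat 27 0 0 = _
  generalize c1.run s = s1 at *
  have hn1 : NExpr.qubits.eval s1 = n := hs1.loaded.qubits
  let e : RExpr := .mul
    (.sign (.get 1 (.cell 60) (.cell 64)) (.xor (.at 11 (.cell 64)) (.get 23 (.cell 63) (.cell 64))))
    (.sign (.get 2 (.cell 60) (.cell 64))
      (.xor (.at 10 (.cell 64)) (.get 22 (.cell 63) (.cell 64))))
  have v := run_loop (x := 60) (e := .qubits) (s := s1) (c := .seq (.signProd e) <|
    .ite (.realLt (.cell 31) (.lit 0)) (.setN 27 (.lit 0) (.lit 0) (.lit 0)) .skip) rfl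
    (fun j s' => s'.nat 27 0 0 =
      if ∀ i : Fin n, (i : ℕ) < j → symp (I.g i) (Q + elts I gen ⟨u, hu⟩) = 0 then 1 else 0)
    (by simp [v1]) (by
      intro j s' hj hc hag hi
      rw [hn1] at hj
      have hs' := hs1.mono hag rfl
      have w := run_signProd (e := e) hs'.loaded.qubits (fun q =>
        chi (xp (I.g ⟨j, hj⟩) q * zp (Q + elts I gen ⟨u, hu⟩) q) *
        chi (zp (I.g ⟨j, hj⟩) q * xp (Q + elts I gen ⟨u, hu⟩) q)) (by
          intro s2 hag2 q hq
          have h2 := hs'.mono hag2 rfl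
          have e60 : s2.nat 60 0 0 = j := by rw [hag2.nat 60 rfl, hc]
          have e63 : s2.nat 63 0 0 = u := by rw [hag2.nat 63 rfl, hag.nat 63 rfl, a1.nat 63 rfl, h63]
          have e10 : s2.nat 10 0 q = (xp Q q).val := by
            rw [hag2.nat 10 rfl, hag.nat 10 rfl, a1.nat 10 rfl, hx]
          have e11 : s2.nat 11 0 q = (zp Q q).val := by
            rw [hag2.nat 11 rfl, hag.nat 11 rfl, a1.nat 11 rfl, hz]
          have f1 := h2.loaded.gx ⟨j, hj⟩ q
          have f2 := h2.loaded.gz ⟨j, hj⟩ q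
          have f3 := h2.enum.listed.x u hu q
          have f4 := h2.enum.listed.z u hu q
          simp only at f1 f2
          simp only [e, RExpr.eval, NExpr.eval, hq, e60, e63, e10, e11, f1, f2, f3, f4,
            h2.tables.xor, h2.tables.sign]
          rfl)
      have hw : ((Prog.signProd e).run s').real 31 0 0 =
          chi (symp (I.g ⟨j, hj⟩) (Q + elts I gen ⟨u, hu⟩)) := by
        rw [w, Finset.prod_mul_distrib, symp, chi_add, dotProduct, dotProduct, chi_sum, chi_sum]
      have a2 := (Prog.signProd e).agree_run rfl s'
      have e27 := a2.nat 27 rfl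
      rw [run_seq]
      generalize (Prog.signProd e).run s' = s2 at *
      have hall : (∀ i : Fin n, (i : ℕ) < j + 1 → symp (I.g i) (Q + elts I gen ⟨u, hu⟩) = 0) ↔
          (∀ i : Fin n, (i : ℕ) < j → symp (I.g i) (Q + elts I gen ⟨u, hu⟩) = 0) ∧
          symp (I.g ⟨j, hj⟩) (Q + elts I gen ⟨u, hu⟩) = 0 := by
        refine ⟨fun h => ⟨fun i hij => h i (by omega), h _ (Nat.lt_succ_self j)⟩, fun h i hij => ?_⟩
        rcases Nat.lt_succ_iff_lt_or_eq.mp hij with h' | h'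
        · exact h.1 i h'
        · obtain rfl : i = ⟨j, hj⟩ := Fin.ext h'
          exact h.2
      rw [if_congr hall rfl rfl]
      rcases zmod2_cases (symp (I.g ⟨j, hj⟩) (Q + elts I gen ⟨u, hu⟩)) with h0 | h0
      · rw [run_ite_neg _ _ (by simp [Test.holds, RExpr.eval, NExpr.eval, hw, h0])]
        simp only [Prog.run, e27, hi, h0, and_true]
      · rw [run_ite_pos _ _ (by simp [Test.holds, RExpr.eval, NExpr.eval, hw, h0])]
        simp [Prog.run, Store.setNat, NExpr.eval, h0])
  rw [hn1] at v
  rw [v]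
  exact if_congr ⟨fun h i => h i i.2, fun h i _ => h i⟩ rfl rfl

/-- The relative amplitude at one label can be nonzero even if the string is not a stabilizer. The
commutation test is therefore needed in addition, to replace such values by zero. -/
theorem run_overlapEntry {I : Quench n m k} {t : ℝ} {s : Store} {gen : ℕ → PauliString n}
    (hs : Ready I t s gen) {Q : PauliString n} (hx : ∀ q : Fin n, s.nat 10 0 q = (xp Q q).val)
    (hz : ∀ q : Fin n, s.nat 11 0 q = (zp Q q).val) {u : ℕ} (hu : u < 2 ^ I.dimK)
    (h63 : s.nat 63 0 0 = u) :
    (Prog.overlapEntry.run s).cx 29 0 0 = I.overlap Q (elts I gen ⟨u, hu⟩) := by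
  have v := run_testStab hs hx hz hu h63
  have a1 := Prog.testStab.agree_run rfl s
  have hs1 := hs.mono a1 rfl
  rw [Prog.overlapEntry, run_seq, run_seq]
  have e63 : (Prog.testStab.run s).nat 63 0 0 = u := by rw [a1.nat 63 rfl, h63]
  have e10 : ∀ q : Fin n, (Prog.testStab.run s).nat 10 0 q = (xp Q q).val := by
    rw [a1.nat 10 rfl]; exact hx
  have e11 : ∀ q : Fin n, (Prog.testStab.run s).nat 11 0 q = (zp Q q).val := by
    rw [a1.nat 11 rfl]; exact hz
  generalize Prog.testStab.run s = s1 at *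
  obtain ⟨o1, o2⟩ := operand_listed hs1 (x := 63) (by simp) hu e63
  have o3 : Operand s1 (.at 10 (.cell 72)) (xp Q) := fun s2 h2 q hq => by
    simp only [NExpr.eval, hq, h2 10 (by simp) (by simp) (by simp), e10]
  have o4 : Operand s1 (.at 11 (.cell 72)) (zp Q) := fun s2 h2 q hq => by
    simp only [NExpr.eval, hq, h2 11 (by simp) (by simp) (by simp), e11]
  have w := run_relC hs1.toSetup o3 o4 o1 o2
  have a2 := (Prog.relC (.at 10 (.cell 72)) (.at 11 (.cell 72)) (.get 22 (.cell 63) (.cell 72))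
    (.get 23 (.cell 63) (.cell 72))).agree_run rfl s1
  rw [← a2.nat 27 rfl] at v
  generalize (Prog.relC (.at 10 (.cell 72)) (.at 11 (.cell 72)) (.get 22 (.cell 63) (.cell 72))
    (.get 23 (.cell 63) (.cell 72))).run s1 = s2 at *
  rw [Quench.overlap]
  split_ifs at v ⊢ with h
  · rw [run_ite_pos _ _ (by simp [Test.holds, NExpr.eval, v])]
    exact w
  · rw [run_ite_neg _ _ (by simp [Test.holds, NExpr.eval, v]), run_setC_cx _ _ _ _ (by simp) rfl]
    simp [NExpr.eval, RExpr.eval]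

/-- Compute the overlaps of the initial state with the images under the given string times the
listed elements. -/
def Prog.overlaps : Prog := .fillC 51 (.lit 0) 63 (.cell 20) .overlapEntry (.cell 29)

/-- The sign attached to a pair of listed elements. -/
def Prog.pairSign : Prog :=
  .signProd (.mul (.sign (.get 23 (.cell 61) (.cell 64))
      (.get 22 (.get 24 (.cell 61) (.cell 65)) (.cell 64)))
    (.mul (.sign (.get 22 (.cell 61) (.cell 64)) (.at 11 (.cell 64)))
      (.sign (.get 23 (.cell 61) (.cell 64)) (.at 10 (.cell 64)))))

/-- Sum the contributions of the pairs with a given first element. -/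
def Prog.pairSum : Prog :=
  .sumC 36 65 (.cell 20) .pairSign
    (.mul (.smul (.cell 31) (.at 49 (.cell 65))) (.at 51 (.get 24 (.cell 61) (.cell 65))))

/-- Compute an expectation value in the evolved state. -/
def Prog.readExpect : Prog :=
  .seq .overlaps <|
  .seq (.sumC 44 61 (.cell 20) .pairSum (.mul (.conj (.at 49 (.cell 61))) (.cell 36))) <|
  .seq (.setR 3 (.lit 0) (.lit 0) (.cell 44)) (.setR 3 (.lit 0) (.lit 1) (.cell 45))

/-- A Pauli string is in memory as an operand. -/
structure HasPauli (s : Store) (Q : PauliString n) : Prop where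
  x : ∀ q : Fin n, s.nat 10 0 q = (xp Q q).val
  z : ∀ q : Fin n, s.nat 11 0 q = (zp Q q).val

theorem HasPauli.mono {s s' : Store} {Q : PauliString n} (h : HasPauli s Q) {c : Prog}
    (ha : Agree c s s') (hk : c.keeps [10, 11] [] = true) : HasPauli s' Q := by
  simp only [Prog.keeps, List.all_cons, List.all_nil, Bool.and_true, Bool.and_eq_true,
    Bool.not_eq_true'] at hk
  exact ⟨by rw [ha.nat 10 hk.1]; exact h.x, by rw [ha.nat 11 hk.2]; exact h.z⟩

theorem run_overlaps {I : Quench n m k} {t : ℝ} {s : Store} {gen : ℕ → PauliString n}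
    (hs : Ready I t s gen) {Q : PauliString n} (hQ : HasPauli s Q) (u : Fin (2 ^ I.dimK)) :
    (Prog.overlaps.run s).cx 51 0 u = I.overlap Q (elts I gen u) := by
  rw [Prog.overlaps, run_fillC (a := 51) (x := 63) (N := .cell 20) (e := .cell 29) rfl (by simp)
    rfl rfl rfl rfl 0 (fun _ _ => rfl) (extz fun u => I.overlap Q (elts I gen u)),
    show (NExpr.cell 20).eval s = 2 ^ I.dimK from hs.enum.order, if_pos ⟨rfl, u.2⟩, extz_val]
  intro j s' hj hx hag
  have hjD : j < 2 ^ I.dimK := by rw [← hs.enum.order]; exact hj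
  have hQ' := hQ.mono hag rfl
  rw [extz_of_lt _ hjD]
  exact run_overlapEntry (hs.mono hag rfl) hQ'.x hQ'.z hjD hx

theorem run_pairSign {I : Quench n m k} {t : ℝ} {s : Store} {gen : ℕ → PauliString n}
    (hs : Ready I t s gen) {Q : PauliString n} (hQ : HasPauli s Q) (u v : Fin (2 ^ I.dimK))
    (hu : s.nat 61 0 0 = u) (hv : s.nat 65 0 0 = v) :
    (Prog.pairSign.run s).real 31 0 0 = chi (zp (elts I gen u) ⬝ᵥ xp (elts I gen u)) *
      chi (zp (elts I gen u) ⬝ᵥ xp (elts I gen v)) * chi (symp (elts I gen u) Q) := by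
  have hlt : (u : ℕ) ^^^ v < 2 ^ I.dimK := Nat.xor_lt_two_pow u.2 v.2
  have hT : bitSum gen I.dimK ((u : ℕ) ^^^ v) = elts I gen u + elts I gen v := bitSum_xor _ _ _ _
  rw [Prog.pairSign, run_signProd hs.loaded.qubits (fun q =>
    chi (zp (elts I gen u) q * xp (elts I gen u + elts I gen v) q) *
      (chi (xp (elts I gen u) q * zp Q q) * chi (zp (elts I gen u) q * xp Q q)))]
  · rw [Finset.prod_mul_distrib, Finset.prod_mul_distrib, ← chi_sum, ← chi_sum, ← chi_sum,
      ← chi_add, ← chi_add, ← chi_add, ← chi_add]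
    congr 1
    change zp (elts I gen u) ⬝ᵥ xp (elts I gen u + elts I gen v) + symp (elts I gen u) Q = _
    rw [xp_add, dotProduct_add]
  · intro s' hag q hq
    have hs' := hs.mono hag rfl
    have hQ' := hQ.mono hag rfl
    have e1 : s'.nat 61 0 0 = u := by rw [hag.nat 61 rfl, hu]
    have e2 : s'.nat 65 0 0 = v := by rw [hag.nat 65 rfl, hv]
    have f1 := hs'.enum.listed.x u u.2 q
    have f2 := hs'.enum.listed.z u u.2 q
    have f3 := hs'.enum.listed.x _ hlt q
    rw [hT] at f3
    simp only [RExpr.eval, NExpr.eval, hq, e1, e2, f1, f2, f3, hQ'.x, hQ'.z, hs'.tables.sign,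
      hs'.enum.tabled.xor u u.2 v v.2]
    rfl

theorem run_pairSum {I : Quench n m k} {t : ℝ} {s : Store} {gen : ℕ → PauliString n}
    {c : Fin (2 ^ I.dimK) → ℂ} (h : Evolved I t s gen c) {Q : PauliString n} (hQ : HasPauli s Q)
    (hF : ∀ u : Fin (2 ^ I.dimK), s.cx 51 0 u = I.overlap Q (elts I gen u)) (u : Fin (2 ^ I.dimK))
    (hu : s.nat 61 0 0 = u) :
    (Prog.pairSum.run s).cx 36 0 0 = ∑ v, c v *
      (chi (zp (elts I gen u) ⬝ᵥ xp (elts I gen u)) *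
      chi (zp (elts I gen u) ⬝ᵥ xp (elts I gen v)) * chi (symp (elts I gen u) Q) : ℝ) *
      I.overlap Q (elts I gen u + elts I gen v) := by
  rw [Prog.pairSum, run_sumC (acc := 36) (x := 65) (N := .cell 20) (c := .pairSign)
    (e := .mul (.smul (.cell 31) (.at 49 (.cell 65))) (.at 51 (.get 24 (.cell 61) (.cell 65))))
    rfl (by simp) rfl rfl rfl (extz fun v => c v *
      (chi (zp (elts I gen u) ⬝ᵥ xp (elts I gen u)) *
      chi (zp (elts I gen u) ⬝ᵥ xp (elts I gen v)) * chi (symp (elts I gen u) Q) : ℝ) *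
      I.overlap Q (elts I gen u + elts I gen v)),
    show (NExpr.cell 20).eval s = 2 ^ I.dimK from h.enum.order, sum_range_extz]
  intro j s' hj hx hag
  have hjD : j < 2 ^ I.dimK := by rw [← h.enum.order]; exact hj
  have h' := h.mono hag rfl
  have e1 : s'.nat 61 0 0 = u := by rw [hag.nat 61 rfl, hu]
  have v := run_pairSign h'.toReady (hQ.mono hag rfl) u ⟨j, hjD⟩ e1 hx
  have ha := Prog.pairSign.agree_run rfl s'
  have h2 := h'.mono ha rfl
  have hlt : (u : ℕ) ^^^ j < 2 ^ I.dimK := Nat.xor_lt_two_pow u.2 hjD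
  have hT : elts I gen ⟨(u : ℕ) ^^^ j, hlt⟩ = elts I gen u + elts I gen ⟨j, hjD⟩ := bitSum_xor _ _ _ _
  have hF' := hF ⟨(u : ℕ) ^^^ j, hlt⟩
  rw [hT] at hF'
  simp only [CExpr.eval_mul, CExpr.eval_smul, CExpr.eval_get, RExpr.eval, NExpr.eval,
    ha.nat 61 rfl, ha.nat 65 rfl, e1, hx, v, h2.enum.tabled.xor u u.2 j hjD, h2.coeff ⟨j, hjD⟩,
    ha.cx 51 rfl rfl, hag.cx 51 rfl rfl, hF', extz_of_lt _ hjD]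
  ring

/-- The overlaps are tabulated first, one reduction per listed element. The double sum then needs
only signs and table lookups. -/
theorem run_readExpect {I : Quench n m k} {t : ℝ} {s : Store} {gen : ℕ → PauliString n}
    {c : Fin (2 ^ I.dimK) → ℂ} (h : Evolved I t s gen c) {Q : PauliString n} (hQ : HasPauli s Q) :
    (Prog.readExpect.run s).outComplex = I.expect t Q := by
  have v := run_overlaps h.toReady hQ
  have a1 := Prog.overlaps.agree_run rfl s
  have h1 := h.mono a1 rfl
  have hQ1 := hQ.mono a1 rfl
  rw [Prog.readExpect, run_seq, run_seq]
  generalize Prog.overlaps.run s = s1 at *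
  have w := run_sumC (acc := 44) (x := 61) (N := .cell 20) (c := .pairSum)
    (e := .mul (.conj (.at 49 (.cell 61))) (.cell 36)) (s := s1) rfl (by simp) rfl rfl rfl
    (extz fun u => ∑ v, (starRingEnd ℂ) (c u) * c v *
      (chi (zp (elts I gen u) ⬝ᵥ xp (elts I gen u)) *
      chi (zp (elts I gen u) ⬝ᵥ xp (elts I gen v)) * chi (symp (elts I gen u) Q) : ℝ) *
      I.overlap Q (elts I gen u + elts I gen v)) (by
      intro j s' hj hx hag
      have hjD : j < 2 ^ I.dimK := by rw [← h1.enum.order]; exact hj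
      have h' := h1.mono hag rfl
      have w := run_pairSum h' (hQ1.mono hag rfl) (fun u => by rw [hag.cx 51 rfl rfl, v]) ⟨j, hjD⟩ hx
      have ha := Prog.pairSum.agree_run rfl s'
      have h2 := h'.mono ha rfl
      simp only [CExpr.eval_mul, CExpr.eval_conj, CExpr.eval_get, NExpr.eval, ha.nat 61 rfl, hx, w,
        h2.coeff ⟨j, hjD⟩, extz_of_lt _ hjD, Finset.mul_sum, mul_assoc])
  rw [show (NExpr.cell 20).eval s1 = 2 ^ I.dimK from h1.enum.order, sum_range_extz,
    ← I.expect_combine, ← h.state] at w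
  rw [Quench.expect, ← w]
  apply Complex.ext <;>
    simp [Prog.run, Store.setReal, NExpr.eval, RExpr.eval, Store.outComplex, Store.cx]

end

section

open scoped ENNReal

variable {n m k : ℕ}

/-! ### Expectations under programs with coin flips -/

/-- The expectation of a function under a discrete distribution. -/
def lexp {α : Type*} (p : PMF α) (f : α → ℝ≥0∞) : ℝ≥0∞ := ∑' a, p a * f a

theorem lexp_pure {α : Type*} (a : α) (f : α → ℝ≥0∞) : lexp (PMF.pure a) f = f a := by
  rw [lexp, tsum_eq_single a]
  · simp
  · intro b hb; simp [PMF.pure_apply, hb]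

theorem lexp_bind {α β : Type*} (p : PMF α) (g : α → PMF β) (f : β → ℝ≥0∞) :
    lexp (p.bind g) f = lexp p fun a => lexp (g a) f := by
  simp only [lexp, PMF.bind_apply, ← ENNReal.tsum_mul_right, ← ENNReal.tsum_mul_left]
  rw [ENNReal.tsum_comm]
  simp only [mul_assoc]

theorem lexp_map {α β : Type*} (p : PMF α) (g : α → β) (f : β → ℝ≥0∞) :
    lexp (p.map g) f = lexp p fun a => f (g a) := by
  rw [PMF.map, lexp_bind]
  simp only [Function.comp, lexp_pure]

theorem lexp_coin {p : ℝ} (h0 : 0 ≤ p) (h1 : p ≤ 1) (f : Bool → ℝ≥0∞) :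
    lexp (coin p) f = ENNReal.ofReal p * f true + ENNReal.ofReal (1 - p) * f false := by
  rw [lexp, tsum_fintype, Fintype.sum_bool]
  simp [coin, PMF.ofFintype_apply, min_eq_right h1, max_eq_right h0]

theorem lexp_seq (c d : Prog) (s : Store) (f : Store → ℝ≥0∞) :
    lexp ((Prog.seq c d).dist s) f = lexp (c.dist s) fun s' => lexp (d.dist s') f :=
  lexp_bind _ _ _

theorem lexp_run {c : Prog} (hc : c.flipFree = true) (s : Store) (f : Store → ℝ≥0∞) :
    lexp (c.dist s) f = f (c.run s) := by
  rw [c.dist_eq_pure_run hc, lexp_pure]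

/-! ### Random walks -/

/-- The endpoint of a walk whose steps are chosen by binary digits. -/
def xorSum (σ : ℕ → ℕ) : ℕ → ℕ → ℕ
  | 0, _ => 0
  | j + 1, b => if b.testBit j then xorSum σ j b ^^^ σ j else xorSum σ j b

theorem xorSum_congr {σ : ℕ → ℕ} {j b b' : ℕ} (h : ∀ l < j, b.testBit l = b'.testBit l) :
    xorSum σ j b = xorSum σ j b' := by
  induction j with
  | zero => rfl
  | succ j ih => rw [xorSum, xorSum, h j (Nat.lt_succ_self j), ih fun l hl => h l (by omega)]

theorem xorSum_lt {σ : ℕ → ℕ} {j d : ℕ} (hσ : ∀ l < j, σ l < 2 ^ d) (b : ℕ) :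
    xorSum σ j b < 2 ^ d := by
  induction j with
  | zero => exact Nat.two_pow_pos d
  | succ j ih =>
    rw [xorSum]
    have := ih fun l hl => hσ l (by omega)
    split_ifs
    · exact Nat.xor_lt_two_pow this (hσ j (Nat.lt_succ_self j))
    · exact this

theorem xorSum_succ_of_lt {σ : ℕ → ℕ} {j b : ℕ} (hb : b < 2 ^ j) :
    xorSum σ (j + 1) b = xorSum σ j b := by
  rw [xorSum, Nat.testBit_lt_two_pow hb]; rfl

theorem xorSum_succ_add {σ : ℕ → ℕ} {j b : ℕ} (hb : b < 2 ^ j) :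
    xorSum σ (j + 1) (2 ^ j + b) = xorSum σ j b ^^^ σ j := by
  rw [xorSum, Nat.testBit_two_pow_add_eq, Nat.testBit_lt_two_pow hb]
  rw [xorSum_congr fun l hl => Nat.testBit_two_pow_add_gt hl b]
  rfl

/-- One random step. -/
def Prog.walkStep (a : ℕ) : Prog :=
  .seq (.flip 42 (.lit 0) (.cell 60)
    (.div (.get 61 (.succ (.cell 60)) (.get 24 (.cell 41) (.at a (.cell 60))))
      (.get 61 (.cell 60) (.cell 41)))) <|
  .ite (.natEq (.at 42 (.cell 60)) (.lit 1))
    (.setN 41 (.lit 0) (.lit 0) (.get 24 (.cell 41) (.at a (.cell 60)))) .skip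

/-- A random walk with the steps listed in the array `a`. -/
def Prog.walk (a : ℕ) (N : NExpr) : Prog :=
  .seq (.setN 41 (.lit 0) (.lit 0) (.lit 0)) (.loop 60 N (.walkStep a))

/-- The weights of a random walk are in memory. -/
structure WalkMem (s : Store) (a N d : ℕ) (σ : ℕ → ℕ) (V : ℕ → ℕ → ℝ) : Prop where
  xor : ∀ x < 2 ^ d, ∀ y < 2 ^ d, s.nat 24 x y = x ^^^ y
  step : ∀ j < N, s.nat a 0 j = σ j
  step_lt : ∀ j < N, σ j < 2 ^ d
  weight : ∀ j ≤ N, ∀ x < 2 ^ d, s.real 61 j x = V j x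
  weight_nonneg : ∀ j ≤ N, ∀ x < 2 ^ d, 0 ≤ V j x
  weight_rec : ∀ j < N, ∀ x < 2 ^ d, V j x = V (j + 1) x + V (j + 1) (x ^^^ σ j)

/-- The step is taken with probability equal to its share of the remaining weight; by the recursion
for the weights this lies in `[0, 1]`, so the coin does not clamp it. If no weight remains, the
quotient is `0` by convention. -/
theorem lexp_walkStep {s : Store} {a N d : ℕ} {σ : ℕ → ℕ} {V : ℕ → ℕ → ℝ}
    (h : WalkMem s a N d σ V) (ha : a ≠ 42) {j x : ℕ} (hj : j < N)
    (hx : x < 2 ^ d) (h60 : s.nat 60 0 0 = j) (h41 : s.nat 41 0 0 = x) (f : Store → ℝ≥0∞) :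
    ∃ s₀ s₁ : Store, (Agree (.walkStep a) s s₀ ∧ s₀.nat 41 0 0 = x ∧ s₀.nat 42 0 j = 0 ∧
        ∀ l < j, s₀.nat 42 0 l = s.nat 42 0 l) ∧
      (Agree (.walkStep a) s s₁ ∧ s₁.nat 41 0 0 = x ^^^ σ j ∧ s₁.nat 42 0 j = 1 ∧
        ∀ l < j, s₁.nat 42 0 l = s.nat 42 0 l) ∧
      lexp ((Prog.walkStep a).dist s) f =
        ENNReal.ofReal (V (j + 1) (x ^^^ σ j) / V j x) * f s₁ +
        ENNReal.ofReal (1 - V (j + 1) (x ^^^ σ j) / V j x) * f s₀ := by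
  have hσ := h.step_lt j hj
  have hlt := Nat.xor_lt_two_pow hx hσ
  have hrec := h.weight_rec j hj x hx
  have n1 := h.weight_nonneg (j + 1) hj x hx
  have n2 := h.weight_nonneg (j + 1) hj _ hlt
  have n3 := h.weight_nonneg j hj.le x hx
  have hstep := h.step j hj
  let c₁ : Prog := .ite (.natEq (.at 42 (.cell 60)) (.lit 1))
    (.setN 41 (.lit 0) (.lit 0) (.get 24 (.cell 41) (.at a (.cell 60)))) .skip
  let s' : ℕ → Store := fun v => s.setNat 42 0 j v
  have e60 : ∀ v, (s' v).nat 60 0 0 = j := fun v => by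
    rw [← h60]; simp only [s', Store.setNat_nat_of_ne s (show (60 : ℕ) ≠ 42 by norm_num)]
  have e41 : ∀ v, (s' v).nat 41 0 0 = x := fun v => by
    rw [← h41]; simp only [s', Store.setNat_nat_of_ne s (show (41 : ℕ) ≠ 42 by norm_num)]
  have e24 : ∀ v, (s' v).nat 24 x (σ j) = x ^^^ σ j := fun v => by
    rw [← h.xor x hx _ hσ]; simp only [s', Store.setNat_nat_of_ne s (show (24 : ℕ) ≠ 42 by norm_num)]
  have ea : ∀ v, (s' v).nat a 0 j = σ j := fun v => by
    rw [← hstep]; simp only [s', Store.setNat_nat_of_ne s ha]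
  have e42 : ∀ v, (s' v).nat 42 0 j = v := fun v => by simp [s', Store.setNat]
  have e42' : ∀ v, ∀ l < j, (s' v).nat 42 0 l = s.nat 42 0 l := fun v l hl => by
    simp [s', Store.setNat, hl.ne]
  have hag : ∀ v, Agree (.walkStep a) s (s' v) := fun v => ⟨fun b hb => by
    simp only [Prog.walkStep, Prog.modN, Bool.or_eq_false_iff, beq_eq_false_iff_ne] at hb
    exact Store.setNat_nat_of_ne s hb.1 _ _ _, fun _ _ => rfl⟩
  have r0 : c₁.run (s' 0) = s' 0 :=
    run_ite_neg _ _ (by simp only [Test.holds, NExpr.eval, e60, e42]; norm_num)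
  have r1 : c₁.run (s' 1) = (s' 1).setNat 41 0 0 (x ^^^ σ j) := by
    rw [run_ite_pos _ _ (by simp only [Test.holds, NExpr.eval, e60, e42])]
    simp only [Prog.run, NExpr.eval, e60, e41, ea, e24]
  refine ⟨s' 0, (s' 1).setNat 41 0 0 (x ^^^ σ j), ⟨hag 0, e41 0, e42 0, e42' 0⟩,
    ⟨⟨fun b hb => ?_, fun _ _ => rfl⟩, by simp [Store.setNat], ?_, fun l hl => ?_⟩, ?_⟩
  · rw [Store.setNat_nat_of_ne, (hag 1).nat b hb]
    simp only [Prog.walkStep, Prog.modN, Bool.or_eq_false_iff, beq_eq_false_iff_ne] at hb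
    exact hb.2.1
  · rw [Store.setNat_nat_of_ne _ (by simp), e42]
  · rw [Store.setNat_nat_of_ne _ (by simp), e42' 1 l hl]
  · rw [Prog.walkStep, lexp_seq]
    have hp : RExpr.eval s (.div (.get 61 (.succ (.cell 60)) (.get 24 (.cell 41) (.at a (.cell 60))))
        (.get 61 (.cell 60) (.cell 41))) = V (j + 1) (x ^^^ σ j) / V j x := by
      simp only [RExpr.eval, NExpr.eval, h60, h41, hstep, h.xor x hx _ hσ,
        h.weight j hj.le x hx, h.weight (j + 1) hj _ hlt]
    rw [Prog.dist, hp, lexp_map, lexp_coin (div_nonneg n2 n3) (div_le_one_of_le₀ (by linarith) n3)]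
    simp only [NExpr.eval, h60, if_true, Bool.false_eq_true, if_false]
    rw [lexp_run (c := c₁) rfl (s' 1), lexp_run (c := c₁) rfl (s' 0), r0, r1]

theorem WalkMem.mono {s s' : Store} {a N d : ℕ} {σ : ℕ → ℕ} {V : ℕ → ℕ → ℝ}
    (h : WalkMem s a N d σ V) (h1 : s'.nat 24 = s.nat 24) (h2 : s'.nat a = s.nat a)
    (h3 : s'.real 61 = s.real 61) : WalkMem s' a N d σ V :=
  ⟨by rw [h1]; exact h.xor, by rw [h2]; exact h.step, h.step_lt, by rw [h3]; exact h.weight,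
    h.weight_nonneg, h.weight_rec⟩

theorem sum_range_two_pow_succ (i : ℕ) (f : ℕ → ℝ≥0∞) :
    ∑ b ∈ Finset.range (2 ^ (i + 1)), f b = ∑ b ∈ Finset.range (2 ^ i), (f b + f (2 ^ i + b)) := by
  rw [pow_succ, mul_two, Finset.sum_range_add, Finset.sum_add_distrib]

/-- This is the chain rule for one coin: the weight of a branch is the weight of the node times the
conditional probability. If `A + B = 0`, both branches have weight zero and the value of the
quotient does not matter. -/
theorem ofReal_split {A B T : ℝ} (hA : 0 ≤ A) (hB : 0 ≤ B) (hT : 0 ≤ T) (x y : ℝ≥0∞) :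
    ENNReal.ofReal (A / T) * x + ENNReal.ofReal (B / T) * y =
      ENNReal.ofReal ((A + B) / T) *
        (ENNReal.ofReal (B / (A + B)) * y + ENNReal.ofReal (1 - B / (A + B)) * x) := by
  rcases (add_nonneg hA hB).eq_or_lt with h | h
  · obtain rfl : A = 0 := by linarith
    obtain rfl : B = 0 := by linarith
    simp
  · have hAB : 0 ≤ (A + B) / T := div_nonneg h.le hT
    rw [mul_add, ← mul_assoc, ← mul_assoc, ← ENNReal.ofReal_mul hAB, ← ENNReal.ofReal_mul hAB,
      add_comm]
    congr 3
    · field_simp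
    · field_simp; ring

/-- The transition probabilities telescope to the quotient of the final and the total weight. The
choices are the binary digits of `b`, recorded in array `42`, and `G b` bounds `f` from below on all
stores that result from them. A lower bound is sufficient for the sampling argument. -/
theorem lexp_walk_loop {s : Store} {a N d : ℕ} {σ : ℕ → ℕ} {V : ℕ → ℕ → ℝ}
    (h : WalkMem s a N d σ V) (ha : a ≠ 41 ∧ a ≠ 42 ∧ a ≠ 60) (h41 : s.nat 41 0 0 = 0) {i : ℕ}
    (hi : i ≤ N) (e : NExpr) (G : ℕ → ℝ≥0∞) (f : Store → ℝ≥0∞)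
    (hG : ∀ b < 2 ^ i, ∀ s', Agree (.loop 60 e (.walkStep a)) s s' →
      s'.nat 41 0 0 = xorSum σ i b → (∀ j < i, s'.nat 42 0 j = (b.testBit j).toNat) → G b ≤ f s') :
    ∑ b ∈ Finset.range (2 ^ i), ENNReal.ofReal (V i (xorSum σ i b) / V 0 0) * G b ≤
      lexp (distLoop 60 (Prog.walkStep a).dist i s) f := by
  induction i generalizing G f with
  | zero =>
    rw [distLoop, lexp_pure, pow_zero, Finset.sum_range_one]
    have h1 := hG 0 (by simp) s (.refl _ _) (by rw [h41]; rfl) (by simp)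
    calc _ ≤ 1 * G 0 := by
          gcongr
          rw [← ENNReal.ofReal_one]
          -- The quotient is `0` rather than `1` if the total weight vanishes, so only an inequality
          -- holds here.
          exact ENNReal.ofReal_le_ofReal (div_self_le_one _)
      _ ≤ f s := by rwa [one_mul]
  | succ i ih =>
    rw [distLoop, lexp_bind, sum_range_two_pow_succ]
    let x : ℕ → ℕ := fun b => xorSum σ i b
    have hx : ∀ b, x b < 2 ^ d := xorSum_lt fun l hl => h.step_lt l (by omega)
    have hy : ∀ b, x b ^^^ σ i < 2 ^ d := fun b => Nat.xor_lt_two_pow (hx b) (h.step_lt i hi)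
    -- The bound one step earlier is the average of the two later ones over the last coin.
    let G' : ℕ → ℝ≥0∞ := fun b =>
      ENNReal.ofReal (V (i + 1) (x b ^^^ σ i) / V i (x b)) * G (2 ^ i + b) +
        ENNReal.ofReal (1 - V (i + 1) (x b ^^^ σ i) / V i (x b)) * G b
    refine le_trans (Finset.sum_le_sum fun b hb => ?_) (ih (by omega) G' _ ?_)
    · have hb' := Finset.mem_range.mp hb
      rw [xorSum_succ_of_lt hb', xorSum_succ_add hb',
        ofReal_split (h.weight_nonneg (i + 1) hi _ (hx b)) (h.weight_nonneg (i + 1) hi _ (hy b))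
          (h.weight_nonneg 0 (Nat.zero_le _) 0 (Nat.two_pow_pos d)),
        ← h.weight_rec i hi _ (hx b)]
    · intro b hb s' hag h41' hbits
      let s₂ := s'.setNat 60 0 0 i
      have hag2 : Agree (.loop 60 e (.walkStep a)) s s₂ := ⟨fun c hc => by
        rw [Store.setNat_nat_of_ne, hag.nat c hc]
        simp only [Prog.modN, Bool.or_eq_false_iff, beq_eq_false_iff_ne] at hc
        exact hc.1, hag.real⟩
      have h2 : WalkMem s₂ a N d σ V := h.mono (hag2.nat 24 rfl)
        (hag2.nat a (by simp [Prog.walkStep, Prog.modN, ha])) (hag2.real 61 rfl)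
      obtain ⟨s₀, s₁, ⟨g0, k0, b0, l0⟩, ⟨g1, k1, b1, l1⟩, hw⟩ := lexp_walkStep h2 ha.2.1 hi (hx b)
        (by simp [s₂, Store.setNat]) (by
          rw [← show s'.nat 41 0 0 = x b from h41']
          simp only [s₂, Store.setNat_nat_of_ne s' (show (41 : ℕ) ≠ 60 by norm_num)]) f
      rw [hw]
      have hbits2 : ∀ l < i, s₂.nat 42 0 l = (b.testBit l).toNat := fun l hl => by
        rw [← hbits l hl]
        simp only [s₂, Store.setNat_nat_of_ne s' (show (42 : ℕ) ≠ 60 by norm_num)]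
      have hcomp : ∀ s₃, Agree (.walkStep a) s₂ s₃ → Agree (.loop 60 e (.walkStep a)) s s₃ :=
        fun s₃ g => ⟨fun c hc => by
          rw [← hag2.nat c hc]
          simp only [Prog.modN, Bool.or_eq_false_iff] at hc
          exact g.nat c hc.2, fun c hc => by rw [← hag2.real c hc]; exact g.real c hc⟩
      have hb2 : 2 ^ (i + 1) = 2 ^ i + 2 ^ i := by rw [pow_succ, mul_two]
      refine add_le_add (mul_le_mul_right ?_ _) (mul_le_mul_right ?_ _)
      · refine hG _ (by omega) s₁ (hcomp _ g1) (by rw [k1, xorSum_succ_add hb]) fun l hl => ?_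
        rcases Nat.lt_succ_iff_lt_or_eq.mp hl with hl' | rfl
        · rw [l1 l hl', hbits2 l hl', Nat.testBit_two_pow_add_gt hl']
        · rw [b1, Nat.testBit_two_pow_add_eq, Nat.testBit_lt_two_pow hb]; rfl
      · refine hG _ (by omega) s₀ (hcomp _ g0) (by rw [k0, xorSum_succ_of_lt hb]) fun l hl => ?_
        rcases Nat.lt_succ_iff_lt_or_eq.mp hl with hl' | rfl
        · rw [l0 l hl', hbits2 l hl']
        · rw [b0, Nat.testBit_lt_two_pow hb]; rfl

/-- A walk ends at each point with at least the probability given by the weights. -/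
theorem lexp_walk {s : Store} {a N d : ℕ} {σ : ℕ → ℕ} {V : ℕ → ℕ → ℝ}
    (h : WalkMem s a N d σ V) (ha : a ≠ 41 ∧ a ≠ 42 ∧ a ≠ 60) {e : NExpr}
    (he : ∀ s', Agree (.setN 41 (.lit 0) (.lit 0) (.lit 0)) s s' → e.eval s' = N) (G : ℕ → ℝ≥0∞)
    (f : Store → ℝ≥0∞) (hG : ∀ b < 2 ^ N, ∀ s', Agree (.walk a e) s s' →
      s'.nat 41 0 0 = xorSum σ N b → (∀ j < N, s'.nat 42 0 j = (b.testBit j).toNat) → G b ≤ f s') :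
    ∑ b ∈ Finset.range (2 ^ N), ENNReal.ofReal (V N (xorSum σ N b) / V 0 0) * G b ≤
      lexp ((Prog.walk a e).dist s) f := by
  rw [Prog.walk, lexp_seq, lexp_run rfl, Prog.dist]
  have a1 := (Prog.setN 41 (.lit 0) (.lit 0) (.lit 0)).agree_run rfl s
  have v1 : ((Prog.setN 41 (.lit 0) (.lit 0) (.lit 0)).run s).nat 41 0 0 = 0 := by
    simp [Prog.run, Store.setNat, NExpr.eval]
  rw [he _ a1]
  generalize (Prog.setN 41 (.lit 0) (.lit 0) (.lit 0)).run s = s1 at *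
  exact lexp_walk_loop (h.mono (a1.nat 24 rfl) (a1.nat a (by simp [Prog.modN, ha]))
    (a1.real 61 rfl)) ha v1 le_rfl e G f fun b hb s' hag => hG b hb s' (a1.seq hag)

/-- Compute the weights of a walk from those in the last row. -/
def Prog.walkWeights (a : ℕ) (N : NExpr) : Prog :=
  .seq (.setN 40 (.lit 0) (.lit 0) N) <|
  .loop 60 N <|
  .seq (.setN 40 (.lit 0) (.lit 0) (.pred (.cell 40))) <|
  .seq (.fillR 62 (.lit 0) 63 (.cell 20) .skip (.add (.get 61 (.succ (.cell 40)) (.cell 63))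
    (.get 61 (.succ (.cell 40)) (.get 24 (.cell 63) (.at a (.cell 40)))))) <|
  .fillR 61 (.cell 40) 63 (.cell 20) .skip (.at 62 (.cell 63))

/-- The total weight of the walks of a given length. -/
def walkWeight (σ : ℕ → ℕ) (w : ℕ → ℝ) : ℕ → ℕ → ℕ → ℝ
  | 0, _, x => w x
  | r + 1, j, x => walkWeight σ w r (j + 1) x + walkWeight σ w r (j + 1) (x ^^^ σ j)

theorem walkWeight_nonneg {σ : ℕ → ℕ} {w : ℕ → ℝ} (hw : ∀ x, 0 ≤ w x) (r j x : ℕ) :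
    0 ≤ walkWeight σ w r j x := by
  induction r generalizing j x with
  | zero => exact hw x
  | succ r ih => exact add_nonneg (ih _ _) (ih _ _)

/-- Unfolding the recursion gives one summand for each of the `2 ^ N` choice sequences. Since many
sequences share an endpoint, the table of weights has only one row per step and one entry per
endpoint. -/
theorem walkWeight_eq_sum (σ : ℕ → ℕ) (w : ℕ → ℝ) (N : ℕ) :
    walkWeight σ w N 0 0 = ∑ b ∈ Finset.range (2 ^ N), w (xorSum σ N b) := by
  have key : ∀ i ≤ N, walkWeight σ w N 0 0 =
      ∑ b ∈ Finset.range (2 ^ i), walkWeight σ w (N - i) i (xorSum σ i b) := by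
    intro i
    induction i with
    | zero => intro _; simp [xorSum]
    | succ i ih =>
      intro hi
      rw [ih (by omega), pow_succ, mul_two, Finset.sum_range_add, ← Finset.sum_add_distrib]
      refine Finset.sum_congr rfl fun b hb => ?_
      have hb' := Finset.mem_range.mp hb
      rw [xorSum_succ_of_lt hb', xorSum_succ_add hb', show N - i = N - (i + 1) + 1 by omega,
        walkWeight]
  rw [key N le_rfl, Nat.sub_self]
  rfl

/-- Rows are computed from the last to the first; loop counters only increase, so `cell 40` counts
down beside the loop. A new row is assembled in array `62`, because `run_fillR` gives no information
about the array being filled. -/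
theorem run_walkWeights {s : Store} {a N d : ℕ} {σ : ℕ → ℕ} {w : ℕ → ℝ} (hd : s.nat 20 0 0 = 2 ^ d)
    (hx : ∀ x < 2 ^ d, ∀ y < 2 ^ d, s.nat 24 x y = x ^^^ y) (hσ : ∀ j < N, s.nat a 0 j = σ j)
    (hlt : ∀ j < N, σ j < 2 ^ d) (hw : ∀ x < 2 ^ d, s.real 61 N x = w x) (hw0 : ∀ x, 0 ≤ w x)
    (ha : a ≠ 40 ∧ a ≠ 60 ∧ a ≠ 63) {e : NExpr}
    (he : ∀ s' : Store, (∀ b, b ≠ 40 → s'.nat b = s.nat b) → e.eval s' = N) :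
    WalkMem ((Prog.walkWeights a e).run s) a N d σ (fun j x => walkWeight σ w (N - j) j x) := by
  have hag := (Prog.walkWeights a e).agree_run rfl s
  refine ⟨by rw [hag.nat 24 rfl]; exact hx, ?_, hlt, ?_, fun j _ x _ => walkWeight_nonneg hw0 _ _ _,
    fun j hj x _ => ?_⟩
  · rw [hag.nat a (by simp [Prog.walkWeights, Prog.fillR, Prog.modN, ha])]
    exact hσ
  · rw [Prog.walkWeights, run_seq]
    have a1 := (Prog.setN 40 (.lit 0) (.lit 0) e).agree_run rfl s
    have v1 : ((Prog.setN 40 (.lit 0) (.lit 0) e).run s).nat 40 0 0 = N := by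
      simp [Prog.run, Store.setNat, NExpr.eval, he s fun _ _ => rfl]
    have e1 : e.eval ((Prog.setN 40 (.lit 0) (.lit 0) e).run s) = N :=
      he _ fun b hb => a1.nat b (by simp [Prog.modN, hb])
    generalize (Prog.setN 40 (.lit 0) (.lit 0) e).run s = s1 at *
    have v := run_loop (x := 60) (e := e) (s := s1) (c :=
      .seq (.setN 40 (.lit 0) (.lit 0) (.pred (.cell 40))) <|
      .seq (.fillR 62 (.lit 0) 63 (.cell 20) .skip (.add (.get 61 (.succ (.cell 40)) (.cell 63))
        (.get 61 (.succ (.cell 40)) (.get 24 (.cell 63) (.at a (.cell 40)))))) <|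
      .fillR 61 (.cell 40) 63 (.cell 20) .skip (.at 62 (.cell 63))) rfl
      (fun i s' => s'.nat 40 0 0 = N - i ∧ ∀ j, N - i ≤ j → j ≤ N → ∀ x < 2 ^ d,
        s'.real 61 j x = walkWeight σ w (N - j) j x)
      ⟨by rw [v1]; rfl, fun j h1 h2 x hx => by
        obtain rfl : j = N := by omega
        rw [Nat.sub_self, walkWeight, a1.real 61 rfl, hw x hx]⟩ (by
        rintro i s' hi hc hag' ⟨k1, k2⟩
        rw [e1] at hi
        rw [run_seq, run_seq]
        have a2 := (Prog.setN 40 (.lit 0) (.lit 0) (.pred (.cell 40))).agree_run rfl s'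
        have v2 : ((Prog.setN 40 (.lit 0) (.lit 0) (.pred (.cell 40))).run s').nat 40 0 0 =
            N - (i + 1) := by
          simp only [Prog.run, Store.setNat, NExpr.eval, and_self, if_true, k1]
          omega
        have r2 := a2.real 61 rfl
        have hD2 : ((Prog.setN 40 (.lit 0) (.lit 0) (.pred (.cell 40))).run s').nat 20 0 0 = 2 ^ d := by
          rw [a2.nat 20 rfl, hag'.nat 20 rfl, a1.nat 20 rfl, hd]
        have x2 : ((Prog.setN 40 (.lit 0) (.lit 0) (.pred (.cell 40))).run s').nat 24 = s.nat 24 := by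
          rw [a2.nat 24 rfl, hag'.nat 24 rfl, a1.nat 24 rfl]
        have σ2 : ((Prog.setN 40 (.lit 0) (.lit 0) (.pred (.cell 40))).run s').nat a = s.nat a := by
          rw [a2.nat a (by simp [Prog.modN, ha]),
            hag'.nat a (by simp [Prog.fillR, Prog.modN, ha]), a1.nat a (by simp [Prog.modN, ha])]
        generalize (Prog.setN 40 (.lit 0) (.lit 0) (.pred (.cell 40))).run s' = s2 at *
        let c3 : Prog := .fillR 62 (.lit 0) 63 (.cell 20) .skip
          (.add (.get 61 (.succ (.cell 40)) (.cell 63)) (.get 61 (.succ (.cell 40))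
            (.get 24 (.cell 63) (.at a (.cell 40)))))
        have a3 := c3.agree_run rfl s2
        have v3 : ∀ x < 2 ^ d, (c3.run s2).real 62 0 x =
            walkWeight σ w (i + 1) (N - (i + 1)) x := by
          intro x hx'
          rw [run_fillR (a := 62) (x := 63) (i := .lit 0) (N := .cell 20) (c := .skip) rfl rfl rfl
            0 (fun _ _ => rfl) (fun x => walkWeight σ w (i + 1) (N - (i + 1)) x),
            show (NExpr.cell 20).eval s2 = 2 ^ d from hD2, if_pos ⟨rfl, hx'⟩]
          intro x s3 hx3 hc3 h3
          rw [show (NExpr.cell 20).eval s2 = 2 ^ d from hD2] at hx3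
          have hj : N - (i + 1) < N := by omega
          have m40 : s3.nat 40 0 0 = N - (i + 1) := by rw [h3.nat 40 rfl, v2]
          have m24 : s3.nat 24 = s.nat 24 := by rw [h3.nat 24 rfl, x2]
          have ma : s3.nat a 0 (N - (i + 1)) = σ (N - (i + 1)) := by
            rw [h3.nat a (by simp [Prog.fillR, Prog.modN, ha]), σ2, hσ _ hj]
          have m61 : ∀ x' < 2 ^ d, s3.real 61 (N - (i + 1) + 1) x' =
              walkWeight σ w i (N - (i + 1) + 1) x' := fun x' hx' => by
            rw [h3.real 61 rfl, r2, k2 _ (by omega) (by omega) x' hx',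
              show N - (N - (i + 1) + 1) = i by omega]
          simp only [Prog.run, RExpr.eval, NExpr.eval, hc3, m40, ma, m24, hx x hx3 _ (hlt _ hj),
            m61 x hx3, m61 _ (Nat.xor_lt_two_pow hx3 (hlt _ hj)), walkWeight]
        have hD3 : (NExpr.cell 20).eval (c3.run s2) = 2 ^ d := by
          change (c3.run s2).nat 20 0 0 = _
          rw [a3.nat 20 rfl, hD2]
        have w3 : (c3.run s2).nat 40 0 0 = N - (i + 1) := by rw [a3.nat 40 rfl, v2]
        have r3 := a3.real 61 rfl
        change (Prog.run _ (c3.run s2)).nat 40 0 0 = _ ∧ ∀ j, _ → _ → ∀ x < _,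
          (Prog.run _ (c3.run s2)).real 61 j x = _
        generalize c3.run s2 = s3 at *
        have a4 := (Prog.fillR 61 (.cell 40) 63 (.cell 20) .skip
          (.at 62 (.cell 63))).agree_run rfl s3
        refine ⟨by rw [a4.nat 40 rfl, w3], fun j h1 h2 x hx' => ?_⟩
        rw [run_fillR (a := 61) (x := 63) (i := .cell 40) (N := .cell 20) (c := .skip) rfl rfl rfl
          (N - (i + 1)) (fun s4 h4 => by
            change s4.nat 40 0 0 = _
            rw [h4.nat 40 rfl, w3])
          (fun x => walkWeight σ w (i + 1) (N - (i + 1)) x), hD3]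
        · by_cases hj : j = N - (i + 1)
          · rw [if_pos ⟨hj, hx'⟩, hj, show N - (N - (i + 1)) = i + 1 by omega]
          · rw [if_neg fun h => hj h.1, r3, r2, k2 j (by omega) h2 x hx']
        · intro x s4 hx4 hc4 h4
          rw [hD3] at hx4
          simp only [Prog.run, RExpr.eval, NExpr.eval, hc4, h4.real 62 rfl, v3 x hx4])
    rw [e1, Nat.sub_self] at v
    exact fun j hj x hx => v.2 j (Nat.zero_le _) hj x hx
  · rw [show N - j = N - (j + 1) + 1 by omega, walkWeight]

/-! ### Weights of the outcomes -/

/-- The contributions to the shifted amplitudes. -/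
def shiftCoeff (I : Quench n m k) (gen : ℕ → PauliString n) (c : Fin (2 ^ I.dimK) → ℂ)
    (s u : Fin (2 ^ I.dimK)) : ℂ :=
  c s * (chi (zp (elts I gen s) ⬝ᵥ (I.zv + xp (elts I gen u) + xp (elts I gen s))) : ℝ) *
    I.rel (mkP (xp (elts I gen s + elts I gen u)) 0)

/-- The weight of an outcome in terms of the index of a Walsh function and the index of a listed
element. -/
def shiftWeight (I : Quench n m k) (gen : ℕ → PauliString n) (c : Fin (2 ^ I.dimK) → ℂ)
    (x : ℕ) (u : Fin (2 ^ I.dimK)) : ℝ :=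
  Complex.normSq (∑ s : Fin (2 ^ I.dimK), (walsh I.dimK x s : ℂ) * shiftCoeff I gen c s u)

theorem shiftWeight_nonneg (I : Quench n m k) (gen : ℕ → PauliString n) (c : Fin (2 ^ I.dimK) → ℂ)
    (x : ℕ) (u : Fin (2 ^ I.dimK)) : 0 ≤ shiftWeight I gen c x u := Complex.normSq_nonneg _

theorem shiftWeight_eq (I : Quench n m k) (gen : ℕ → PauliString n) (c : Fin (2 ^ I.dimK) → ℂ)
    {x : ℕ} {G : PauliString n} (u : Fin (2 ^ I.dimK))
    (h : ∀ s : Fin (2 ^ I.dimK), walsh I.dimK x s = chi (symp G (elts I gen s))) :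
    shiftWeight I gen c x u =
      ‖I.shiftedAmp (elts I gen) c (fun s => chi (symp G (elts I gen s))) u‖ ^ 2 := by
  rw [shiftWeight, Complex.normSq_eq_norm_sq]
  congr 2
  refine Finset.sum_congr rfl fun s _ => ?_
  rw [h, shiftCoeff]
  push_cast
  ring

/-! ### Tables for sampling -/

/-- Compute the relative amplitudes at shifted labels. -/
def Prog.shiftRel : Prog :=
  .fillC 51 (.lit 0) 63 (.cell 20)
    (.relC (.get 22 (.cell 63) (.cell 72)) (.lit 0) (.lit 0) (.lit 0)) (.cell 29)

/-- Compute the sign of a contribution to a shifted amplitude. -/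
def Prog.shiftSign : Prog :=
  .signProd (.mul (.sign (.get 23 (.cell 63) (.cell 64)) (.at 8 (.cell 64)))
    (.sign (.get 23 (.cell 63) (.cell 64)) (.get 22 (.get 24 (.cell 63) (.cell 65)) (.cell 64))))

/-- Compute the contributions to the shifted amplitudes. -/
def Prog.shiftCoeffs : Prog :=
  .fillC₂ 58 63 (.cell 20) 65 (.cell 20) .shiftSign
    (.mul (.smul (.cell 31) (.at 49 (.cell 63))) (.at 51 (.get 24 (.cell 63) (.cell 65))))

/-- Compute one row of weights. -/
def Prog.weightRow : Prog :=
  .fillR 46 (.cell 61) 63 (.cell 20) (.sumC 36 65 (.cell 20) .skip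
    (.smul (.get 23 (.cell 61) (.cell 65)) (.get 58 (.cell 65) (.cell 63))))
    (.add (.mul (.cell 36) (.cell 36)) (.mul (.cell 37) (.cell 37)))

/-- Compute the weights. -/
def Prog.weights : Prog := .loop 61 (.cell 20) .weightRow

/-- Compute the indices of the Walsh functions of the generators. -/
def Prog.genIdx : Prog :=
  .loop 60 .qubits <|
  .seq (.charIdx (.get 1 (.cell 60) (.cell 74)) (.get 2 (.cell 60) (.cell 74)))
    (.setN 39 (.lit 0) (.cell 60) (.cell 37))

theorem run_shiftRel {I : Quench n m k} {t : ℝ} {s : Store} {gen : ℕ → PauliString n}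
    (hs : Ready I t s gen) (u : Fin (2 ^ I.dimK)) :
    (Prog.shiftRel.run s).cx 51 0 u = I.rel (mkP (xp (elts I gen u)) 0) := by
  rw [Prog.shiftRel, run_fillC (a := 51) (x := 63) (N := .cell 20) (e := .cell 29) rfl (by simp)
    rfl rfl rfl rfl 0 (fun _ _ => rfl) (extz fun u => I.rel (mkP (xp (elts I gen u)) 0)),
    show (NExpr.cell 20).eval s = 2 ^ I.dimK from hs.enum.order, if_pos ⟨rfl, u.2⟩, extz_val]
  intro j s' hj hx hag
  have hjD : j < 2 ^ I.dimK := by rw [← hs.enum.order]; exact hj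
  have hs' := hs.mono hag rfl
  obtain ⟨o1, -⟩ := operand_listed hs' (x := 63) (by simp) hjD hx
  rw [extz_of_lt _ hjD, CExpr.eval_get, NExpr.eval,
    run_relC hs'.toSetup (A := mkP (xp (elts I gen ⟨j, hjD⟩)) 0) (B := 0) o1
    (operand_zero s' (n := n)) (operand_zero s' (n := n)) (operand_zero s' (n := n)),
    iph_mkP_zero]
  simp

theorem run_shiftCoeffs {I : Quench n m k} {t : ℝ} {s : Store} {gen : ℕ → PauliString n}
    {c : Fin (2 ^ I.dimK) → ℂ} (h : Evolved I t s gen c)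
    (hF : ∀ u : Fin (2 ^ I.dimK), s.cx 51 0 u = I.rel (mkP (xp (elts I gen u)) 0))
    (u v : Fin (2 ^ I.dimK)) :
    (Prog.shiftCoeffs.run s).cx 58 u v = shiftCoeff I gen c u v := by
  have hD : (NExpr.cell 20).eval s = 2 ^ I.dimK := h.enum.order
  rw [Prog.shiftCoeffs, run_fillC₂ (a := 58) (x := 63) (y := 65) (M := .cell 20) (N := .cell 20)
    (c := .shiftSign) rfl (by simp) rfl rfl rfl rfl (by simp) rfl (2 ^ I.dimK)
    (fun s' hag => (h.mono hag rfl).enum.order)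
    (fun a b => extz (fun a => extz (fun b => shiftCoeff I gen c a b) b) a), hD,
    if_pos ⟨u.2, v.2⟩, extz_val, extz_val]
  intro i j s' hi hj hx hy hag
  rw [hD] at hi
  have h' := h.mono hag rfl
  have hlt : i ^^^ j < 2 ^ I.dimK := Nat.xor_lt_two_pow hi hj
  have hT : elts I gen ⟨i ^^^ j, hlt⟩ = elts I gen ⟨i, hi⟩ + elts I gen ⟨j, hj⟩ :=
    bitSum_xor _ _ _ _
  have w := run_signProd (s := s') (e := .mul (.sign (.get 23 (.cell 63) (.cell 64))
    (.at 8 (.cell 64))) (.sign (.get 23 (.cell 63) (.cell 64))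
      (.get 22 (.get 24 (.cell 63) (.cell 65)) (.cell 64)))) h'.loaded.qubits
    (fun q => chi (zp (elts I gen ⟨i, hi⟩) q * I.zv q) *
      chi (zp (elts I gen ⟨i, hi⟩) q * xp (elts I gen ⟨i, hi⟩ + elts I gen ⟨j, hj⟩) q)) (by
      intro s2 hag2 q hq
      have h2 := h'.mono hag2 rfl
      have e1 : s2.nat 63 0 0 = i := by rw [hag2.nat 63 rfl, hx]
      have e2 : s2.nat 65 0 0 = j := by rw [hag2.nat 65 rfl, hy]
      have f2 := h2.enum.listed.z i hi q
      have f3 := h2.enum.listed.x _ hlt q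
      rw [show bitSum gen I.dimK (i ^^^ j) = _ from hT] at f3
      simp only [RExpr.eval, NExpr.eval, hq, e1, e2, f2, f3, h2.tables.sign, h2.loaded.zv,
        h2.enum.tabled.xor i hi j hj]
      rfl)
  change (Prog.shiftSign.run s').real 31 0 0 = _ at w
  rw [Finset.prod_mul_distrib, ← chi_sum, ← chi_sum, ← chi_add] at w
  have ha := Prog.shiftSign.agree_run rfl s'
  have h2 := h'.mono ha rfl
  have hF' := hF ⟨i ^^^ j, hlt⟩
  rw [hT] at hF'
  simp only [CExpr.eval_mul, CExpr.eval_smul, CExpr.eval_get, RExpr.eval, NExpr.eval,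
    ha.nat 63 rfl, ha.nat 65 rfl, hx, hy, w, h2.enum.tabled.xor i hi j hj, h2.coeff ⟨i, hi⟩,
    ha.cx 51 rfl rfl, hag.cx 51 rfl rfl, hF', extz_of_lt _ hi, extz_of_lt _ hj, shiftCoeff]
  rw [mul_comm (c ⟨i, hi⟩)]
  congr 4
  change zp (elts I gen ⟨i, hi⟩) ⬝ᵥ I.zv +
    zp (elts I gen ⟨i, hi⟩) ⬝ᵥ xp (elts I gen ⟨i, hi⟩ + elts I gen ⟨j, hj⟩) = _
  rw [← dotProduct_add, xp_add, add_comm (xp (elts I gen ⟨i, hi⟩)), add_assoc]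

/-- A sum over the group for each pair of a character and a group element: these three nested loops
cost the third power of the group order. -/
theorem run_weights {I : Quench n m k} {t : ℝ} {s : Store} {gen : ℕ → PauliString n}
    {c : Fin (2 ^ I.dimK) → ℂ} (h : Ready I t s gen)
    (hC : ∀ u v : Fin (2 ^ I.dimK), s.cx 58 u v = shiftCoeff I gen c u v) :
    ∀ x < 2 ^ I.dimK, ∀ u : Fin (2 ^ I.dimK),
      (Prog.weights.run s).real 46 x u = shiftWeight I gen c x u := by
  have hD : (NExpr.cell 20).eval s = 2 ^ I.dimK := h.enum.order
  have v := run_loop (x := 61) (e := .cell 20) (s := s) (c := .weightRow) rfl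
    (fun j s' => ∀ x < j, ∀ u : Fin (2 ^ I.dimK), s'.real 46 x u = shiftWeight I gen c x u)
    (by simp) (by
      intro j s' hj hc hag hi x hxj u
      rw [hD] at hj
      have h' := h.mono hag rfl
      have hD' : (NExpr.cell 20).eval s' = 2 ^ I.dimK := h'.enum.order
      rw [Prog.weightRow, run_fillR (a := 46) (x := 63) (i := .cell 61) (N := .cell 20)
        (e := .add (.mul (.cell 36) (.cell 36)) (.mul (.cell 37) (.cell 37))) rfl rfl rfl j
        (fun s2 h2 => by
          change (Prog.run _ s2).nat 61 0 0 = j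
          rw [(Prog.agree_run _ rfl s2).nat 61 rfl, h2.nat 61 rfl, hc])
        (extz fun u => shiftWeight I gen c j u), hD', extz_val]
      · by_cases hx : x = j
        · rw [if_pos ⟨hx, u.2⟩, hx]
        · rw [if_neg fun h => hx h.1, hi x (by omega)]
      · intro l s2 hl hx2 hag2
        have h2 := h'.mono hag2 rfl
        rw [hD'] at hl
        have w := run_sumC (acc := 36) (x := 65) (N := .cell 20) (c := .skip) (s := s2)
          (e := .smul (.get 23 (.cell 61) (.cell 65)) (.get 58 (.cell 65) (.cell 63))) rfl
          (by simp) rfl rfl rfl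
          (extz fun r => (walsh I.dimK j r : ℂ) * shiftCoeff I gen c r ⟨l, hl⟩) (by
            intro r s3 hr hx3 hag3
            have hr' : r < 2 ^ I.dimK := by rw [← h2.enum.order]; exact hr
            have h3 := h2.mono hag3 rfl
            have e1 : s3.nat 61 0 0 = j := by rw [hag3.nat 61 rfl, hag2.nat 61 rfl, hc]
            have e2 : s3.nat 63 0 0 = l := by rw [hag3.nat 63 rfl, hx2]
            simp only [Prog.run, CExpr.eval_smul, CExpr.eval_get, RExpr.eval, NExpr.eval, e1, e2,
              hx3, h3.enum.tabled.walsh j hj r hr', hag3.cx 58 rfl rfl, hag2.cx 58 rfl rfl,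
              hag.cx 58 rfl rfl, hC ⟨r, hr'⟩ ⟨l, hl⟩, extz_of_lt _ hr'])
        rw [show (NExpr.cell 20).eval s2 = 2 ^ I.dimK from h2.enum.order, sum_range_extz] at w
        rw [extz_of_lt _ hl, shiftWeight, ← w]
        simp only [Store.cx, Complex.normSq_mk, RExpr.eval, NExpr.eval])
  rw [hD] at v
  exact v

theorem run_genIdx {I : Quench n m k} {t : ℝ} {s : Store} {gen : ℕ → PauliString n}
    (hs : Ready I t s gen) (i : Fin n) :
    (Prog.genIdx.run s).nat 39 0 i < 2 ^ I.dimK ∧ ∀ a, walsh I.dimK ((Prog.genIdx.run s).nat 39 0 i) a =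
      chi (symp (I.g i) (bitSum gen I.dimK a)) := by
  have hn : NExpr.qubits.eval s = n := hs.loaded.qubits
  have v := run_loop (x := 60) (e := .qubits) (s := s) (c :=
    .seq (.charIdx (.get 1 (.cell 60) (.cell 74)) (.get 2 (.cell 60) (.cell 74)))
    (.setN 39 (.lit 0) (.cell 60) (.cell 37))) rfl
    (fun j s' => ∀ i : Fin n, (i : ℕ) < j → s'.nat 39 0 i < 2 ^ I.dimK ∧
      ∀ a, walsh I.dimK (s'.nat 39 0 i) a = chi (symp (I.g i) (bitSum gen I.dimK a)))
    (by simp) (by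
      intro j s' hj hc hag hi i hij
      rw [hn] at hj
      have hs' := hs.mono hag rfl
      have w := run_charIdx hs' (hx := .get 1 (.cell 60) (.cell 74)) (hz := .get 2 (.cell 60) (.cell 74))
        (Q := I.g ⟨j, hj⟩)
        (fun s2 h2 q hq => by
          simp only [NExpr.eval, hq, h2 1 (by simp) (by simp) (by simp),
            h2 60 (by simp) (by simp) (by simp), hc]
          exact hs'.loaded.gx ⟨j, hj⟩ q)
        (fun s2 h2 q hq => by
          simp only [NExpr.eval, hq, h2 2 (by simp) (by simp) (by simp),
            h2 60 (by simp) (by simp) (by simp), hc]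
          exact hs'.loaded.gz ⟨j, hj⟩ q)
      have a1 := (Prog.charIdx (.get 1 (.cell 60) (.cell 74))
        (.get 2 (.cell 60) (.cell 74))).agree_run rfl s'
      have e60 : ((Prog.charIdx (.get 1 (.cell 60) (.cell 74))
        (.get 2 (.cell 60) (.cell 74))).run s').nat 60 0 0 = j := by rw [a1.nat 60 rfl, hc]
      have e39 := a1.nat 39 rfl
      rw [run_seq]
      generalize (Prog.charIdx (.get 1 (.cell 60) (.cell 74))
        (.get 2 (.cell 60) (.cell 74))).run s' = s1 at *
      simp only [Prog.run, Store.setNat, NExpr.eval, e60, e39, true_and]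
      by_cases h : (i : ℕ) = j
      · obtain rfl : i = ⟨j, hj⟩ := Fin.ext h
        rw [if_pos rfl]
        exact w
      · rw [if_neg h]
        exact hi i (by omega))
  rw [hn] at v
  exact v i i.2

/-! ### The output register -/

/-- A bit vector is in the output cells. -/
def HasOut (s : Store) (v : Vec n) : Prop := ∀ q : Fin n, s.nat 12 0 q = (v q).val

/-- Add a bit vector to the output. -/
def Prog.xorOut (e : NExpr) : Prog :=
  .loop 64 .qubits <| .setN 12 (.lit 0) (.cell 64) (.xor (.at 12 (.cell 64)) e)

theorem run_xorOut {s : Store} (ht : Tables s) (hn : s.nat 0 0 0 = n) {v w : Vec n}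
    (hv : HasOut s v) {e : NExpr} (he : ∀ s' : Store, Agree (.xorOut e) s s' →
      ∀ q : Fin n, s'.nat 64 0 0 = q → e.eval s' = (w q).val) :
    HasOut ((Prog.xorOut e).run s) (v + w) := by
  have hn0 : NExpr.qubits.eval s = n := hn
  have u := run_loop (x := 64) (e := .qubits) (s := s)
    (c := .setN 12 (.lit 0) (.cell 64) (.xor (.at 12 (.cell 64)) e)) rfl
    (fun j s' => ∀ q : Fin n, s'.nat 12 0 q = if (q : ℕ) < j then (v q + w q).val else (v q).val)
    (fun q => by simpa using hv q) (by
      intro j s' hj hc hag hi q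
      rw [hn0] at hj
      have h1 := hi ⟨j, hj⟩
      simp only [lt_irrefl, if_false] at h1
      have h2 := (ht.mono hag rfl).xor
      simp only [Prog.run, Store.setNat, NExpr.eval, hc, he s' hag ⟨j, hj⟩ hc, h1, h2, true_and]
      by_cases hq : (q : ℕ) = j
      · obtain rfl : q = ⟨j, hj⟩ := Fin.ext hq
        rw [if_pos rfl, if_pos (Nat.lt_succ_self _)]
      · rw [if_neg hq, hi]
        exact if_congr (by omega) rfl rfl)
  rw [hn0] at u
  exact fun q => (u q).trans (if_pos q.2)

/-- Add the generators chosen by the random walk to the output. -/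
def Prog.addGens : Prog :=
  .loop 61 .qubits <|
  .ite (.natEq (.at 42 (.cell 61)) (.lit 1)) (.xorOut (.get 1 (.cell 61) (.cell 64))) .skip

/-- The bit vector of the binary digits of a number. -/
def vecOf (n b : ℕ) : Vec n := fun i => if b.testBit i then 1 else 0

theorem vecOf_bijective (n : ℕ) : Function.Bijective fun b : Fin (2 ^ n) => vecOf n b := by
  rw [Fintype.bijective_iff_injective_and_card]
  refine ⟨fun a b h => Fin.ext (Nat.eq_of_testBit_eq fun i => ?_), by simp⟩
  by_cases hi : i < n
  · have := congrFun h ⟨i, hi⟩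
    simp only [vecOf] at this
    cases ha : (a : ℕ).testBit i <;> cases hb : (b : ℕ).testBit i <;> simp_all
  · have h2 : ∀ c : Fin (2 ^ n), (c : ℕ).testBit i = false := fun c =>
      Nat.testBit_lt_two_pow (lt_of_lt_of_le c.2 (Nat.pow_le_pow_right (by simp) (by omega)))
    rw [h2, h2]

theorem sum_vecOf {R : Type*} [AddCommMonoid R] (F : Vec n → R) :
    ∑ b ∈ Finset.range (2 ^ n), F (vecOf n b) = ∑ a, F a := by
  rw [Finset.sum_range]
  exact Function.Bijective.sum_comp (vecOf_bijective n) F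

theorem run_addGens {I : Quench n m k} {t : ℝ} {s : Store} {gen : ℕ → PauliString n}
    (hs : Ready I t s gen) {v : Vec n} (hv : HasOut s v) {b : ℕ}
    (hb : ∀ j < n, s.nat 42 0 j = (b.testBit j).toNat) :
    HasOut (Prog.addGens.run s) (v + xp (I.gcomb (vecOf n b))) := by
  have hn : NExpr.qubits.eval s = n := hs.loaded.qubits
  have u := run_loop (x := 61) (e := .qubits) (s := s) (c :=
    .ite (.natEq (.at 42 (.cell 61)) (.lit 1)) (.xorOut (.get 1 (.cell 61) (.cell 64))) .skip) rfl
    (fun j s' => HasOut s' (v + ∑ i ∈ Finset.range j, extz (fun i => vecOf n b i • xp (I.g i)) i))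
    (by simpa using hv) (by
      intro j s' hj hc hag hi
      rw [hn] at hj
      have hs' := hs.mono hag rfl
      have h42 : s'.nat 42 0 j = (b.testBit j).toNat := by rw [hag.nat 42 rfl, hb j hj]
      rw [Finset.sum_range_succ, ← add_assoc, extz_of_lt _ hj, vecOf]
      cases hbj : b.testBit j
      · rw [hbj] at h42
        rw [run_ite_neg _ _ (by simp [Test.holds, NExpr.eval, hc, h42])]
        simpa [Prog.run] using hi
      · rw [hbj] at h42
        rw [run_ite_pos _ _ (by simp [Test.holds, NExpr.eval, hc, h42])]
        simp only [if_true, one_smul]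
        refine run_xorOut hs'.tables hs'.loaded.qubits hi fun s2 h2 q hq => ?_
        simp only [NExpr.eval, h2.nat 61 rfl, hc, hq]
        exact (hs'.mono h2 rfl).loaded.gx ⟨j, hj⟩ q)
  rw [hn, sum_range_extz] at u
  rw [I.xp_gcomb]
  exact u

/-! ### Sampling -/

theorem walsh_xor_left (d x y a : ℕ) : walsh d (x ^^^ y) a = walsh d x a * walsh d y a := by
  rw [walsh, walsh, walsh, ← Finset.prod_mul_distrib]
  refine Finset.prod_congr rfl fun l _ => ?_
  rw [Nat.testBit_xor]
  cases x.testBit l <;> cases y.testBit l <;> cases a.testBit l <;> simp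

theorem walsh_zero_left (d a : ℕ) : walsh d 0 a = 1 := by
  simp [walsh]

/-- Characters of products multiply, and the exclusive or of indices describes their product. So the
walk, which sees only indices, keeps track of the character of the stabilizer chosen so far. -/
theorem walsh_xorSum {I : Quench n m k} {gen : ℕ → PauliString n} {σ : ℕ → ℕ}
    (hσ : ∀ i : Fin n, ∀ a, walsh I.dimK (σ i) a = chi (symp (I.g i) (bitSum gen I.dimK a)))
    (b a : ℕ) : walsh I.dimK (xorSum σ n b) a =
      chi (symp (I.gcomb (vecOf n b)) (bitSum gen I.dimK a)) := by
  have key : ∀ j ≤ n, walsh I.dimK (xorSum σ j b) a =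
      pprod (fun i : Fin n => chi (vecOf n b i * symp (I.g i) (bitSum gen I.dimK a))) j := by
    intro j
    induction j with
    | zero => intro _; simp [xorSum, walsh_zero_left]
    | succ j ih =>
      intro hj
      rw [pprod_succ _ hj, ← ih (by omega), xorSum, vecOf]
      have := hσ ⟨j, hj⟩ a
      cases b.testBit j
      · simp
      · simp [walsh_xor_left, this]
  rw [key n le_rfl, pprod_self, I.symp_gcomb, chi_sum]

/-- With powers of two as steps the choices are the digits of the endpoint. The second walk thus
draws the index of a listed element digit by digit. -/
theorem xorSum_two_pow {d u : ℕ} (hu : u < 2 ^ d) : xorSum (fun l => 2 ^ l) d u = u := by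
  induction d generalizing u with
  | zero => simp only [pow_zero, Nat.lt_one_iff] at hu; subst hu; rfl
  | succ d ih =>
    by_cases h : u < 2 ^ d
    · rw [xorSum_succ_of_lt h, ih h]
    · obtain ⟨b, rfl⟩ := Nat.exists_eq_add_of_le (not_lt.mp h)
      have hb : b < 2 ^ d := by rw [pow_succ] at hu; omega
      rw [xorSum_succ_add hb, ih hb, two_pow_add_eq_xor hb, Nat.xor_comm]

/-- The dimension of the listed group. -/
abbrev NExpr.dim : NExpr := .get 20 (.lit 0) (.lit 1)

/-- Prepare the random walk over the stabilizer group. -/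
def Prog.prepareWalk : Prog :=
  .seq .shiftRel <| .seq .shiftCoeffs <| .seq .weights <| .seq .genIdx <|
  .seq (.fillR 61 .qubits 63 (.cell 20) (.sumR 31 65 (.cell 20) .skip (.get 46 (.cell 63) (.cell 65)))
    (.cell 31)) (.walkWeights 39 .qubits)

/-- Prepare the random walk over the listed elements. -/
def Prog.condition : Prog :=
  .seq (.xorOut (.at 8 (.cell 64))) <| .seq .addGens <|
  .seq (.fillR 61 .dim 63 (.cell 20) .skip (.get 46 (.cell 41) (.cell 63))) (.walkWeights 25 .dim)

/-- Sample an outcome from the evolved vector. -/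
def Prog.readSample : Prog :=
  .seq .prepareWalk <| .seq (.walk 39 .qubits) <| .seq .condition <|
  .seq (.walk 25 .dim) (.xorOut (.get 22 (.cell 41) (.cell 64)))

/-- The weights of the outcomes are in memory. -/
structure Weighted (I : Quench n m k) (t : ℝ) (s : Store) (gen : ℕ → PauliString n)
    (c : Fin (2 ^ I.dimK) → ℂ) : Prop extends Ready I t s gen where
  weight : ∀ x < 2 ^ I.dimK, ∀ u : Fin (2 ^ I.dimK), s.real 46 x u = shiftWeight I gen c x u

theorem Weighted.mono {I : Quench n m k} {t : ℝ} {s s' : Store} {gen : ℕ → PauliString n}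
    {c : Fin (2 ^ I.dimK) → ℂ} (h : Weighted I t s gen c) {A : Prog} (ha : Agree A s s')
    (hk : A.keeps [0, 1, 2, 3, 4, 5, 6, 7, 8, 20, 21, 22, 23, 24, 25, 33, 34, 35]
      [0, 1, 2, 20, 21, 22, 23, 24, 27, 28, 46] = true) : Weighted I t s' gen c := by
  simp only [Prog.keeps, List.all_cons, List.all_nil, Bool.and_true, Bool.and_eq_true,
    Bool.not_eq_true'] at hk
  refine ⟨h.toReady.mono ha (by simp [Prog.keeps, hk]), ?_⟩
  rw [ha.real 46 (by simp [hk])]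
  exact h.weight

/-- The weights for the choice of a stabilizer. -/
def totalWeight (I : Quench n m k) (gen : ℕ → PauliString n) (c : Fin (2 ^ I.dimK) → ℂ) (x : ℕ) : ℝ :=
  ∑ u, shiftWeight I gen c x u

theorem run_prepareWalk {I : Quench n m k} {t : ℝ} {s : Store} {gen : ℕ → PauliString n}
    {c : Fin (2 ^ I.dimK) → ℂ} (h : Evolved I t s gen c) :
    ∃ σ : ℕ → ℕ, (∀ i : Fin n, ∀ a, walsh I.dimK (σ i) a = chi (symp (I.g i) (bitSum gen I.dimK a))) ∧
      Weighted I t (Prog.prepareWalk.run s) gen c ∧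
      WalkMem (Prog.prepareWalk.run s) 39 n I.dimK σ
        fun j x => walkWeight σ (totalWeight I gen c) (n - j) j x := by
  rw [Prog.prepareWalk, run_seq, run_seq, run_seq, run_seq, run_seq]
  have v1 := run_shiftRel h.toReady
  have h1 := h.mono (Prog.shiftRel.agree_run rfl s) rfl
  generalize Prog.shiftRel.run s = s1 at *
  have v2 := run_shiftCoeffs h1 v1
  have h2 := h1.toReady.mono (Prog.shiftCoeffs.agree_run rfl s1) rfl
  generalize Prog.shiftCoeffs.run s1 = s2 at *
  have h3 : Weighted I t (Prog.weights.run s2) gen c :=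
    ⟨h2.mono (Prog.weights.agree_run rfl s2) rfl, run_weights h2 v2⟩
  generalize Prog.weights.run s2 = s3 at *
  have v4 := run_genIdx h3.toReady
  have h4 := h3.mono (Prog.genIdx.agree_run rfl s3) rfl
  generalize Prog.genIdx.run s3 = s4 at *
  have hD : (NExpr.cell 20).eval s4 = 2 ^ I.dimK := h4.enum.order
  have v5 : ∀ x < 2 ^ I.dimK, ((Prog.fillR 61 .qubits 63 (.cell 20) (.sumR 31 65 (.cell 20) .skip
      (.get 46 (.cell 63) (.cell 65))) (.cell 31)).run s4).real 61 n x = totalWeight I gen c x := by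
    intro x hx
    rw [run_fillR (a := 61) (x := 63) (i := .qubits) (N := .cell 20) (e := .cell 31) rfl rfl rfl n
      (fun s' hag => by
        change (Prog.run _ s').nat 0 0 0 = n
        rw [(Prog.agree_run _ rfl s').nat 0 rfl, hag.nat 0 rfl, h4.loaded.qubits])
      (totalWeight I gen c), hD, if_pos ⟨rfl, hx⟩]
    intro j s' hj hc hag
    rw [hD] at hj
    have h' := h4.mono hag rfl
    rw [RExpr.eval, NExpr.eval, run_sumR (acc := 31) (x := 65) (N := .cell 20) rfl rfl
      (extz fun u => shiftWeight I gen c j u),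
      show (NExpr.cell 20).eval s' = 2 ^ I.dimK from h'.enum.order, sum_range_extz, totalWeight]
    intro l s2 hl hc2 hag2
    have hl' : l < 2 ^ I.dimK := by rw [← h'.enum.order]; exact hl
    have h2 := h'.mono hag2 rfl
    simp only [Prog.run, RExpr.eval, NExpr.eval, hc2, hag2.nat 63 rfl, hc, extz_of_lt _ hl']
    exact h2.weight j hj ⟨l, hl'⟩
  have a5 := (Prog.fillR 61 .qubits 63 (.cell 20) (.sumR 31 65 (.cell 20) .skip
      (.get 46 (.cell 63) (.cell 65))) (.cell 31)).agree_run rfl s4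
  have h5 := h4.mono a5 rfl
  rw [← a5.nat 39 rfl] at v4
  generalize (Prog.fillR 61 .qubits 63 (.cell 20) (.sumR 31 65 (.cell 20) .skip
      (.get 46 (.cell 63) (.cell 65))) (.cell 31)).run s4 = s5 at *
  exact ⟨s5.nat 39 0, fun i => (v4 i).2, h5.mono (Prog.agree_run _ rfl s5) rfl,
    run_walkWeights h5.enum.order h5.enum.tabled.xor (fun _ _ => rfl) (fun j hj => (v4 ⟨j, hj⟩).1) v5
      (fun x => Finset.sum_nonneg fun u _ => shiftWeight_nonneg I gen c x u) (by simp)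
      fun s' hs' => by
        change s'.nat 0 0 0 = n
        rw [hs' 0 (by simp), h5.loaded.qubits]⟩

/-- Once the stabilizer is chosen, its label shift can be added to the output. The row of weights at
its character gives the final weights for the second walk. -/
theorem run_condition {I : Quench n m k} {t : ℝ} {s : Store} {gen : ℕ → PauliString n}
    {c : Fin (2 ^ I.dimK) → ℂ} (h : Weighted I t s gen c) (h12 : HasOut s (0 : Vec n)) {b x : ℕ}
    (hb : ∀ j < n, s.nat 42 0 j = (b.testBit j).toNat) (hx : x < 2 ^ I.dimK) (h41 : s.nat 41 0 0 = x) :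
    HasOut (Prog.condition.run s) (I.zv + xp (I.gcomb (vecOf n b))) ∧
      Ready I t (Prog.condition.run s) gen ∧
      WalkMem (Prog.condition.run s) 25 I.dimK I.dimK (fun l => 2 ^ l)
        fun j u => walkWeight (fun l => 2 ^ l) (extz (shiftWeight I gen c x)) (I.dimK - j) j u := by
  rw [Prog.condition, run_seq, run_seq, run_seq]
  have v1 := run_xorOut (w := I.zv) h.tables h.loaded.qubits h12 (e := .at 8 (.cell 64))
    fun s' hag q hq => by
      simp only [NExpr.eval, hq]
      exact (h.mono hag rfl).loaded.zv q
  rw [zero_add] at v1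
  have a1 := (Prog.xorOut (.at 8 (.cell 64))).agree_run rfl s
  have h1 := h.mono a1 rfl
  rw [← a1.nat 42 rfl] at hb
  rw [← a1.nat 41 rfl] at h41
  generalize (Prog.xorOut (.at 8 (.cell 64))).run s = s1 at *
  have v2 := run_addGens h1.toReady v1 hb
  have a2 := Prog.addGens.agree_run rfl s1
  have h2 := h1.mono a2 rfl
  rw [← a2.nat 41 rfl] at h41
  generalize Prog.addGens.run s1 = s2 at *
  let c3 : Prog := .fillR 61 .dim 63 (.cell 20) .skip (.get 46 (.cell 41) (.cell 63))
  have hD : (NExpr.cell 20).eval s2 = 2 ^ I.dimK := h2.enum.order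
  have v3 : ∀ u < 2 ^ I.dimK, (c3.run s2).real 61 I.dimK u = extz (shiftWeight I gen c x) u := by
    intro u hu
    rw [run_fillR (a := 61) (x := 63) (i := .dim) (N := .cell 20) (c := .skip)
      (e := .get 46 (.cell 41) (.cell 63)) rfl rfl rfl I.dimK
      (fun s' hag => (h2.mono hag rfl).enum.dim) (extz (shiftWeight I gen c x)), hD,
      if_pos ⟨rfl, hu⟩]
    intro j s' hj hc hag
    rw [hD] at hj
    simp only [Prog.run, RExpr.eval, NExpr.eval, hc, hag.nat 41 rfl, h41, extz_of_lt _ hj]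
    exact (h2.mono hag rfl).weight x hx ⟨j, hj⟩
  have a3 := c3.agree_run rfl s2
  have h3 := h2.mono a3 rfl
  have o3 : HasOut (c3.run s2) (I.zv + xp (I.gcomb (vecOf n b))) := by
    intro q
    rw [a3.nat 12 rfl]
    exact v2 q
  change HasOut (Prog.run _ (c3.run s2)) _ ∧ Ready I t (Prog.run _ (c3.run s2)) gen ∧
    WalkMem (Prog.run _ (c3.run s2)) _ _ _ _ _
  generalize c3.run s2 = s3 at *
  have a4 := (Prog.walkWeights 25 .dim).agree_run rfl s3
  refine ⟨fun q => by rw [a4.nat 12 rfl]; exact o3 q, h3.toReady.mono a4 rfl,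
    run_walkWeights h3.enum.order h3.enum.tabled.xor h3.enum.pow
      (fun j hj => Nat.pow_lt_pow_right (by simp) hj) v3 (fun u => ?_) (by simp)
      fun s' hs' => ?_⟩
  · unfold extz
    split_ifs
    · exact shiftWeight_nonneg _ _ _ _ _
    · exact le_rfl
  · change s'.nat 20 0 1 = _
    rw [hs' 20 (by simp), h3.enum.dim]

open scoped Classical in
/-- The indicator function of an outcome. -/
def outInd (y : Vec n) (s : Store) : ℝ≥0∞ := if HasOut s y then 1 else 0

open scoped Classical in
-- Given the character `x`, the second walk draws an element with its share of the weights in row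
-- `x`, and its `X`-bits complete the output.
theorem lexp_element {I : Quench n m k} {t : ℝ} {s : Store} {gen : ℕ → PauliString n}
    {c : Fin (2 ^ I.dimK) → ℂ} {x : ℕ} {v : Vec n} (hv : HasOut s v) (hs : Ready I t s gen)
    (hw : WalkMem s 25 I.dimK I.dimK (fun l => 2 ^ l)
      fun j u => walkWeight (fun l => 2 ^ l) (extz (shiftWeight I gen c x)) (I.dimK - j) j u)
    (y : Vec n) :
    ∑ u, ENNReal.ofReal (shiftWeight I gen c x u / totalWeight I gen c x) *
      (if v + xp (elts I gen u) = y then 1 else 0) ≤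
    lexp ((Prog.seq (.walk 25 .dim) (.xorOut (.get 22 (.cell 41) (.cell 64)))).dist s)
      (outInd y) := by
  rw [lexp_seq]
  have hwalk := lexp_walk hw (by simp) (e := .dim) (fun s' hag => by
      change s'.nat 20 0 1 = _
      rw [hag.nat 20 rfl, hs.enum.dim])
    (extz fun u => if v + xp (elts I gen u) = y then 1 else 0)
    (fun s' => lexp ((Prog.xorOut (.get 22 (.cell 41) (.cell 64))).dist s') (outInd y)) (by
      intro b hb s' hag h41 _
      rw [xorSum_two_pow hb] at h41
      have hs' := hs.mono hag rfl
      rw [lexp_run rfl, extz_of_lt _ hb]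
      split_ifs with h
      · rw [outInd, if_pos]
        rw [← h]
        refine run_xorOut hs'.tables hs'.loaded.qubits
          (fun q => by rw [hag.nat 12 rfl]; exact hv q) fun s2 h2 q hq => ?_
        simp only [NExpr.eval, hq, h2.nat 41 rfl, h41]
        exact (hs'.mono h2 rfl).enum.listed.x b hb q
      · exact zero_le)
  refine le_trans (le_of_eq ?_) hwalk
  rw [← Fin.sum_univ_eq_sum_range fun b => ENNReal.ofReal (walkWeight (fun l => 2 ^ l)
    (extz (shiftWeight I gen c x)) (I.dimK - I.dimK) I.dimK (xorSum (fun l => 2 ^ l) I.dimK b) /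
    walkWeight (fun l => 2 ^ l) (extz (shiftWeight I gen c x)) (I.dimK - 0) 0 0) *
    extz (fun u => if v + xp (elts I gen u) = y then (1 : ℝ≥0∞) else 0) b]
  refine Finset.sum_congr rfl fun u _ => ?_
  have htot : walkWeight (fun l => 2 ^ l) (extz (shiftWeight I gen c x)) (I.dimK - 0) 0 0 =
      totalWeight I gen c x := by
    rw [Nat.sub_zero, walkWeight_eq_sum, totalWeight, ← sum_range_extz]
    exact Finset.sum_congr rfl fun b hb => by rw [xorSum_two_pow (Finset.mem_range.mp hb)]
  rw [htot, extz_val, xorSum_two_pow u.2, Nat.sub_self, walkWeight, extz_val]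

theorem ofReal_div_mul_div {a b c : ℝ} (ha : 0 ≤ a) (hab : a ≤ b) (hc : 0 ≤ c) :
    ENNReal.ofReal (b / c) * ENNReal.ofReal (a / b) = ENNReal.ofReal (a / c) := by
  rw [← ENNReal.ofReal_mul (div_nonneg (ha.trans hab) hc)]
  congr 1
  rcases (ha.trans hab).eq_or_lt with h | h
  · obtain rfl : a = 0 := by linarith
    simp [← h]
  · field_simp

open scoped Classical in
/-- Every outcome is sampled with at least the right probability. -/
theorem lexp_readSample {I : Quench n m k} {t : ℝ} {s : Store} {gen : ℕ → PauliString n}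
    {c : Fin (2 ^ I.dimK) → ℂ} (h : Evolved I t s gen c) (h12 : HasOut s (0 : Vec n)) (y : Vec n) :
    ENNReal.ofReal (‖I.ψ t (bitsEquiv y)‖ ^ 2) ≤ lexp (Prog.readSample.dist s) (outInd y) := by
  obtain ⟨σ, hσ, hW, hM⟩ := run_prepareWalk h
  have a1 := Prog.prepareWalk.agree_run rfl s
  rw [Prog.readSample, lexp_seq, lexp_run rfl, lexp_seq]
  have o1 : HasOut (Prog.prepareWalk.run s) (0 : Vec n) := fun q => by
    rw [a1.nat 12 rfl]; exact h12 q
  generalize Prog.prepareWalk.run s = s1 at *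
  let wt : ℕ → Fin (2 ^ I.dimK) → ℝ := fun b u => shiftWeight I gen c (xorSum σ n b) u
  let tot : ℕ → ℝ := fun b => totalWeight I gen c (xorSum σ n b)
  let S : ℝ := ∑ b ∈ Finset.range (2 ^ n), tot b
  let hit : ℕ → Fin (2 ^ I.dimK) → Prop := fun b u =>
    I.zv + xp (I.gcomb (vecOf n b)) + xp (elts I gen u) = y
  have hwt0 : ∀ b u, 0 ≤ wt b u := fun b u => shiftWeight_nonneg _ _ _ _ _
  have hwt1 : ∀ b u, wt b u ≤ tot b := fun b u =>
    Finset.single_le_sum (fun u _ => hwt0 b u) (Finset.mem_univ u)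
  have hS0 : 0 ≤ S := Finset.sum_nonneg fun b _ => Finset.sum_nonneg fun u _ => hwt0 b u
  have hwalk := lexp_walk hM (by simp) (e := .qubits) (fun s' hag => by
      change s'.nat 0 0 0 = _
      rw [hag.nat 0 rfl, hW.loaded.qubits])
    (fun b => ∑ u, ENNReal.ofReal (wt b u / tot b) * if hit b u then 1 else 0)
    (fun s' => lexp ((Prog.seq .condition (.seq (.walk 25 .dim)
      (.xorOut (.get 22 (.cell 41) (.cell 64))))).dist s') (outInd y)) (by
      intro b hb s' hag h41 hbits
      have hW' := hW.mono hag rfl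
      have hx : xorSum σ n b < 2 ^ I.dimK := xorSum_lt (fun l hl => hM.step_lt l hl) b
      obtain ⟨k1, k2, k3⟩ := run_condition hW' (fun q => by rw [hag.nat 12 rfl]; exact o1 q) hbits hx
        h41
      rw [lexp_seq, lexp_run rfl]
      exact lexp_element k1 k2 k3 y)
  refine le_trans (le_of_eq ?_) hwalk
  simp only [Nat.sub_self, Nat.sub_zero, walkWeight_eq_sum, walkWeight]
  -- The probability of the stabilizer times the conditional probability of the element is the
  -- normalised joint weight.
  have hstep : ∀ b, ENNReal.ofReal (tot b / S) *
      (∑ u, ENNReal.ofReal (wt b u / tot b) * if hit b u then 1 else 0) =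
      ENNReal.ofReal (∑ u, if hit b u then wt b u / S else 0) := by
    intro b
    rw [Finset.mul_sum, ENNReal.ofReal_sum_of_nonneg fun u _ => by
      split_ifs
      · exact div_nonneg (hwt0 b u) hS0
      · exact le_rfl]
    refine Finset.sum_congr rfl fun u _ => ?_
    split_ifs
    · rw [mul_one, ofReal_div_mul_div (hwt0 b u) (hwt1 b u) hS0]
    · rw [mul_zero, mul_zero, ENNReal.ofReal_zero]
  rw [Finset.sum_congr rfl fun b _ => hstep b, ← ENNReal.ofReal_sum_of_nonneg fun b _ =>
    Finset.sum_nonneg fun u _ => by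
      split_ifs
      · exact div_nonneg (hwt0 b u) hS0
      · exact le_rfl]
  congr 1
  let q : Vec n → Fin (2 ^ I.dimK) → ℝ := fun a u =>
    ‖I.shiftedAmp (elts I gen) c (fun s => chi (symp (I.gcomb a) (elts I gen s))) u‖ ^ 2
  have hwq : ∀ b u, wt b u = q (vecOf n b) u := fun b u =>
    shiftWeight_eq I gen c u fun s => walsh_xorSum hσ b s
  have hκ : 0 < ‖I.ψ₀ I.z‖ ^ 2 := pow_pos (norm_pos_iff.mpr I.ψ₀_ref) 2
  -- The weights are outcome probabilities divided by the squared modulus of the reference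
  -- amplitude. As all outcomes that can occur have equally many preimages, normalisation removes
  -- both this factor and the multiplicity.
  obtain ⟨hpos, hfib⟩ := I.sum_fiber h.enum.elts_injective h.enum.exists_elts h.state (q := q) hκ
    (fun a u => by rw [h.state, I.norm_combine_shift _ _ _ (I.gcomb_mem a), mul_pow]) y
  have hS : S = ∑ a, ∑ u, q a u := by
    rw [← sum_vecOf fun a => ∑ u, q a u]
    exact Finset.sum_congr rfl fun b _ => Finset.sum_congr rfl fun u _ => hwq b u
  have hfin : ∑ b ∈ Finset.range (2 ^ n), ∑ u, (if hit b u then wt b u / S else 0) =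
      (∑ a, ∑ u, if I.zv + xp (elts I gen u) + xp (I.gcomb a) = y then q a u else 0) / S := by
    rw [← sum_vecOf fun a => ∑ u, if I.zv + xp (elts I gen u) + xp (I.gcomb a) = y then q a u else 0,
      Finset.sum_div]
    refine Finset.sum_congr rfl fun b _ => ?_
    rw [Finset.sum_div]
    refine Finset.sum_congr rfl fun u _ => ?_
    rw [ite_div, zero_div, hwq]
    simp only [hit, add_right_comm]
  rw [hfin, hfib, hS, mul_div_assoc, div_self hpos.ne', mul_one]

/-- The sampled distribution is the distribution of the outcomes. -/
theorem lexp_outInd_eq {I : Quench n m k} {t : ℝ} (p : PMF Store)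
    (h : ∀ y : Vec n, ENNReal.ofReal (‖I.ψ t (bitsEquiv y)‖ ^ 2) ≤ lexp p (outInd y)) (y : Vec n) :
    lexp p (outInd y) = ENNReal.ofReal (‖I.ψ t (bitsEquiv y)‖ ^ 2) := by
  classical
  -- A store holds at most one output, so the sampled probabilities sum to at most one. The lower
  -- bounds already sum to one, so none of them can be strict.
  have h1 : ∑ y : Vec n, lexp p (outInd y) ≤ 1 := by
    simp only [lexp]
    rw [← Summable.tsum_finsetSum fun _ _ => ENNReal.summable, ← p.tsum_coe]
    refine ENNReal.tsum_le_tsum fun s => ?_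
    rw [← Finset.mul_sum]
    refine mul_le_of_le_one_right' ?_
    simp only [outInd]
    rw [Finset.sum_ite, Finset.sum_const_zero, add_zero, Finset.sum_const, nsmul_eq_mul, mul_one]
    exact_mod_cast Finset.card_le_one.mpr fun a ha b hb => val_eq_iff.mpr fun q => by
      rw [← (Finset.mem_filter.mp ha).2 q, ← (Finset.mem_filter.mp hb).2 q]
  have h2 : ∑ y : Vec n, ENNReal.ofReal (‖I.ψ t (bitsEquiv y)‖ ^ 2) = 1 := by
    rw [← ENNReal.ofReal_sum_of_nonneg fun _ _ => by positivity]
    rw [Equiv.sum_comp bitsEquiv fun y => ‖I.ψ t y‖ ^ 2, I.norm_ψ, ENNReal.ofReal_one]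
  refine le_antisymm ?_ (h y)
  by_contra hlt
  rw [not_le] at hlt
  have h4 : ∑ y : Vec n, ENNReal.ofReal (‖I.ψ t (bitsEquiv y)‖ ^ 2) < ∑ y : Vec n, lexp p (outInd y) := by
    rw [← Finset.add_sum_erase _ _ (Finset.mem_univ y), ← Finset.add_sum_erase _ _ (Finset.mem_univ y)]
    refine ENNReal.add_lt_add_of_lt_of_le ?_ hlt (Finset.sum_le_sum fun y _ => h y)
    exact (ENNReal.sum_lt_top.mpr fun _ _ => ENNReal.ofReal_lt_top).ne
  rw [h2] at h4
  exact absurd h1 (not_le.mpr h4)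

/-! ### Running times -/

/-- The sizes in memory are those of the problem, or are not yet set. -/
structure SizesOk (I : Quench n m k) (s : Store) : Prop where
  qubits : s.nat 0 0 0 = n
  terms : s.nat 0 0 1 = m
  perts : s.nat 0 0 2 = k
  order : s.nat 20 0 0 ≤ 2 ^ I.dimK
  dim : s.nat 20 0 1 ≤ I.dimK

theorem SizesOk.of_sameSizes {I : Quench n m k} {s s' : Store} (h : SizesOk I s)
    (h' : SameSizes s s') : SizesOk I s' :=
  ⟨by rw [h'.1, h.qubits], by rw [h'.1, h.terms], by rw [h'.1, h.perts],
    by rw [h'.2]; exact h.order, by rw [h'.2]; exact h.dim⟩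

/-- The expression is one of the given cells in row `0`. -/
def NExpr.isCell (l : List (ℕ × ℕ)) : NExpr → Bool
  | .get a (.lit 0) (.lit j) => l.contains (a, j)
  | _ => false

theorem NExpr.eval_le_of_isCell {l : List (ℕ × ℕ)} {e : NExpr} (he : e.isCell l = true) {s : Store}
    {M : ℕ} (h : ∀ p ∈ l, s.nat p.1 0 p.2 ≤ M) : e.eval s ≤ M := by
  unfold NExpr.isCell at he
  split at he
  · exact h _ (List.contains_iff_mem.mp he)
  · simp at he

/-- The claimed bound for the running time, up to a constant factor. -/
def budget (I : Quench n m k) : ℕ := n ^ 2 * (n + m) + 2 ^ (3 * I.dimK)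

theorem one_le_budget (I : Quench n m k) : 1 ≤ budget I :=
  le_trans (Nat.one_le_two_pow) (Nat.le_add_left _ _)

theorem pow_three_le_budget (I : Quench n m k) : max n (2 ^ I.dimK) ^ 3 ≤ budget I := by
  rcases max_cases n (2 ^ I.dimK) with ⟨h, -⟩ | ⟨h, -⟩
  · rw [h, budget]; nlinarith [Nat.zero_le (n ^ 2 * m), Nat.zero_le (2 ^ (3 * I.dimK))]
  · rw [h, budget, ← pow_mul, mul_comm I.dimK]; exact Nat.le_add_left _ _

/-- The program certainly stops within `T` steps, and then the sizes in memory are right. -/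
def Prog.Within (I : Quench n m k) (c : Prog) (s : Store) (T : ℕ) : Prop :=
  ∀ s' ∈ (c.eval s).support, s'.time ≤ s.time + T ∧ SizesOk I s'

theorem Prog.Within.seq {I : Quench n m k} {c d : Prog} {s : Store} {T U : ℕ}
    (hc : c.Within I s T) (hd : ∀ s' ∈ (c.eval s).support, SizesOk I s' → d.Within I s' U) :
    (Prog.seq c d).Within I s (T + U) := by
  intro s' h
  rw [Prog.eval, PMF.mem_support_bind_iff] at h
  obtain ⟨s1, h1, h2⟩ := h
  obtain ⟨t1, k1⟩ := hc s1 h1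
  obtain ⟨t2, k2⟩ := hd s1 h1 k1 s' h2
  exact ⟨by omega, k2⟩

/-- The sizes `n`, `2 ^ |K|` and `|K|` are all at most `max n (2 ^ |K|)`, whose third power is
within the budget. -/
theorem Prog.within_of_static {I : Quench n m k} (c : Prog) (hc : c.static = true)
    (hb : c.bounds.all (NExpr.isCell [(0, 0), (20, 0), (20, 1)]) = true) (hd : c.depth ≤ 3)
    {s : Store} (hs : SizesOk I s) : c.Within I s (c.size * budget I) := by
  intro s' h
  have hM : 1 ≤ max n (2 ^ I.dimK) := le_max_of_le_right Nat.one_le_two_pow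
  obtain ⟨h1, h2⟩ := c.time_le hM hc s (fun e he => NExpr.eval_le_of_isCell
    (List.all_eq_true.mp hb e he) (by
      intro p hp
      simp only [List.mem_cons, List.not_mem_nil, or_false] at hp
      rcases hp with rfl | rfl | rfl
      · exact hs.qubits.le.trans (le_max_left _ _)
      · exact hs.order.trans (le_max_right _ _)
      · exact (hs.dim.trans Nat.lt_two_pow_self.le).trans (le_max_right _ _))) s' h
  refine ⟨h1.trans ?_, hs.of_sameSizes h2⟩
  gcongr
  exact (Nat.pow_le_pow_right hM hd).trans (pow_three_le_budget I)

theorem Prog.time_le_of_bounds_nil (c : Prog) (hc : c.bounds = []) (s : Store) :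
    ∀ s' ∈ (c.eval s).support, s'.time ≤ s.time + c.size := by
  induction c generalizing s with
  | skip =>
    intro s' h; rw [Prog.eval, PMF.mem_support_pure_iff] at h; subst h
    simp [Prog.size, Store.tick]
  | setN a i j e =>
    intro s' h; rw [Prog.eval, PMF.mem_support_pure_iff] at h; subst h
    simp [Prog.size, Store.tick, Store.setNat]
  | setR a i j e =>
    intro s' h; rw [Prog.eval, PMF.mem_support_pure_iff] at h; subst h
    simp [Prog.size, Store.tick, Store.setReal]
  | root a i j b l d r => simp [Prog.bounds] at hc
  | flip a i j p =>
    intro s' h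
    rw [Prog.eval, PMF.mem_support_map_iff] at h
    obtain ⟨b, -, rfl⟩ := h
    simp [Prog.size, Store.tick, Store.setNat]
  | seq c d ihc ihd =>
    intro s' h
    rw [Prog.eval, PMF.mem_support_bind_iff] at h
    obtain ⟨s1, h1, h2⟩ := h
    simp only [Prog.bounds, List.append_eq_nil_iff] at hc
    have t1 := ihc hc.1 s s1 h1
    have t2 := ihd hc.2 s1 s' h2
    simp only [Prog.size]
    omega
  | ite b c d ihc ihd =>
    intro s' h
    rw [Prog.eval] at h
    simp only [Prog.bounds, List.append_eq_nil_iff] at hc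
    simp only [Prog.size]
    split_ifs at h
    · have := ihc hc.1 _ s' h
      simp only [Store.tick] at this
      omega
    · have := ihd hc.2 _ s' h
      simp only [Store.tick] at this
      omega
  | loop x e c ih => simp [Prog.bounds] at hc

/-- The time for a loop without coin flips. -/
theorem Prog.time_le_loop {x : ℕ} {e : NExpr} {c : Prog} (hc : c.flipFree = true) {s : Store} {T : ℕ}
    (h : ∀ j < e.eval s, ∀ s₁ : Store,
      s₁.erase = ((Prog.loop x (.lit j) c).run s.erase).setNat x 0 0 j →
      ∀ s₂ ∈ (c.eval s₁).support, s₂.time ≤ s₁.time + T) :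
    ∀ s' ∈ ((Prog.loop x e c).eval s).support,
      s'.time ≤ s.time + (e.cost + 1 + e.eval s * (T + 1)) := by
  -- Without coin flips the memory after each round is known exactly, so the cost of the body has to
  -- be bounded only on stores that are really reached.
  have key : ∀ N ≤ e.eval s, ∀ s' ∈ (loopEval x c.eval N (s.tick (e.cost + 1))).support,
      s'.erase = (Prog.loop x (.lit N) c).run s.erase ∧
        s'.time ≤ s.time + (e.cost + 1 + N * (T + 1)) := by
    intro N
    induction N with
    | zero =>
      intro _ s' h; rw [loopEval, PMF.mem_support_pure_iff] at h; subst h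
      exact ⟨rfl, by simp [Store.tick]⟩
    | succ N ih =>
      intro hN s' h'
      rw [loopEval, PMF.mem_support_bind_iff] at h'
      obtain ⟨s1, h1, h2⟩ := h'
      obtain ⟨k1, k2⟩ := ih (by omega) s1 h1
      have e1 : ((s1.setNat x 0 0 N).tick 1).erase =
          ((Prog.loop x (.lit N) c).run s.erase).setNat x 0 0 N := by
        rw [← k1]; rfl
      have k3 := h N hN _ e1 s' h2
      refine ⟨?_, ?_⟩
      · rw [Prog.support_erase hc h2, e1]
        rfl
      · simp only [Store.tick, Store.setNat] at k3
        rw [add_mul]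
        omega
  intro s' h'
  exact (key _ le_rfl s' h').2

/-- The perturbing strings are distinct elements of the group. This bounds the number of rounds of
the enumeration and removes `k` from the running time. -/
theorem perts_le (I : Quench n m k) : k ≤ 2 ^ I.dimK := by
  rw [← card_K I]
  have := Nat.card_le_card_of_injective (fun i : Fin k => (⟨I.P i, Submodule.subset_span ⟨i, rfl⟩⟩ : I.K))
    (fun i j h => I.P_inj (congrArg Subtype.val h))
  rwa [Nat.card_eq_fintype_card, Fintype.card_fin] at this

/-- This makes finding the character of a string quadratic in `n`, however large the group is. -/
theorem dimK_le (I : Quench n m k) : I.dimK ≤ 2 * n := by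
  refine (Submodule.finrank_le _).trans ?_
  simp [PauliString, Module.finrank_pi_fintype, mul_comm]

/-- For `n ≥ 1` one has `2 n + 1 ≤ 3 n`, whence the constant `9`. For `n = 0` there is only one
Pauli string, so `m ≤ 1`, and the exponential term of the budget pays for it. -/
theorem terms_mul_le_budget (I : Quench n m k) : m * (2 * n + 1) ^ 2 ≤ 9 * budget I := by
  rcases n.eq_zero_or_pos with rfl | hn
  · have hm : m ≤ 1 := by
      have := Fintype.card_le_of_injective I.h I.h_inj
      simpa [PauliString] using this
    have := one_le_budget I
    simpa using by omega
  · have h1 : (2 * n + 1) ^ 2 ≤ 9 * n ^ 2 := by nlinarith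
    calc m * (2 * n + 1) ^ 2 ≤ m * (9 * n ^ 2) := Nat.mul_le_mul_left _ h1
      _ ≤ 9 * budget I := by
        rw [budget]
        nlinarith [Nat.zero_le (n ^ 3), Nat.zero_le (2 ^ (3 * I.dimK)), Nat.zero_le (n ^ 2 * n)]

theorem terms_le_budget (I : Quench n m k) : m ≤ 9 * budget I :=
  (Nat.le_mul_of_pos_right m (by positivity)).trans (terms_mul_le_budget I)

theorem Loaded.of_erase {I : Quench n m k} {t : ℝ} {s : Store} (h : Loaded I t s) :
    Loaded I t s.erase := ⟨h.nat, h.real⟩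

theorem Fresh.of_erase {s : Store} (h : Fresh s) : Fresh s.erase := ⟨h.nat, h.real⟩

theorem SizesOk.of_erase {I : Quench n m k} {s : Store} (h : SizesOk I s.erase) : SizesOk I s :=
  ⟨h.qubits, h.terms, h.perts, h.order, h.dim⟩

theorem SizesOk.of_agree {I : Quench n m k} {s s' : Store} (h : SizesOk I s) {c : Prog}
    (ha : Agree c s s') (h0 : c.modN 0 = false) (h20 : c.modN 20 = false) : SizesOk I s' :=
  h.of_sameSizes ⟨ha.nat 0 h0, ha.nat 20 h20⟩

theorem Enum.sizesOk {I : Quench n m k} {t : ℝ} {s : Store} (hl : Loaded I t s) {i d : ℕ}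
    {gen : ℕ → PauliString n} (h : Enum I s i d gen) : SizesOk I s :=
  ⟨hl.qubits, hl.terms, hl.perts,
    by rw [h.order]; exact Nat.pow_le_pow_right (by simp) h.pow_le, by rw [h.dim]; exact h.pow_le⟩

theorem pow_mul_le_budget (I : Quench n m k) (K : ℕ) :
    2 ^ I.dimK * (K * max n (2 ^ I.dimK) ^ 2) ≤ K * budget I := by
  calc 2 ^ I.dimK * (K * max n (2 ^ I.dimK) ^ 2)
      ≤ max n (2 ^ I.dimK) * (K * max n (2 ^ I.dimK) ^ 2) := Nat.mul_le_mul_right _ (le_max_right _ _)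
    _ = K * max n (2 ^ I.dimK) ^ 3 := by ring
    _ ≤ K * budget I := Nat.mul_le_mul_left _ (pow_three_le_budget I)

/-- The program overwrites the size cells, so the general bound is applied only to its first part,
where loops are nested two deep and these cells are not touched. The update at the end has no loops.
-/
theorem time_addTerm {I : Quench n m k} {s : Store} (hs : SizesOk I s) :
    ∀ s' ∈ (Prog.addTerm.eval s).support,
      s'.time ≤ s.time + Prog.addTerm.size * max n (2 ^ I.dimK) ^ 2 := by
  intro s' h
  have hM : 1 ≤ max n (2 ^ I.dimK) := le_max_of_le_right Nat.one_le_two_pow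
  rw [Prog.addTerm, Prog.eval, PMF.mem_support_bind_iff] at h
  obtain ⟨s1, h1, h2⟩ := h
  have t2 := Prog.time_le_of_bounds_nil _ rfl s1 s' h2
  obtain ⟨t1, -⟩ := Prog.time_le hM _ rfl s (fun e he => NExpr.eval_le_of_isCell
    (l := [(0, 0), (20, 0)]) (List.all_eq_true.mp rfl e he) (by
      intro p hp
      simp only [List.mem_cons, List.not_mem_nil, or_false] at hp
      rcases hp with rfl | rfl
      · exact hs.qubits.le.trans (le_max_left _ _)
      · exact hs.order.trans (le_max_right _ _))) s1 h1
  rw [Prog.addTerm, Prog.size, add_mul]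
  have := Nat.le_mul_of_pos_right (Prog.size (.ite (.natEq (.cell 28) (.lit 0))
    (.seq (.setN 20 (.lit 0) (.lit 1) (.succ (.get 20 (.lit 0) (.lit 1))))
      (.setN 20 (.lit 0) (.lit 0) (.cell 30))) .skip)) (pow_pos hM 2)
  exact t2.trans (by
    refine (Nat.add_le_add (t1.trans le_rfl) this).trans ?_
    rw [add_assoc]
    rfl)

/-- The size cells grow during the loop, so their values are taken from the correctness proof: after
every prefix the listed elements are distinct members of `K`. At most `2 ^ |K|` rounds of quadratic
cost give the cubic bound. -/
theorem within_enumerate {I : Quench n m k} {t : ℝ} {s : Store} (hs : Start I t s.erase) :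
    Prog.enumerate.Within I s ((Prog.initGroup.size + 4 + (Prog.addTerm.size + 1)) * budget I) := by
  intro s' h
  have he := Prog.support_erase rfl h
  have h20 := hs.nat 20 (by simp)
  have h22 := hs.nat 22 (by simp)
  have h23 := hs.nat 23 (by simp)
  have h24 := hs.nat 24 (by simp)
  have hr := hs.real 24 (by simp)
  refine ⟨?_, .of_erase ?_⟩
  · rw [Prog.enumerate, Prog.eval, PMF.mem_support_bind_iff] at h
    obtain ⟨s1, h1, h2⟩ := h
    have e1 := Prog.support_erase rfl h1
    have t1 := Prog.time_le_of_bounds_nil _ rfl s s1 h1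
    have hl1 : Loaded I t s1.erase := by
      rw [e1]; exact hs.loaded.mono (Prog.initGroup.agree_run rfl s.erase) rfl
    have hk : (NExpr.get 0 (.lit 0) (.lit 2)).eval s1 = k := hl1.perts
    have t2 := Prog.time_le_loop (T := Prog.addTerm.size * max n (2 ^ I.dimK) ^ 2) rfl (by
      intro j hj s2 h2
      rw [hk] at hj
      rw [e1] at h2
      obtain ⟨d, gen, hE⟩ := run_addTerms hs.loaded hs.tables h20 h22 h23 h24 hr hj.le
      have hl2 : Loaded I t ((Prog.loop 60 (.lit j) .addTerm).run (Prog.initGroup.run s.erase)) := by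
        rw [← e1]; exact hl1.mono (Prog.agree_run _ rfl s1.erase) rfl
      have hl3 : Loaded I t s2.erase := by
        rw [h2]
        exact ⟨fun a ha => (Store.setNat_nat_of_ne _ (by omega) _ _ _).trans (hl2.nat a ha), hl2.real⟩
      exact time_addTerm (SizesOk.of_erase (Enum.sizesOk hl3 (h2 ▸ hE.setCounter j)))) s' h2
    rw [hk] at t2
    have t3 := Nat.mul_le_mul_right (Prog.addTerm.size * max n (2 ^ I.dimK) ^ 2 + 1) (perts_le I)
    have t4 : 2 ^ I.dimK * (Prog.addTerm.size * max n (2 ^ I.dimK) ^ 2 + 1) ≤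
        (Prog.addTerm.size + 1) * budget I := by
      refine le_trans (Nat.mul_le_mul_left _ ?_) (pow_mul_le_budget I (Prog.addTerm.size + 1))
      rw [add_mul, one_mul]
      exact Nat.add_le_add_left (Nat.one_le_pow _ _ (le_max_of_le_right Nat.one_le_two_pow)) _
    have t5 := Nat.le_mul_of_pos_right (Prog.initGroup.size + 4) (one_le_budget I)
    have t6 : (NExpr.get 0 (.lit 0) (.lit 2)).cost = 3 := rfl
    rw [add_mul]
    omega
  · rw [he]
    obtain ⟨gen, hE⟩ := run_enumerate hs.loaded hs.tables h20 h22 h23 h24 hr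
    exact hE.sizesOk (hs.loaded.mono (Prog.enumerate.agree_run rfl s.erase) rfl)

/-- The number `m` is not bounded by the other sizes, so the outer loop is counted separately. The
body has depth two and loops of length `n` or `|K|`, both below `2 n + 1`. -/
theorem within_buckets {I : Quench n m k} {s : Store} (hs : SizesOk I s) :
    Prog.buckets.Within I s ((4 + 9 * (Prog.bucketStep.size + 1)) * budget I) := by
  intro s' h
  have he := Prog.support_erase rfl h
  have hs' : SizesOk I s.erase := ⟨hs.qubits, hs.terms, hs.perts, hs.order, hs.dim⟩
  refine ⟨?_, .of_erase ?_⟩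
  · have hm : (NExpr.get 0 (.lit 0) (.lit 1)).eval s = m := hs.terms
    have t2 := Prog.time_le_loop (x := 60) (e := .get 0 (.lit 0) (.lit 1)) (c := .bucketStep)
      (T := Prog.bucketStep.size * (2 * n + 1) ^ 2) rfl (by
      intro j hj s2 h2 s3 h3
      have hs2 : SizesOk I s2.erase := by
        rw [h2]
        exact hs'.of_agree (c := .loop 60 (.lit (j + 1)) .bucketStep) ⟨fun a ha => by
          rw [Store.setNat_nat_of_ne]
          · exact (Prog.agree_run (.loop 60 (.lit j) .bucketStep) rfl s.erase).nat a ha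
          · simp only [Prog.modN, Bool.or_eq_false_iff, beq_eq_false_iff_ne] at ha
            exact ha.1, (Prog.agree_run (.loop 60 (.lit j) .bucketStep) rfl s.erase).real⟩ rfl rfl
      refine (Prog.time_le (M := 2 * n + 1) (by omega) _ rfl s2 (fun e he => NExpr.eval_le_of_isCell
        (l := [(0, 0), (20, 1)]) (List.all_eq_true.mp rfl e he) (by
          intro p hp
          simp only [List.mem_cons, List.not_mem_nil, or_false] at hp
          have h4 := dimK_le I
          have h5 : s2.nat 0 0 0 = n := hs2.qubits
          have h6 : s2.nat 20 0 1 ≤ I.dimK := hs2.dim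
          rcases hp with rfl | rfl
          · simp only; omega
          · simp only; omega)) s3 h3).1) s' h
    rw [hm] at t2
    have t3 : m * (Prog.bucketStep.size * (2 * n + 1) ^ 2 + 1) ≤
        9 * (Prog.bucketStep.size + 1) * budget I := by
      have h1 := Nat.mul_le_mul_left Prog.bucketStep.size (terms_mul_le_budget I)
      have h2 := terms_le_budget I
      calc m * (Prog.bucketStep.size * (2 * n + 1) ^ 2 + 1) =
          Prog.bucketStep.size * (m * (2 * n + 1) ^ 2) + m := by ring
        _ ≤ Prog.bucketStep.size * (9 * budget I) + 9 * budget I := Nat.add_le_add h1 h2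
        _ = 9 * (Prog.bucketStep.size + 1) * budget I := by ring
    have t5 := Nat.le_mul_of_pos_right 4 (one_le_budget I)
    have t6 : (NExpr.get 0 (.lit 0) (.lit 1)).cost = 3 := rfl
    rw [add_mul]
    omega
  · rw [he]
    exact hs'.of_agree (Prog.buckets.agree_run rfl s.erase) rfl rfl

theorem exists_within_prepare : ∃ C, ∀ {n m k : ℕ} (I : Quench n m k) (t : ℝ) (s : Store),
    Loaded I t s → Fresh s → Prog.prepare.Within I s (C * budget I) := by
  -- The constants are bracketed as in the composed program, so that factoring out the budget yields
  -- precisely this sum.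
  refine ⟨(Prog.prelude.size + ((Prog.initGroup.size + 4 + (Prog.addTerm.size + 1)) +
    ((4 + 9 * (Prog.bucketStep.size + 1)) + (Prog.energies.size + Prog.fillMat.size)))) +
    (Prog.lanczos.size + Prog.evolve.size), fun {n m k} I t s hl hf => ?_⟩
  have h0 : SizesOk I s := ⟨hl.qubits, hl.terms, hl.perts,
    by rw [hf.nat 20 le_rfl]; exact Nat.zero_le _, by rw [hf.nat 20 le_rfl]; exact Nat.zero_le _⟩
  have hst : ∀ {c : Prog} (hc : c.static = true)
      (hb : c.bounds.all (NExpr.isCell [(0, 0), (20, 0), (20, 1)]) = true) (hd : c.depth ≤ 3)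
      {s : Store}, SizesOk I s → c.Within I s (c.size * budget I) :=
    fun hc hb hd _ hs => Prog.within_of_static _ hc hb hd hs
  have key := ((hst (c := .prelude) rfl rfl (by decide) h0).seq fun s1 h1 _ =>
    (within_enumerate (t := t) (I := I) (s := s1) (by
      rw [Prog.support_erase rfl h1]; exact run_prelude hl.of_erase hf.of_erase)).seq fun s2 _ k2 =>
    (within_buckets k2).seq fun s3 _ k3 =>
    (hst (c := .energies) rfl rfl (by decide) k3).seq fun s4 _ k4 =>
    hst (c := .fillMat) rfl rfl (by decide) k4).seq fun s5 _ k5 =>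
    (hst (c := .lanczos) rfl rfl (by decide) k5).seq fun s6 _ k6 =>
    hst (c := .evolve) rfl rfl (by decide) k6
  simp only [← add_mul] at key
  exact key

theorem exists_runsIn_seq {c : Prog} (hc : c.static = true)
    (hb : c.bounds.all (NExpr.isCell [(0, 0), (20, 0), (20, 1)]) = true) (hd : c.depth ≤ 3) :
    ∃ C, ∀ {n m k : ℕ} (I : Quench n m k) (t : ℝ) (s : Store), Loaded I t s → Fresh s →
      ∀ C' ≥ C, (Prog.seq .prepare c).RunsIn s (C' * budget I) := by
  obtain ⟨C, hC⟩ := exists_within_prepare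
  refine ⟨C + c.size, fun {n m k} I t s hl hf C' hC' s' h => ?_⟩
  have := ((hC I t s hl hf).seq fun s1 _ k1 => c.within_of_static hc hb hd k1) s' h
  rw [← add_mul] at this
  exact this.1.trans (Nat.add_le_add_left (Nat.mul_le_mul_right _ hC') _)

/-! ### The three programs -/

theorem loaded_input (I : Quench n m k) (t : ℝ) {s : Store}
    (hn : ∀ a, a ≠ 9 → a ≠ 10 → a ≠ 11 → s.nat a = (I.input t).nat a)
    (hr : s.real = (I.input t).real) : Loaded I t s ∧ Fresh s :=
  ⟨⟨fun a ha => hn a (by omega) (by omega) (by omega), fun a _ => by rw [hr]⟩,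
    ⟨fun a ha => by
      rw [hn a (by omega) (by omega) (by omega)]
      obtain ⟨b, rfl⟩ := Nat.exists_eq_add_of_le' ha
      rfl, fun _ ha => by
      rw [hr]
      obtain ⟨b, rfl⟩ := Nat.exists_eq_add_of_le' ha
      rfl⟩⟩

theorem loaded_withBits (I : Quench n m k) (t : ℝ) (y : Bits n) :
    Loaded I t ((I.input t).withBits y) ∧ Fresh ((I.input t).withBits y) :=
  loaded_input I t (fun _ h _ _ => if_neg h) rfl

theorem loaded_withPauli (I : Quench n m k) (t : ℝ) (Q : PauliString n) :
    Loaded I t ((I.input t).withPauli Q) ∧ Fresh ((I.input t).withPauli Q) :=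
  loaded_input I t (fun _ _ h1 h2 => (if_neg h1).trans (if_neg h2)) rfl

theorem outputs_readAmp (I : Quench n m k) (t : ℝ) (y : Bits n) :
    (Prog.seq .prepare .readAmp).Outputs ((I.input t).withBits y) (I.ψ t y) := by
  intro s' h
  obtain ⟨hl, hf⟩ := loaded_withBits I t y
  obtain ⟨gen, c, hE⟩ := run_prepare hl.of_erase hf.of_erase
  change s'.erase.outComplex = _
  rw [Prog.support_erase rfl h, run_seq]
  refine run_readAmp hE (y := bitsEquiv.symm y) fun q => ?_
  rw [(Prog.prepare.agree_run rfl _).nat 9 rfl]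
  simp [Store.erase, Store.withBits, row, bitsEquiv]
  rfl

theorem outputs_readExpect (I : Quench n m k) (t : ℝ) (Q : PauliString n) :
    (Prog.seq .prepare .readExpect).Outputs ((I.input t).withPauli Q) (I.expect t Q) := by
  intro s' h
  obtain ⟨hl, hf⟩ := loaded_withPauli I t Q
  obtain ⟨gen, c, hE⟩ := run_prepare hl.of_erase hf.of_erase
  change s'.erase.outComplex = _
  rw [Prog.support_erase rfl h, run_seq]
  refine run_readExpect hE ⟨fun q => ?_, fun q => ?_⟩
  · rw [(Prog.prepare.agree_run rfl _).nat 10 rfl]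
    simp [Store.erase, Store.withPauli, row, xp]
  · rw [(Prog.prepare.agree_run rfl _).nat 11 rfl]
    simp [Store.erase, Store.withPauli, row, zp]

theorem probOut_eq_lexp (c : Prog) (s : Store) (y : Vec n) :
    c.probOut s (bitsEquiv y) = lexp (c.dist s.erase) (outInd y) := by
  rw [← c.map_erase_eval, lexp_map, Prog.probOut, PMF.toOuterMeasure_apply, lexp]
  refine tsum_congr fun s' => ?_
  classical
  rw [Set.indicator_apply, outInd]
  have : s' ∈ {s' : Store | s'.OutBits (bitsEquiv y)} ↔ HasOut s'.erase y := Iff.rfl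
  by_cases h : HasOut s'.erase y
  · rw [if_pos (this.mpr h), if_pos h, mul_one]
  · rw [if_neg (mt this.mp h), if_neg h, mul_zero]

theorem probOut_readSample (I : Quench n m k) (t : ℝ) (y : Vec n) :
    (Prog.seq .prepare .readSample).probOut (I.input t) (bitsEquiv y) =
      ENNReal.ofReal (‖I.ψ t (bitsEquiv y)‖ ^ 2) := by
  rw [probOut_eq_lexp]
  refine lexp_outInd_eq _ (fun y => ?_) y
  obtain ⟨hl, hf⟩ := loaded_input I t (s := I.input t) (fun _ _ _ _ => rfl) rfl
  obtain ⟨gen, c, hE⟩ := run_prepare hl.of_erase hf.of_erase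
  rw [lexp_seq, lexp_run rfl]
  refine lexp_readSample hE (fun q => ?_) y
  rw [(Prog.prepare.agree_run rfl _).nat 12 rfl]
  rfl

end

end StabQuench

end

theorem theorem4 :
    ∃ (amp expv samp : Prog) (C : ℕ),
      ∀ (n m k : ℕ) (I : Quench n m k) (t : ℝ),
        (∀ y : Bits n,
          amp.Outputs ((I.input t).withBits y) (I.ψ t y) ∧
          amp.RunsIn ((I.input t).withBits y) (C * (n ^ 2 * (n + m) + 2 ^ (3 * I.dimK)))) ∧
        (∀ Q : PauliString n,
          expv.Outputs ((I.input t).withPauli Q) (I.expect t Q) ∧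
          expv.RunsIn ((I.input t).withPauli Q) (C * (n ^ 2 * (n + m) + 2 ^ (3 * I.dimK)))) ∧
        ((∀ y : Bits n,
          samp.probOut (I.input t) y = ENNReal.ofReal (‖I.ψ t y‖ ^ 2)) ∧
          samp.RunsIn (I.input t) (C * (n ^ 2 * (n + m) + 2 ^ (3 * I.dimK)))) := by
  obtain ⟨C₁, h₁⟩ := exists_runsIn_seq (c := .readAmp) rfl rfl (by decide)
  obtain ⟨C₂, h₂⟩ := exists_runsIn_seq (c := .readExpect) rfl rfl (by decide)
  obtain ⟨C₃, h₃⟩ := exists_runsIn_seq (c := .readSample) rfl rfl (by decide)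
  refine ⟨.seq .prepare .readAmp, .seq .prepare .readExpect, .seq .prepare .readSample,
    C₁ + C₂ + C₃, fun n m k I t => ⟨fun y => ⟨outputs_readAmp I t y, ?_⟩,
      fun Q => ⟨outputs_readExpect I t Q, ?_⟩, fun y => probOut_readSample I t (bitsEquiv.symm y), ?_⟩⟩
  · obtain ⟨hl, hf⟩ := loaded_withBits I t y
    exact h₁ I t _ hl hf _ (by omega)
  · obtain ⟨hl, hf⟩ := loaded_withPauli I t Q
    exact h₂ I t _ hl hf _ (by omega)
  · obtain ⟨hl, hf⟩ := loaded_input I t (s := I.input t) (fun _ _ _ _ => rfl) rfl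
    exact h₃ I t _ hl hf _ (by omega)
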